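/- **Setting.** Let $\mathbb I=\mathbb R/\mathbb Z$ and let $(\cdot,\cdot)$ be the $L^2(\mathbb I)$ inner product. Let $T>0$ and suppose that $$\mathbf x\cdot\mathbf e_1\,|\mathbf x_\rho|^2\,\mathbf x_t-(\mathbf x\cdot\mathbf e_1\,\mathbf x_\rho)_\rho+|\mathbf x_\rho|^2\,\mathbf e_1=\mathbf 0$$ (axisymmetric genus-1 mean curvature flow in DeTurck form) has a solution $\mathbf x:\mathbb I\times[0,T]\to\mathbb R^2$ with $\mathbf x\in C([0,T];[W^{2,\infty}(\mathbb I)]^2)$, $\mathbf x_t,\mathbf x_{tt}\in C([0,T];[H^2(\mathbb I)]^2)$, $\mathbf x_{ttt}\in C([0,T];[L^2(\mathbb I)]^2)$, and $|\mathbf x_\rho|>0$, $\mathbf x\cdot\mathbf e_1>0$ on $\mathbb I\times[0,T]$. For integers $J\ge3$, $M\ge1$ put $h=1/J$, $\Delta t=T/M$, $\mathbf x^m=\mathbf x(\cdot,m\Delta t)$. Let $\mathbf V^h$ be the space of continuous functions $\mathbb I\to\mathbb R^2$ that are affine on each $[(j-1)h,jh]$, $1\le j\le J$, and let $\Pi^h$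 be the nodal interpolation operator onto $\mathbf V^h$. For $A,V,W,\eta$ write $$B(A,V,W;\eta)=\big(A\cdot\mathbf e_1\,V,\eta\,|A_\rho|^2\big)+\big(A\cdot\mathbf e_1\,W_\rho,\eta_\rho\big)+\big(\eta\cdot\mathbf e_1,|A_\rho|^2\big).$$ Given $\mathbf X^0,\mathbf X^1\in\mathbf V^h$, the methods seek $\mathbf X^{m+1}\in\mathbf V^h$, $m=1,\dots,M-1$, such that for all $\eta\in\mathbf V^h$: * Crank–Nicolson: $B\big(\tfrac{3\mathbf X^m-\mathbf X^{m-1}}2,\ \tfrac{\mathbf X^{m+1}-\mathbf X^m}{\Delta t},\ \tfrac{\mathbf X^{m+1}+\mathbf X^m}2;\ \eta\big)=0$; * BDF2: $B\big(2\mathbf X^m-\mathbf X^{m-1},\ \tfrac{3\mathbf X^{m+1}-4\mathbf X^m+\mathbf X^{m-1}}{2\Delta t},\ \mathbf X^{m+1};\ \eta\big)=0$. The starting values are $\mathbf X^0=\Pi^h\mathbf x^0$ and an $\mathbf X^1\in\mathbf V^h$ that either * (a) is given by one linear backward Euler (BDF1) step: $B\big(\mathbf X^0,\ \tfrac{\mathbf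 X^1-\mathbf X^0}{\Delta t},\ \mathbf X^1;\ \eta\big)=0$ for all $\eta\in\mathbf V^h$; or * (b) is any second-order accurate starting value: $\|\Pi^h\mathbf x^1-\mathbf X^1\|_{H^1}\le K(\Delta t^2+h^2)$, where $K$ is a constant fixed in advance. **Theorem.** For every $K$ there exist positive constants $\Delta t_0,h_0,\gamma_1,\gamma_2,C$ (independent of $h$ and $\Delta t$) such that, whenever $h\le h_0$, $\Delta t\le\Delta t_0$, $\Delta t\le\gamma_1h^{1/4}$ and $h\le\gamma_2\sqrt{\Delta t}$, the step (a) has a unique solution, and for every $\mathbf X^1$ as in (a) or (b) the Crank–Nicolson method and the BDF2 method each have a unique solution $\mathbf X^{m+1}$, $m=1,\dots,M-1$, and each solution satisfies $$\max_{0\le m\le M}\|\mathbf x^m-\mathbf X^m\|_{L^2}\le C(\Delta t^2+h^2),\qquad \max_{0\le m\le M}|\mathbf x^m-\mathbf X^m|_{H^1}\le C(\Delta t^2+h),$$ $$\max_{0\le m\le M}\|\Pi^h\mathbf x^m-\mathbf X^m\|_{H^1}\le C(\Delta t^2+h^2).$$ -/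

import Mathlib

open MeasureTheory Set Filter Topology
open scoped ENNReal

namespace GenusOneMCF

/-- The plane `ℝ²` with the Euclidean norm. The coordinate `v 0` is `v · e₁`. -/
abbrev Plane : Type := EuclideanSpace ℝ (Fin 2)

/-- The first unit vector. -/
noncomputable def e₁ : Plane := EuclideanSpace.single 0 1

/-! ### Functions on the circle `𝕀 = ℝ/ℤ`

A function on `𝕀` is a 1-periodic function on `ℝ`; integrals and `L^p` norms are taken over one
period, and a function of which only the a.e. class matters is used through its values on `(0, 1]`. -/

/-- Lebesgue measure on one period. -/
noncomputable def circleVol : Measure ℝ := volume.restrict (Ioc (0 : ℝ) 1)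

/-- `g` is the weak derivative of `f` on `ℝ/ℤ`, tested with smooth 1-periodic functions. -/
def HasWeakDeriv (f g : ℝ → Plane) : Prop :=
  Integrable f circleVol ∧ Integrable g circleVol ∧
    ∀ φ : ℝ → ℝ, ContDiff ℝ (⊤ : ℕ∞) φ → Function.Periodic φ 1 →
      ∫ ρ in (0 : ℝ)..1, deriv φ ρ • f ρ = -∫ ρ in (0 : ℝ)..1, φ ρ • g ρ

open Classical in
/-- The weak derivative `f_ρ` (unique up to a null set), and `0` if there is none. -/
noncomputable def wderiv (f : ℝ → Plane) : ℝ → Plane :=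
  if H : ∃ g, HasWeakDeriv f g then H.choose else 0

/-- Membership in the Sobolev space `W^{l,p}(𝕀)²`. -/
def MemSobolev : ℕ → ℝ≥0∞ → (ℝ → Plane) → Prop
  | 0, p, f => MemLp f p circleVol
  | l + 1, p, f => MemLp f p circleVol ∧ ∃ g, HasWeakDeriv f g ∧ MemSobolev l p g

/-- The norm of `W^{l,p}(𝕀)²` (meaningful for members of the space). -/
noncomputable def sobolevNorm (l : ℕ) (p : ℝ≥0∞) (f : ℝ → Plane) : ℝ≥0∞ :=
  if p = ∞ then ⨆ k ∈ Finset.range (l + 1), eLpNorm (wderiv^[k] f) ∞ circleVol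
  else (∑ k ∈ Finset.range (l + 1), eLpNorm (wderiv^[k] f) p circleVol ^ p.toReal) ^ (1 / p.toReal)

/-- The norm of `L²(𝕀)²`. -/
noncomputable def normL2 (f : ℝ → Plane) : ℝ≥0∞ := eLpNorm f 2 circleVol

/-- The seminorm of `H¹(𝕀)²`. -/
noncomputable def seminormH1 (f : ℝ → Plane) : ℝ≥0∞ := eLpNorm (wderiv f) 2 circleVol

/-- The norm of `H¹(𝕀)² = W^{1,2}(𝕀)²`. -/
noncomputable def normH1 (f : ℝ → Plane) : ℝ≥0∞ := sobolevNorm 1 2 f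

/-! ### Time-dependent functions; `u t ρ` is the value at time `t` and parameter `ρ` -/

/-- `u ∈ C([0,T]; W^{l,p}(𝕀)²)`. -/
def ContInSobolev (T : ℝ) (l : ℕ) (p : ℝ≥0∞) (u : ℝ → ℝ → Plane) : Prop :=
  (∀ t ∈ Icc 0 T, MemSobolev l p (u t)) ∧
    ∀ t ∈ Icc 0 T, Tendsto (fun s => sobolevNorm l p (u s - u t)) (𝓝[Icc 0 T] t) (𝓝 0)

/-- `v = u_t` on `[0,T]` (one-sided at the end points), as the limit in `L²(𝕀)²` of the difference
quotients. -/
def HasTimeDeriv (T : ℝ) (u v : ℝ → ℝ → Plane) : Prop :=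
  ∀ t ∈ Icc 0 T, Tendsto (fun s => normL2 ((s - t)⁻¹ • (u s - u t) - v t))
    (𝓝[Icc 0 T \ {t}] t) (𝓝 0)

/-- `x` is a solution on `𝕀 × [0,T]` of
`x·e₁ |x_ρ|² x_t - (x·e₁ x_ρ)_ρ + |x_ρ|² e₁ = 0`
with `|x_ρ| > 0` and `x·e₁ > 0`, with time derivatives `xt`, `xtt`, `xttt`, and of the regularity
`x ∈ C(W^{2,∞})`, `x_t, x_tt ∈ C(H²)`, `x_ttt ∈ C(L²)`. Here `x t` is the continuous representative
of its class, which is then continuously differentiable. -/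
structure IsRegularSolution (T : ℝ) (x xt xtt xttt : ℝ → ℝ → Plane) : Prop where
  periodic : ∀ t ∈ Icc 0 T, Function.Periodic (x t) 1
  continuous : ∀ t ∈ Icc 0 T, Continuous (x t)
  time_deriv₁ : HasTimeDeriv T x xt
  time_deriv₂ : HasTimeDeriv T xt xtt
  time_deriv₃ : HasTimeDeriv T xtt xttt
  reg₀ : ContInSobolev T 2 ∞ x
  reg₁ : ContInSobolev T 2 2 xt
  reg₂ : ContInSobolev T 2 2 xtt
  reg₃ : ContInSobolev T 0 2 xttt
  equation : ∀ t ∈ Ioc 0 T, ∀ᵐ ρ ∂circleVol,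
    (x t ρ 0 * ‖wderiv (x t) ρ‖ ^ 2) • xt t ρ - wderiv (fun σ => x t σ 0 • wderiv (x t) σ) ρ
      + ‖wderiv (x t) ρ‖ ^ 2 • e₁ = 0
  immersed : ∀ t ∈ Icc 0 T, ∀ ρ : ℝ, 0 < ‖deriv (x t) ρ‖
  pos : ∀ t ∈ Icc 0 T, ∀ ρ : ℝ, 0 < x t ρ 0

/-! ### Finite elements -/

/-- The space `V^h × V^h` of continuous piecewise affine functions on the uniform mesh of `𝕀` with
nodes `j/J`. -/
def feSpace (J : ℕ) : Set (ℝ → Plane) :=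
  {χ | Continuous χ ∧ Function.Periodic χ 1 ∧ MemSobolev 1 2 χ ∧
    ∀ j : ℕ, j < J → ∃ a b : Plane, ∀ ρ ∈ Icc ((j : ℝ) / J) ((j + 1 : ℝ) / J), χ ρ = a + ρ • b}

/-- The nodal interpolant `Π^h f`: affine between neighbouring nodes, equal to `f` at the nodes. -/
noncomputable def interp (J : ℕ) (f : ℝ → Plane) : ℝ → Plane := fun ρ =>
  (1 - Int.fract (ρ * J)) • f ((⌊ρ * J⌋ : ℝ) / J) +
    Int.fract (ρ * J) • f (((⌊ρ * J⌋ : ℝ) + 1) / J)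

/-- `(A·e₁ V, η |A_ρ|²) + (A·e₁ W_ρ, η_ρ) + (η·e₁, |A_ρ|²)`, with `L²(𝕀)` inner products. -/
noncomputable def schemeForm (A V W η : ℝ → Plane) : ℝ :=
  (∫ ρ in (0 : ℝ)..1, A ρ 0 * inner ℝ (V ρ) (η ρ) * ‖wderiv A ρ‖ ^ 2) +
    (∫ ρ in (0 : ℝ)..1, A ρ 0 * inner ℝ (wderiv W ρ) (wderiv η ρ)) +
    ∫ ρ in (0 : ℝ)..1, η ρ 0 * ‖wderiv A ρ‖ ^ 2

/-- `X¹` is obtained from `X⁰` by one step of the linear semi-implicit Euler (BDF1) method. -/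
def IsBDF1Step (J : ℕ) (dt : ℝ) (X0 X1 : ℝ → Plane) : Prop :=
  X1 ∈ feSpace J ∧ ∀ η ∈ feSpace J, schemeForm X0 (dt⁻¹ • (X1 - X0)) X1 η = 0

/-- `X⁰, …, X^M` is a solution of the Crank-Nicolson method with the given starting values. Only the
members with index at most `M` of the sequence `X` are relevant. -/
def IsCNSolution (J M : ℕ) (dt : ℝ) (X0 X1 : ℝ → Plane) (X : ℕ → ℝ → Plane) : Prop :=
  X 0 = X0 ∧ X 1 = X1 ∧ (∀ m ≤ M, X m ∈ feSpace J) ∧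
    ∀ m, 1 ≤ m → m + 1 ≤ M → ∀ η ∈ feSpace J,
      schemeForm ((1 / 2 : ℝ) • ((3 : ℝ) • X m - X (m - 1)))
        (dt⁻¹ • (X (m + 1) - X m))
        ((1 / 2 : ℝ) • (X (m + 1) + X m)) η = 0

/-- `X⁰, …, X^M` is a solution of the BDF2 method with the given starting values. Only the
members with index at most `M` of the sequence `X` are relevant. -/
def IsBDF2Solution (J M : ℕ) (dt : ℝ) (X0 X1 : ℝ → Plane) (X : ℕ → ℝ → Plane) : Prop :=
  X 0 = X0 ∧ X 1 = X1 ∧ (∀ m ≤ M, X m ∈ feSpace J) ∧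
    ∀ m, 1 ≤ m → m + 1 ≤ M → ∀ η ∈ feSpace J,
      schemeForm ((2 : ℝ) • X m - X (m - 1))
        ((2 * dt)⁻¹ • ((3 : ℝ) • X (m + 1) - (4 : ℝ) • X m + X (m - 1)))
        (X (m + 1)) η = 0

/-- The error bounds with constant `C`, for mesh size `h = 1/J` and time step `dt`. -/
def ErrorBounds (x : ℝ → ℝ → Plane) (J M : ℕ) (h dt C : ℝ) (X : ℕ → ℝ → Plane) : Prop :=
  ∀ m ≤ M,
    normL2 (x (m * dt) - X m) ≤ ENNReal.ofReal (C * (dt ^ 2 + h ^ 2)) ∧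
    seminormH1 (x (m * dt) - X m) ≤ ENNReal.ofReal (C * (dt ^ 2 + h)) ∧
    normH1 (interp J (x (m * dt)) - X m) ≤ ENNReal.ofReal (C * (dt ^ 2 + h ^ 2))

end GenusOneMCF

open GenusOneMCF

/-!
The scheme is linear in the new time level, and both methods belong to one family with a parameter
`θ`: with `A = X^m + θ (X^m - X^{m-1})`, `W = X^m + θ (X^{m+1} - X^m)` and
`V = ((θ + 1/2) (X^{m+1} - X^m) - (θ - 1/2) (X^m - X^{m-1})) / Δt`, the value `θ = 1/2` is
Crank-Nicolson and `θ = 1` is BDF2. All three are second order approximations at time `t_m + θ Δt`.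
Piecewise affine curves are identified with their nodal values in `ZMod J → Plane`; integrals over the
elements are polynomials in these (`schemeForm_plin`), and the rest is a statement about nodal values.

*Stability* (`step_stability`). The error equation is tested not with the discrete time derivative `D`
of the error but with the nodal quotient `D / (A·e₁)`. On each element the mean of `A·e₁` times the
mean of its inverse is `1` up to `O(h²)`, so the stiffness form becomes the `H¹` inner product with
constant weight, and the mass form controls `‖D‖²` in `L²`, which absorbs everything of lower order.
The perturbation of the coefficient in the stiffness form is summed by parts onto the exact solution
(`abs_stiffForm_le`). With the `G`-stability identity for `θ ∈ [1/2, 1]` (`multistepEnergy_le`) and a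
discrete Gronwall inequality (`gronwall_two_step`), the `H¹` error is bounded by the consistency error.
The argument needs the coefficient to stay a non-degenerate curve in the right half plane. By an inverse
estimate it does if the squared `H¹` error is at most a small multiple of `h`; since that square is
`O(Δt⁴ + h⁴)`, this is implied by `Δt ≤ γ₁ h^{1/4}` (`theta_apriori`). It also makes each linear system
uniquely solvable (`theta_scheme`).

*Consistency in space* (`space_consistency`). For smooth curves the form of the scheme differs from the
moments of the strong residual by `O(h²)`. For mass and load the contributions of the two elements that
meet at a node are values at `h` and `-h` of one function, so that odd powers of `h` cancel
(`mass_consistency`). For the stiffness form the error on one element is `O(h³)`, and changes from one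
element to the next by `O(h⁴)` because its derivative is a difference of trapezoidal rules
(`stiff_consistency`).

*Consistency in time* (`FlowData.stepData`). The time levels of the exact solution are expanded in `L²`,
also for the first two spatial derivatives, and the embedding of `H¹` in the continuous functions turns
this into pointwise bounds for the curve and its tangent. The regularity of `x_ρρ` that this requires
comes from the equation itself (`exists_flowData`).

*The starting step* (`FlowData.euler_start`). The residual of the backward Euler step is `O(Δt)`
together with its Lipschitz constant. Divided by the mass density and multiplied by `Δt` it is the
leading part of the error; what remains is small enough for the energy estimate (`euler_step_error`).

The bounds of the theorem follow from the nodal bound by the triangle inequality with the interpolation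
error (`errorBounds_of_energy`).
-/

namespace GenusOneMCF

/-! ### The scheme in nodal values -/

section Nodal

set_option linter.unusedSectionVars false

variable {J : ℕ} [NeZero J]

/-- Forward difference of a vector of nodal values. The cyclic index set `ZMod J` encodes the
periodicity. -/
def nodeDiff (u : ZMod J → Plane) (j : ZMod J) : Plane := u (j + 1) - u j

/-- `∫₀¹ p ⟪v, w⟫` for `p`, `v`, `w` affine on `[0,1]` with the given end point values. -/
noncomputable def massQ (p0 p1 : ℝ) (v0 v1 w0 w1 : Plane) : ℝ :=
  (3 * p0 * inner ℝ v0 w0 + p0 * inner ℝ v0 w1 + p0 * inner ℝ v1 w0 + p1 * inner ℝ v0 w0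
    + p1 * inner ℝ v1 w0 + p1 * inner ℝ v0 w1 + p0 * inner ℝ v1 w1 + 3 * p1 * inner ℝ v1 w1) / 12

/-- The form `(A·e₁ V, η |A_ρ|²)` for piecewise affine functions with the given nodal values. -/
noncomputable def massForm (h : ℝ) (A V η : ZMod J → Plane) : ℝ :=
  ∑ j, ‖nodeDiff A j‖ ^ 2 / h * massQ (A j 0) (A (j + 1) 0) (V j) (V (j + 1)) (η j) (η (j + 1))

/-- The form `(A·e₁ W_ρ, η_ρ)` for piecewise affine functions with the given nodal values. -/
noncomputable def stiffForm (h : ℝ) (A W η : ZMod J → Plane) : ℝ :=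
  ∑ j, (A j 0 + A (j + 1) 0) / 2 * inner ℝ (nodeDiff W j) (nodeDiff η j) / h

/-- The functional `(η·e₁, |A_ρ|²)` for piecewise affine functions with the given nodal values. -/
noncomputable def loadForm (h : ℝ) (A η : ZMod J → Plane) : ℝ :=
  ∑ j, ‖nodeDiff A j‖ ^ 2 / h * ((η j 0 + η (j + 1) 0) / 2)

/-- The form of the scheme for piecewise affine functions with the given nodal values. -/
noncomputable def nodalForm (h : ℝ) (A V W η : ZMod J → Plane) : ℝ :=
  massForm h A V η + stiffForm h A W η + loadForm h A η

/-- Mass-lumped squared `L²` norm. -/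
noncomputable def l2sq (h : ℝ) (u : ZMod J → Plane) : ℝ := h * ∑ j, ‖u j‖ ^ 2

/-- Squared `H¹` seminorm of the piecewise affine function with the given nodal values. -/
noncomputable def h1sq (h : ℝ) (u : ZMod J → Plane) : ℝ := (∑ j, ‖nodeDiff u j‖ ^ 2) / h

/-- Discrete squared `H¹` norm. -/
noncomputable def energy (h : ℝ) (u : ZMod J → Plane) : ℝ := l2sq h u + h1sq h u

/-- The inner product that belongs to `energy`. -/
noncomputable def energyInner (h : ℝ) (u v : ZMod J → Plane) : ℝ :=
  h * ∑ j, inner ℝ (u j) (v j) + (∑ j, inner ℝ (nodeDiff u j) (nodeDiff v j)) / h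

theorem sum_shift (f : ZMod J → ℝ) : ∑ j, f (j + 1) = ∑ j, f j :=
  Equiv.sum_comp (Equiv.addRight (1 : ZMod J)) f

theorem nodeDiff_add (u v : ZMod J → Plane) (j : ZMod J) :
    nodeDiff (u + v) j = nodeDiff u j + nodeDiff v j := by
  simp only [nodeDiff, Pi.add_apply]; abel

theorem nodeDiff_sub (u v : ZMod J → Plane) (j : ZMod J) :
    nodeDiff (u - v) j = nodeDiff u j - nodeDiff v j := by
  simp only [nodeDiff, Pi.sub_apply]; abel

theorem nodeDiff_smul (c : ℝ) (u : ZMod J → Plane) (j : ZMod J) :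
    nodeDiff (c • u) j = c • nodeDiff u j := by
  simp only [nodeDiff, Pi.smul_apply, smul_sub]

theorem l2sq_nonneg {h : ℝ} (hh : 0 < h) (u : ZMod J → Plane) : 0 ≤ l2sq h u := by
  unfold l2sq; positivity

theorem h1sq_nonneg {h : ℝ} (hh : 0 < h) (u : ZMod J → Plane) : 0 ≤ h1sq h u := by
  unfold h1sq; positivity

theorem energy_nonneg {h : ℝ} (hh : 0 < h) (u : ZMod J → Plane) : 0 ≤ energy h u :=
  add_nonneg (l2sq_nonneg hh u) (h1sq_nonneg hh u)

theorem massForm_sub (h : ℝ) (A V V' η : ZMod J → Plane) :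
    massForm h A (V - V') η = massForm h A V η - massForm h A V' η := by
  simp only [massForm, massQ, ← Finset.sum_sub_distrib, Pi.sub_apply, inner_sub_left]
  exact Finset.sum_congr rfl fun j _ => by ring

theorem massForm_add (h : ℝ) (A V V' η : ZMod J → Plane) :
    massForm h A (V + V') η = massForm h A V η + massForm h A V' η := by
  simp only [massForm, massQ, ← Finset.sum_add_distrib, Pi.add_apply, inner_add_left]
  exact Finset.sum_congr rfl fun j _ => by ring

theorem massForm_smul (h c : ℝ) (A V η : ZMod J → Plane) :
    massForm h A (c • V) η = c * massForm h A V η := by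
  simp only [massForm, massQ, Finset.mul_sum, Pi.smul_apply, real_inner_smul_left]
  exact Finset.sum_congr rfl fun j _ => by ring

theorem massForm_add_right (h : ℝ) (A V η η' : ZMod J → Plane) :
    massForm h A V (η + η') = massForm h A V η + massForm h A V η' := by
  simp only [massForm, massQ, ← Finset.sum_add_distrib, Pi.add_apply, inner_add_right]
  exact Finset.sum_congr rfl fun j _ => by ring

theorem massForm_smul_right (h c : ℝ) (A V η : ZMod J → Plane) :
    massForm h A V (c • η) = c * massForm h A V η := by
  simp only [massForm, massQ, Finset.mul_sum, Pi.smul_apply, real_inner_smul_right]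
  exact Finset.sum_congr rfl fun j _ => by ring

theorem stiffForm_sub (h : ℝ) (A W W' η : ZMod J → Plane) :
    stiffForm h A (W - W') η = stiffForm h A W η - stiffForm h A W' η := by
  simp only [stiffForm, ← Finset.sum_sub_distrib, nodeDiff_sub, inner_sub_left]
  exact Finset.sum_congr rfl fun j _ => by ring

theorem stiffForm_add (h : ℝ) (A W W' η : ZMod J → Plane) :
    stiffForm h A (W + W') η = stiffForm h A W η + stiffForm h A W' η := by
  simp only [stiffForm, ← Finset.sum_add_distrib, nodeDiff_add, inner_add_left]
  exact Finset.sum_congr rfl fun j _ => by ring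

theorem stiffForm_smul (h c : ℝ) (A W η : ZMod J → Plane) :
    stiffForm h A (c • W) η = c * stiffForm h A W η := by
  simp only [stiffForm, Finset.mul_sum, nodeDiff_smul, real_inner_smul_left]
  exact Finset.sum_congr rfl fun j _ => by ring

theorem stiffForm_add_right (h : ℝ) (A W η η' : ZMod J → Plane) :
    stiffForm h A W (η + η') = stiffForm h A W η + stiffForm h A W η' := by
  simp only [stiffForm, ← Finset.sum_add_distrib, nodeDiff_add, inner_add_right]
  exact Finset.sum_congr rfl fun j _ => by ring

theorem stiffForm_smul_right (h c : ℝ) (A W η : ZMod J → Plane) :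
    stiffForm h A W (c • η) = c * stiffForm h A W η := by
  simp only [stiffForm, Finset.mul_sum, nodeDiff_smul, real_inner_smul_right]
  exact Finset.sum_congr rfl fun j _ => by ring

theorem loadForm_add_right (h : ℝ) (A η η' : ZMod J → Plane) :
    loadForm h A (η + η') = loadForm h A η + loadForm h A η' := by
  simp only [loadForm, ← Finset.sum_add_distrib, Pi.add_apply, PiLp.add_apply]
  exact Finset.sum_congr rfl fun j _ => by ring

theorem loadForm_smul_right (h c : ℝ) (A η : ZMod J → Plane) :
    loadForm h A (c • η) = c * loadForm h A η := by
  simp only [loadForm, Finset.mul_sum, Pi.smul_apply, PiLp.smul_apply, smul_eq_mul]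
  exact Finset.sum_congr rfl fun j _ => by ring

theorem abs_coord_le (v : Plane) (i : Fin 2) : |v i| ≤ ‖v‖ := by
  simpa using PiLp.norm_apply_le v i

/-! ### Bounds on a single element -/

theorem massQ_bound {p0 p1 P Vb : ℝ} {v0 v1 w0 w1 : Plane} (hp0 : |p0| ≤ P) (hp1 : |p1| ≤ P)
    (hv0 : ‖v0‖ ≤ Vb) (hv1 : ‖v1‖ ≤ Vb) :
    |massQ p0 p1 v0 v1 w0 w1| ≤ P * Vb * (‖w0‖ + ‖w1‖) := by
  have hP : 0 ≤ P := (abs_nonneg _).trans hp0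
  have hV : 0 ≤ Vb := (norm_nonneg _).trans hv0
  have key : ∀ (p : ℝ) (v w : Plane), |p| ≤ P → ‖v‖ ≤ Vb → |p * inner ℝ v w| ≤ P * Vb * ‖w‖ := by
    intro p v w hp hv
    rw [abs_mul, mul_assoc]
    refine mul_le_mul hp ((abs_real_inner_le_norm v w).trans ?_) (abs_nonneg _) hP
    gcongr
  have h1 := abs_le.1 (key p0 v0 w0 hp0 hv0)
  have h2 := abs_le.1 (key p0 v0 w1 hp0 hv0)
  have h3 := abs_le.1 (key p0 v1 w0 hp0 hv1)
  have h4 := abs_le.1 (key p1 v0 w0 hp1 hv0)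
  have h5 := abs_le.1 (key p1 v1 w0 hp1 hv1)
  have h6 := abs_le.1 (key p1 v0 w1 hp1 hv0)
  have h7 := abs_le.1 (key p0 v1 w1 hp0 hv1)
  have h8 := abs_le.1 (key p1 v1 w1 hp1 hv1)
  have n0 : 0 ≤ P * Vb * ‖w0‖ := by positivity
  have n1 : 0 ≤ P * Vb * ‖w1‖ := by positivity
  unfold massQ
  rw [abs_le, mul_add]
  constructor <;> linarith

theorem inner_bounds (v w : Plane) :
    2 * inner ℝ v w ≤ ‖v‖ ^ 2 + ‖w‖ ^ 2 ∧ -(‖v‖ ^ 2 + ‖w‖ ^ 2) ≤ 2 * inner ℝ v w := by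
  have h := abs_le.1 (abs_real_inner_le_norm v w)
  constructor <;> nlinarith [sq_nonneg (‖v‖ - ‖w‖)]

/-- Coercivity of the element mass form, tested with the nodal quotient `D / A`. -/
theorem massQ_coercive {p0 p1 : ℝ} (hp0 : 0 < p0) (hp1 : 0 < p1) (h01 : p0 ≤ 2 * p1)
    (h10 : p1 ≤ 2 * p0) (d0 d1 : Plane) :
    (‖d0‖ ^ 2 + ‖d1‖ ^ 2) / 10 ≤ massQ p0 p1 d0 d1 (p0⁻¹ • d0) (p1⁻¹ • d1) := by
  set r := p1 / p0 with hr
  set s := p0 / p1 with hs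
  have hr0 : 0 < r := by positivity
  have hs0 : 0 < s := by positivity
  have hrs : r * s = 1 := by rw [hr, hs]; field_simp
  have hr2 : r ≤ 2 := by rw [hr, div_le_iff₀ hp0]; linarith
  have hs2 : s ≤ 2 := by rw [hs, div_le_iff₀ hp1]; linarith
  have hr1 : 1 / 2 ≤ r := by nlinarith
  have hs1 : 1 / 2 ≤ s := by nlinarith
  have hsum : r + s ≤ 5 / 2 := by nlinarith
  have e : massQ p0 p1 d0 d1 (p0⁻¹ • d0) (p1⁻¹ • d1)
      = ((3 + r) * ‖d0‖ ^ 2 + (3 + s) * ‖d1‖ ^ 2 + (2 + r + s) * inner ℝ d0 d1) / 12 := by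
    simp only [massQ, real_inner_smul_right, real_inner_self_eq_norm_sq,
      real_inner_comm d0 d1, hr, hs]
    field_simp
    ring
  rw [e]
  obtain ⟨_, hi⟩ := inner_bounds d0 d1
  nlinarith [sq_nonneg ‖d0‖, sq_nonneg ‖d1‖]

theorem massQ_self_pos {p0 p1 : ℝ} (v0 v1 : Plane) (hp0 : 0 < p0) (hp1 : 0 < p1) :
    (p0 * ‖v0‖ ^ 2 + p1 * ‖v1‖ ^ 2) / 6 ≤ massQ p0 p1 v0 v1 v0 v1 := by
  obtain ⟨_, hi⟩ := inner_bounds v0 v1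
  simp only [massQ, real_inner_self_eq_norm_sq, real_inner_comm v0 v1]
  nlinarith

theorem abs_normSq_sub_le (u v : Plane) : |‖u‖ ^ 2 - ‖v‖ ^ 2| ≤ ‖u - v‖ * (‖u‖ + ‖v‖) := by
  have := abs_norm_sub_norm_le u v
  rw [show ‖u‖ ^ 2 - ‖v‖ ^ 2 = (‖u‖ - ‖v‖) * (‖u‖ + ‖v‖) by ring, abs_mul,
    abs_of_nonneg (by positivity : 0 ≤ ‖u‖ + ‖v‖)]
  gcongr

/-- On one element, the stiffness form tested with the nodal quotient `D / A` is the form with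
constant weight, up to a lower order term: `(A₀ + A₁)/2 · (1/A₀ + 1/A₁)/2 = 1 + (A₁ - A₀)²/(4A₀A₁)`. -/
theorem stiff_element_quotient {p0 p1 c L h : ℝ} (hc : 0 < c) (hL : 0 ≤ L) (hh : 0 < h)
    (hp0 : c ≤ p0) (hp1 : c ≤ p1) (hd : |p1 - p0| ≤ L * h) (hP : p0 ≤ L)
    (e d0 d1 : Plane) :
    inner ℝ e (d1 - d0) / h - (L ^ 2 / c ^ 2) * (‖e‖ * (‖d0‖ + ‖d1‖)) ≤
      (p0 + p1) / 2 * inner ℝ e (p1⁻¹ • d1 - p0⁻¹ • d0) / h := by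
  have h0 : 0 < p0 := hc.trans_le hp0
  have h1 : 0 < p1 := hc.trans_le hp1
  have e1 : (p0 + p1) / 2 * inner ℝ e (p1⁻¹ • d1 - p0⁻¹ • d0) / h - inner ℝ e (d1 - d0) / h
      = ((p0 - p1) / h) * (inner ℝ e d0 / (2 * p0) + inner ℝ e d1 / (2 * p1)) := by
    simp only [inner_sub_right, real_inner_smul_right]
    field_simp
    ring
  have b0 : |inner ℝ e d0 / (2 * p0)| ≤ ‖e‖ * ‖d0‖ / (2 * c) := by
    rw [abs_div, abs_of_pos (by positivity : 0 < 2 * p0)]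
    exact div_le_div₀ (by positivity) (abs_real_inner_le_norm _ _) (by positivity) (by linarith)
  have b1 : |inner ℝ e d1 / (2 * p1)| ≤ ‖e‖ * ‖d1‖ / (2 * c) := by
    rw [abs_div, abs_of_pos (by positivity : 0 < 2 * p1)]
    exact div_le_div₀ (by positivity) (abs_real_inner_le_norm _ _) (by positivity) (by linarith)
  have b2 : |(p0 - p1) / h| ≤ L := by
    rw [abs_div, abs_of_pos hh, div_le_iff₀ hh, abs_sub_comm]; exact hd
  have b3 : |((p0 - p1) / h) * (inner ℝ e d0 / (2 * p0) + inner ℝ e d1 / (2 * p1))|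
      ≤ L * (‖e‖ * ‖d0‖ / (2 * c) + ‖e‖ * ‖d1‖ / (2 * c)) := by
    rw [abs_mul]
    exact mul_le_mul b2 ((abs_add_le _ _).trans (add_le_add b0 b1)) (abs_nonneg _) hL
  have b4 : L * (‖e‖ * ‖d0‖ / (2 * c) + ‖e‖ * ‖d1‖ / (2 * c))
      ≤ (L ^ 2 / c ^ 2) * (‖e‖ * (‖d0‖ + ‖d1‖)) := by
    have hLc : c ≤ L := hp0.trans hP
    have : L / (2 * c) ≤ L ^ 2 / c ^ 2 := by
      rw [div_le_div_iff₀ (by positivity) (by positivity)]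
      nlinarith [mul_nonneg hL hc.le, mul_le_mul_of_nonneg_left hLc (mul_nonneg hL hc.le)]
    calc _ = L / (2 * c) * (‖e‖ * (‖d0‖ + ‖d1‖)) := by field_simp
      _ ≤ _ := by gcongr
  have := (abs_le.1 (b3.trans b4)).1
  linarith

end Nodal

/-! ### Stability of one time step -/

section Stability

set_option linter.unusedSectionVars false

variable {J : ℕ} [NeZero J]

theorem young_sum {κ h : ℝ} (hκ : 0 < κ) (hh : 0 < h) (P x : ZMod J → ℝ) :
    ∑ j, P j * (x j + x (j + 1)) ≤ 2 * κ * (h * ∑ j, x j ^ 2) + (2 * κ)⁻¹ * ((∑ j, P j ^ 2) / h) := by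
  have h1 : ∀ j, P j * (x j + x (j + 1)) ≤
      κ * h * (x j ^ 2 + x (j + 1) ^ 2) + (2 * κ)⁻¹ * (P j ^ 2 / h) := by
    intro j
    have hs : ∀ y, P j * y ≤ κ * h * y ^ 2 + (4 * κ)⁻¹ * (P j ^ 2 / h) := by
      intro y
      have : κ * h * y ^ 2 + (4 * κ)⁻¹ * (P j ^ 2 / h) - P j * y
          = (2 * κ * h * y - P j) ^ 2 / (4 * κ * h) := by field_simp; ring
      have : 0 ≤ (2 * κ * h * y - P j) ^ 2 / (4 * κ * h) := by positivity
      linarith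
    have e : (2 * κ)⁻¹ * (P j ^ 2 / h) = (4 * κ)⁻¹ * (P j ^ 2 / h) + (4 * κ)⁻¹ * (P j ^ 2 / h) := by
      field_simp; ring
    rw [e]
    linarith [hs (x j), hs (x (j + 1))]
  refine (Finset.sum_le_sum fun j _ => h1 j).trans (le_of_eq ?_)
  rw [Finset.sum_add_distrib, ← Finset.mul_sum, Finset.sum_add_distrib,
    sum_shift (fun j => x j ^ 2), ← Finset.mul_sum, Finset.sum_div]
  ring

/-- Summation by parts moves the difference quotient in the stiffness form from the test function
to the coefficient and to the trial function. -/
theorem abs_stiffForm_le {h L : ℝ} (hh : 0 < h) (ε b η : ZMod J → Plane)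
    (hb : ∀ j, ‖nodeDiff b j‖ ≤ L * h)
    (hb2 : ∀ j, ‖nodeDiff b (j + 1) - nodeDiff b j‖ ≤ L * h ^ 2) :
    |stiffForm h ε b η| ≤ ∑ j, L * (‖nodeDiff ε j‖ + ‖nodeDiff ε (j + 1)‖ + h * ‖ε j‖
      + h * ‖ε (j + 1)‖) * ‖η (j + 1)‖ := by
  have hL : 0 ≤ L := by
    have := (norm_nonneg _).trans (hb 0)
    exact nonneg_of_mul_nonneg_left this hh
  set f : ZMod J → Plane := fun j => ((ε j 0 + ε (j + 1) 0) / 2 / h) • nodeDiff b j with hf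
  have e : stiffForm h ε b η = ∑ j, inner ℝ (f j - f (j + 1)) (η (j + 1)) := by
    have e1 : stiffForm h ε b η = ∑ j, (inner ℝ (f j) (η (j + 1)) - inner ℝ (f j) (η j)) := by
      unfold stiffForm
      refine Finset.sum_congr rfl fun j _ => ?_
      simp only [hf, real_inner_smul_left, nodeDiff, inner_sub_right]
      ring
    rw [e1, Finset.sum_sub_distrib, ← sum_shift (fun j => inner ℝ (f j) (η j)),
      ← Finset.sum_sub_distrib]
    simp only [inner_sub_left]
  rw [e]
  refine (Finset.abs_sum_le_sum_abs _ _).trans (Finset.sum_le_sum fun j _ => ?_)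
  refine (abs_real_inner_le_norm _ _).trans ?_
  gcongr
  have e2 : f j - f (j + 1) =
      ((ε j 0 + ε (j + 1) 0) / 2 / h) • (nodeDiff b j - nodeDiff b (j + 1))
      - ((nodeDiff ε j 0 + nodeDiff ε (j + 1) 0) / 2 / h) • nodeDiff b (j + 1) := by
    simp only [hf, nodeDiff, PiLp.sub_apply, smul_sub, sub_smul, add_smul, add_div, sub_div]
    abel
  rw [e2]
  refine (norm_sub_le _ _).trans ?_
  rw [norm_smul, norm_smul, Real.norm_eq_abs, Real.norm_eq_abs]
  have b1 : |(ε j 0 + ε (j + 1) 0) / 2 / h| ≤ (‖ε j‖ + ‖ε (j + 1)‖) / h := by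
    rw [abs_div, abs_of_pos hh]
    gcongr
    have := abs_add_le (ε j 0) (ε (j + 1) 0)
    rw [abs_div, abs_two]
    linarith [abs_coord_le (ε j) 0, abs_coord_le (ε (j + 1)) 0, norm_nonneg (ε j),
      norm_nonneg (ε (j + 1))]
  have b2 : |(nodeDiff ε j 0 + nodeDiff ε (j + 1) 0) / 2 / h|
      ≤ (‖nodeDiff ε j‖ + ‖nodeDiff ε (j + 1)‖) / h := by
    rw [abs_div, abs_of_pos hh]
    gcongr
    have := abs_add_le (nodeDiff ε j 0) (nodeDiff ε (j + 1) 0)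
    rw [abs_div, abs_two]
    linarith [abs_coord_le (nodeDiff ε j) 0, abs_coord_le (nodeDiff ε (j + 1)) 0,
      norm_nonneg (nodeDiff ε j), norm_nonneg (nodeDiff ε (j + 1))]
  have b3 := hb2 j
  rw [norm_sub_rev] at b3
  calc _ ≤ (‖ε j‖ + ‖ε (j + 1)‖) / h * (L * h ^ 2)
        + (‖nodeDiff ε j‖ + ‖nodeDiff ε (j + 1)‖) / h * (L * h) := by
        gcongr
        exact hb (j + 1)
    _ = _ := by field_simp; ring

/-- The effect of a perturbation `ε` of the coefficient `a`. -/
theorem nodalForm_perturb {h L : ℝ} (hh : 0 < h) (hL : 1 ≤ L) (a b Dh ε η : ZMod J → Plane)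
    (ha : ∀ j, |a j 0| ≤ L) (ha1 : ∀ j, ‖nodeDiff a j‖ ≤ L * h) (hb : ∀ j, ‖nodeDiff b j‖ ≤ L * h)
    (hb2 : ∀ j, ‖nodeDiff b (j + 1) - nodeDiff b j‖ ≤ L * h ^ 2) (hD : ∀ j, ‖Dh j‖ ≤ L)
    (hε : ∀ j, ‖ε j‖ ≤ L) (hε1 : ∀ j, ‖nodeDiff ε j‖ ≤ L * h) :
    |nodalForm h (a - ε) Dh b η - nodalForm h a Dh b η| ≤ ∑ j, 11 * L ^ 3 * (‖nodeDiff ε j‖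
      + ‖nodeDiff ε (j + 1)‖ + h * ‖ε j‖ + h * ‖ε (j + 1)‖) * (‖η j‖ + ‖η (j + 1)‖) := by
  have hL0 : 0 < L := by linarith
  have hL3 : L ≤ L ^ 3 := by
    have := pow_le_pow_right₀ hL (by norm_num : 1 ≤ 3); simpa using this
  have e : nodalForm h (a - ε) Dh b η - nodalForm h a Dh b η =
      ∑ j, ((‖nodeDiff (a - ε) j‖ ^ 2 - ‖nodeDiff a j‖ ^ 2) / h *
          massQ ((a - ε) j 0) ((a - ε) (j + 1) 0) (Dh j) (Dh (j + 1)) (η j) (η (j + 1))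
        + ‖nodeDiff a j‖ ^ 2 / h *
          massQ (-ε j 0) (-ε (j + 1) 0) (Dh j) (Dh (j + 1)) (η j) (η (j + 1))
        + (‖nodeDiff (a - ε) j‖ ^ 2 - ‖nodeDiff a j‖ ^ 2) / h * ((η j 0 + η (j + 1) 0) / 2))
      - stiffForm h ε b η := by
    simp only [nodalForm, massForm, loadForm, stiffForm]
    rw [← sub_eq_zero]
    simp only [← Finset.sum_add_distrib, ← Finset.sum_sub_distrib]
    refine Finset.sum_eq_zero fun j _ => ?_
    simp only [Pi.sub_apply, PiLp.sub_apply, massQ]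
    ring
  rw [e]
  have hs := abs_stiffForm_le hh ε b η hb hb2
  refine (abs_sub _ _).trans ((add_le_add (Finset.abs_sum_le_sum_abs _ _) hs).trans ?_)
  rw [← Finset.sum_add_distrib]
  refine Finset.sum_le_sum fun j _ => ?_
  set x := ‖η j‖
  set y := ‖η (j + 1)‖
  have hx : 0 ≤ x := norm_nonneg _
  have hy : 0 ≤ y := norm_nonneg _
  have n1 : 0 ≤ ‖nodeDiff ε j‖ := norm_nonneg _
  have n2 : 0 ≤ ‖nodeDiff ε (j + 1)‖ := norm_nonneg _
  have n3 : 0 ≤ h * ‖ε j‖ := by positivity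
  have n4 : 0 ≤ h * ‖ε (j + 1)‖ := by positivity
  have dA : |(‖nodeDiff (a - ε) j‖ ^ 2 - ‖nodeDiff a j‖ ^ 2) / h| ≤ 3 * L * ‖nodeDiff ε j‖ := by
    rw [abs_div, abs_of_pos hh, div_le_iff₀ hh]
    refine (abs_normSq_sub_le _ _).trans ?_
    rw [nodeDiff_sub, sub_sub_cancel_left, norm_neg]
    have := norm_sub_le (nodeDiff a j) (nodeDiff ε j)
    have : ‖nodeDiff a j - nodeDiff ε j‖ + ‖nodeDiff a j‖ ≤ 3 * (L * h) := by
      linarith [ha1 j, hε1 j]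
    calc _ ≤ ‖nodeDiff ε j‖ * (3 * (L * h)) := by gcongr
      _ = _ := by ring
  have cA : ∀ i, |(a - ε) i 0| ≤ 2 * L := by
    intro i
    simp only [Pi.sub_apply, PiLp.sub_apply]
    have := abs_sub (a i 0) (ε i 0)
    linarith [ha i, abs_coord_le (ε i) 0, hε i]
  have q1 := massQ_bound (w0 := η j) (w1 := η (j + 1)) (cA j) (cA (j + 1)) (hD j) (hD (j + 1))
  have q2 := massQ_bound (p0 := -ε j 0) (p1 := -ε (j + 1) 0) (P := ‖ε j‖ + ‖ε (j + 1)‖)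
    (w0 := η j) (w1 := η (j + 1))
    (by rw [abs_neg]; linarith [abs_coord_le (ε j) 0, norm_nonneg (ε (j + 1))])
    (by rw [abs_neg]; linarith [abs_coord_le (ε (j + 1)) 0, norm_nonneg (ε j)]) (hD j) (hD (j + 1))
  have q3 : |(η j 0 + η (j + 1) 0) / 2| ≤ x + y := by
    have := abs_add_le (η j 0) (η (j + 1) 0)
    rw [abs_div, abs_two]
    linarith [abs_coord_le (η j) 0, abs_coord_le (η (j + 1)) 0]
  have q4 : |‖nodeDiff a j‖ ^ 2 / h| ≤ L ^ 2 * h := by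
    rw [abs_of_nonneg (by positivity), div_le_iff₀ hh]
    calc _ ≤ (L * h) ^ 2 := by gcongr; exact ha1 j
      _ = _ := by ring
  have t1 := mul_le_mul dA q1 (abs_nonneg _) (by positivity)
  have t2 := mul_le_mul q4 q2 (abs_nonneg _) (by positivity)
  have t3 := mul_le_mul dA q3 (abs_nonneg _) (by positivity)
  rw [← abs_mul] at t1 t2 t3
  refine (add_le_add (((abs_add_le _ _).trans (add_le_add (abs_add_le _ _) le_rfl)).trans
    (add_le_add (add_le_add t1 t2) t3)) le_rfl).trans ?_
  have m1 : 3 * L * ‖nodeDiff ε j‖ * (x + y) ≤ 3 * L ^ 3 * ‖nodeDiff ε j‖ * (x + y) := by gcongr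
  have m2 : L * (‖nodeDiff ε j‖ + ‖nodeDiff ε (j + 1)‖ + h * ‖ε j‖ + h * ‖ε (j + 1)‖) * y ≤
      L ^ 3 * (‖nodeDiff ε j‖ + ‖nodeDiff ε (j + 1)‖ + h * ‖ε j‖ + h * ‖ε (j + 1)‖) * (x + y) := by
    gcongr
    linarith
  have m3 : 0 ≤ L ^ 3 * ‖nodeDiff ε (j + 1)‖ * (x + y) := by positivity
  have m4 : 0 ≤ L ^ 3 * (h * ‖ε j‖) * (x + y) := by positivity
  have m5 : 0 ≤ L ^ 3 * (h * ‖ε (j + 1)‖) * (x + y) := by positivity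
  have m6 : 0 ≤ L ^ 3 * ‖nodeDiff ε j‖ * (x + y) := by positivity
  nlinarith

/-- The key estimate for one time step. The error equation is tested with the nodal quotient of the
discrete time derivative `D` of the error and the first component of the coefficient `a - ε`; this
turns the stiffness form into the `H¹` inner product with constant weight, so that no time
difference of the coefficient ever has to be estimated. -/
theorem step_stability {c L : ℝ} (hc : 0 < c) (hL : 1 ≤ L) (hcL : c ≤ L) :
    ∃ C : ℝ, 0 < C ∧ ∀ (J : ℕ) [NeZero J] (h ρ : ℝ) (a b Dh ε e D : ZMod J → Plane),
      0 < h → 8 * L * h ≤ c → 0 ≤ ρ → (∀ j, c ≤ a j 0) → (∀ j, |a j 0| ≤ L) →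
      (∀ j, c * h ≤ ‖nodeDiff a j‖) → (∀ j, ‖nodeDiff a j‖ ≤ L * h) →
      (∀ j, ‖nodeDiff b j‖ ≤ L * h) → (∀ j, ‖nodeDiff b (j + 1) - nodeDiff b j‖ ≤ L * h ^ 2) →
      (∀ j, ‖Dh j‖ ≤ L) → (∀ j, ‖ε j‖ ≤ c / 2) → (∀ j, ‖nodeDiff ε j‖ ≤ c / 2 * h) →
      (∀ η, |nodalForm h a Dh b η| ≤ ρ * √(l2sq h η)) →
      (∀ η, nodalForm h (a - ε) (Dh - D) (b - e) η = 0) →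
      energyInner h e D ≤ C * (ρ ^ 2 + energy h ε + energy h e) := by
  have hL0 : 0 < L := by linarith
  set K : ℝ := 22 * L ^ 3 / c + 16 * L ^ 2 / c ^ 2 + 1 with hK
  have hK0 : 0 < K := by positivity
  refine ⟨40 / c ^ 4 + 480 * K ^ 2 / c ^ 2, by positivity, ?_⟩
  intro J _ h ρ a b Dh ε e D hh hhc hρ ha haL ha1 ha2 hb hb2 hD hε hε1 hres heq
  set A := a - ε with hA
  have hA0 : ∀ j, c / 2 ≤ A j 0 := fun j => by
    have := (abs_le.1 (abs_coord_le (ε j) 0)).2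
    simp only [hA, Pi.sub_apply, PiLp.sub_apply]
    linarith [ha j, hε j]
  have hA2 : ∀ j, A j 0 ≤ 2 * L := fun j => by
    have := (abs_le.1 (abs_coord_le (ε j) 0)).1
    simp only [hA, Pi.sub_apply, PiLp.sub_apply]
    linarith [(abs_le.1 (haL j)).2, hε j]
  have hdA : ∀ j, ‖nodeDiff A j‖ ≤ 2 * L * h := fun j => by
    rw [hA, nodeDiff_sub]
    have := norm_sub_le (nodeDiff a j) (nodeDiff ε j)
    nlinarith [ha2 j, hε1 j, mul_le_mul_of_nonneg_right hcL hh.le]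
  have hdA' : ∀ j, c / 2 * h ≤ ‖nodeDiff A j‖ := fun j => by
    rw [hA, nodeDiff_sub]
    have := norm_sub_norm_le (nodeDiff a j) (nodeDiff ε j)
    linarith [ha1 j, hε1 j]
  have hdA0 : ∀ j, |A (j + 1) 0 - A j 0| ≤ 2 * L * h := fun j =>
    (abs_coord_le (nodeDiff A j) 0).trans (hdA j)
  set η : ZMod J → Plane := fun j => (A j 0)⁻¹ • D j with hη
  have hApos : ∀ j, 0 < A j 0 := fun j => (by positivity : 0 < c / 2).trans_le (hA0 j)
  have hηD : ∀ j, ‖η j‖ ≤ 2 / c * ‖D j‖ := fun j => by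
    simp only [hη, norm_smul, norm_inv, Real.norm_eq_abs, abs_of_pos (hApos j)]
    gcongr
    rw [inv_le_comm₀ (hApos j) (by positivity), inv_div]
    exact hA0 j
  set S := l2sq h D with hS
  have hS0 : 0 ≤ S := l2sq_nonneg hh D
  -- the mass form
  have hmass : c ^ 2 / 20 * S ≤ massForm h A D η := by
    have : c ^ 2 / 20 * S = ∑ j, c ^ 2 / 4 * h * ((‖D j‖ ^ 2 + ‖D (j + 1)‖ ^ 2) / 10) := by
      rw [← Finset.mul_sum, ← Finset.sum_div, Finset.sum_add_distrib,
        sum_shift (fun j => ‖D j‖ ^ 2), hS, l2sq]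
      ring
    rw [this, massForm]
    refine Finset.sum_le_sum fun j _ => ?_
    have r1 := (abs_le.1 (hdA0 j)).1
    have r2 := (abs_le.1 (hdA0 j)).2
    refine mul_le_mul ?_ (massQ_coercive (hApos j) (hApos (j + 1))
      (by linarith [hA0 (j + 1)]) (by linarith [hA0 j]) _ _) (by positivity) (by positivity)
    rw [le_div_iff₀ hh]
    calc c ^ 2 / 4 * h * h = (c / 2 * h) ^ 2 := by ring
      _ ≤ _ := by gcongr; exact hdA' j
  -- the stiffness form
  have hstiff : (∑ j, inner ℝ (nodeDiff e j) (nodeDiff D j)) / h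
      - ∑ j, 16 * L ^ 2 / c ^ 2 * ‖nodeDiff e j‖ * (‖D j‖ + ‖D (j + 1)‖) ≤ stiffForm h A e η := by
    rw [Finset.sum_div, ← Finset.sum_sub_distrib, stiffForm]
    refine Finset.sum_le_sum fun j _ => ?_
    have := stiff_element_quotient (by positivity : 0 < c / 2) (by positivity : 0 ≤ 2 * L) hh
      (hA0 j) (hA0 (j + 1)) (hdA0 j) (hA2 j) (nodeDiff e j) (D j) (D (j + 1))
    have e1 : (2 * L) ^ 2 / (c / 2) ^ 2 = 16 * L ^ 2 / c ^ 2 := by field_simp; ring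
    rw [e1, ← mul_assoc] at this
    exact this
  -- the consistency and the perturbation of the coefficient
  have hpert := nodalForm_perturb hh hL a b Dh ε η haL ha2 hb hb2 hD
    (fun j => (hε j).trans (by linarith)) (fun j => (hε1 j).trans (by gcongr; linarith))
  have heqn : massForm h A D η + stiffForm h A e η = nodalForm h A Dh b η := by
    have := heq η
    simp only [nodalForm, massForm_sub, stiffForm_sub] at this ⊢
    linarith
  have hresη : |nodalForm h a Dh b η| ≤ ρ * (2 / c * √S) := by
    refine (hres η).trans ?_
    gcongr
    rw [hS, ← Real.sqrt_sq (by positivity : 0 ≤ 2 / c), ← Real.sqrt_mul (by positivity)]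
    apply Real.sqrt_le_sqrt
    have : ∑ j, ‖η j‖ ^ 2 ≤ (2 / c) ^ 2 * ∑ j, ‖D j‖ ^ 2 := by
      rw [Finset.mul_sum]
      refine Finset.sum_le_sum fun j _ => ?_
      rw [← mul_pow]
      exact pow_le_pow_left₀ (norm_nonneg _) (hηD j) 2
    rw [l2sq, l2sq, mul_left_comm]
    exact mul_le_mul_of_nonneg_left this hh.le
  have hpert2 : |nodalForm h A Dh b η - nodalForm h a Dh b η| ≤ ∑ j, 22 * L ^ 3 / c *
      (‖nodeDiff ε j‖ + ‖nodeDiff ε (j + 1)‖ + h * ‖ε j‖ + h * ‖ε (j + 1)‖) *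
      (‖D j‖ + ‖D (j + 1)‖) := by
    refine hpert.trans (Finset.sum_le_sum fun j _ => ?_)
    have : ‖η j‖ + ‖η (j + 1)‖ ≤ 2 / c * (‖D j‖ + ‖D (j + 1)‖) := by
      linarith [hηD j, hηD (j + 1)]
    calc _ ≤ 11 * L ^ 3 * (‖nodeDiff ε j‖ + ‖nodeDiff ε (j + 1)‖ + h * ‖ε j‖ + h * ‖ε (j + 1)‖) *
        (2 / c * (‖D j‖ + ‖D (j + 1)‖)) := by gcongr
      _ = _ := by ring
  -- the `L²` part of the energy inner product is of lower order
  have hip0 : h * ∑ j, inner ℝ (e j) (D j) ≤ ∑ j, h * ‖e j‖ * (‖D j‖ + ‖D (j + 1)‖) := by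
    rw [Finset.mul_sum]
    refine Finset.sum_le_sum fun j _ => ?_
    have := real_inner_le_norm (e j) (D j)
    calc _ ≤ h * (‖e j‖ * ‖D j‖) := by gcongr
      _ = h * ‖e j‖ * ‖D j‖ := by ring
      _ ≤ _ := by gcongr; linarith [norm_nonneg (D (j + 1))]
  set P : ZMod J → ℝ := fun j => K * (‖nodeDiff ε j‖ + ‖nodeDiff ε (j + 1)‖ + h * ‖ε j‖
    + h * ‖ε (j + 1)‖ + ‖nodeDiff e j‖ + h * ‖e j‖) with hP
  have hsum : ∑ j, 22 * L ^ 3 / c *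
      (‖nodeDiff ε j‖ + ‖nodeDiff ε (j + 1)‖ + h * ‖ε j‖ + h * ‖ε (j + 1)‖) *
      (‖D j‖ + ‖D (j + 1)‖)
      + ∑ j, 16 * L ^ 2 / c ^ 2 * ‖nodeDiff e j‖ * (‖D j‖ + ‖D (j + 1)‖)
      + ∑ j, h * ‖e j‖ * (‖D j‖ + ‖D (j + 1)‖) ≤ ∑ j, P j * (‖D j‖ + ‖D (j + 1)‖) := by
    rw [← Finset.sum_add_distrib, ← Finset.sum_add_distrib]
    refine Finset.sum_le_sum fun j _ => ?_
    rw [← add_mul, ← add_mul]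
    gcongr
    have k1 : 22 * L ^ 3 / c ≤ K := by rw [hK]; linarith [(by positivity : 0 ≤ 16 * L ^ 2 / c ^ 2)]
    have k2 : 16 * L ^ 2 / c ^ 2 ≤ K := by
      rw [hK]; linarith [(by positivity : 0 ≤ 22 * L ^ 3 / c)]
    have k3 : 1 ≤ K := by
      rw [hK]
      linarith [(by positivity : 0 ≤ 22 * L ^ 3 / c), (by positivity : 0 ≤ 16 * L ^ 2 / c ^ 2)]
    have m1 := mul_le_mul_of_nonneg_right k1 (by positivity :
      0 ≤ ‖nodeDiff ε j‖ + ‖nodeDiff ε (j + 1)‖ + h * ‖ε j‖ + h * ‖ε (j + 1)‖)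
    have m2 := mul_le_mul_of_nonneg_right k2 (norm_nonneg (nodeDiff e j))
    have m3 := mul_le_mul_of_nonneg_right k3 (by positivity : 0 ≤ h * ‖e j‖)
    simp only [hP]
    linarith
  -- the norm of `D` produced by the lower order terms is absorbed by the mass form
  have hy := young_sum (by positivity : 0 < c ^ 2 / 80) hh P (fun j => ‖D j‖)
  have hPsq : (∑ j, P j ^ 2) / h ≤ 12 * K ^ 2 * (energy h ε + energy h e) := by
    have e1 : ∀ j, P j ^ 2 ≤ 6 * K ^ 2 * (‖nodeDiff ε j‖ ^ 2 + ‖nodeDiff ε (j + 1)‖ ^ 2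
        + h ^ 2 * ‖ε j‖ ^ 2 + h ^ 2 * ‖ε (j + 1)‖ ^ 2 + ‖nodeDiff e j‖ ^ 2 + h ^ 2 * ‖e j‖ ^ 2) := by
      intro j
      have sq6 : ∀ x1 x2 x3 x4 x5 x6 : ℝ, (x1 + x2 + x3 + x4 + x5 + x6) ^ 2 ≤
          6 * (x1 ^ 2 + x2 ^ 2 + x3 ^ 2 + x4 ^ 2 + x5 ^ 2 + x6 ^ 2) := by
        intro x1 x2 x3 x4 x5 x6
        have := sq_sum_le_card_mul_sum_sq (s := Finset.univ) (f := ![x1, x2, x3, x4, x5, x6])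
        simpa [Fin.sum_univ_succ, add_assoc] using this
      simp only [hP, mul_pow]
      have := mul_le_mul_of_nonneg_left (sq6 ‖nodeDiff ε j‖ ‖nodeDiff ε (j + 1)‖ (h * ‖ε j‖)
        (h * ‖ε (j + 1)‖) ‖nodeDiff e j‖ (h * ‖e j‖)) (sq_nonneg K)
      simp only [mul_pow] at this
      linarith
    have e2 : ∑ j, P j ^ 2 ≤ 6 * K ^ 2 * (2 * (∑ j, ‖nodeDiff ε j‖ ^ 2)
        + 2 * (h ^ 2 * ∑ j, ‖ε j‖ ^ 2) + (∑ j, ‖nodeDiff e j‖ ^ 2) + h ^ 2 * ∑ j, ‖e j‖ ^ 2) := by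
      refine (Finset.sum_le_sum fun j _ => e1 j).trans (le_of_eq ?_)
      rw [← Finset.mul_sum]
      simp only [Finset.sum_add_distrib, ← Finset.mul_sum,
        sum_shift (fun j => ‖nodeDiff ε j‖ ^ 2), sum_shift (fun j => ‖ε j‖ ^ 2)]
      ring
    rw [div_le_iff₀ hh]
    refine e2.trans ?_
    have e3 : 12 * K ^ 2 * (energy h ε + energy h e) * h = 6 * K ^ 2 *
        (2 * (∑ j, ‖nodeDiff ε j‖ ^ 2) + 2 * (h ^ 2 * ∑ j, ‖ε j‖ ^ 2)
          + 2 * (∑ j, ‖nodeDiff e j‖ ^ 2) + 2 * (h ^ 2 * ∑ j, ‖e j‖ ^ 2)) := by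
      simp only [energy, l2sq, h1sq]; field_simp; ring
    rw [e3]
    have : 0 ≤ ∑ j, ‖nodeDiff e j‖ ^ 2 := by positivity
    have : 0 ≤ h ^ 2 * ∑ j, ‖e j‖ ^ 2 := by positivity
    refine mul_le_mul_of_nonneg_left ?_ (by positivity)
    linarith
  have hρS : ρ * (2 / c * √S) ≤ c ^ 2 / 40 * S + 40 / c ^ 4 * ρ ^ 2 := by
    have : c ^ 2 / 40 * (√S) ^ 2 + 40 / c ^ 4 * ρ ^ 2 - ρ * (2 / c * √S)
        = (c ^ 3 * √S - 40 * ρ) ^ 2 / (40 * c ^ 4) := by field_simp; ring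
    rw [Real.sq_sqrt hS0] at this
    have : 0 ≤ (c ^ 3 * √S - 40 * ρ) ^ 2 / (40 * c ^ 4) := by positivity
    linarith
  have hfin : energyInner h e D ≤ 40 / c ^ 4 * ρ ^ 2
      + (2 * (c ^ 2 / 80))⁻¹ * ((∑ j, P j ^ 2) / h) := by
    have h1 := (abs_le.1 hresη).2
    have h2 := (abs_le.1 hpert2).2
    have h3 : 2 * (c ^ 2 / 80) * (h * ∑ j, ‖D j‖ ^ 2) = c ^ 2 / 40 * S := by
      rw [hS, l2sq]; ring
    rw [h3] at hy
    unfold energyInner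
    linarith
  refine hfin.trans ?_
  have e4 : (2 * (c ^ 2 / 80))⁻¹ * ((∑ j, P j ^ 2) / h) ≤
      480 * K ^ 2 / c ^ 2 * (energy h ε + energy h e) := by
    calc _ ≤ (2 * (c ^ 2 / 80))⁻¹ * (12 * K ^ 2 * (energy h ε + energy h e)) := by gcongr
      _ = _ := by field_simp; ring
  have n1 := energy_nonneg hh ε
  have n2 := energy_nonneg hh e
  have n3 : 0 ≤ 40 / c ^ 4 * (energy h ε + energy h e) := by positivity
  have n4 : 0 ≤ 480 * K ^ 2 / c ^ 2 * ρ ^ 2 := by positivity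
  linarith

end Stability

/-! ### Solvability of one time step -/

section Stepping

set_option linter.unusedSectionVars false

variable {J : ℕ} [NeZero J]

theorem massForm_self_ge {h c κ : ℝ} (hh : 0 < h) (hc : 0 < c) (hκ : 0 ≤ κ) (A X : ZMod J → Plane)
    (hA : ∀ j, c ≤ A j 0) (hdA : ∀ j, κ * h ≤ ‖nodeDiff A j‖) :
    κ ^ 2 * c / 3 * l2sq h X ≤ massForm h A X X := by
  have : κ ^ 2 * c / 3 * l2sq h X =
      ∑ j, κ ^ 2 * h * ((c * ‖X j‖ ^ 2 + c * ‖X (j + 1)‖ ^ 2) / 6) := by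
    rw [← Finset.mul_sum, ← Finset.sum_div, Finset.sum_add_distrib, ← Finset.mul_sum,
      ← Finset.mul_sum, sum_shift (fun j => ‖X j‖ ^ 2), l2sq]
    ring
  rw [this, massForm]
  refine Finset.sum_le_sum fun j _ => ?_
  refine mul_le_mul ?_ (le_trans ?_ (massQ_self_pos _ _ (hc.trans_le (hA j))
    (hc.trans_le (hA (j + 1))))) (by positivity) (by positivity)
  · rw [le_div_iff₀ hh]
    calc κ ^ 2 * h * h = (κ * h) ^ 2 := by ring
      _ ≤ _ := by gcongr; exact hdA j
  · gcongr
    · exact hA j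
    · exact hA (j + 1)

theorem stiffForm_self_ge {h c : ℝ} (hh : 0 < h) (A W : ZMod J → Plane)
    (hA : ∀ j, c ≤ A j 0) : c * h1sq h W ≤ stiffForm h A W W := by
  rw [h1sq, stiffForm, Finset.sum_div, Finset.mul_sum]
  refine Finset.sum_le_sum fun j _ => ?_
  rw [real_inner_self_eq_norm_sq, mul_div_assoc]
  gcongr
  linarith [hA j, hA (j + 1)]

theorem l2sq_eq_zero {h : ℝ} (hh : 0 < h) {u : ZMod J → Plane} (hu : l2sq h u ≤ 0) : u = 0 := by
  have h1 : ∑ j, ‖u j‖ ^ 2 = 0 := by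
    refine le_antisymm ?_ (by positivity)
    by_contra hcon
    push Not at hcon
    exact absurd hu (not_le.2 (mul_pos hh hcon))
  funext j
  have := (Finset.sum_eq_zero_iff_of_nonneg (fun j _ => by positivity)).1 h1 j (Finset.mem_univ j)
  simpa using this

/-- The linear system of one time step is uniquely solvable as soon as the coefficient is a
non-degenerate curve in the right half plane. -/
theorem nodalForm_solvable {h c κ μ θ : ℝ} (hh : 0 < h) (hc : 0 < c) (hκ : 0 < κ) (hμ : 0 < μ)
    (hθ : 0 ≤ θ) (A V₀ W₀ : ZMod J → Plane) (hA : ∀ j, c ≤ A j 0)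
    (hdA : ∀ j, κ * h ≤ ‖nodeDiff A j‖) :
    ∃! X : ZMod J → Plane, ∀ η, nodalForm h A (μ • X + V₀) (θ • X + W₀) η = 0 := by
  let B : (ZMod J → Plane) →ₗ[ℝ] Module.Dual ℝ (ZMod J → Plane) :=
    LinearMap.mk₂ ℝ (fun X η => μ * massForm h A X η + θ * stiffForm h A X η)
      (fun X X' η => by rw [massForm_add, stiffForm_add]; ring)
      (fun r X η => by rw [massForm_smul, stiffForm_smul, smul_eq_mul]; ring)
      (fun X η η' => by rw [massForm_add_right, stiffForm_add_right]; ring)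
      (fun r X η => by rw [massForm_smul_right, stiffForm_smul_right, smul_eq_mul]; ring)
  let ℓ : Module.Dual ℝ (ZMod J → Plane) :=
    { toFun := fun η => -(massForm h A V₀ η + stiffForm h A W₀ η + loadForm h A η)
      map_add' := fun η η' => by
        rw [massForm_add_right, stiffForm_add_right, loadForm_add_right]; ring
      map_smul' := fun r η => by
        rw [massForm_smul_right, stiffForm_smul_right, loadForm_smul_right, smul_eq_mul,
          RingHom.id_apply]; ring }
  have hinj : Function.Injective B := by
    rw [← LinearMap.ker_eq_bot, LinearMap.ker_eq_bot']
    intro X hX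
    have h1 : μ * massForm h A X X + θ * stiffForm h A X X = 0 := by
      have := LinearMap.congr_fun hX X
      simpa [B] using this
    have h2 := massForm_self_ge hh hc hκ.le A X hA hdA
    have h3 := (mul_nonneg hc.le (h1sq_nonneg hh X)).trans (stiffForm_self_ge hh A X hA)
    have h4 : 0 < κ ^ 2 * c / 3 := by positivity
    have h5 : massForm h A X X ≤ 0 := by nlinarith [mul_nonneg hθ h3]
    exact l2sq_eq_zero hh (by nlinarith)
  have hbij : Function.Bijective B := ⟨hinj,
    (LinearMap.injective_iff_surjective_of_finrank_eq_finrank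
      (Subspace.dual_finrank_eq (K := ℝ) (V := ZMod J → Plane)).symm).1 hinj⟩
  have hiff : ∀ X, (∀ η, nodalForm h A (μ • X + V₀) (θ • X + W₀) η = 0) ↔ B X = ℓ := by
    intro X
    have e : ∀ η, nodalForm h A (μ • X + V₀) (θ • X + W₀) η = B X η - ℓ η := by
      intro η
      simp only [nodalForm, massForm_add, stiffForm_add, massForm_smul, stiffForm_smul, B, ℓ,
        LinearMap.mk₂_apply, LinearMap.coe_mk, AddHom.coe_mk]
      ring
    constructor
    · intro hX
      refine LinearMap.ext fun η => ?_
      linarith [hX η, e η]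
    · intro hX η
      rw [e, hX, sub_self]
  obtain ⟨X, hX, hu⟩ := hbij.existsUnique ℓ
  exact ⟨X, (hiff X).2 hX, fun Y hY => hu Y ((hiff Y).1 hY)⟩

/-! ### The energy inner product -/

theorem energyInner_add_left (h : ℝ) (u v w : ZMod J → Plane) :
    energyInner h (u + v) w = energyInner h u w + energyInner h v w := by
  simp only [energyInner, nodeDiff_add, Pi.add_apply, inner_add_left, Finset.sum_add_distrib]
  ring

theorem energyInner_smul_left (h c : ℝ) (u w : ZMod J → Plane) :
    energyInner h (c • u) w = c * energyInner h u w := by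
  simp only [energyInner, nodeDiff_smul, Pi.smul_apply, real_inner_smul_left, ← Finset.mul_sum]
  ring

theorem energyInner_comm (h : ℝ) (u v : ZMod J → Plane) :
    energyInner h u v = energyInner h v u := by
  simp only [energyInner, real_inner_comm]

theorem energyInner_self (h : ℝ) (u : ZMod J → Plane) : energyInner h u u = energy h u := by
  simp only [energyInner, real_inner_self_eq_norm_sq, energy, l2sq, h1sq]

theorem energyInner_add_right (h : ℝ) (u v w : ZMod J → Plane) :
    energyInner h w (u + v) = energyInner h w u + energyInner h w v := by
  rw [energyInner_comm, energyInner_add_left, energyInner_comm h u, energyInner_comm h v]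

theorem energyInner_smul_right (h c : ℝ) (u w : ZMod J → Plane) :
    energyInner h w (c • u) = c * energyInner h w u := by
  rw [energyInner_comm, energyInner_smul_left, energyInner_comm]

theorem energy_add_smul (h c : ℝ) (u v : ZMod J → Plane) :
    energy h (u + c • v) = energy h u + 2 * c * energyInner h u v + c ^ 2 * energy h v := by
  simp only [← energyInner_self, energyInner_add_left, energyInner_add_right,
    energyInner_smul_left, energyInner_smul_right, energyInner_comm h v u]
  ring

theorem energy_add_le {h : ℝ} (hh : 0 < h) (u v : ZMod J → Plane) :
    energy h (u + v) ≤ 2 * energy h u + 2 * energy h v := by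
  have h1 := energy_add_smul h 1 u v
  have h2 := energy_add_smul h (-1) u v
  have h3 := energy_nonneg hh (u + (-1 : ℝ) • v)
  rw [one_smul] at h1
  linarith

theorem energy_smul (h c : ℝ) (u : ZMod J → Plane) : energy h (c • u) = c ^ 2 * energy h u := by
  simp only [← energyInner_self, energyInner_smul_left, energyInner_smul_right]
  ring

theorem energy_zero (h : ℝ) : energy h (0 : ZMod J → Plane) = 0 := by
  have := energy_smul h 0 (0 : ZMod J → Plane)
  simpa using this

theorem norm_le_of_energy {h s : ℝ} (hh : 0 < h) (hs : 0 ≤ s) {u : ZMod J → Plane}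
    (hu : energy h u ≤ s ^ 2 * h) (j : ZMod J) : ‖u j‖ ≤ s ∧ ‖nodeDiff u j‖ ≤ s * h := by
  have h1 : ‖u j‖ ^ 2 ≤ ∑ j, ‖u j‖ ^ 2 :=
    Finset.single_le_sum (f := fun j => ‖u j‖ ^ 2) (fun j _ => by positivity) (Finset.mem_univ j)
  have h2 : ‖nodeDiff u j‖ ^ 2 ≤ ∑ j, ‖nodeDiff u j‖ ^ 2 :=
    Finset.single_le_sum (f := fun j => ‖nodeDiff u j‖ ^ 2) (fun j _ => by positivity)
      (Finset.mem_univ j)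
  have h3 := l2sq_nonneg hh u
  have h4 := h1sq_nonneg hh u
  unfold energy at hu
  constructor
  · refine abs_le_of_sq_le_sq' ?_ hs |>.2
    have : h * ‖u j‖ ^ 2 ≤ h * s ^ 2 := by
      calc _ ≤ l2sq h u := by unfold l2sq; gcongr
        _ ≤ _ := by linarith
    exact le_of_mul_le_mul_left this hh
  · refine abs_le_of_sq_le_sq' ?_ (by positivity) |>.2
    have : ‖nodeDiff u j‖ ^ 2 / h ≤ s ^ 2 * h := by
      calc _ ≤ h1sq h u := by unfold h1sq; gcongr
        _ ≤ _ := by linarith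
    rw [div_le_iff₀ hh] at this
    linarith

/-! ### The two multistep methods as members of one family

For `θ = 1/2` the following is the Crank-Nicolson method and for `θ = 1` it is BDF2. All three
quantities are second order approximations at time `t_m + θ dt`. -/

/-- Extrapolation to time `t_m + θ dt`. -/
noncomputable def extrap {E : Type*} [AddCommGroup E] [Module ℝ E] (θ : ℝ) (X : ℕ → E) (m : ℕ) : E :=
  X m + θ • (X m - X (m - 1))

/-- Interpolation at time `t_m + θ dt`. -/
noncomputable def midval {E : Type*} [AddCommGroup E] [Module ℝ E] (θ : ℝ) (X : ℕ → E) (m : ℕ) : E :=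
  X m + θ • (X (m + 1) - X m)

/-- Difference quotient for the time derivative at time `t_m + θ dt`. -/
noncomputable def timeDiff {E : Type*} [AddCommGroup E] [Module ℝ E] (θ dt : ℝ) (X : ℕ → E)
    (m : ℕ) : E :=
  dt⁻¹ • ((θ + 1 / 2) • (X (m + 1) - X m) - (θ - 1 / 2) • (X m - X (m - 1)))

/-- The energy of the multistep method, `G`-norm of two successive errors. -/
noncomputable def multistepEnergy (h θ : ℝ) (e : ℕ → ZMod J → Plane) (m : ℕ) : ℝ :=
  1 / 2 * energy h (e m) + (θ - 1 / 2) * energyInner h (e m) (e m - e (m - 1))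
    + θ * (θ - 1 / 2) / 2 * energy h (e m - e (m - 1))

/-- `G`-stability: the difference of the two sides is `θ (θ - 1/2) / 2` times the energy of the
second difference of `e`. -/
theorem multistepEnergy_le {h θ dt : ℝ} (hh : 0 < h) (hθ : 1 / 2 ≤ θ) (hdt : 0 < dt)
    (e : ℕ → ZMod J → Plane) {m : ℕ} :
    multistepEnergy h θ e (m + 1) - multistepEnergy h θ e m ≤
      dt * energyInner h (midval θ e m) (timeDiff θ dt e m) := by
  set p := e (m + 1) - e m with hp
  set q := e m - e (m - 1) with hq
  have e1 : e (m + 1) = e m + (1 : ℝ) • p := by rw [hp]; simp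
  have e2 : dt * energyInner h (midval θ e m) (timeDiff θ dt e m) =
      energyInner h (e m + θ • p) ((θ + 1 / 2) • p + (-(θ - 1 / 2)) • q) := by
    rw [timeDiff, energyInner_smul_right, midval, neg_smul, ← sub_eq_add_neg,
      ← mul_assoc, mul_inv_cancel₀ hdt.ne', one_mul]
  have e3 : multistepEnergy h θ e (m + 1) = 1 / 2 * energy h (e m + (1 : ℝ) • p)
      + (θ - 1 / 2) * energyInner h (e m + (1 : ℝ) • p) p + θ * (θ - 1 / 2) / 2 * energy h p := by
    rw [multistepEnergy, Nat.add_sub_cancel, ← hp, ← e1]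
  have key := energy_nonneg hh (p + (-1 : ℝ) • q)
  rw [energy_add_smul] at key
  rw [e2, e3, multistepEnergy, ← hq, energy_add_smul]
  simp only [energyInner_add_left, energyInner_add_right, energyInner_smul_left,
    energyInner_smul_right, energyInner_self]
  have hc : 0 ≤ θ * (θ - 1 / 2) / 2 := by
    have : 0 ≤ θ - 1 / 2 := by linarith
    have : 0 ≤ θ := by linarith
    positivity
  have := mul_nonneg hc key
  nlinarith

theorem energy_le_multistepEnergy {h θ : ℝ} (hh : 0 < h) (hθ : 1 / 2 ≤ θ) (hθ1 : θ ≤ 1)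
    (e : ℕ → ZMod J → Plane) (m : ℕ) : energy h (e m) ≤ 4 * multistepEnergy h θ e m := by
  have hθ0 : 0 < θ := by linarith
  have key := energy_nonneg hh (e m + θ • (e m - e (m - 1)))
  rw [energy_add_smul] at key
  have e1 : 4 * multistepEnergy h θ e m = energy h (e m) / θ + 2 * (θ - 1 / 2) / θ *
      (energy h (e m) + 2 * θ * energyInner h (e m) (e m - e (m - 1))
        + θ ^ 2 * energy h (e m - e (m - 1))) := by
    unfold multistepEnergy; field_simp; ring
  rw [e1]
  have h1 : energy h (e m) ≤ energy h (e m) / θ := by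
    rw [le_div_iff₀ hθ0]; nlinarith [energy_nonneg hh (e m)]
  have h2 : 0 ≤ 2 * (θ - 1 / 2) / θ := by
    have : 0 ≤ θ - 1 / 2 := by linarith
    positivity
  nlinarith [mul_nonneg h2 key]

theorem multistepEnergy_one_le {h θ : ℝ} (hh : 0 < h) (hθ : 1 / 2 ≤ θ) (hθ1 : θ ≤ 1)
    (e : ℕ → ZMod J → Plane) (he : e 0 = 0) :
    multistepEnergy h θ e 1 ≤ 2 * energy h (e 1) := by
  have hn := energy_nonneg hh (e 1)
  simp only [multistepEnergy, Nat.sub_self, he, sub_zero, energyInner_self]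
  have : θ * (θ - 1 / 2) ≤ 1 := by nlinarith
  nlinarith

end Stepping

/-! ### Error estimate for the multistep methods in nodal values -/

/-- What the analysis of one time step needs to know about the nodal values `a`, `Dh`, `b` of the
exact coefficient, time derivative and solution; `ρ` bounds the consistency error. -/
structure StepData {J : ℕ} [NeZero J] (c L h ρ : ℝ) (a Dh b : ZMod J → Plane) : Prop where
  lower : ∀ j, c ≤ a j 0
  upper : ∀ j, |a j 0| ≤ L
  slope_lower : ∀ j, c * h ≤ ‖nodeDiff a j‖
  slope_upper : ∀ j, ‖nodeDiff a j‖ ≤ L * h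
  slope_mid : ∀ j, ‖nodeDiff b j‖ ≤ L * h
  second_diff : ∀ j, ‖nodeDiff b (j + 1) - nodeDiff b j‖ ≤ L * h ^ 2
  velocity : ∀ j, ‖Dh j‖ ≤ L
  residual : ∀ η, |nodalForm h a Dh b η| ≤ ρ * √(l2sq h η)

section Stepping

variable {J : ℕ} [NeZero J]

/-- One step of the multistep method, in nodal values. -/
def IsThetaStep (h dt θ : ℝ) (X : ℕ → ZMod J → Plane) (m : ℕ) : Prop :=
  ∀ η, nodalForm h (extrap θ X m) (timeDiff θ dt X m) (midval θ X m) η = 0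

theorem extrap_sub {E : Type*} [AddCommGroup E] [Module ℝ E] (θ : ℝ) (y e : ℕ → E) (m : ℕ) :
    extrap θ (y - e) m = extrap θ y m - extrap θ e m := by
  simp only [extrap, Pi.sub_apply]; module

theorem midval_sub {E : Type*} [AddCommGroup E] [Module ℝ E] (θ : ℝ) (y e : ℕ → E) (m : ℕ) :
    midval θ (y - e) m = midval θ y m - midval θ e m := by
  simp only [midval, Pi.sub_apply]; module

theorem timeDiff_sub {E : Type*} [AddCommGroup E] [Module ℝ E] (θ dt : ℝ) (y e : ℕ → E) (m : ℕ) :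
    timeDiff θ dt (y - e) m = timeDiff θ dt y m - timeDiff θ dt e m := by
  simp only [timeDiff, Pi.sub_apply]; module

theorem energy_extrap_le {h θ : ℝ} (hh : 0 < h) (hθ : 0 ≤ θ) (hθ1 : θ ≤ 1)
    (e : ℕ → ZMod J → Plane) (m : ℕ) :
    energy h (extrap θ e m) ≤ 8 * energy h (e m) + 2 * energy h (e (m - 1)) := by
  have e1 : extrap θ e m = (1 + θ) • e m + (-θ) • e (m - 1) := by unfold extrap; module
  rw [e1]
  refine (energy_add_le hh _ _).trans ?_
  rw [energy_smul, energy_smul]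
  have n1 := energy_nonneg hh (e m)
  have n2 := energy_nonneg hh (e (m - 1))
  have h1 : (1 + θ) ^ 2 ≤ 4 := by nlinarith
  have h2 : (-θ) ^ 2 ≤ 1 := by nlinarith
  nlinarith

theorem energy_midval_le {h θ : ℝ} (hh : 0 < h) (hθ : 0 ≤ θ) (hθ1 : θ ≤ 1)
    (e : ℕ → ZMod J → Plane) (m : ℕ) :
    energy h (midval θ e m) ≤ 2 * energy h (e m) + 2 * energy h (e (m + 1)) := by
  have e1 : midval θ e m = (1 - θ) • e m + θ • e (m + 1) := by unfold midval; module
  rw [e1]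
  refine (energy_add_le hh _ _).trans ?_
  rw [energy_smul, energy_smul]
  have n1 := energy_nonneg hh (e m)
  have n2 := energy_nonneg hh (e (m + 1))
  have h1 : (1 - θ) ^ 2 ≤ 1 := by nlinarith
  have h2 : θ ^ 2 ≤ 1 := by nlinarith
  nlinarith

/-- An error with energy at most `s² h` is small in `W^{1,∞}` at the nodes, and so is its
extrapolation. -/
theorem extrap_small {h s θ : ℝ} (hh : 0 < h) (hs : 0 ≤ s) (hθ : 0 ≤ θ) (hθ1 : θ ≤ 1)
    (e : ℕ → ZMod J → Plane) {m : ℕ} (h1 : energy h (e m) ≤ s ^ 2 * h)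
    (h2 : energy h (e (m - 1)) ≤ s ^ 2 * h) (j : ZMod J) :
    ‖extrap θ e m j‖ ≤ 3 * s ∧ ‖nodeDiff (extrap θ e m) j‖ ≤ 3 * s * h := by
  have key : ∀ (u v : Plane) (r : ℝ), ‖u‖ ≤ r → ‖v‖ ≤ r → ‖u + θ • (u - v)‖ ≤ 3 * r := by
    intro u v r hu hv
    have h3 := norm_add_le u (θ • (u - v))
    rw [norm_smul, Real.norm_eq_abs, abs_of_nonneg hθ] at h3
    have h4 := norm_sub_le u v
    nlinarith [norm_nonneg (u - v)]
  obtain ⟨a1, a2⟩ := norm_le_of_energy hh hs h1 j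
  obtain ⟨b1, b2⟩ := norm_le_of_energy hh hs h2 j
  constructor
  · exact key _ _ _ a1 b1
  · rw [extrap, nodeDiff_add, nodeDiff_smul, nodeDiff_sub, mul_assoc]
    exact key _ _ _ a2 b2

end Stepping

/-- A discrete Gronwall inequality for an implicit two-step recursion. -/
theorem gronwall_two_step {κ dt ρ B : ℝ} (hκ : 0 < κ) (hdt : 0 < dt) (hκdt : κ * dt ≤ 1 / 8)
    (hB : 0 ≤ B) (hρB : ρ ^ 2 ≤ B) {G E : ℕ → ℝ} {n : ℕ} (hE0 : E 0 = 0)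
    (hEG : ∀ m, E m ≤ 4 * G m) (hG1 : G 1 ≤ B)
    (hstep : ∀ m, 1 ≤ m → m + 1 ≤ n → (∀ k ≤ m, E k ≤ 4 * B * Real.exp (17 * κ * (m * dt))) →
      G (m + 1) - G m ≤ κ * dt * (ρ ^ 2 + E (m - 1) + E m + E (m + 1))) :
    ∀ m ≤ n, E m ≤ 4 * B * Real.exp (17 * κ * (m * dt)) := by
  have hmono : ∀ k m : ℕ, k ≤ m → B * Real.exp (17 * κ * (k * dt)) ≤
      B * Real.exp (17 * κ * (m * dt)) := by
    intro k m hkm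
    gcongr
  have main : ∀ m, 1 ≤ m → m ≤ n → G m ≤ B * Real.exp (17 * κ * (m * dt)) := by
    intro m
    induction m using Nat.strong_induction_on with
    | _ m ih =>
      intro hm hmn
      rcases Nat.eq_or_lt_of_le hm with rfl | hm2
      · refine hG1.trans (le_mul_of_one_le_right hB ?_)
        exact Real.one_le_exp (by positivity)
      · obtain ⟨k, rfl⟩ : ∃ k, m = k + 1 := ⟨m - 1, by omega⟩
        set Z := B * Real.exp (17 * κ * (k * dt)) with hZ
        have hEk : ∀ i ≤ k, E i ≤ 4 * Z := by
          intro i hi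
          rcases Nat.eq_zero_or_pos i with rfl | hi0
          · rw [hE0]; positivity
          · have := ih i (by omega) hi0 (by omega)
            have := hmono i k hi
            linarith [hEG i]
        have hst := hstep k (by omega) hmn (fun i hi => (hEk i hi).trans (le_of_eq (by rw [hZ]; ring)))
        have hGk := ih k (by omega) (by omega) (by omega)
        have hBZ : B ≤ Z := le_mul_of_one_le_right hB (Real.one_le_exp (by positivity))
        have hZ0 : 0 ≤ Z := hB.trans hBZ
        set y := κ * dt with hy
        have hy0 : 0 < y := by positivity
        have h1 : G (k + 1) * (1 - 4 * y) ≤ Z * (1 + 9 * y) := by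
          nlinarith [hEk (k - 1) (by omega), hEk k le_rfl, hEG (k + 1)]
        have h2 : G (k + 1) ≤ Z * (1 + 17 * y + 72 * y ^ 2) := by
          have h3 : (1 + 9 * y) ≤ (1 + 17 * y + 72 * y ^ 2) * (1 - 4 * y) := by nlinarith
          have h4 : 0 < 1 - 4 * y := by linarith
          have h5 : G (k + 1) * (1 - 4 * y) ≤ Z * (1 + 17 * y + 72 * y ^ 2) * (1 - 4 * y) := by
            rw [mul_assoc]
            exact h1.trans (mul_le_mul_of_nonneg_left h3 hZ0)
          exact le_of_mul_le_mul_right h5 h4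
        have h6 : 1 + 17 * y + 72 * y ^ 2 ≤ Real.exp (17 * y) := by
          have := Real.quadratic_le_exp_of_nonneg (by positivity : 0 ≤ 17 * y)
          nlinarith [sq_nonneg y]
        calc G (k + 1) ≤ Z * (1 + 17 * y + 72 * y ^ 2) := h2
          _ ≤ Z * Real.exp (17 * y) := by gcongr
          _ = _ := by
            rw [hZ, mul_assoc, ← Real.exp_add]
            congr 2
            push_cast
            rw [hy]; ring
  intro m hmn
  rcases Nat.eq_zero_or_pos m with rfl | hm
  · rw [hE0]; positivity
  · linarith [hEG m, main m hm hmn]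

/-- A priori error estimate: as long as the multistep solution exists, its distance to the exact
nodal values is of second order, and so small that the coefficients stay non-degenerate. -/
theorem theta_apriori {c L R K T : ℝ} (hc : 0 < c) (hL : 1 ≤ L) (hcL : c ≤ L) (hR : 0 ≤ R)
    (hK : 0 ≤ K) :
    ∃ C dt₀ h₀ γ : ℝ, 0 < C ∧ 0 < dt₀ ∧ 0 < h₀ ∧ 0 < γ ∧
      ∀ (J : ℕ) [NeZero J] (h dt θ : ℝ) (n : ℕ) (y X : ℕ → ZMod J → Plane), 0 < h → h ≤ h₀ →
        0 < dt → dt ≤ dt₀ → dt ^ 4 ≤ γ * h → 1 / 2 ≤ θ → θ ≤ 1 → n * dt ≤ T →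
        (∀ m, 1 ≤ m → m + 1 ≤ n → StepData c L h (R * (dt ^ 2 + h ^ 2)) (extrap θ y m)
          (timeDiff θ dt y m) (midval θ y m)) →
        X 0 = y 0 → energy h (y 1 - X 1) ≤ K * (dt ^ 2 + h ^ 2) ^ 2 →
        (∀ m, 1 ≤ m → m + 1 ≤ n → IsThetaStep h dt θ X m) →
        ∀ m ≤ n, energy h (y m - X m) ≤ C * (dt ^ 2 + h ^ 2) ^ 2 ∧
          energy h (y m - X m) ≤ (c / 6) ^ 2 * h := by
  obtain ⟨C0, hC0, hstab⟩ := step_stability hc hL hcL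
  set κ := 10 * C0 with hκ
  have hκ0 : 0 < κ := by positivity
  set C := 4 * (2 * K + R ^ 2) * Real.exp (17 * κ * T) + 1 with hC
  have hCpos : 0 < C := by positivity
  have hL0 : 0 < L := by linarith
  set γ := (c / 6) ^ 2 / (4 * C) with hγ
  have hγ0 : 0 < γ := by positivity
  refine ⟨C, 1 / (8 * κ), min 1 (min (c / (8 * L)) γ), γ, hCpos, by positivity, by positivity, hγ0,
    ?_⟩
  intro J _ h dt θ n y X hh hh0 hdt hdt0 hdt4 hθ hθ1 hn hdata hX0 hX1 hsol
  have hh1 : h ≤ 1 := hh0.trans (min_le_left _ _)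
  have hhc : 8 * L * h ≤ c := by
    have := hh0.trans ((min_le_right _ _).trans (min_le_left _ _))
    rw [le_div_iff₀ (by positivity)] at this; linarith
  have hhγ : h ≤ γ := hh0.trans ((min_le_right _ _).trans (min_le_right _ _))
  have hκdt : κ * dt ≤ 1 / 8 := by
    rw [le_div_iff₀ (by positivity)] at hdt0; linarith
  set τ := dt ^ 2 + h ^ 2 with hτ
  -- `dt ^ 4 ≤ γ h` turns the second order bound into smallness in `W^{1,∞}`
  have hsmall : C * τ ^ 2 ≤ (c / 6) ^ 2 * h := by
    have h1 : τ ^ 2 ≤ 2 * (dt ^ 4 + h ^ 4) := by rw [hτ]; nlinarith [sq_nonneg (dt ^ 2 - h ^ 2)]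
    have h2 : h ^ 4 ≤ γ * h := by
      have : h ^ 4 = h ^ 3 * h := by ring
      rw [this]
      gcongr
      exact (pow_le_of_le_one hh.le hh1 (by norm_num)).trans hhγ
    calc C * τ ^ 2 ≤ C * (2 * (γ * h + γ * h)) := by gcongr; linarith
      _ = _ := by rw [hγ]; field_simp; ring
  set e : ℕ → ZMod J → Plane := y - X with he
  have hXe : X = y - e := by rw [he]; abel
  have he0 : e 0 = 0 := by simp [he, hX0]
  set B := (2 * K + R ^ 2) * τ ^ 2 with hB
  have hBC : ∀ m : ℕ, m ≤ n → 4 * B * Real.exp (17 * κ * (m * dt)) ≤ C * τ ^ 2 := by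
    intro m hm
    have h1 : (m : ℝ) * dt ≤ T := le_trans (by gcongr) hn
    have h2 : Real.exp (17 * κ * (m * dt)) ≤ Real.exp (17 * κ * T) := by gcongr
    calc 4 * B * Real.exp (17 * κ * (m * dt)) ≤ 4 * B * Real.exp (17 * κ * T) := by gcongr
      _ = 4 * (2 * K + R ^ 2) * Real.exp (17 * κ * T) * τ ^ 2 := by rw [hB]; ring
      _ ≤ _ := by gcongr; rw [hC]; linarith
  have hmain := gronwall_two_step (κ := κ) (dt := dt) (ρ := R * τ) (B := B) (n := n)
    (G := multistepEnergy h θ e) (E := fun m => energy h (e m)) hκ0 hdt hκdt (by positivity)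
    (by rw [hB, mul_pow]; gcongr; linarith) (by simp [he0, energy_zero])
    (energy_le_multistepEnergy hh hθ hθ1 e)
    ((multistepEnergy_one_le hh hθ hθ1 e he0).trans (by
      have : energy h (e 1) ≤ K * τ ^ 2 := hX1
      rw [hB]; nlinarith [mul_nonneg (sq_nonneg R) (sq_nonneg τ)]))
    (by
      intro m hm hmn hsm
      -- the bound already proved at earlier times keeps the coefficient non-degenerate
      have hs : ∀ k ≤ m, energy h (e k) ≤ (c / 6) ^ 2 * h := fun k hk =>
        (hsm k hk).trans ((hBC m (by omega)).trans hsmall)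
      have hd := hdata m hm hmn
      have hth : 0 ≤ θ := by linarith
      have hext := extrap_small hh (by positivity) hth hθ1 e (hs m le_rfl) (hs (m - 1) (by omega))
      have heq := hsol m hm hmn
      rw [IsThetaStep, hXe, extrap_sub, midval_sub, timeDiff_sub] at heq
      have := hstab J h (R * τ) _ _ _ _ _ _ hh hhc (by positivity) hd.lower hd.upper hd.slope_lower
        hd.slope_upper hd.slope_mid hd.second_diff hd.velocity
        (fun j => (hext j).1.trans (by linarith)) (fun j => (hext j).2.trans (by
          apply le_of_eq; ring)) hd.residual heq
      have h1 := energy_extrap_le hh hth hθ1 e m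
      have h2 := energy_midval_le hh hth hθ1 e m
      have n1 := energy_nonneg hh (e m)
      have n2 := energy_nonneg hh (e (m + 1))
      have n3 := energy_nonneg hh (e (m - 1))
      refine (multistepEnergy_le hh hθ hdt e).trans ?_
      have h3 : (R * τ) ^ 2 + energy h (extrap θ e m) + energy h (midval θ e m) ≤
          10 * ((R * τ) ^ 2 + energy h (e (m - 1)) + energy h (e m) + energy h (e (m + 1))) := by
        linarith [sq_nonneg (R * τ)]
      calc dt * energyInner h (midval θ e m) (timeDiff θ dt e m)
          ≤ dt * (C0 * (10 * ((R * τ) ^ 2 + energy h (e (m - 1)) + energy h (e m)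
            + energy h (e (m + 1))))) := by
            gcongr
            exact this.trans (by gcongr)
        _ = _ := by rw [hκ]; ring)
  intro m hm
  have h1 := (hmain m hm).trans (hBC m hm)
  exact ⟨h1, h1.trans hsmall⟩

/-- Existence, uniqueness and error estimate for the multistep methods in nodal values. -/
theorem theta_scheme {c L R K T : ℝ} (hc : 0 < c) (hL : 1 ≤ L) (hcL : c ≤ L) (hR : 0 ≤ R)
    (hK : 0 ≤ K) :
    ∃ C dt₀ h₀ γ : ℝ, 0 < C ∧ 0 < dt₀ ∧ 0 < h₀ ∧ 0 < γ ∧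
      ∀ (J : ℕ) [NeZero J] (h dt θ : ℝ) (M : ℕ) (y : ℕ → ZMod J → Plane) (X1 : ZMod J → Plane),
        0 < h → h ≤ h₀ → 0 < dt → dt ≤ dt₀ → dt ^ 4 ≤ γ * h → 1 / 2 ≤ θ → θ ≤ 1 → M * dt ≤ T →
        (∀ m, 1 ≤ m → m + 1 ≤ M → StepData c L h (R * (dt ^ 2 + h ^ 2)) (extrap θ y m)
          (timeDiff θ dt y m) (midval θ y m)) →
        energy h (y 1 - X1) ≤ K * (dt ^ 2 + h ^ 2) ^ 2 →
        ∃ X : ℕ → ZMod J → Plane, X 0 = y 0 ∧ X 1 = X1 ∧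
          (∀ m, 1 ≤ m → m + 1 ≤ M → IsThetaStep h dt θ X m) ∧
          (∀ Y : ℕ → ZMod J → Plane, Y 0 = y 0 → Y 1 = X1 →
            (∀ m, 1 ≤ m → m + 1 ≤ M → IsThetaStep h dt θ Y m) → ∀ m, 1 ≤ M → m ≤ M → Y m = X m) ∧
          ∀ m, 1 ≤ M → m ≤ M → energy h (y m - X m) ≤ C * (dt ^ 2 + h ^ 2) ^ 2 := by
  obtain ⟨C, dt₀, h₀, γ, hC, hdt₀, hh₀, hγ, hap⟩ := theta_apriori (T := T) hc hL hcL hR hK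
  refine ⟨C, dt₀, h₀, γ, hC, hdt₀, hh₀, hγ, ?_⟩
  intro J _ h dt θ M y X1 hh hhh hdt hdtt hdt4 hθ hθ1 hM hdata hX1
  have hth : 0 ≤ θ := by linarith
  -- the a priori estimate makes each step uniquely solvable
  have hsolve : ∀ (X : ℕ → ZMod J → Plane) (n : ℕ), 1 ≤ n → n + 1 ≤ M → X 0 = y 0 → X 1 = X1 →
      (∀ m, 1 ≤ m → m + 1 ≤ n → IsThetaStep h dt θ X m) →
      ∃! Z : ZMod J → Plane, ∀ η, nodalForm h (extrap θ X n)
        (dt⁻¹ • ((θ + 1 / 2) • (Z - X n) - (θ - 1 / 2) • (X n - X (n - 1))))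
        (X n + θ • (Z - X n)) η = 0 := by
    intro X n hn hnM h0 h1 hst
    have hnd : (n : ℝ) * dt ≤ T := le_trans (by gcongr; omega) hM
    have hE := hap J h dt θ n y X hh hhh hdt hdtt hdt4 hθ hθ1 hnd
      (fun m hm hmn => hdata m hm (by omega)) h0 (by rw [h1]; exact hX1) hst
    have hd := hdata n hn hnM
    have hext := extrap_small hh (by positivity) hth hθ1 (y - X) (hE n le_rfl).2
      (hE (n - 1) (by omega)).2
    have hXe : X = y - (y - X) := by abel
    have hA0 : ∀ j, c / 2 ≤ extrap θ X n j 0 := fun j => by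
      rw [hXe, extrap_sub]
      have := (abs_le.1 ((abs_coord_le (extrap θ (y - X) n j) 0).trans (hext j).1)).2
      simp only [Pi.sub_apply, PiLp.sub_apply]
      linarith [hd.lower j]
    have hA1 : ∀ j, c / 2 * h ≤ ‖nodeDiff (extrap θ X n) j‖ := fun j => by
      rw [hXe, extrap_sub, nodeDiff_sub]
      have := norm_sub_norm_le (nodeDiff (extrap θ y n) j) (nodeDiff (extrap θ (y - X) n) j)
      linarith [hd.slope_lower j, (hext j).2]
    have := nodalForm_solvable (μ := dt⁻¹ * (θ + 1 / 2)) hh (by positivity : 0 < c / 2)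
      (by positivity : 0 < c / 2) (by positivity) hth (extrap θ X n)
      (-(dt⁻¹ • ((θ + 1 / 2) • X n + (θ - 1 / 2) • (X n - X (n - 1))))) (X n - θ • X n) hA0 hA1
    have e1 : ∀ Z : ZMod J → Plane, dt⁻¹ • ((θ + 1 / 2) • (Z - X n) - (θ - 1 / 2) • (X n - X (n - 1)))
        = (dt⁻¹ * (θ + 1 / 2)) • Z
          + -(dt⁻¹ • ((θ + 1 / 2) • X n + (θ - 1 / 2) • (X n - X (n - 1)))) := by
      intro Z; module
    have e2 : ∀ Z : ZMod J → Plane, X n + θ • (Z - X n) = θ • Z + (X n - θ • X n) := by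
      intro Z; module
    simp only [e1, e2]
    exact this
  have hex : ∀ n, 1 ≤ n → n ≤ M → ∃ X : ℕ → ZMod J → Plane, X 0 = y 0 ∧ X 1 = X1 ∧
      ∀ m, 1 ≤ m → m + 1 ≤ n → IsThetaStep h dt θ X m := by
    intro n hn
    induction n, hn using Nat.le_induction with
    | base =>
      intro _
      exact ⟨fun m => if m = 0 then y 0 else X1, by simp, by simp, fun m hm hm2 => by omega⟩
    | succ n hn ih =>
      intro hnM
      obtain ⟨X, h0, h1, hst⟩ := ih (by omega)
      obtain ⟨Z, hZ, -⟩ := hsolve X n hn hnM h0 h1 hst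
      have hup : ∀ k, k ≤ n → Function.update X (n + 1) Z k = X k := fun k hk =>
        Function.update_of_ne (by omega) _ _
      refine ⟨Function.update X (n + 1) Z, by rw [hup 0 (by omega), h0], by rw [hup 1 hn, h1], ?_⟩
      intro m hm hmn
      rcases Nat.eq_or_lt_of_le hmn with heq | hlt
      · obtain rfl : m = n := by omega
        intro η
        have := hZ η
        simpa only [extrap, timeDiff, midval, hup m le_rfl, hup (m - 1) (by omega),
          Function.update_self] using this
      · have := hst m hm (by omega)
        intro η
        have := this η
        simpa only [extrap, timeDiff, midval, hup m (by omega), hup (m - 1) (by omega),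
          hup (m + 1) (by omega)] using this
  rcases Nat.eq_zero_or_pos M with rfl | hM1
  · exact ⟨fun m => if m = 0 then y 0 else X1, by simp, by simp, fun m hm hm2 => by omega,
      fun Y _ _ _ m h1 => by omega, fun m h1 => by omega⟩
  obtain ⟨X, h0, h1, hst⟩ := hex M hM1 le_rfl
  refine ⟨X, h0, h1, hst, ?_, ?_⟩
  · intro Y hY0 hY1 hYst m _
    induction m using Nat.strong_induction_on with
    | _ m ih =>
      intro hmM
      match m, ih, hmM with
      | 0, _, _ => rw [hY0, h0]
      | 1, _, _ => rw [hY1, h1]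
      | n + 2, ih, hmM =>
        obtain ⟨Z, -, hu⟩ := hsolve X (n + 1) (by omega) hmM h0 h1
          (fun m hm hmn => hst m hm (by omega))
        have hX2 := hu (X (n + 2)) (hst (n + 1) (by omega) hmM)
        have hY2 := hu (Y (n + 2)) (by
          have := hYst (n + 1) (by omega) hmM
          intro η
          have := this η
          simpa only [extrap, timeDiff, midval, ih (n + 1) (by omega) (by omega),
            ih (n + 1 - 1) (by omega) (by omega)] using this)
        rw [hX2, hY2]
  · intro m _ hm
    exact (hap J h dt θ M y X hh hhh hdt hdtt hdt4 hθ hθ1 hM hdata h0 (by rw [h1]; exact hX1) hst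
      m hm).1

/-! ### Stability of the starting step -/

/-- Error of one linear backward Euler step. Testing with `e - q`, where `dt⁻¹ q` absorbs the smooth
part of the consistency error, keeps the full order `dt²` in `H¹`; the plain energy estimate would
only give `dt^(3/2)`. -/
theorem euler_step_error {c L : ℝ} (hc : 0 < c) (hL : 0 < L) :
    ∃ C : ℝ, 0 < C ∧ ∀ (J : ℕ) [NeZero J] (h dt ρ : ℝ) (a e q : ZMod J → Plane), 0 < h → 0 < dt →
      dt ≤ 1 → (∀ j, c ≤ a j 0) → (∀ j, |a j 0| ≤ L) → (∀ j, c * h ≤ ‖nodeDiff a j‖) →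
      (∀ η, |massForm h a (dt⁻¹ • (e - q)) η + stiffForm h a e η| ≤ ρ * √(l2sq h η)) →
      energy h e ≤ C * (energy h q + dt * ρ ^ 2) := by
  set K := L ^ 2 / (2 * c) + 3 / (2 * c ^ 3) with hK
  have hK0 : 0 < K := by positivity
  refine ⟨12 * K / c ^ 3 + 2 * K / c + 2, by positivity, ?_⟩
  intro J _ h dt ρ a e q hh hdt hdt1 ha haL hda hR
  set g := e - q with hg
  set S := l2sq h g with hS
  have hS0 : 0 ≤ S := l2sq_nonneg hh g
  have hm := massForm_self_ge hh hc hc.le a g ha hda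
  have hk := stiffForm_self_ge hh a e ha
  have hkq : stiffForm h a e q ≤ c / 2 * h1sq h e + L ^ 2 / (2 * c) * h1sq h q := by
    have : c / 2 * h1sq h e + L ^ 2 / (2 * c) * h1sq h q =
        ∑ j, (c / 2 * ‖nodeDiff e j‖ ^ 2 + L ^ 2 / (2 * c) * ‖nodeDiff q j‖ ^ 2) / h := by
      rw [← Finset.sum_div, Finset.sum_add_distrib, ← Finset.mul_sum, ← Finset.mul_sum, h1sq, h1sq]
      ring
    rw [this, stiffForm]
    refine Finset.sum_le_sum fun j _ => ?_
    gcongr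
    have h1 : |(a j 0 + a (j + 1) 0) / 2| ≤ L := by
      rw [abs_div, abs_two]
      linarith [abs_add_le (a j 0) (a (j + 1) 0), haL j, haL (j + 1)]
    have h2 := mul_le_mul h1 (abs_real_inner_le_norm (nodeDiff e j) (nodeDiff q j))
      (abs_nonneg _) hL.le
    rw [← abs_mul] at h2
    refine (le_abs_self _).trans (h2.trans ?_)
    have : c / 2 * ‖nodeDiff e j‖ ^ 2 + L ^ 2 / (2 * c) * ‖nodeDiff q j‖ ^ 2
        - L * (‖nodeDiff e j‖ * ‖nodeDiff q j‖)
        = (c * ‖nodeDiff e j‖ - L * ‖nodeDiff q j‖) ^ 2 / (2 * c) := by field_simp; ring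
    have : 0 ≤ (c * ‖nodeDiff e j‖ - L * ‖nodeDiff q j‖) ^ 2 / (2 * c) := by positivity
    linarith
  have hmain := (abs_le.1 (hR g)).2
  have e1 : stiffForm h a e g = stiffForm h a e e - stiffForm h a e q := by
    have : g = e + (-1 : ℝ) • q := by rw [hg]; module
    rw [this, stiffForm_add_right, stiffForm_smul_right]; ring
  rw [massForm_smul, e1] at hmain
  have hρ : ρ * √S ≤ c ^ 3 / 6 * (dt⁻¹ * S) + 3 / (2 * c ^ 3) * (dt * ρ ^ 2) := by
    have : c ^ 3 / 6 * (dt⁻¹ * √S ^ 2) + 3 / (2 * c ^ 3) * (dt * ρ ^ 2) - ρ * √S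
        = (c ^ 3 * √S - 3 * dt * ρ) ^ 2 / (6 * c ^ 3 * dt) := by field_simp; ring
    rw [Real.sq_sqrt hS0] at this
    have : 0 ≤ (c ^ 3 * √S - 3 * dt * ρ) ^ 2 / (6 * c ^ 3 * dt) := by positivity
    linarith
  have hm2 : c ^ 3 / 3 * (dt⁻¹ * S) ≤ dt⁻¹ * massForm h a g g := by
    calc _ = dt⁻¹ * (c ^ 2 * c / 3 * S) := by ring
      _ ≤ _ := by gcongr
  have n1 : 0 ≤ dt⁻¹ * S := by positivity
  have n2 := h1sq_nonneg hh e
  have n3 := h1sq_nonneg hh q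
  have n4 := l2sq_nonneg hh q
  have n5 : 0 ≤ dt * ρ ^ 2 := by positivity
  set Q := energy h q + dt * ρ ^ 2 with hQ
  have hQq : h1sq h q ≤ Q := by rw [hQ, energy]; linarith
  have hQ0 : 0 ≤ Q := n3.trans hQq
  have hQq' : l2sq h q ≤ Q := by rw [hQ, energy]; linarith
  have hQρ : dt * ρ ^ 2 ≤ Q := by rw [hQ]; linarith [energy_nonneg hh q]
  have htot : c ^ 3 / 6 * (dt⁻¹ * S) + c / 2 * h1sq h e ≤ K * Q := by
    have h1 : L ^ 2 / (2 * c) * h1sq h q ≤ L ^ 2 / (2 * c) * Q := by gcongr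
    have h2 : 3 / (2 * c ^ 3) * (dt * ρ ^ 2) ≤ 3 / (2 * c ^ 3) * Q := by gcongr
    rw [hK, add_mul]
    linarith
  have hSQ : S ≤ 6 * K / c ^ 3 * Q := by
    have h1 : S ≤ dt⁻¹ * S := le_mul_of_one_le_left hS0 ((one_le_inv₀ hdt).2 hdt1)
    have h2 : c ^ 3 / 6 * S ≤ K * Q := by
      have : c ^ 3 / 6 * S ≤ c ^ 3 / 6 * (dt⁻¹ * S) := by gcongr
      nlinarith
    have h3 : 6 * K / c ^ 3 * Q = K * Q / (c ^ 3 / 6) := by field_simp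
    rw [h3, le_div_iff₀ (by positivity)]
    linarith
  have hHQ : h1sq h e ≤ 2 * K / c * Q := by
    have h2 : c / 2 * h1sq h e ≤ K * Q := by
      have : 0 ≤ c ^ 3 / 6 * (dt⁻¹ * S) := by positivity
      linarith
    have h3 : 2 * K / c * Q = K * Q / (c / 2) := by field_simp
    rw [h3, le_div_iff₀ (by positivity)]
    linarith
  have hle : l2sq h e ≤ 2 * S + 2 * l2sq h q := by
    have : ∀ j, ‖e j‖ ^ 2 ≤ 2 * ‖g j‖ ^ 2 + 2 * ‖q j‖ ^ 2 := by
      intro j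
      have h1 : e j = g j + q j := by simp [hg]
      have h2 := norm_add_le (g j) (q j)
      rw [← h1] at h2
      nlinarith [sq_nonneg (‖g j‖ - ‖q j‖), norm_nonneg (e j)]
    rw [hS, l2sq, l2sq, l2sq]
    calc h * ∑ j, ‖e j‖ ^ 2 ≤ h * ∑ j, (2 * ‖g j‖ ^ 2 + 2 * ‖q j‖ ^ 2) := by
          gcongr with j; exact this j
      _ = _ := by rw [Finset.sum_add_distrib, ← Finset.mul_sum, ← Finset.mul_sum]; ring
  calc energy h e = l2sq h e + h1sq h e := rfl
    _ ≤ 2 * (6 * K / c ^ 3 * Q) + 2 * Q + 2 * K / c * Q := by linarith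
    _ = _ := by ring

/-! ### Weak derivatives on the circle -/

theorem integral_circleVol {E : Type*} [NormedAddCommGroup E] [NormedSpace ℝ E] (f : ℝ → E) :
    ∫ ρ, f ρ ∂circleVol = ∫ ρ in (0 : ℝ)..1, f ρ :=
  (intervalIntegral.integral_of_le zero_le_one).symm

theorem integrable_circleVol_iff {E : Type*} [NormedAddCommGroup E] {f : ℝ → E} :
    Integrable f circleVol ↔ IntervalIntegrable f volume 0 1 :=
  (intervalIntegrable_iff_integrableOn_Ioc_of_le zero_le_one).symm

instance : IsProbabilityMeasure circleVol := ⟨by simp [circleVol]⟩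

theorem intervalIntegral_congr_circleVol {E : Type*} [NormedAddCommGroup E] [NormedSpace ℝ E]
    {f g : ℝ → E} (h : f =ᵐ[circleVol] g) : ∫ ρ in (0 : ℝ)..1, f ρ = ∫ ρ in (0 : ℝ)..1, g ρ := by
  rw [← integral_circleVol, ← integral_circleVol]
  exact integral_congr_ae h

/-- The periodic extension of a smooth function supported in `(0,1)` is smooth. -/
theorem contDiff_comp_fract {g : ℝ → ℝ} (hg : ContDiff ℝ (⊤ : ℕ∞) g) (hs : tsupport g ⊆ Ioo 0 1) :
    ContDiff ℝ (⊤ : ℕ∞) fun ρ => g (Int.fract ρ) := by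
  have hz : ∀ t, t ∉ Ioo (0 : ℝ) 1 → g t = 0 := fun t ht =>
    image_eq_zero_of_notMem_tsupport fun h => ht (hs h)
  rw [contDiff_iff_contDiffAt]
  intro ρ₀
  set n : ℝ := (⌊ρ₀⌋ : ℝ) with hn
  have h1 : ContDiffAt ℝ (⊤ : ℕ∞) (fun ρ => g (ρ - n) + g (ρ - n + 1)) ρ₀ := by
    apply ContDiff.contDiffAt
    fun_prop
  refine h1.congr_of_eventuallyEq ?_
  have hmem : Ioo (n - 1) (n + 1) ∈ 𝓝 ρ₀ :=
    Ioo_mem_nhds (by linarith [Int.floor_le ρ₀]) (Int.lt_floor_add_one ρ₀)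
  filter_upwards [hmem] with ρ hρ
  rcases lt_or_ge ρ n with hlt | hge
  · have : ⌊ρ⌋ = ⌊ρ₀⌋ - 1 := by
      rw [Int.floor_eq_iff]; push_cast
      constructor <;> linarith [hρ.1, hn]
    rw [Int.fract, this, hz (ρ - n) fun h => by linarith [h.1]]
    push_cast
    rw [← hn]; ring_nf
  · have : ⌊ρ⌋ = ⌊ρ₀⌋ := by
      rw [Int.floor_eq_iff]
      constructor <;> linarith [hρ.2, hn]
    rw [Int.fract, this, hz (ρ - n + 1) fun h => by linarith [h.2]]
    rw [← hn, add_zero]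

/-- Periodic smooth functions separate the classes of integrable functions. -/
theorem ae_eq_zero_of_periodic_test {E : Type*} [NormedAddCommGroup E] [NormedSpace ℝ E]
    [CompleteSpace E] {k : ℝ → E}
    (hk : Integrable k circleVol)
    (h : ∀ φ : ℝ → ℝ, ContDiff ℝ (⊤ : ℕ∞) φ → Function.Periodic φ 1 →
      ∫ ρ in (0 : ℝ)..1, φ ρ • k ρ = 0) : k =ᵐ[circleVol] 0 := by
  have hloc : LocallyIntegrableOn k (Ioo (0 : ℝ) 1) volume := by
    apply IntegrableOn.locallyIntegrableOn
    exact IntegrableOn.mono_set hk Ioo_subset_Ioc_self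
  have h1 : ∀ᵐ ρ ∂volume, ρ ∈ Ioo (0 : ℝ) 1 → k ρ = 0 := by
    refine isOpen_Ioo.ae_eq_zero_of_integral_contDiff_smul_eq_zero hloc ?_
    intro g hg _ hgs
    have hz : ∀ t, t ∉ Ioo (0 : ℝ) 1 → g t = 0 := fun t ht =>
      image_eq_zero_of_notMem_tsupport fun h => ht (hgs h)
    have h2 := h (fun ρ => g (Int.fract ρ)) (contDiff_comp_fract hg hgs) (fun ρ => by simp)
    rw [intervalIntegral.integral_of_le zero_le_one, integral_Ioc_eq_integral_Ioo] at h2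
    rw [← setIntegral_eq_integral_of_forall_compl_eq_zero (s := Ioo (0 : ℝ) 1)
      (fun ρ hρ => by rw [hz ρ hρ, zero_smul]), ← h2]
    refine setIntegral_congr_fun measurableSet_Ioo fun ρ hρ => ?_
    rw [Int.fract_eq_self.2 ⟨hρ.1.le, hρ.2⟩]
  have h2 : ∀ᵐ ρ ∂(volume.restrict (Ioo (0 : ℝ) 1)), k ρ = 0 :=
    (ae_restrict_iff' measurableSet_Ioo).2 h1
  rw [Measure.restrict_congr_set Ioo_ae_eq_Ioc] at h2
  exact h2

theorem continuous_smul_integrable {E : Type*} [NormedAddCommGroup E] [NormedSpace ℝ E]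
    {φ : ℝ → ℝ} {k : ℝ → E} (hφ : Continuous φ) (hk : Integrable k circleVol) :
    IntervalIntegrable (fun ρ => φ ρ • k ρ) volume 0 1 :=
  (integrable_circleVol_iff.1 hk).continuousOn_smul hφ.continuousOn

theorem HasWeakDeriv.unique {f f' g g' : ℝ → Plane} (hg : HasWeakDeriv f g)
    (hg' : HasWeakDeriv f' g') (hf : f =ᵐ[circleVol] f') : g =ᵐ[circleVol] g' := by
  have h := ae_eq_zero_of_periodic_test (hg.2.1.sub hg'.2.1) (fun φ hφ hp => by
    have h1 := hg.2.2 φ hφ hp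
    have h2 := hg'.2.2 φ hφ hp
    have h3 : ∫ ρ in (0 : ℝ)..1, deriv φ ρ • f ρ = ∫ ρ in (0 : ℝ)..1, deriv φ ρ • f' ρ := by
      apply intervalIntegral_congr_circleVol
      filter_upwards [hf] with ρ hρ
      rw [hρ]
    simp only [Pi.sub_apply, smul_sub]
    rw [intervalIntegral.integral_sub (continuous_smul_integrable hφ.continuous hg.2.1)
      (continuous_smul_integrable hφ.continuous hg'.2.1)]
    rw [← h3, h1, neg_inj] at h2
    rw [h2, sub_self])
  filter_upwards [h] with ρ hρ
  simpa [sub_eq_zero] using hρ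

theorem HasWeakDeriv.wderiv_ae {f g : ℝ → Plane} (hg : HasWeakDeriv f g) :
    wderiv f =ᵐ[circleVol] g := by
  have hex : ∃ g, HasWeakDeriv f g := ⟨g, hg⟩
  rw [wderiv, dif_pos hex]
  exact hex.choose_spec.unique hg ae_eq_rfl

theorem HasWeakDeriv.congr {f f' g g' : ℝ → Plane} (h : HasWeakDeriv f g)
    (hf : f =ᵐ[circleVol] f') (hg : g =ᵐ[circleVol] g') : HasWeakDeriv f' g' := by
  refine ⟨h.1.congr hf, h.2.1.congr hg, fun φ hφ hp => ?_⟩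
  have h1 : ∫ ρ in (0 : ℝ)..1, deriv φ ρ • f ρ = ∫ ρ in (0 : ℝ)..1, deriv φ ρ • f' ρ := by
    apply intervalIntegral_congr_circleVol
    filter_upwards [hf] with ρ hρ
    rw [hρ]
  have h2 : ∫ ρ in (0 : ℝ)..1, φ ρ • g ρ = ∫ ρ in (0 : ℝ)..1, φ ρ • g' ρ := by
    apply intervalIntegral_congr_circleVol
    filter_upwards [hg] with ρ hρ
    rw [hρ]
  rw [← h1, ← h2]
  exact h.2.2 φ hφ hp

theorem continuous_deriv_of_smooth {φ : ℝ → ℝ} (hφ : ContDiff ℝ (⊤ : ℕ∞) φ) :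
    Continuous (deriv φ) := hφ.continuous_deriv (by simp)

theorem HasWeakDeriv.sub {f f' g g' : ℝ → Plane} (h : HasWeakDeriv f g)
    (h' : HasWeakDeriv f' g') : HasWeakDeriv (f - f') (g - g') := by
  refine ⟨h.1.sub h'.1, h.2.1.sub h'.2.1, fun φ hφ hp => ?_⟩
  have hd := continuous_deriv_of_smooth hφ
  simp only [Pi.sub_apply, smul_sub]
  rw [intervalIntegral.integral_sub (continuous_smul_integrable hd h.1)
      (continuous_smul_integrable hd h'.1),
    intervalIntegral.integral_sub (continuous_smul_integrable hφ.continuous h.2.1)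
      (continuous_smul_integrable hφ.continuous h'.2.1), h.2.2 φ hφ hp, h'.2.2 φ hφ hp]
  abel

/-- A continuous periodic function that is differentiable off a countable set, with integrable
derivative, is weakly differentiable. -/
theorem hasWeakDeriv_of_hasDerivAt {f f' : ℝ → Plane} (hf : Continuous f)
    (hp : Function.Periodic f 1) {S : Set ℝ} (hS : S.Countable)
    (hd : ∀ ρ, ρ ∉ S → HasDerivAt f (f' ρ) ρ) (hi : Integrable f' circleVol) :
    HasWeakDeriv f f' := by
  have hfi : Integrable f circleVol := integrable_circleVol_iff.2 (hf.intervalIntegrable _ _)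
  refine ⟨hfi, hi, fun φ hφ hφp => ?_⟩
  have hφd := continuous_deriv_of_smooth hφ
  have i1 := continuous_smul_integrable hφd hfi
  have i2 := continuous_smul_integrable hφ.continuous hi
  have h1 := integral_eq_of_hasDerivAt_off_countable (fun ρ => φ ρ • f ρ)
    (fun ρ => φ ρ • f' ρ + deriv φ ρ • f ρ) (a := 0) (b := 1) hS
    ((hφ.continuous.smul hf).continuousOn)
    (fun ρ hρ => ((hφ.differentiable (by simp) ρ).hasDerivAt.smul (hd ρ hρ.2)))
    (i2.add i1)
  rw [intervalIntegral.integral_add i2 i1] at h1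
  have h2 : φ 1 = φ 0 := by simpa using hφp 0
  have h3 : f 1 = f 0 := by simpa using hp 0
  rw [h2, h3, sub_self] at h1
  exact eq_neg_of_add_eq_zero_right h1

/-- Integration by parts against the primitive of an integrable function. -/
theorem integral_deriv_mul_primitive {φ φ' g F : ℝ → ℝ} (hφ : ∀ ρ, HasDerivAt φ (φ' ρ) ρ)
    (hφ' : Continuous φ') (hg : IntervalIntegrable g volume 0 1)
    (hF : ∀ ρ ∈ Icc (0 : ℝ) 1, F ρ = F 0 + ∫ σ in (0 : ℝ)..ρ, g σ) :
    ∫ ρ in (0 : ℝ)..1, φ' ρ * F ρ = φ 1 * F 1 - φ 0 * F 0 - ∫ ρ in (0 : ℝ)..1, φ ρ * g ρ := by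
  have hderiv : deriv φ = φ' := funext fun ρ => (hφ ρ).deriv
  have acφ : AbsolutelyContinuousOnInterval φ 0 1 := by
    apply ContDiffOn.absolutelyContinuousOnInterval
    apply ContDiff.contDiffOn
    rw [contDiff_one_iff_deriv]
    exact ⟨fun ρ => (hφ ρ).differentiableAt, by rw [hderiv]; exact hφ'⟩
  have acc : AbsolutelyContinuousOnInterval (fun _ : ℝ => F 0) 0 1 :=
    (contDiff_const.contDiffOn).absolutelyContinuousOnInterval
  have acG := hg.absolutelyContinuousOnInterval_intervalIntegral (c := 0) left_mem_uIcc
  have acs : AbsolutelyContinuousOnInterval (fun ρ => F 0 + ∫ v in (0 : ℝ)..ρ, g v) 0 1 :=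
    acc.add acG
  have key := acφ.integral_mul_deriv_eq_deriv_mul acs
  have e1 : ∫ ρ in (0 : ℝ)..1, φ ρ * deriv (fun ρ => F 0 + ∫ v in (0 : ℝ)..ρ, g v) ρ
      = ∫ ρ in (0 : ℝ)..1, φ ρ * g ρ := by
    apply intervalIntegral.integral_congr_ae
    filter_upwards [hg.ae_hasDerivAt_integral] with ρ hρ hmem
    have hmem' : ρ ∈ uIcc (0 : ℝ) 1 := uIoc_subset_uIcc hmem
    have := (hρ hmem' 0 left_mem_uIcc).const_add (F 0)
    rw [this.deriv]
  have e2 : ∫ ρ in (0 : ℝ)..1, deriv φ ρ * (F 0 + ∫ v in (0 : ℝ)..ρ, g v)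
      = ∫ ρ in (0 : ℝ)..1, φ' ρ * F ρ := by
    apply intervalIntegral.integral_congr
    intro ρ hρ
    rw [uIcc_of_le zero_le_one] at hρ
    simp only [hderiv]
    rw [← hF ρ hρ]
  rw [e1, e2] at key
  have h0 := hF 0 (by simp)
  have h1 := hF 1 (by simp)
  rw [← h0, ← h1] at key
  linarith

theorem intervalIntegral_coord {f : ℝ → Plane} {a b : ℝ} (hf : IntervalIntegrable f volume a b)
    (i : Fin 2) : (∫ ρ in a..b, f ρ) i = ∫ ρ in a..b, f ρ i := by
  have := (EuclideanSpace.proj i : Plane →L[ℝ] ℝ).intervalIntegral_comp_comm hf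
  simpa using this.symm

theorem intervalIntegrable_coord {f : ℝ → Plane} {a b : ℝ}
    (hf : IntervalIntegrable f volume a b) (i : Fin 2) :
    IntervalIntegrable (fun ρ => f ρ i) volume a b := by
  exact ⟨(EuclideanSpace.proj i : Plane →L[ℝ] ℝ).integrable_comp hf.1,
    (EuclideanSpace.proj i : Plane →L[ℝ] ℝ).integrable_comp hf.2⟩

theorem intervalIntegrable_of_circle {g : ℝ → Plane} (hg : Integrable g circleVol) {ρ : ℝ}
    (hρ : ρ ∈ Icc (0 : ℝ) 1) : IntervalIntegrable g volume 0 ρ :=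
  (integrable_circleVol_iff.1 hg).mono_set (by
    rw [uIcc_of_le hρ.1, uIcc_of_le zero_le_one]; exact Icc_subset_Icc_right hρ.2)

theorem integral_deriv_smul_primitive {φ φ' : ℝ → ℝ} {g F : ℝ → Plane}
    (hφ : ∀ ρ, HasDerivAt φ (φ' ρ) ρ) (hφ' : Continuous φ') (hg : Integrable g circleVol)
    (hFc : Continuous F) (hF : ∀ ρ ∈ Icc (0 : ℝ) 1, F ρ = F 0 + ∫ σ in (0 : ℝ)..ρ, g σ) :
    ∫ ρ in (0 : ℝ)..1, φ' ρ • F ρ = φ 1 • F 1 - φ 0 • F 0 - ∫ ρ in (0 : ℝ)..1, φ ρ • g ρ := by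
  have hFi : Integrable F circleVol := integrable_circleVol_iff.2 (hFc.intervalIntegrable _ _)
  have hφc : Continuous φ := continuous_iff_continuousAt.2 fun ρ => (hφ ρ).continuousAt
  ext i
  simp only [PiLp.sub_apply]
  rw [intervalIntegral_coord (continuous_smul_integrable hφ' hFi),
    intervalIntegral_coord (continuous_smul_integrable hφc hg)]
  simp only [PiLp.smul_apply, smul_eq_mul]
  refine integral_deriv_mul_primitive (F := fun ρ => F ρ i) (g := fun ρ => g ρ i) hφ hφ'
    (intervalIntegrable_coord (integrable_circleVol_iff.1 hg) i) ?_
  intro ρ hρ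
  rw [hF ρ hρ, PiLp.add_apply, intervalIntegral_coord (intervalIntegrable_of_circle hg hρ)]

/-- A primitive of an integrable function that closes up is weakly differentiable, and so is its
product with a periodic `C¹` function. -/
theorem hasWeakDeriv_smul_primitive {a a' : ℝ → ℝ} {g F : ℝ → Plane}
    (ha : ∀ ρ, HasDerivAt a (a' ρ) ρ) (ha' : Continuous a') (hap : a 1 = a 0)
    (hg : Integrable g circleVol) (hFc : Continuous F) (hFp : F 1 = F 0)
    (hF : ∀ ρ ∈ Icc (0 : ℝ) 1, F ρ = F 0 + ∫ σ in (0 : ℝ)..ρ, g σ) :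
    HasWeakDeriv (fun ρ => a ρ • F ρ) (fun ρ => a' ρ • F ρ + a ρ • g ρ) := by
  have hac : Continuous a := continuous_iff_continuousAt.2 fun ρ => (ha ρ).continuousAt
  have hFi : Integrable F circleVol := integrable_circleVol_iff.2 (hFc.intervalIntegrable _ _)
  have i1 : Integrable (fun ρ => a ρ • g ρ) circleVol :=
    integrable_circleVol_iff.2 (continuous_smul_integrable hac hg)
  have i2 : Integrable (fun ρ => a' ρ • F ρ) circleVol :=
    integrable_circleVol_iff.2 (continuous_smul_integrable ha' hFi)
  refine ⟨integrable_circleVol_iff.2 ((hac.smul hFc).intervalIntegrable _ _), i2.add i1, ?_⟩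
  intro φ hφ hφp
  have hφd := continuous_deriv_of_smooth hφ
  have hφ1 : φ 1 = φ 0 := by simpa using hφp 0
  have key := integral_deriv_smul_primitive (φ := fun ρ => φ ρ * a ρ)
    (φ' := fun ρ => deriv φ ρ * a ρ + φ ρ * a' ρ)
    (fun ρ => (hφ.differentiable (by simp) ρ).hasDerivAt.mul (ha ρ))
    ((hφd.mul hac).add (hφ.continuous.mul ha')) hg hFc hF
  simp only [hφ1, hap, hFp, sub_self, add_smul, mul_smul, zero_sub] at key
  have j1 : IntervalIntegrable (fun ρ => deriv φ ρ • a ρ • F ρ) volume 0 1 :=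
    (hφd.smul (hac.smul hFc)).intervalIntegrable _ _
  have j2 : IntervalIntegrable (fun ρ => φ ρ • a' ρ • F ρ) volume 0 1 :=
    (hφ.continuous.smul (ha'.smul hFc)).intervalIntegrable _ _
  rw [intervalIntegral.integral_add j1 j2] at key
  simp only [smul_add]
  rw [intervalIntegral.integral_add j2
    (continuous_smul_integrable hφ.continuous i1), neg_add]
  rw [← key]
  abel

/-- A function with vanishing weak derivative is constant; tested form. -/
theorem ae_const_of_periodic_test {k : ℝ → Plane} (hk : Integrable k circleVol)
    (h : ∀ φ : ℝ → ℝ, ContDiff ℝ (⊤ : ℕ∞) φ → Function.Periodic φ 1 →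
      ∫ ρ in (0 : ℝ)..1, deriv φ ρ • k ρ = 0) :
    ∃ c : Plane, k =ᵐ[circleVol] fun _ => c := by
  set c := ∫ ρ in (0 : ℝ)..1, k ρ with hc
  refine ⟨c, ?_⟩
  have hki := integrable_circleVol_iff.1 hk
  have h0 := ae_eq_zero_of_periodic_test (k := fun ρ => k ρ - c) (hk.sub (integrable_const c)) (by
    intro φ hφ hφp
    set m := ∫ ρ in (0 : ℝ)..1, φ ρ with hm
    set ψ : ℝ → ℝ := fun ρ => ∫ σ in (0 : ℝ)..ρ, (φ σ - m) with hψ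
    have hcont : Continuous fun σ => φ σ - m := hφ.continuous.sub continuous_const
    have hψd : ∀ ρ, HasDerivAt ψ (φ ρ - m) ρ := fun ρ =>
      intervalIntegral.integral_hasDerivAt_right (hcont.intervalIntegrable _ _)
        (hcont.stronglyMeasurableAtFilter _ _) hcont.continuousAt
    have hderiv : deriv ψ = fun ρ => φ ρ - m := funext fun ρ => (hψd ρ).deriv
    have hψs : ContDiff ℝ (⊤ : ℕ∞) ψ := by
      rw [contDiff_infty_iff_deriv]
      exact ⟨fun ρ => (hψd ρ).differentiableAt, by rw [hderiv]; exact hφ.sub contDiff_const⟩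
    have hψp : Function.Periodic ψ 1 := by
      intro ρ
      have hper : Function.Periodic (fun σ => φ σ - m) 1 := fun σ => by simp [hφp σ]
      have e := hper.intervalIntegral_add_eq ρ 0
      have e0 : ∫ σ in (0 : ℝ)..1, (φ σ - m) = 0 := by
        rw [intervalIntegral.integral_sub (hφ.continuous.intervalIntegrable _ _)
          (by simp), intervalIntegral.integral_const, ← hm]
        simp
      rw [zero_add, e0] at e
      simp only [hψ]
      rw [← intervalIntegral.integral_add_adjacent_intervals (b := ρ)
        (hcont.intervalIntegrable _ _) (hcont.intervalIntegrable _ _), e, add_zero]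
    have h1 := h ψ hψs hψp
    rw [hderiv] at h1
    simp only [sub_smul] at h1
    have iφk := continuous_smul_integrable hφ.continuous hk
    have imk : IntervalIntegrable (fun ρ => m • k ρ) volume 0 1 := hki.smul m
    rw [intervalIntegral.integral_sub iφk imk, intervalIntegral.integral_smul,
      sub_eq_zero] at h1
    simp only [smul_sub]
    have iφc : IntervalIntegrable (fun ρ => φ ρ • c) volume 0 1 :=
      (hφ.continuous.smul continuous_const).intervalIntegrable _ _
    rw [intervalIntegral.integral_sub iφk iφc, h1,
      intervalIntegral.integral_smul_const, sub_self])
  filter_upwards [h0] with ρ hρ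
  simpa [sub_eq_zero] using hρ

/-- A weakly differentiable function has a continuous periodic representative, which is a primitive
of its weak derivative. -/
theorem HasWeakDeriv.exists_primitive {f g : ℝ → Plane} (h : HasWeakDeriv f g) :
    ∃ F : ℝ → Plane, Continuous F ∧ Function.Periodic F 1 ∧ F =ᵐ[circleVol] f ∧
      ∀ ρ ∈ Icc (0 : ℝ) 1, F ρ = F 0 + ∫ σ in (0 : ℝ)..ρ, g σ := by
  have hgi := integrable_circleVol_iff.1 h.2.1
  have hmean : ∫ ρ in (0 : ℝ)..1, g ρ = 0 := by
    have := h.2.2 (fun _ => 1) contDiff_const (fun _ => rfl)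
    simpa using this.symm
  set gp : ℝ → Plane := fun ρ => g (Int.fract ρ) with hgp
  have hgpp : Function.Periodic gp 1 := fun ρ => by simp [hgp]
  have hgpg : ∀ ρ ∈ Icc (0 : ℝ) 1, ∫ σ in (0 : ℝ)..ρ, gp σ = ∫ σ in (0 : ℝ)..ρ, g σ := by
    intro ρ hρ
    rw [intervalIntegral.integral_of_le hρ.1, intervalIntegral.integral_of_le hρ.1,
      integral_Ioc_eq_integral_Ioo, integral_Ioc_eq_integral_Ioo]
    refine setIntegral_congr_fun measurableSet_Ioo fun σ hσ => ?_
    simp only [hgp]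
    rw [Int.fract_eq_self.2 ⟨hσ.1.le, hσ.2.trans_le hρ.2⟩]
  have hgpi : IntervalIntegrable gp volume 0 1 := by
    refine hgi.congr_ae ?_
    rw [uIoc_of_le zero_le_one, ← Measure.restrict_congr_set Ioo_ae_eq_Ioc]
    filter_upwards [ae_restrict_mem measurableSet_Ioo] with σ hσ
    simp only [hgp]
    rw [Int.fract_eq_self.2 ⟨hσ.1.le, hσ.2⟩]
  have hgpi' : ∀ a b, IntervalIntegrable gp volume a b := fun a b =>
    hgpp.intervalIntegrable (t := 0) one_ne_zero (by simpa using hgpi) a b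
  set F0 : ℝ → Plane := fun ρ => ∫ σ in (0 : ℝ)..ρ, gp σ with hF0
  have hF0c : Continuous F0 := intervalIntegral.continuous_primitive hgpi' 0
  have hF0p : Function.Periodic F0 1 := by
    intro ρ
    have e := hgpp.intervalIntegral_add_eq ρ 0
    rw [zero_add, hgpg 1 (by simp), hmean] at e
    simp only [hF0]
    rw [← intervalIntegral.integral_add_adjacent_intervals (hgpi' 0 ρ) (hgpi' ρ (ρ + 1)), e,
      add_zero]
  have hF00 : F0 0 = 0 := by simp [hF0]
  have hF0i : Integrable F0 circleVol := integrable_circleVol_iff.2 (hF0c.intervalIntegrable _ _)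
  have hF0F : ∀ ρ ∈ Icc (0 : ℝ) 1, F0 ρ = F0 0 + ∫ σ in (0 : ℝ)..ρ, g σ := by
    intro ρ hρ
    rw [hF00, zero_add, ← hgpg ρ hρ]
  obtain ⟨c, hc⟩ := ae_const_of_periodic_test (k := f - F0) (h.1.sub hF0i) (by
    intro φ hφ hφp
    have hφd := continuous_deriv_of_smooth hφ
    have e := integral_deriv_smul_primitive
      (fun ρ => (hφ.differentiable (by simp) ρ).hasDerivAt) hφd h.2.1 hF0c hF0F
    have h1 : F0 1 = F0 0 := by simpa using hF0p 0
    have h2 : φ 1 = φ 0 := by simpa using hφp 0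
    rw [h1, h2, sub_self, zero_sub] at e
    simp only [Pi.sub_apply, smul_sub]
    rw [intervalIntegral.integral_sub (continuous_smul_integrable hφd h.1)
      (continuous_smul_integrable hφd hF0i), e, h.2.2 φ hφ hφp, sub_self])
  refine ⟨fun ρ => c + F0 ρ, continuous_const.add hF0c, fun ρ => by simp [hF0p ρ], ?_, ?_⟩
  · filter_upwards [hc] with ρ hρ
    rw [← hρ]; simp
  · intro ρ hρ
    simp only []
    rw [hF0F ρ hρ, add_assoc]

/-! ### Piecewise affine functions and their nodal values -/

section FiniteElements

set_option linter.unusedSectionVars false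

variable {J : ℕ} [NeZero J]

/-- The continuous piecewise affine 1-periodic function with nodal values `u`. -/
noncomputable def plin (u : ZMod J → Plane) : ℝ → Plane := fun ρ =>
  (1 - Int.fract (ρ * J)) • u (⌊ρ * J⌋ : ZMod J) + Int.fract (ρ * J) • u ((⌊ρ * J⌋ : ZMod J) + 1)

/-- The elementwise constant derivative of `plin u`. -/
noncomputable def plinSlope (u : ZMod J → Plane) : ℝ → Plane := fun ρ =>
  (J : ℝ) • nodeDiff u (⌊ρ * J⌋ : ZMod J)

/-- Nodal values of a function. -/
noncomputable def nodal (J : ℕ) (f : ℝ → Plane) : ZMod J → Plane := fun j => f ((j.val : ℝ) / J)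

theorem J_pos : (0 : ℝ) < J := Nat.cast_pos.2 (Nat.pos_of_ne_zero (NeZero.ne J))

theorem plin_elem (u : ZMod J → Plane) (k : ℤ) {s : ℝ} (hs : s ∈ Icc (0 : ℝ) 1) :
    plin u ((k + s) / J) = (1 - s) • u (k : ZMod J) + s • u ((k : ZMod J) + 1) := by
  have hJ : (J : ℝ) ≠ 0 := (J_pos (J := J)).ne'
  have e : ((k : ℝ) + s) / J * J = k + s := by field_simp
  rw [plin, e]
  rcases eq_or_lt_of_le hs.2 with rfl | h1
  · simp [Int.fract_add_one]
  · have hf : ⌊(k : ℝ) + s⌋ = k := by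
      rw [Int.floor_eq_iff]; constructor <;> linarith [hs.1]
    rw [Int.fract, hf, add_sub_cancel_left]

theorem plinSlope_elem (u : ZMod J → Plane) (k : ℤ) {s : ℝ} (hs : s ∈ Ico (0 : ℝ) 1) :
    plinSlope u ((k + s) / J) = (J : ℝ) • nodeDiff u (k : ZMod J) := by
  have hJ : (J : ℝ) ≠ 0 := (J_pos (J := J)).ne'
  have e : ((k : ℝ) + s) / J * J = k + s := by field_simp
  have hf : ⌊(k : ℝ) + s⌋ = k := by
    rw [Int.floor_eq_iff]; constructor <;> linarith [hs.1, hs.2]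
  rw [plinSlope, e, hf]

theorem exists_elem (J : ℕ) [NeZero J] (ρ : ℝ) :
    ∃ (k : ℤ) (s : ℝ), s ∈ Ico (0 : ℝ) 1 ∧ ρ = (k + s) / J := by
  have hJ : (J : ℝ) ≠ 0 := (J_pos (J := J)).ne'
  refine ⟨⌊ρ * J⌋, Int.fract (ρ * J), ⟨Int.fract_nonneg _, Int.fract_lt_one _⟩, ?_⟩
  rw [Int.floor_add_fract]; field_simp

theorem plin_add (u v : ZMod J → Plane) : plin (u + v) = plin u + plin v := by
  funext ρ; simp only [plin, Pi.add_apply]; module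

theorem plin_sub (u v : ZMod J → Plane) : plin (u - v) = plin u - plin v := by
  funext ρ; simp only [plin, Pi.sub_apply]; module

theorem plin_smul (c : ℝ) (u : ZMod J → Plane) : plin (c • u) = c • plin u := by
  funext ρ; simp only [plin, Pi.smul_apply]; module

theorem plinSlope_sub (u v : ZMod J → Plane) : plinSlope (u - v) = plinSlope u - plinSlope v := by
  funext ρ; simp only [plinSlope, Pi.sub_apply, nodeDiff_sub, smul_sub]

theorem plin_periodic (u : ZMod J → Plane) : Function.Periodic (plin u) 1 := by
  intro ρ
  have e : (ρ + 1) * (J : ℝ) = ρ * J + ((J : ℤ) : ℝ) := by push_cast; ring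
  simp only [plin, e, Int.fract_add_intCast, Int.floor_add_intCast]
  push_cast
  simp

theorem plin_near (u : ZMod J → Plane) (k : ℤ) {ρ : ℝ} (h1 : (k : ℝ) - 1 < ρ * J)
    (h2 : ρ * J < k + 1) : plin u ρ = u (k : ZMod J)
      + max (ρ * J - k) 0 • (u ((k : ZMod J) + 1) - u (k : ZMod J))
      + min (ρ * J - k) 0 • (u (k : ZMod J) - u ((k : ZMod J) - 1)) := by
  rcases lt_or_ge (ρ * J) k with h | h
  · have hf : ⌊ρ * J⌋ = k - 1 := by
      rw [Int.floor_eq_iff]; push_cast; constructor <;> linarith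
    rw [max_eq_right (by linarith), min_eq_left (by linarith), plin, Int.fract, hf]
    push_cast
    rw [sub_add_cancel]
    module
  · have hf : ⌊ρ * J⌋ = k := by
      rw [Int.floor_eq_iff]; constructor <;> linarith
    rw [max_eq_left (by linarith), min_eq_right (by linarith), plin, Int.fract, hf]
    module

theorem plin_continuous (u : ZMod J → Plane) : Continuous (plin u) := by
  rw [continuous_iff_continuousAt]
  intro ρ₀
  set k := ⌊ρ₀ * J⌋ with hk
  have hc : Continuous fun ρ : ℝ => u (k : ZMod J)
      + max (ρ * J - k) 0 • (u ((k : ZMod J) + 1) - u (k : ZMod J))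
      + min (ρ * J - k) 0 • (u (k : ZMod J) - u ((k : ZMod J) - 1)) := by fun_prop
  refine hc.continuousAt.congr ?_
  have hmul : ContinuousAt (fun ρ : ℝ => ρ * J) ρ₀ := by fun_prop
  have hmem : Ioo ((k : ℝ) - 1) (k + 1) ∈ 𝓝 (ρ₀ * J) :=
    Ioo_mem_nhds (by linarith [Int.floor_le (ρ₀ * J)]) (Int.lt_floor_add_one _)
  filter_upwards [hmul hmem] with ρ hρ
  exact (plin_near u k hρ.1 hρ.2).symm

theorem plin_hasDerivAt (u : ZMod J → Plane) {ρ : ℝ} (hρ : ρ ∉ range fun k : ℤ => (k : ℝ) / J) :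
    HasDerivAt (plin u) (plinSlope u ρ) ρ := by
  have hJ : (0 : ℝ) < J := J_pos (J := J)
  set k := ⌊ρ * J⌋ with hk
  have hne : (k : ℝ) ≠ ρ * J := fun h => hρ ⟨k, by simp only []; rw [h]; field_simp⟩
  have hlt : (k : ℝ) < ρ * J := lt_of_le_of_ne (Int.floor_le _) hne
  have hd : HasDerivAt (fun σ : ℝ => u (k : ZMod J) + (σ * J - k) • nodeDiff u (k : ZMod J))
      (plinSlope u ρ) ρ := by
    have h1 : HasDerivAt (fun σ : ℝ => σ * J - (k : ℝ)) (J : ℝ) ρ := by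
      simpa using ((hasDerivAt_id ρ).mul_const (J : ℝ)).sub_const (k : ℝ)
    exact (h1.smul_const (nodeDiff u (k : ZMod J))).const_add _
  refine hd.congr_of_eventuallyEq ?_
  have hmul : ContinuousAt (fun ρ : ℝ => ρ * J) ρ := by fun_prop
  have hmem : Ioo (k : ℝ) (k + 1) ∈ 𝓝 (ρ * J) := Ioo_mem_nhds hlt (Int.lt_floor_add_one _)
  filter_upwards [hmul hmem] with σ hσ
  have h1 : (k : ℝ) < σ * J := hσ.1
  rw [plin_near u k (by linarith) hσ.2, max_eq_left (by linarith), min_eq_right (by linarith)]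
  simp [nodeDiff]

theorem plinSlope_measurable (u : ZMod J → Plane) : Measurable (plinSlope u) := by
  have h1 : Measurable fun k : ℤ => (J : ℝ) • nodeDiff u (k : ZMod J) := measurable_from_top
  exact h1.comp (Int.measurable_floor.comp (measurable_id.mul_const _))

theorem plinSlope_memLp (u : ZMod J → Plane) : MemLp (plinSlope u) 2 circleVol := by
  refine MemLp.of_bound (plinSlope_measurable u).aestronglyMeasurable
    (∑ j, ‖(J : ℝ) • nodeDiff u j‖) (Eventually.of_forall fun ρ => ?_)
  exact Finset.single_le_sum (f := fun j => ‖(J : ℝ) • nodeDiff u j‖) (fun j _ => norm_nonneg _)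
    (Finset.mem_univ _)

theorem memLp_of_continuous_periodic {F : ℝ → Plane} (hF : Continuous F) (p : ℝ≥0∞) :
    MemLp F p circleVol := by
  obtain ⟨C, hC⟩ := isCompact_Icc.exists_bound_of_continuousOn (s := Icc (0 : ℝ) 1) hF.continuousOn
  refine MemLp.of_bound hF.aestronglyMeasurable C ?_
  unfold circleVol
  filter_upwards [ae_restrict_mem measurableSet_Ioc] with ρ hρ
  exact hC ρ ⟨hρ.1.le, hρ.2⟩

theorem plin_hasWeakDeriv (u : ZMod J → Plane) : HasWeakDeriv (plin u) (plinSlope u) :=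
  hasWeakDeriv_of_hasDerivAt (plin_continuous u) (plin_periodic u)
    (countable_range fun k : ℤ => (k : ℝ) / J) (fun _ hρ => plin_hasDerivAt u hρ)
    ((plinSlope_memLp u).integrable one_le_two)

theorem plin_mem_feSpace (u : ZMod J → Plane) : plin u ∈ feSpace J := by
  refine ⟨plin_continuous u, plin_periodic u, ⟨memLp_of_continuous_periodic (plin_continuous u) 2,
    _, plin_hasWeakDeriv u, plinSlope_memLp u⟩, fun j _ => ?_⟩
  have hJ : (0 : ℝ) < J := J_pos (J := J)
  refine ⟨u (j : ZMod J) - (j : ℝ) • nodeDiff u (j : ZMod J), (J : ℝ) • nodeDiff u (j : ZMod J), ?_⟩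
  intro ρ hρ
  have h1 := plin_elem u (j : ℤ) (s := ρ * J - j) ⟨by
    have := hρ.1; rw [div_le_iff₀ hJ] at this; linarith, by
    have := hρ.2; rw [le_div_iff₀ hJ] at this; linarith⟩
  have e : (((j : ℤ) : ℝ) + (ρ * J - j)) / J = ρ := by push_cast; field_simp; ring
  rw [e] at h1
  rw [h1, nodeDiff]
  push_cast
  module

theorem nodal_int {f : ℝ → Plane} (hf : Function.Periodic f 1) (k : ℤ) :
    f ((k : ℝ) / J) = nodal J f (k : ZMod J) := by
  have hJ : (J : ℝ) ≠ 0 := (J_pos (J := J)).ne'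
  have h1 : (((k : ZMod J).val : ℤ)) = k % J := ZMod.val_intCast k
  have h2 : (k : ℝ) = ((k : ZMod J).val : ℝ) + J * ((k / J : ℤ) : ℝ) := by
    have := Int.emod_add_mul_ediv k J
    rw [← h1] at this
    have := congrArg (fun z : ℤ => (z : ℝ)) this
    push_cast at this
    exact this.symm
  rw [nodal, h2, add_div, mul_div_cancel_left₀ _ hJ]
  have := hf.int_mul (k / J) (((k : ZMod J).val : ℝ) / J)
  rwa [mul_one] at this

theorem nodal_succ {f : ℝ → Plane} (hf : Function.Periodic f 1) (k : ℤ) :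
    f (((k : ℝ) + 1) / J) = nodal J f ((k : ZMod J) + 1) := by
  have := nodal_int (J := J) hf (k + 1)
  push_cast at this
  exact this

theorem zmod_cast_val (j : ZMod J) : (((j.val : ℕ) : ℤ) : ZMod J) = j := by simp

theorem nodal_shift {f : ℝ → Plane} (hf : Function.Periodic f 1) (j : ZMod J) :
    nodal J f (j + 1) = f ((j.val : ℝ) / J + 1 / J) := by
  have := nodal_succ (J := J) hf (j.val : ℤ)
  rw [zmod_cast_val] at this
  rw [← this, ← add_div]
  push_cast
  rfl

theorem interp_eq {f : ℝ → Plane} (hf : Function.Periodic f 1) : interp J f = plin (nodal J f) := by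
  funext ρ
  rw [interp, plin, nodal_int hf, nodal_succ hf]

theorem nodal_plin (u : ZMod J → Plane) : nodal J (plin u) = u := by
  funext j
  have := plin_elem u (j.val : ℤ) (s := 0) (by simp)
  rw [zmod_cast_val] at this
  simpa [nodal] using this

theorem feSpace_eq_plin {χ : ℝ → Plane} (hχ : χ ∈ feSpace J) : χ = plin (nodal J χ) := by
  obtain ⟨-, hp, -, haff⟩ := hχ
  have hJ : (0 : ℝ) < J := J_pos (J := J)
  have key : ∀ ρ ∈ Ico (0 : ℝ) 1, χ ρ = plin (nodal J χ) ρ := by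
    intro ρ hρ
    obtain ⟨k, s, hs, rfl⟩ := exists_elem J ρ
    have hks0 : (0 : ℝ) ≤ k + s := by
      have := hρ.1; rw [le_div_iff₀ hJ] at this; linarith
    have hks1 : (k : ℝ) + s < J := by
      have := hρ.2; rw [div_lt_iff₀ hJ] at this; linarith
    have hk0 : 0 ≤ k := by
      have h2 : (-1 : ℝ) < k := by linarith [hs.2]
      have : (-1 : ℤ) < k := by exact_mod_cast h2
      omega
    have hkJ : k < J := by
      have : (k : ℝ) < J := by linarith [hs.1]
      exact_mod_cast this
    obtain ⟨n, rfl⟩ := Int.eq_ofNat_of_zero_le hk0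
    obtain ⟨a, b, hab⟩ := haff n (by exact_mod_cast hkJ)
    rw [plin_elem _ _ ⟨hs.1, hs.2.le⟩, ← nodal_int hp, ← nodal_succ hp]
    simp only [Int.cast_natCast]
    have hn : (n : ℝ) / J ≤ ((n : ℝ) + 1) / J := by gcongr; linarith
    rw [hab _ ⟨le_rfl, hn⟩, hab _ ⟨hn, le_rfl⟩, hab _ ⟨by gcongr; linarith [hs.1],
      by gcongr; linarith [hs.2]⟩]
    have : ((n : ℝ) + s) / J = (1 - s) * ((n : ℝ) / J) + s * (((n : ℝ) + 1) / J) := by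
      field_simp; ring
    rw [this]
    module
  funext ρ
  have h1 : χ (Int.fract ρ) = χ ρ := by
    have := hp.sub_int_mul_eq (x := ρ) ⌊ρ⌋
    rw [mul_one] at this
    exact this
  have h2 : plin (nodal J χ) (Int.fract ρ) = plin (nodal J χ) ρ := by
    have := (plin_periodic (nodal J χ)).sub_int_mul_eq (x := ρ) ⌊ρ⌋
    rw [mul_one] at this
    exact this
  rw [← h1, ← h2]
  exact key _ ⟨Int.fract_nonneg _, Int.fract_lt_one _⟩

/-! ### Elementwise integration -/

theorem sum_range_zmod (f : ZMod J → ℝ) : ∑ i ∈ Finset.range J, f (i : ZMod J) = ∑ j, f j := by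
  refine Finset.sum_nbij' (fun i => (i : ZMod J)) ZMod.val (fun _ _ => Finset.mem_univ _)
    (fun j _ => Finset.mem_range.2 (ZMod.val_lt j)) (fun i hi => ?_) (fun j _ => by simp)
    (fun _ _ => rfl)
  exact ZMod.val_natCast_of_lt (Finset.mem_range.1 hi)

/-- Integration of a function that is given on each element by a continuous function of the local
coordinate `s`. -/
theorem integral_elements {G : ℝ → ℝ} {g : ZMod J → ℝ → ℝ} (hg : ∀ j, Continuous (g j))
    (hG : ∀ (k : ℤ), ∀ s ∈ Ioo (0 : ℝ) 1, G ((k + s) / J) = g (k : ZMod J) s) :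
    ∫ ρ in (0 : ℝ)..1, G ρ = ∑ j, (∫ s in (0 : ℝ)..1, g j s) / J := by
  have hJ : (0 : ℝ) < J := J_pos (J := J)
  have hcong : ∀ i : ℕ, ∀ ρ ∈ Ioo ((i : ℝ) / J) (((i + 1 : ℕ) : ℝ) / J),
      g (i : ZMod J) (J * ρ - i) = G ρ := by
    intro i ρ hρ
    have h1 := hG i (J * ρ - i) ⟨by
      have := hρ.1; rw [div_lt_iff₀ hJ] at this; linarith, by
      have := hρ.2; rw [lt_div_iff₀ hJ] at this; push_cast at this; linarith⟩
    have e : (((i : ℤ) : ℝ) + (J * ρ - i)) / J = ρ := by push_cast; field_simp; ring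
    rw [e] at h1
    rw [h1]
    push_cast
    rfl
  have hle : ∀ i : ℕ, (i : ℝ) / J ≤ ((i + 1 : ℕ) : ℝ) / J := fun i => by
    gcongr; linarith
  have hae : ∀ i : ℕ, (fun ρ => g (i : ZMod J) (J * ρ - i)) =ᵐ[volume.restrict
      (uIoc ((i : ℝ) / J) (((i + 1 : ℕ) : ℝ) / J))] G := by
    intro i
    rw [uIoc_of_le (hle i), ← Measure.restrict_congr_set Ioo_ae_eq_Ioc]
    filter_upwards [ae_restrict_mem measurableSet_Ioo] with ρ hρ
    exact hcong i ρ hρ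
  have hcont : ∀ i : ℕ, Continuous fun ρ : ℝ => g (i : ZMod J) (J * ρ - i) := fun i =>
    (hg i).comp (by fun_prop)
  have hint : ∀ i < J, IntervalIntegrable G volume ((i : ℝ) / J) (((i + 1 : ℕ) : ℝ) / J) :=
    fun i _ => ((hcont i).intervalIntegrable _ _).congr_ae (hae i)
  have hsum := intervalIntegral.sum_integral_adjacent_intervals (a := fun i : ℕ => (i : ℝ) / J) hint
  simp only [Nat.cast_zero, zero_div, div_self hJ.ne'] at hsum
  rw [← hsum, ← sum_range_zmod]
  refine Finset.sum_congr rfl fun i _ => ?_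
  have e1 : ∫ ρ in ((i : ℝ) / J)..(((i + 1 : ℕ) : ℝ) / J), G ρ =
      ∫ ρ in ((i : ℝ) / J)..(((i + 1 : ℕ) : ℝ) / J), g (i : ZMod J) (J * ρ - i) := by
    rw [intervalIntegral.integral_of_le (hle i), intervalIntegral.integral_of_le (hle i)]
    have := hae i
    rw [uIoc_of_le (hle i)] at this
    exact (integral_congr_ae this).symm
  rw [e1, intervalIntegral.integral_comp_mul_sub (fun s => g (i : ZMod J) s) hJ.ne']
  have e2 : (J : ℝ) * ((i : ℝ) / J) - i = 0 := by field_simp; ring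
  have e3 : (J : ℝ) * (((i + 1 : ℕ) : ℝ) / J) - i = 1 := by push_cast; field_simp; ring
  rw [e2, e3, smul_eq_mul]
  field_simp

theorem integral_cubic (c0 c1 c2 c3 : ℝ) :
    ∫ s in (0 : ℝ)..1, (c0 + c1 * s + c2 * s ^ 2 + c3 * s ^ 3) = c0 + c1 / 2 + c2 / 3 + c3 / 4 := by
  have hd : ∀ s ∈ uIcc (0 : ℝ) 1, HasDerivAt
      (fun s => c0 * s + c1 / 2 * s ^ 2 + c2 / 3 * s ^ 3 + c3 / 4 * s ^ 4)
      (c0 + c1 * s + c2 * s ^ 2 + c3 * s ^ 3) s := by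
    intro s _
    have h := ((((hasDerivAt_id s).const_mul c0).add ((hasDerivAt_pow 2 s).const_mul (c1 / 2))).add
      ((hasDerivAt_pow 3 s).const_mul (c2 / 3))).add ((hasDerivAt_pow 4 s).const_mul (c3 / 4))
    refine h.congr_deriv ?_
    push_cast
    ring
  rw [intervalIntegral.integral_eq_sub_of_hasDerivAt hd
    (Continuous.intervalIntegrable (by fun_prop) _ _)]
  ring

theorem inner_lerp (v0 v1 w0 w1 : Plane) (s : ℝ) :
    inner ℝ ((1 - s) • v0 + s • v1) ((1 - s) • w0 + s • w1) =
      (1 - s) ^ 2 * inner ℝ v0 w0 + s * (1 - s) * (inner ℝ v0 w1 + inner ℝ v1 w0)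
        + s ^ 2 * inner ℝ v1 w1 := by
  simp only [inner_add_left, inner_add_right, real_inner_smul_left, real_inner_smul_right]
  ring

theorem integral_massQ (p0 p1 : ℝ) (v0 v1 w0 w1 : Plane) :
    ∫ s in (0 : ℝ)..1, ((1 - s) * p0 + s * p1) *
      inner ℝ ((1 - s) • v0 + s • v1) ((1 - s) • w0 + s • w1) = massQ p0 p1 v0 v1 w0 w1 := by
  set X := inner ℝ v0 w0 with hX
  set Y := inner ℝ v0 w1 with hY
  set Z := inner ℝ v1 w0 with hZ
  set W := inner ℝ v1 w1 with hW
  have e : ∀ s : ℝ, ((1 - s) * p0 + s * p1) *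
      inner ℝ ((1 - s) • v0 + s • v1) ((1 - s) • w0 + s • w1) =
      p0 * X + (p0 * (Y + Z - 2 * X) + (p1 - p0) * X) * s
        + (p0 * (X - Y - Z + W) + (p1 - p0) * (Y + Z - 2 * X)) * s ^ 2
        + ((p1 - p0) * (X - Y - Z + W)) * s ^ 3 := by
    intro s
    rw [inner_lerp, ← hX, ← hY, ← hZ, ← hW]; ring
  simp only [e]
  rw [integral_cubic, massQ, ← hX, ← hY, ← hZ, ← hW]
  ring

/-- The form of the scheme, evaluated in nodal values. -/
theorem schemeForm_plin (A V W η : ZMod J → Plane) :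
    schemeForm (plin A) (plin V) (plin W) (plin η) = nodalForm (1 / J) A V W η := by
  have hJ : (0 : ℝ) < J := J_pos (J := J)
  have hA := (plin_hasWeakDeriv A).wderiv_ae
  have hW := (plin_hasWeakDeriv W).wderiv_ae
  have hη := (plin_hasWeakDeriv η).wderiv_ae
  have cl : ∀ (u : ZMod J → Plane) (j : ZMod J) (s : ℝ),
      ((1 - s) • u j + s • u (j + 1)) 0 = (1 - s) * u j 0 + s * u (j + 1) 0 := by
    intro u j s; simp
  have hn : ∀ v : Plane, ‖(J : ℝ) • v‖ ^ 2 = (J : ℝ) ^ 2 * ‖v‖ ^ 2 := by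
    intro v; rw [norm_smul, mul_pow, Real.norm_eq_abs, sq_abs]
  rw [schemeForm, nodalForm]
  congr 1
  · congr 1
    · rw [intervalIntegral_congr_circleVol (g := fun ρ => plin A ρ 0 *
        inner ℝ (plin V ρ) (plin η ρ) * ‖plinSlope A ρ‖ ^ 2) (by
          filter_upwards [hA] with ρ hρ; rw [hρ])]
      rw [integral_elements (J := J) (g := fun j s => ((1 - s) * A j 0 + s * A (j + 1) 0) *
        inner ℝ ((1 - s) • V j + s • V (j + 1)) ((1 - s) • η j + s • η (j + 1)) *
          ((J : ℝ) ^ 2 * ‖nodeDiff A j‖ ^ 2)) (fun j => by fun_prop) (fun k s hs => by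
            have hs' : s ∈ Icc (0 : ℝ) 1 := ⟨hs.1.le, hs.2.le⟩
            rw [plin_elem _ _ hs', plin_elem _ _ hs', plin_elem _ _ hs', cl,
              plinSlope_elem _ _ ⟨hs.1.le, hs.2⟩, hn])]
      refine Finset.sum_congr rfl fun j _ => ?_
      rw [intervalIntegral.integral_mul_const, integral_massQ]
      field_simp
    · rw [intervalIntegral_congr_circleVol (g := fun ρ => plin A ρ 0 *
        inner ℝ (plinSlope W ρ) (plinSlope η ρ)) (by
          filter_upwards [hW, hη] with ρ hρ hρ'; rw [hρ, hρ'])]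
      rw [integral_elements (J := J) (g := fun j s => ((1 - s) * A j 0 + s * A (j + 1) 0) *
        ((J : ℝ) ^ 2 * inner ℝ (nodeDiff W j) (nodeDiff η j))) (fun j => by fun_prop)
          (fun k s hs => by
            rw [plin_elem _ _ ⟨hs.1.le, hs.2.le⟩, cl, plinSlope_elem _ _ ⟨hs.1.le, hs.2⟩,
              plinSlope_elem _ _ ⟨hs.1.le, hs.2⟩, real_inner_smul_left, real_inner_smul_right]
            ring)]
      refine Finset.sum_congr rfl fun j _ => ?_
      have e : ∀ s : ℝ, ((1 - s) * A j 0 + s * A (j + 1) 0) = A j 0 + (A (j + 1) 0 - A j 0) * s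
        + 0 * s ^ 2 + 0 * s ^ 3 := fun s => by ring
      rw [intervalIntegral.integral_mul_const]
      simp only [e]
      rw [integral_cubic]
      field_simp
      ring
  · rw [intervalIntegral_congr_circleVol (g := fun ρ => plin η ρ 0 * ‖plinSlope A ρ‖ ^ 2) (by
          filter_upwards [hA] with ρ hρ; rw [hρ])]
    rw [integral_elements (J := J) (g := fun j s => ((1 - s) * η j 0 + s * η (j + 1) 0) *
        ((J : ℝ) ^ 2 * ‖nodeDiff A j‖ ^ 2)) (fun j => by fun_prop)
          (fun k s hs => by
            rw [plin_elem _ _ ⟨hs.1.le, hs.2.le⟩, cl, plinSlope_elem _ _ ⟨hs.1.le, hs.2⟩, hn])]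
    refine Finset.sum_congr rfl fun j _ => ?_
    have e : ∀ s : ℝ, ((1 - s) * η j 0 + s * η (j + 1) 0) = η j 0 + (η (j + 1) 0 - η j 0) * s
      + 0 * s ^ 2 + 0 * s ^ 3 := fun s => by ring
    rw [intervalIntegral.integral_mul_const]
    simp only [e]
    rw [integral_cubic]
    field_simp
    ring

/-! ### Norms of finite element functions -/

theorem eLpNorm_two {f : ℝ → Plane} (hf : MemLp f 2 circleVol) :
    eLpNorm f 2 circleVol = ENNReal.ofReal (√(∫ ρ in (0 : ℝ)..1, ‖f ρ‖ ^ 2)) := by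
  rw [hf.eLpNorm_eq_integral_rpow_norm two_ne_zero ENNReal.ofNat_ne_top, ← integral_circleVol,
    Real.sqrt_eq_rpow]
  norm_num

theorem integral_plin_sq (u : ZMod J → Plane) :
    l2sq (1 / J) u / 3 ≤ ∫ ρ in (0 : ℝ)..1, ‖plin u ρ‖ ^ 2 ∧
      ∫ ρ in (0 : ℝ)..1, ‖plin u ρ‖ ^ 2 ≤ l2sq (1 / J) u := by
  have hJ : (0 : ℝ) < J := J_pos (J := J)
  have e : ∫ ρ in (0 : ℝ)..1, ‖plin u ρ‖ ^ 2 =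
      ∑ j, massQ 1 1 (u j) (u (j + 1)) (u j) (u (j + 1)) / J := by
    rw [integral_elements (J := J) (g := fun j s => ((1 - s) * 1 + s * 1) *
      inner ℝ ((1 - s) • u j + s • u (j + 1)) ((1 - s) • u j + s • u (j + 1)))
      (fun j => by fun_prop) (fun k s hs => by
        rw [plin_elem _ _ ⟨hs.1.le, hs.2.le⟩, real_inner_self_eq_norm_sq]; ring)]
    simp only [integral_massQ]
  have e2 : l2sq (1 / J) u = ∑ j, ((‖u j‖ ^ 2 + ‖u (j + 1)‖ ^ 2) / 2) / J := by
    rw [← Finset.sum_div, ← Finset.sum_div, Finset.sum_add_distrib,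
      sum_shift (fun j => ‖u j‖ ^ 2), l2sq]
    ring
  rw [e, e2]
  constructor
  · rw [Finset.sum_div]
    refine Finset.sum_le_sum fun j _ => ?_
    rw [div_right_comm]
    gcongr
    have := massQ_self_pos (u j) (u (j + 1)) one_pos one_pos
    linarith
  · refine Finset.sum_le_sum fun j _ => ?_
    gcongr
    obtain ⟨hi, _⟩ := inner_bounds (u j) (u (j + 1))
    simp only [massQ, real_inner_self_eq_norm_sq, real_inner_comm (u j) (u (j + 1))]
    linarith

theorem integral_plinSlope_sq (u : ZMod J → Plane) :
    ∫ ρ in (0 : ℝ)..1, ‖plinSlope u ρ‖ ^ 2 = h1sq (1 / J) u := by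
  have hJ : (0 : ℝ) < J := J_pos (J := J)
  rw [integral_elements (J := J) (g := fun j _ => ‖(J : ℝ) • nodeDiff u j‖ ^ 2)
    (fun j => continuous_const) (fun k s hs => by rw [plinSlope_elem _ _ ⟨hs.1.le, hs.2⟩])]
  rw [h1sq, Finset.sum_div]
  refine Finset.sum_congr rfl fun j _ => ?_
  rw [intervalIntegral.integral_const, norm_smul, mul_pow, Real.norm_eq_abs, sq_abs]
  simp
  field_simp

theorem normH1_plin (u : ZMod J → Plane) : normH1 (plin u) =
    ENNReal.ofReal (√((∫ ρ in (0 : ℝ)..1, ‖plin u ρ‖ ^ 2) + h1sq (1 / J) u)) := by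
  have hJ : (0 : ℝ) < J := J_pos (J := J)
  have h1 : eLpNorm (wderiv (plin u)) 2 circleVol = ENNReal.ofReal (√(h1sq (1 / J) u)) := by
    rw [eLpNorm_congr_ae (plin_hasWeakDeriv u).wderiv_ae, eLpNorm_two (plinSlope_memLp u),
      integral_plinSlope_sq]
  have h0 := eLpNorm_two (memLp_of_continuous_periodic (plin_continuous u) 2)
  have n0 : 0 ≤ ∫ ρ in (0 : ℝ)..1, ‖plin u ρ‖ ^ 2 :=
    intervalIntegral.integral_nonneg zero_le_one fun ρ _ => by positivity
  have n1 : 0 ≤ h1sq (1 / J) u := h1sq_nonneg (by positivity) u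
  rw [normH1, sobolevNorm, if_neg ENNReal.ofNat_ne_top]
  simp only [Finset.sum_range_succ, Finset.sum_range_zero, zero_add, Function.iterate_zero, id,
    Function.iterate_one, h0, h1, ENNReal.toReal_ofNat]
  rw [ENNReal.ofReal_rpow_of_nonneg (Real.sqrt_nonneg _) zero_le_two,
    ENNReal.ofReal_rpow_of_nonneg (Real.sqrt_nonneg _) zero_le_two,
    ← ENNReal.ofReal_add (by positivity) (by positivity),
    ENNReal.ofReal_rpow_of_nonneg (by positivity) (by norm_num)]
  rw [Real.rpow_two, Real.rpow_two, Real.sq_sqrt n0, Real.sq_sqrt n1, Real.sqrt_eq_rpow]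

theorem normH1_plin_le (u : ZMod J → Plane) :
    normH1 (plin u) ≤ ENNReal.ofReal (√(energy (1 / J) u)) := by
  rw [normH1_plin, energy]
  gcongr
  exact (integral_plin_sq u).2

theorem energy_le_of_normH1 (u : ZMod J → Plane) {r : ℝ}
    (hr : normH1 (plin u) ≤ ENNReal.ofReal r) : energy (1 / J) u ≤ 3 * r ^ 2 := by
  have hJ : (0 : ℝ) < J := J_pos (J := J)
  have n1 : 0 ≤ h1sq (1 / J) u := h1sq_nonneg (by positivity) u
  have n0 : 0 ≤ l2sq (1 / J) u := l2sq_nonneg (by positivity) u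
  have h2 := (integral_plin_sq u).1
  have h1 : √((∫ ρ in (0 : ℝ)..1, ‖plin u ρ‖ ^ 2) + h1sq (1 / J) u) ≤ |r| := by
    rw [normH1_plin] at hr
    have := hr.trans (ENNReal.ofReal_le_ofReal (le_abs_self r))
    exact (ENNReal.ofReal_le_ofReal_iff (abs_nonneg r)).1 this
  rw [Real.sqrt_le_left (abs_nonneg r), sq_abs] at h1
  unfold energy
  linarith

/-! ### Interpolation error -/

theorem taylor_one {E : Type*} [NormedAddCommGroup E] [NormedSpace ℝ E] {f f' : ℝ → E} {B : ℝ}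
    (hf : ∀ ρ, HasDerivAt f (f' ρ) ρ)
    (hB : ∀ ρ σ, ‖f' ρ - f' σ‖ ≤ B * |ρ - σ|) (ρ t : ℝ) :
    ‖f (ρ + t) - f ρ - t • f' ρ‖ ≤ B * t ^ 2 := by
  have hB0 : 0 ≤ B := by
    have := (norm_nonneg _).trans (hB 1 0); simpa using this
  have hd : ∀ σ ∈ uIcc (0 : ℝ) t, HasDerivWithinAt (fun σ => f (ρ + σ) - σ • f' ρ)
      (f' (ρ + σ) - f' ρ) (uIcc (0 : ℝ) t) σ := by
    intro σ _
    have h1 : HasDerivAt (fun σ => f (ρ + σ)) (f' (ρ + σ)) σ := (hf (ρ + σ)).comp_const_add ρ σ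
    have h2 : HasDerivAt (fun σ : ℝ => σ • f' ρ) (f' ρ) σ := by
      simpa using (hasDerivAt_id σ).smul_const (f' ρ)
    exact (h1.sub h2).hasDerivWithinAt
  have hbound : ∀ σ ∈ uIcc (0 : ℝ) t, ‖f' (ρ + σ) - f' ρ‖ ≤ B * |t| := by
    intro σ hσ
    refine (hB _ _).trans ?_
    rw [add_sub_cancel_left]
    refine mul_le_mul_of_nonneg_left ?_ hB0
    have := abs_sub_left_of_mem_uIcc hσ
    simpa using this
  have := (convex_uIcc (0 : ℝ) t).norm_image_sub_le_of_norm_hasDerivWithin_le hd hbound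
    left_mem_uIcc right_mem_uIcc
  simp only [add_zero, zero_smul, sub_zero, Real.norm_eq_abs] at this
  rw [mul_assoc, abs_mul_abs_self, ← pow_two] at this
  rwa [sub_right_comm] at this

/-- Interpolation error of a curve with Lipschitz derivative, in the maximum norm. -/
theorem interp_error {f f' : ℝ → Plane} {B : ℝ} (hp : Function.Periodic f 1)
    (hf : ∀ ρ, HasDerivAt f (f' ρ) ρ) (hB : ∀ ρ σ, ‖f' ρ - f' σ‖ ≤ B * |ρ - σ|) (ρ : ℝ) :
    ‖f ρ - plin (nodal J f) ρ‖ ≤ 2 * B * (1 / J) ^ 2 ∧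
      ‖f' ρ - plinSlope (nodal J f) ρ‖ ≤ 2 * B * (1 / J) := by
  have hJ : (0 : ℝ) < J := J_pos (J := J)
  have hB0 : 0 ≤ B := by
    have := (norm_nonneg _).trans (hB 1 0); simpa using this
  obtain ⟨k, s, hs, rfl⟩ := exists_elem J ρ
  set z : ℝ := (k : ℝ) / J with hz
  set h : ℝ := 1 / J with hh
  have hh0 : 0 < h := by positivity
  have e1 : ((k : ℝ) + s) / J = z + s * h := by rw [hz, hh]; ring
  have e2 : ((k : ℝ) + 1) / J = z + h := by rw [hz, hh]; ring
  have t1 := taylor_one hf hB z (s * h)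
  have t2 := taylor_one hf hB z h
  have hs2 : s ^ 2 ≤ 1 := by nlinarith [hs.1, hs.2]
  constructor
  · rw [plin_elem _ _ ⟨hs.1, hs.2.le⟩, ← nodal_int hp, ← nodal_succ hp, e1, e2, ← hz]
    have e3 : f (z + s * h) - ((1 - s) • f z + s • f (z + h)) =
        (f (z + s * h) - f z - (s * h) • f' z) - s • (f (z + h) - f z - h • f' z) := by module
    rw [e3]
    refine (norm_sub_le _ _).trans ?_
    rw [norm_smul, Real.norm_eq_abs, abs_of_nonneg hs.1]
    have h1 : B * (s * h) ^ 2 ≤ B * h ^ 2 := by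
      rw [mul_pow]
      have : s ^ 2 * h ^ 2 ≤ 1 * h ^ 2 := by gcongr
      rw [one_mul] at this
      gcongr
    have h2 : s * ‖f (z + h) - f z - h • f' z‖ ≤ 1 * (B * h ^ 2) := by
      gcongr
      exact hs.2.le
    linarith
  · rw [plinSlope_elem _ _ hs, nodeDiff, ← nodal_int hp, ← nodal_succ hp, e1, e2, ← hz]
    have hJh : (J : ℝ) * h = 1 := by rw [hh]; field_simp
    have e3 : f' (z + s * h) - (J : ℝ) • (f (z + h) - f z) =
        (f' (z + s * h) - f' z) - (J : ℝ) • (f (z + h) - f z - h • f' z) := by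
      rw [smul_sub (J : ℝ) (f (z + h) - f z), smul_smul, hJh, one_smul]; abel
    rw [e3]
    refine (norm_sub_le _ _).trans ?_
    rw [norm_smul, Real.norm_eq_abs, abs_of_pos hJ]
    have h1 := hB (z + s * h) z
    rw [add_sub_cancel_left, abs_of_nonneg (mul_nonneg hs.1 hh0.le)] at h1
    have h2 : (J : ℝ) * ‖f (z + h) - f z - h • f' z‖ ≤ J * (B * h ^ 2) := by gcongr
    have h3 : (J : ℝ) * (B * h ^ 2) = B * h := by
      calc _ = (J * h) * (B * h) := by ring
        _ = _ := by rw [hJh, one_mul]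
    have h4 : B * (s * h) ≤ B * h := by
      gcongr
      nlinarith [hs.2]
    linarith

theorem eLpNorm_le_of_bound {f : ℝ → Plane} {C : ℝ} (hf : ∀ ρ, ‖f ρ‖ ≤ C) :
    eLpNorm f 2 circleVol ≤ ENNReal.ofReal C := by
  have := eLpNorm_le_of_ae_bound (p := 2) (μ := circleVol) (Eventually.of_forall hf)
  simpa using this

/-- From the nodal error to the error bounds of the theorem, for one time level. -/
theorem errorBounds_of_energy {f f' : ℝ → Plane} {B r : ℝ} (hp : Function.Periodic f 1)
    (hf : ∀ ρ, HasDerivAt f (f' ρ) ρ) (hB : ∀ ρ σ, ‖f' ρ - f' σ‖ ≤ B * |ρ - σ|)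
    (hr : 0 ≤ r) (u : ZMod J → Plane) (hu : energy (1 / J) (nodal J f - u) ≤ r ^ 2) :
    normL2 (f - plin u) ≤ ENNReal.ofReal (2 * B * (1 / J) ^ 2 + r) ∧
      seminormH1 (f - plin u) ≤ ENNReal.ofReal (2 * B * (1 / J) + r) ∧
      normH1 (interp J f - plin u) ≤ ENNReal.ofReal r := by
  have hJ : (0 : ℝ) < J := J_pos (J := J)
  have hB0 : 0 ≤ B := by
    have := (norm_nonneg _).trans (hB 1 0); simpa using this
  set d := nodal J f - u with hd
  have n1 : 0 ≤ h1sq (1 / J) d := h1sq_nonneg (by positivity) d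
  have n0 : 0 ≤ l2sq (1 / J) d := l2sq_nonneg (by positivity) d
  have hfc : Continuous f := continuous_iff_continuousAt.2 fun ρ => (hf ρ).continuousAt
  have hf'c : Continuous f' := by
    have : LipschitzWith ⟨B, hB0⟩ f' := LipschitzWith.of_dist_le_mul fun ρ σ => by
      rw [dist_eq_norm, Real.dist_eq]; exact hB ρ σ
    exact this.continuous
  have hsplit : f - plin u = (f - plin (nodal J f)) + plin d := by rw [hd, plin_sub]; abel
  refine ⟨?_, ?_, ?_⟩
  · rw [normL2, hsplit, ENNReal.ofReal_add (by positivity) hr]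
    have m1 : AEStronglyMeasurable (f - plin (nodal J f)) circleVol :=
      (hfc.sub (plin_continuous _)).aestronglyMeasurable
    refine (eLpNorm_add_le m1 (plin_continuous _).aestronglyMeasurable one_le_two).trans
      (add_le_add (eLpNorm_le_of_bound fun ρ => (interp_error hp hf hB ρ).1) ?_)
    rw [eLpNorm_two (memLp_of_continuous_periodic (plin_continuous _) 2)]
    apply ENNReal.ofReal_le_ofReal
    rw [Real.sqrt_le_left hr]
    have := (integral_plin_sq d).2
    unfold energy at hu
    linarith
  · have hw : HasWeakDeriv f f' := hasWeakDeriv_of_hasDerivAt hfc hp countable_empty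
      (fun ρ _ => hf ρ) (integrable_circleVol_iff.2 (hf'c.intervalIntegrable _ _))
    have hs2 : f' - plinSlope u = (f' - plinSlope (nodal J f)) + plinSlope d := by
      rw [hd, plinSlope_sub]; abel
    rw [seminormH1, eLpNorm_congr_ae (hw.sub (plin_hasWeakDeriv u)).wderiv_ae, hs2,
      ENNReal.ofReal_add (by positivity) hr]
    have m1 : AEStronglyMeasurable (f' - plinSlope (nodal J f)) circleVol :=
      hf'c.aestronglyMeasurable.sub (plinSlope_measurable _).aestronglyMeasurable
    refine (eLpNorm_add_le m1 (plinSlope_measurable _).aestronglyMeasurable one_le_two).trans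
      (add_le_add (eLpNorm_le_of_bound fun ρ => (interp_error hp hf hB ρ).2) ?_)
    rw [eLpNorm_two (plinSlope_memLp _), integral_plinSlope_sq]
    apply ENNReal.ofReal_le_ofReal
    rw [Real.sqrt_le_left hr]
    unfold energy at hu
    linarith
  · rw [interp_eq hp, ← plin_sub, ← hd]
    refine (normH1_plin_le d).trans (ENNReal.ofReal_le_ofReal ?_)
    rw [Real.sqrt_le_left hr]
    exact hu

end FiniteElements

/-! ### First order expansions with quadratic remainder -/

section Jets

variable {E : Type*} [NormedAddCommGroup E] [NormedSpace ℝ E]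

/-- `f u = f₀ + u f₁ + O(u²)` for `0 < |u| ≤ 1`, with all constants at most `C`. -/
def HasJet (C : ℝ) (f : ℝ → E) (f₀ : E) : Prop :=
  ‖f₀‖ ≤ C ∧ ∃ f₁ : E, ‖f₁‖ ≤ C ∧ ∀ u : ℝ, u ≠ 0 → |u| ≤ 1 → ‖f u - f₀ - u • f₁‖ ≤ C * u ^ 2

theorem HasJet.nonneg {C : ℝ} {f : ℝ → E} {f₀ : E} (h : HasJet C f f₀) : 0 ≤ C :=
  (norm_nonneg _).trans h.1

theorem HasJet.const {C : ℝ} {c : E} (h : ‖c‖ ≤ C) : HasJet C (fun _ => c) c := by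
  have hC : 0 ≤ C := (norm_nonneg _).trans h
  exact ⟨h, 0, by simpa using hC, fun u _ _ => by simpa using mul_nonneg hC (sq_nonneg u)⟩

theorem HasJet.add {C C' : ℝ} {f g : ℝ → E} {f₀ g₀ : E} (hf : HasJet C f f₀)
    (hg : HasJet C' g g₀) : HasJet (C + C') (fun u => f u + g u) (f₀ + g₀) := by
  obtain ⟨hf0, f1, hf1, hfu⟩ := hf
  obtain ⟨hg0, g1, hg1, hgu⟩ := hg
  refine ⟨(norm_add_le _ _).trans (add_le_add hf0 hg0), f1 + g1,
    (norm_add_le _ _).trans (add_le_add hf1 hg1), fun u hu hu1 => ?_⟩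
  have e : f u + g u - (f₀ + g₀) - u • (f1 + g1) =
      (f u - f₀ - u • f1) + (g u - g₀ - u • g1) := by module
  rw [e, add_mul]
  exact (norm_add_le _ _).trans (add_le_add (hfu u hu hu1) (hgu u hu hu1))

theorem HasJet.smul {C C' : ℝ} {f : ℝ → ℝ} {g : ℝ → E} {f₀ : ℝ} {g₀ : E} (hf : HasJet C f f₀)
    (hg : HasJet C' g g₀) : HasJet (6 * (C * C')) (fun u => f u • g u) (f₀ • g₀) := by
  have hC := hf.nonneg
  have hC' := hg.nonneg
  obtain ⟨hf0, f1, hf1, hfu⟩ := hf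
  obtain ⟨hg0, g1, hg1, hgu⟩ := hg
  have hCC : 0 ≤ C * C' := mul_nonneg hC hC'
  have key : ∀ (x : ℝ) (y : E) (A B : ℝ), ‖x‖ ≤ A → ‖y‖ ≤ B → ‖x • y‖ ≤ A * B := by
    intro x y A B hx hy
    rw [norm_smul]
    exact mul_le_mul hx hy (norm_nonneg _) ((norm_nonneg _).trans hx)
  refine ⟨(key _ _ _ _ hf0 hg0).trans (by linarith), f₀ • g1 + f1 • g₀, ?_, fun u hu hu1 => ?_⟩
  · refine (norm_add_le _ _).trans ((add_le_add (key _ _ _ _ hf0 hg1) (key _ _ _ _ hf1 hg0)).trans ?_)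
    linarith
  · set R := f u - f₀ - u • f1 with hR
    set S := g u - g₀ - u • g1 with hS
    have e : f u • g u - f₀ • g₀ - u • (f₀ • g1 + f1 • g₀) =
        (u ^ 2 * f1) • g1 + R • (g₀ + u • g1 + S) + (f₀ + u * f1) • S := by
      rw [hR, hS, smul_eq_mul]; module
    have hu2 : u ^ 2 ≤ 1 := by
      rw [← sq_abs]; nlinarith [abs_nonneg u]
    have n1 : ‖(u ^ 2 * f1) • g1‖ ≤ (u ^ 2 * C) * C' := by
      refine key _ _ _ _ ?_ hg1
      rw [norm_mul, Real.norm_eq_abs, abs_of_nonneg (sq_nonneg u)]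
      gcongr
    have n2 : ‖g₀ + u • g1 + S‖ ≤ 3 * C' := by
      refine (norm_add₃_le).trans ?_
      rw [norm_smul, Real.norm_eq_abs]
      have h1 : |u| * ‖g1‖ ≤ 1 * C' := mul_le_mul hu1 hg1 (norm_nonneg _) zero_le_one
      have h2 : ‖S‖ ≤ C' * 1 := (hgu u hu hu1).trans (by gcongr)
      linarith
    have n3 : ‖f₀ + u * f1‖ ≤ 2 * C := by
      refine (norm_add_le _ _).trans ?_
      rw [norm_mul, Real.norm_eq_abs u]
      have h1 : |u| * ‖f1‖ ≤ 1 * C := mul_le_mul hu1 hf1 (norm_nonneg _) zero_le_one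
      linarith
    rw [e]
    refine (norm_add₃_le).trans ((add_le_add (add_le_add n1 (key _ _ _ _ (hfu u hu hu1) n2))
      (key _ _ _ _ n3 (hgu u hu hu1))).trans (le_of_eq ?_))
    ring

theorem HasJet.coord {C : ℝ} {f : ℝ → Plane} {f₀ : Plane} (hf : HasJet C f f₀) (i : Fin 2) :
    HasJet C (fun u => f u i) (f₀ i) := by
  obtain ⟨hf0, f1, hf1, hfu⟩ := hf
  refine ⟨(abs_coord_le _ i).trans hf0, f1 i, (abs_coord_le _ i).trans hf1, fun u hu hu1 => ?_⟩
  have := (abs_coord_le (f u - f₀ - u • f1) i).trans (hfu u hu hu1)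
  simpa using this

theorem plane_normSq (v : Plane) : ‖v‖ ^ 2 = v 0 * v 0 + v 1 * v 1 := by
  rw [EuclideanSpace.norm_sq_eq, Fin.sum_univ_two]
  simp [pow_two]

theorem HasJet.normSq {C : ℝ} {f : ℝ → Plane} {f₀ : Plane} (hf : HasJet C f f₀) :
    HasJet (12 * C ^ 2) (fun u => ‖f u‖ ^ 2) (‖f₀‖ ^ 2) := by
  have := ((hf.coord 0).smul (hf.coord 0)).add ((hf.coord 1).smul (hf.coord 1))
  simp only [smul_eq_mul, ← plane_normSq] at this
  convert this using 1
  ring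

/-- The linear term drops out of the even part; this is why contributions of two adjacent elements to a
node are accurate of second order. -/
theorem HasJet.even {C : ℝ} {f : ℝ → E} {f₀ : E} (hf : HasJet C f f₀) {u : ℝ} (hu : u ≠ 0)
    (hu1 : |u| ≤ 1) : ‖f u + f (-u) - (2 : ℝ) • f₀‖ ≤ 2 * C * u ^ 2 := by
  obtain ⟨-, f1, -, hfu⟩ := hf
  have e : f u + f (-u) - (2 : ℝ) • f₀ = (f u - f₀ - u • f1) + (f (-u) - f₀ - (-u) • f1) := by
    module
  rw [e]
  refine (norm_add_le _ _).trans ((add_le_add (hfu u hu hu1)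
    (hfu (-u) (neg_ne_zero.2 hu) (by rwa [abs_neg]))).trans (le_of_eq ?_))
  ring

theorem taylor_two {f f' f'' : ℝ → E} {B : ℝ} (hf : ∀ ρ, HasDerivAt f (f' ρ) ρ)
    (hf' : ∀ ρ, HasDerivAt f' (f'' ρ) ρ) (hB : ∀ ρ σ, ‖f'' ρ - f'' σ‖ ≤ B * |ρ - σ|) (ρ t : ℝ) :
    ‖f (ρ + t) - f ρ - t • f' ρ - (t ^ 2 / 2) • f'' ρ‖ ≤ B * t ^ 2 * |t| := by
  have hB0 : 0 ≤ B := by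
    have := (norm_nonneg _).trans (hB 1 0); simpa using this
  have hd : ∀ σ ∈ uIcc (0 : ℝ) t,
      HasDerivWithinAt (fun σ => f (ρ + σ) - σ • f' ρ - (σ ^ 2 / 2) • f'' ρ)
      (f' (ρ + σ) - f' ρ - σ • f'' ρ) (uIcc (0 : ℝ) t) σ := by
    intro σ _
    have h1 : HasDerivAt (fun σ => f (ρ + σ)) (f' (ρ + σ)) σ := (hf (ρ + σ)).comp_const_add ρ σ
    have h2 : HasDerivAt (fun σ : ℝ => σ • f' ρ) (f' ρ) σ := by
      simpa using (hasDerivAt_id σ).smul_const (f' ρ)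
    have h3 : HasDerivAt (fun σ : ℝ => (σ ^ 2 / 2) • f'' ρ) (σ • f'' ρ) σ := by
      have := ((hasDerivAt_pow 2 σ).div_const 2).smul_const (f'' ρ)
      simpa using this
    exact ((h1.sub h2).sub h3).hasDerivWithinAt
  have hbound : ∀ σ ∈ uIcc (0 : ℝ) t, ‖f' (ρ + σ) - f' ρ - σ • f'' ρ‖ ≤ B * t ^ 2 := by
    intro σ hσ
    refine (taylor_one hf' hB ρ σ).trans ?_
    have := abs_sub_left_of_mem_uIcc hσ
    rw [sub_zero, sub_zero] at this
    refine mul_le_mul_of_nonneg_left ?_ hB0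
    exact sq_le_sq.2 this
  have := (convex_uIcc (0 : ℝ) t).norm_image_sub_le_of_norm_hasDerivWithin_le hd hbound
    left_mem_uIcc right_mem_uIcc
  simp only [add_zero, zero_smul, sub_zero, Real.norm_eq_abs, ne_eq, OfNat.ofNat_ne_zero,
    not_false_eq_true, zero_pow, zero_div] at this
  have e : f (ρ + t) - f ρ - t • f' ρ - (t ^ 2 / 2) • f'' ρ =
    f (ρ + t) - t • f' ρ - (t ^ 2 / 2) • f'' ρ - f ρ := by abel
  rw [e]
  exact this

/-- Error of the trapezoidal rule. -/
theorem trapezoid {f f' f'' : ℝ → E} {B : ℝ} (hf : ∀ ρ, HasDerivAt f (f' ρ) ρ)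
    (hf' : ∀ ρ, HasDerivAt f' (f'' ρ) ρ) (hB : ∀ ρ σ, ‖f'' ρ - f'' σ‖ ≤ B * |ρ - σ|) (ρ : ℝ)
    {h : ℝ} (hh : 0 < h) :
    ‖f (ρ + h) - f ρ - (h / 2) • (f' ρ + f' (ρ + h))‖ ≤ 2 * B * h ^ 3 := by
  have t2 := taylor_two hf hf' hB ρ h
  have t1 := taylor_one hf' hB ρ h
  rw [abs_of_pos hh] at t2
  have e : f (ρ + h) - f ρ - (h / 2) • (f' ρ + f' (ρ + h)) =
      (f (ρ + h) - f ρ - h • f' ρ - (h ^ 2 / 2) • f'' ρ)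
        - (h / 2) • (f' (ρ + h) - f' ρ - h • f'' ρ) := by module
  rw [e]
  refine (norm_sub_le _ _).trans ?_
  rw [norm_smul, Real.norm_eq_abs, abs_of_pos (by positivity)]
  have : h / 2 * ‖f' (ρ + h) - f' ρ - h • f'' ρ‖ ≤ h / 2 * (B * h ^ 2) := by gcongr
  have hB0 : 0 ≤ B := by
    have := (norm_nonneg _).trans (hB 1 0); simpa using this
  nlinarith [mul_nonneg hB0 (pow_nonneg hh.le 3)]

theorem hasJet_taylor {f f' : ℝ → E} {B : ℝ} (hf : ∀ ρ, HasDerivAt f (f' ρ) ρ)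
    (hB : ∀ ρ σ, ‖f' ρ - f' σ‖ ≤ B * |ρ - σ|) (h0 : ∀ ρ, ‖f ρ‖ ≤ B) (h1 : ∀ ρ, ‖f' ρ‖ ≤ B)
    (z : ℝ) : HasJet B (fun u => f (z + u)) (f z) :=
  ⟨h0 z, f' z, h1 z, fun u _ _ => taylor_one hf hB z u⟩

/-- A difference quotient has a first order expansion as soon as the second derivative is Lipschitz. -/
theorem hasJet_quotient {f f' f'' : ℝ → E} {B : ℝ} (hf : ∀ ρ, HasDerivAt f (f' ρ) ρ)
    (hf' : ∀ ρ, HasDerivAt f' (f'' ρ) ρ) (hB : ∀ ρ σ, ‖f'' ρ - f'' σ‖ ≤ B * |ρ - σ|)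
    (h1 : ∀ ρ, ‖f' ρ‖ ≤ B) (h2 : ∀ ρ, ‖f'' ρ‖ ≤ B) (z : ℝ) :
    HasJet B (fun u => u⁻¹ • (f (z + u) - f z)) (f' z) := by
  refine ⟨h1 z, (1 / 2 : ℝ) • f'' z, ?_, fun u hu _ => ?_⟩
  · rw [norm_smul]
    have := h2 z
    norm_num
    linarith [norm_nonneg (f'' z)]
  · have e : u⁻¹ • (f (z + u) - f z) - f' z - u • (1 / 2 : ℝ) • f'' z =
        u⁻¹ • (f (z + u) - f z - u • f' z - (u ^ 2 / 2) • f'' z) := by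
      simp only [smul_sub, smul_smul]
      congr 2
      · rw [inv_mul_cancel₀ hu, one_smul]
      · field_simp
    rw [e, norm_smul, norm_inv, Real.norm_eq_abs]
    have hu' : 0 < |u| := abs_pos.2 hu
    rw [inv_mul_le_iff₀ hu', mul_comm |u|]
    exact taylor_two hf hf' hB z u

end Jets

/-! ### Consistency in space -/

/-- A 1-periodic `C²` curve with first and second derivative `f'` and `f''`, all bounded by `L`, and
with Lipschitz second derivative. -/
structure IsC2Lip (L : ℝ) (f f' f'' : ℝ → Plane) : Prop where
  periodic : Function.Periodic f 1
  deriv₁ : ∀ ρ, HasDerivAt f (f' ρ) ρ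
  deriv₂ : ∀ ρ, HasDerivAt f' (f'' ρ) ρ
  bound₀ : ∀ ρ, ‖f ρ‖ ≤ L
  bound₁ : ∀ ρ, ‖f' ρ‖ ≤ L
  bound₂ : ∀ ρ, ‖f'' ρ‖ ≤ L
  lip₂ : ∀ ρ σ, ‖f'' ρ - f'' σ‖ ≤ L * |ρ - σ|

/-- The strong form of the operator, for coefficient `a`, velocity `D` and solution `b`. -/
noncomputable def strongRes (a a' b' b'' D : ℝ → Plane) (ρ : ℝ) : Plane :=
  (a ρ 0 * ‖a' ρ‖ ^ 2) • D ρ - (a' ρ 0 • b' ρ + a ρ 0 • b'' ρ) + ‖a' ρ‖ ^ 2 • e₁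

section Consistency

set_option linter.unusedSectionVars false

variable {L : ℝ}

theorem IsC2Lip.continuous₀ {f f' f'' : ℝ → Plane} (h : IsC2Lip L f f' f'') : Continuous f :=
  continuous_iff_continuousAt.2 fun ρ => (h.deriv₁ ρ).continuousAt

theorem IsC2Lip.continuous₁ {f f' f'' : ℝ → Plane} (h : IsC2Lip L f f' f'') : Continuous f' :=
  continuous_iff_continuousAt.2 fun ρ => (h.deriv₂ ρ).continuousAt

theorem continuous_of_lip {f : ℝ → Plane} (h : ∀ ρ σ, ‖f ρ - f σ‖ ≤ L * |ρ - σ|) :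
    Continuous f := by
  have hL : 0 ≤ L := by
    have := (norm_nonneg _).trans (h 1 0); simpa using this
  have : LipschitzWith ⟨L, hL⟩ f := LipschitzWith.of_dist_le_mul fun ρ σ => by
    rw [dist_eq_norm, Real.dist_eq]; exact h ρ σ
  exact this.continuous

theorem IsC2Lip.continuous₂ {f f' f'' : ℝ → Plane} (h : IsC2Lip L f f' f'') : Continuous f'' :=
  continuous_of_lip h.lip₂

theorem lip_of_deriv_bound {E : Type*} [NormedAddCommGroup E] [NormedSpace ℝ E] {f f' : ℝ → E}
    (h : ∀ ρ, HasDerivAt f (f' ρ) ρ) (hb : ∀ ρ, ‖f' ρ‖ ≤ L) (ρ σ : ℝ) :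
    ‖f ρ - f σ‖ ≤ L * |ρ - σ| :=
  convex_univ.norm_image_sub_le_of_norm_hasDerivWithin_le
    (fun x _ => (h x).hasDerivWithinAt) (fun x _ => hb x) (mem_univ σ) (mem_univ ρ)

theorem IsC2Lip.lip₁ {f f' f'' : ℝ → Plane} (h : IsC2Lip L f f' f'') (ρ σ : ℝ) :
    ‖f' ρ - f' σ‖ ≤ L * |ρ - σ| := lip_of_deriv_bound h.deriv₂ h.bound₂ ρ σ

theorem IsC2Lip.lip₀ {f f' f'' : ℝ → Plane} (h : IsC2Lip L f f' f'') (ρ σ : ℝ) :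
    ‖f ρ - f σ‖ ≤ L * |ρ - σ| := lip_of_deriv_bound h.deriv₁ h.bound₁ ρ σ

theorem continuous_coord {f : ℝ → Plane} (hf : Continuous f) (i : Fin 2) :
    Continuous fun ρ => f ρ i :=
  (EuclideanSpace.proj i : Plane →L[ℝ] ℝ).continuous.comp hf

theorem hasDerivAt_coord {f : ℝ → Plane} {f' : Plane} {ρ : ℝ} (hf : HasDerivAt f f' ρ) (i : Fin 2) :
    HasDerivAt (fun ρ => f ρ i) (f' i) ρ :=
  ((EuclideanSpace.proj i : Plane →L[ℝ] ℝ).hasFDerivAt.comp_hasDerivAt ρ hf)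

/-- The quadrature error of the stiffness form on the element `[ρ, ρ + h]`. -/
noncomputable def stiffErr (a b b' : ℝ → Plane) (h ρ : ℝ) : Plane :=
  ((a ρ 0 + a (ρ + h) 0) / 2) • (b (ρ + h) - b ρ) - ∫ σ in ρ..(ρ + h), a σ 0 • b' σ

/-- The quadrature error varies slowly from one element to the next: its derivative is a difference
of two trapezoidal rules. -/
theorem stiffErr_diff_le {a a' a'' b b' b'' : ℝ → Plane} (ha : IsC2Lip L a a' a'')
    (hb : IsC2Lip L b b' b'') {h : ℝ} (hh : 0 < h) (ρ : ℝ) :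
    ‖stiffErr a b b' h (ρ + h) - stiffErr a b b' h ρ‖ ≤ 4 * L ^ 2 * h ^ 4 := by
  have hL : 0 ≤ L := (norm_nonneg _).trans (ha.bound₀ 0)
  have hcont : Continuous fun σ => a σ 0 • b' σ := (continuous_coord ha.continuous₀ 0).smul hb.continuous₁
  set κ' : ℝ → Plane := fun ρ => (1 / 2 : ℝ) • ((a' ρ 0 + a' (ρ + h) 0) • (b (ρ + h) - b ρ)
    - (a (ρ + h) 0 - a ρ 0) • (b' ρ + b' (ρ + h))) with hκ'
  have hd : ∀ ρ, HasDerivAt (stiffErr a b b' h) (κ' ρ) ρ := by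
    intro ρ
    have da0 := hasDerivAt_coord (ha.deriv₁ ρ) 0
    have da1 := (hasDerivAt_coord (ha.deriv₁ (ρ + h)) 0).comp_add_const ρ h
    have db1 := (hb.deriv₁ (ρ + h)).comp_add_const ρ h
    have h1 := ((da0.add da1).div_const 2).smul (db1.sub (hb.deriv₁ ρ))
    have hprim : ∀ σ, HasDerivAt (fun σ => ∫ τ in (0 : ℝ)..σ, a τ 0 • b' τ) (a σ 0 • b' σ) σ :=
      fun σ => intervalIntegral.integral_hasDerivAt_right (hcont.intervalIntegrable _ _)
        (hcont.stronglyMeasurableAtFilter _ _) hcont.continuousAt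
    have h2 := ((hprim (ρ + h)).comp_add_const ρ h).sub (hprim ρ)
    have h3 := h1.sub h2
    have e : stiffErr a b b' h = fun ρ => ((a ρ 0 + a (ρ + h) 0) / 2) • (b (ρ + h) - b ρ)
        - ((∫ τ in (0 : ℝ)..(ρ + h), a τ 0 • b' τ) - ∫ τ in (0 : ℝ)..ρ, a τ 0 • b' τ) := by
      funext ρ
      rw [stiffErr, intervalIntegral.integral_interval_sub_left (hcont.intervalIntegrable _ _)
        (hcont.intervalIntegrable _ _)]
    rw [e]
    refine h3.congr_deriv ?_
    simp only [hκ', Pi.add_apply, Pi.sub_apply]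
    module
  have hbound : ∀ ρ, ‖κ' ρ‖ ≤ 4 * L ^ 2 * h ^ 3 := by
    intro ρ
    have tb := trapezoid hb.deriv₁ hb.deriv₂ hb.lip₂ ρ hh
    have ta := (abs_coord_le _ 0).trans (trapezoid ha.deriv₁ ha.deriv₂ ha.lip₂ ρ hh)
    simp only [PiLp.sub_apply, PiLp.add_apply, PiLp.smul_apply, smul_eq_mul] at ta
    set Eb := b (ρ + h) - b ρ - (h / 2) • (b' ρ + b' (ρ + h)) with hEb
    set Ea := a (ρ + h) 0 - a ρ 0 - h / 2 * (a' ρ 0 + a' (ρ + h) 0) with hEa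
    have e : κ' ρ = (1 / 2 : ℝ) • ((a' ρ 0 + a' (ρ + h) 0) • Eb - Ea • (b' ρ + b' (ρ + h))) := by
      simp only [hκ', hEb, hEa]; module
    rw [e, norm_smul]
    have n1 : ‖(a' ρ 0 + a' (ρ + h) 0) • Eb‖ ≤ (2 * L) * (2 * L * h ^ 3) := by
      rw [norm_smul, Real.norm_eq_abs]
      refine mul_le_mul ?_ tb (norm_nonneg _) (by positivity)
      linarith [abs_add_le (a' ρ 0) (a' (ρ + h) 0), abs_coord_le (a' ρ) 0,
        abs_coord_le (a' (ρ + h)) 0, ha.bound₁ ρ, ha.bound₁ (ρ + h)]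
    have n2 : ‖Ea • (b' ρ + b' (ρ + h))‖ ≤ (2 * L * h ^ 3) * (2 * L) := by
      rw [norm_smul, Real.norm_eq_abs]
      refine mul_le_mul ta ?_ (norm_nonneg _) (by positivity)
      linarith [norm_add_le (b' ρ) (b' (ρ + h)), hb.bound₁ ρ, hb.bound₁ (ρ + h)]
    have n3 := (norm_sub_le ((a' ρ 0 + a' (ρ + h) 0) • Eb) (Ea • (b' ρ + b' (ρ + h))))
    rw [Real.norm_eq_abs, abs_of_pos (by norm_num : (0 : ℝ) < 1 / 2)]
    linarith
  have := lip_of_deriv_bound hd hbound (ρ + h) ρ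
  rw [add_sub_cancel_left, abs_of_pos hh] at this
  refine this.trans (le_of_eq ?_)
  ring

variable {J : ℕ} [NeZero J]

/-- Left end point of the element with index `j`. -/
noncomputable def node (j : ZMod J) : ℝ := (j.val : ℝ) / J

theorem nodal_node (f : ℝ → Plane) (j : ZMod J) : nodal J f j = f (node j) := rfl

theorem nodal_node_succ {f : ℝ → Plane} (hf : Function.Periodic f 1) (j : ZMod J) :
    nodal J f (j + 1) = f (node j + 1 / J) := nodal_shift hf j

theorem nodal_node_succ_add {f : ℝ → Plane} (hf : Function.Periodic f 1) (t : ℝ) (j : ZMod J) :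
    f (node (j + 1) + t) = f (node j + 1 / J + t) := by
  have hp : Function.Periodic (fun ρ => f (ρ + t)) 1 := fun ρ => by
    have := hf (ρ + t)
    rw [show ρ + t + 1 = ρ + 1 + t by ring] at this
    exact this
  exact nodal_shift hp j

/-- Consistency error of the stiffness form. -/
theorem stiff_consistency {a a' a'' b b' b'' : ℝ → Plane} (ha : IsC2Lip L a a' a'')
    (hb : IsC2Lip L b b' b'') (η : ZMod J → Plane) :
    |stiffForm (1 / J) (nodal J a) (nodal J b) η + ∑ j, 1 / J * ∫ s in (0 : ℝ)..1,
      inner ℝ (a' (node j + s * (1 / J)) 0 • b' (node j + s * (1 / J))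
        + a (node j + s * (1 / J)) 0 • b'' (node j + s * (1 / J)))
        ((1 - s) • η j + s • η (j + 1))| ≤ 4 * L ^ 2 * (1 / J) ^ 2 * ((1 / J) * ∑ j, ‖η j‖) := by
  have hJ : (0 : ℝ) < J := J_pos (J := J)
  set h : ℝ := 1 / J with hh
  have hh0 : 0 < h := by positivity
  have hac := continuous_coord ha.continuous₀ 0
  set P : ℝ → Plane := fun ρ => a ρ 0 • b' ρ with hP
  set P' : ℝ → Plane := fun ρ => a' ρ 0 • b' ρ + a ρ 0 • b'' ρ with hP'
  have hPc : Continuous P := hac.smul hb.continuous₁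
  have hP'c : Continuous P' := ((continuous_coord ha.continuous₁ 0).smul hb.continuous₁).add
    (hac.smul hb.continuous₂)
  have hPd : ∀ ρ, HasDerivAt P (P' ρ) ρ := by
    intro ρ
    refine ((hasDerivAt_coord (ha.deriv₁ ρ) 0).smul (hb.deriv₂ ρ)).congr_deriv ?_
    simp only [hP']; abel
  have hPp : Function.Periodic P 1 := by
    have hbp : Function.Periodic b' 1 := by
      intro ρ
      have h1 := (hb.deriv₁ (ρ + 1)).comp_add_const ρ 1
      have h2 : (fun ρ => b (ρ + 1)) = b := funext hb.periodic
      rw [h2] at h1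
      exact h1.unique (hb.deriv₁ ρ)
    intro ρ
    simp only [hP]
    rw [ha.periodic ρ, hbp ρ]
  -- integration by parts on one element
  have hparts : ∀ j : ZMod J, h * ∫ s in (0 : ℝ)..1, inner ℝ (P' (node j + s * h))
      ((1 - s) • η j + s • η (j + 1)) =
      inner ℝ (P (node (j + 1))) (η (j + 1)) - inner ℝ (P (node j)) (η j)
        - inner ℝ (∫ σ in (node j)..(node j + h), P σ) (nodeDiff η j) / h := by
    intro j
    have hd : ∀ s ∈ uIcc (0 : ℝ) 1, HasDerivAt
        (fun s => inner ℝ (P (node j + s * h)) ((1 - s) • η j + s • η (j + 1)))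
        (inner ℝ (P (node j + s * h)) (nodeDiff η j)
          + h * inner ℝ (P' (node j + s * h)) ((1 - s) • η j + s • η (j + 1))) s := by
      intro s _
      have hin : HasDerivAt (fun s : ℝ => node j + s * h) h s := by
        simpa using ((hasDerivAt_id s).mul_const h).const_add (node j)
      have d1 := (hPd (node j + s * h)).scomp s hin
      have d2 : HasDerivAt (fun s : ℝ => (1 - s) • η j + s • η (j + 1)) (nodeDiff η j) s := by
        have e1 := (((hasDerivAt_id s).const_sub 1).smul_const (η j)).add
          ((hasDerivAt_id s).smul_const (η (j + 1)))
        refine e1.congr_deriv ?_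
        rw [nodeDiff]; module
      have d3 := d1.inner ℝ d2
      refine d3.congr_deriv ?_
      rw [real_inner_smul_left]
      rfl
    have c1 : Continuous fun s => inner ℝ (P (node j + s * h)) (nodeDiff η j) := by fun_prop
    have c2 : Continuous fun s =>
        inner ℝ (P' (node j + s * h)) ((1 - s) • η j + s • η (j + 1)) := by fun_prop
    have hftc := intervalIntegral.integral_eq_sub_of_hasDerivAt hd
      ((c1.add (c2.const_mul h)).intervalIntegrable _ _)
    rw [intervalIntegral.integral_add (c1.intervalIntegrable _ _)
      ((c2.const_mul h).intervalIntegrable _ _), intervalIntegral.integral_const_mul] at hftc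
    have e2 : ∫ s in (0 : ℝ)..1, inner ℝ (P (node j + s * h)) (nodeDiff η j) =
        inner ℝ (∫ σ in (node j)..(node j + h), P σ) (nodeDiff η j) / h := by
      have e3 : ∫ s in (0 : ℝ)..1, P (node j + s * h) =
          h⁻¹ • ∫ σ in (node j)..(node j + h), P σ := by
        have := intervalIntegral.integral_comp_add_mul P hh0.ne' (node j) (a := 0) (b := 1)
        simp only [mul_zero, add_zero, mul_one] at this
        rw [← this]
        simp only [mul_comm h]
      have e4 : ∀ s, inner ℝ (P (node j + s * h)) (nodeDiff η j) =
          inner ℝ (nodeDiff η j) (P (node j + s * h)) := fun s => real_inner_comm _ _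
      simp only [e4]
      have c3 : Continuous fun s => P (node j + s * h) := by fun_prop
      have := (innerSL ℝ (nodeDiff η j)).intervalIntegral_comp_comm
        (c3.intervalIntegrable (μ := volume) 0 1)
      simp only [innerSL_apply_apply] at this
      rw [this, e3, real_inner_smul_right, real_inner_comm]
      field_simp
    rw [e2] at hftc
    have e5 : P (node (j + 1)) = P (node j + h) := nodal_node_succ hPp j
    rw [e5]
    simp only [one_mul, zero_mul, add_zero, sub_self, zero_smul, one_smul, zero_add, sub_zero] at hftc
    linarith
  have hsum : stiffForm h (nodal J a) (nodal J b) η + ∑ j, h * ∫ s in (0 : ℝ)..1,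
      inner ℝ (P' (node j + s * h)) ((1 - s) • η j + s • η (j + 1)) =
      ∑ j, inner ℝ (stiffErr a b b' h (node j) - stiffErr a b b' h (node (j + 1))) (η (j + 1)) / h := by
    simp only [hparts]
    have e1 : ∑ j, inner ℝ (stiffErr a b b' h (node j) - stiffErr a b b' h (node (j + 1)))
        (η (j + 1)) / h = ∑ j, inner ℝ (stiffErr a b b' h (node j)) (nodeDiff η j) / h := by
      simp only [inner_sub_left, sub_div, Finset.sum_sub_distrib]
      rw [sum_shift (fun j => inner ℝ (stiffErr a b b' h (node j)) (η j) / h),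
        ← Finset.sum_sub_distrib]
      simp only [nodeDiff, inner_sub_right, sub_div]
    rw [e1, Finset.sum_sub_distrib, Finset.sum_sub_distrib,
      sum_shift (fun j => inner ℝ (P (node j)) (η j)), sub_self, zero_sub, ← sub_eq_add_neg,
      stiffForm, ← Finset.sum_sub_distrib]
    refine Finset.sum_congr rfl fun j _ => ?_
    have e2 : nodeDiff (nodal J b) j = b (node j + h) - b (node j) := by
      rw [nodeDiff, nodal_node_succ hb.periodic, nodal_node]
    rw [e2, nodal_node_succ ha.periodic, nodal_node, stiffErr, ← hh,
      inner_sub_left (((a (node j) 0 + a (node j + h) 0) / 2) • (b (node j + h) - b (node j))),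
      real_inner_smul_left]
    ring
  rw [hsum]
  refine (Finset.abs_sum_le_sum_abs _ _).trans ?_
  have e3 : 4 * L ^ 2 * h ^ 2 * (h * ∑ j, ‖η j‖) = ∑ j, 4 * L ^ 2 * h ^ 3 * ‖η (j + 1)‖ := by
    rw [← Finset.mul_sum, sum_shift (fun j => ‖η j‖)]; ring
  rw [e3]
  refine Finset.sum_le_sum fun j _ => ?_
  rw [abs_div, abs_of_pos hh0, div_le_iff₀ hh0]
  refine (abs_real_inner_le_norm _ _).trans ?_
  have e4 : stiffErr a b b' h (node (j + 1)) = stiffErr a b b' h (node j + h) := by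
    have hper : Function.Periodic (stiffErr a b b' h) 1 := by
      intro ρ
      have e5 : ∫ σ in (ρ + 1)..(ρ + 1 + h), P σ = ∫ σ in ρ..(ρ + h), P σ := by
        have := intervalIntegral.integral_comp_add_right P (1 : ℝ) (a := ρ) (b := ρ + h)
        rw [show ρ + 1 + h = ρ + h + 1 by ring, ← this]
        simp only [hPp _]
      have e6 : ρ + 1 + h = ρ + h + 1 := by ring
      simp only [hP] at e5
      rw [stiffErr, stiffErr, e5, e6, ha.periodic, ha.periodic, hb.periodic, hb.periodic]
    exact nodal_node_succ hper j
  rw [e4, norm_sub_rev]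
  calc _ ≤ 4 * L ^ 2 * h ^ 4 * ‖η (j + 1)‖ := by
        gcongr; exact stiffErr_diff_le ha hb hh0 (node j)
    _ = _ := by ring

end Consistency

/-! ### Consistency of the mass and load terms -/

section MassConsistency

set_option linter.unusedSectionVars false

variable {L : ℝ} {J : ℕ} [NeZero J]

/-- A 1-periodic curve with derivative `f'`, both bounded by `L`, and with Lipschitz derivative. -/
structure IsC1Lip (L : ℝ) (f f' : ℝ → Plane) : Prop where
  periodic : Function.Periodic f 1
  deriv₁ : ∀ ρ, HasDerivAt f (f' ρ) ρ
  bound₀ : ∀ ρ, ‖f ρ‖ ≤ L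
  bound₁ : ∀ ρ, ‖f' ρ‖ ≤ L
  lip₁ : ∀ ρ σ, ‖f' ρ - f' σ‖ ≤ L * |ρ - σ|

theorem IsC1Lip.continuous₀ {f f' : ℝ → Plane} (h : IsC1Lip L f f') : Continuous f :=
  continuous_iff_continuousAt.2 fun ρ => (h.deriv₁ ρ).continuousAt

theorem IsC2Lip.periodic₁ {f f' f'' : ℝ → Plane} (h : IsC2Lip L f f' f'') :
    Function.Periodic f' 1 := by
  intro ρ
  have h1 := (h.deriv₁ (ρ + 1)).comp_add_const ρ 1
  rw [show (fun ρ => f (ρ + 1)) = f from funext h.periodic] at h1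
  exact h1.unique (h.deriv₁ ρ)

/-- The density of the mass and load terms. -/
noncomputable def massDensity (a a' D : ℝ → Plane) (ρ : ℝ) : Plane :=
  (a ρ 0 * ‖a' ρ‖ ^ 2) • D ρ + ‖a' ρ‖ ^ 2 • e₁

/-- The contribution to a node `z` of the mass and load terms on the element between `z` and
`z + u`, divided by the mesh size. -/
noncomputable def massFlux (a D : ℝ → Plane) (z u : ℝ) : Plane :=
  ‖u⁻¹ • (a (z + u) - a z)‖ ^ 2 • (((a z 0 / 4 + (1 / 12 : ℝ) • a (z + u) 0) • D z
    + (a z 0 / 12 + (1 / 12 : ℝ) • a (z + u) 0) • D (z + u)) + (1 / 2 : ℝ) • e₁)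

theorem norm_e₁ : ‖e₁‖ = 1 := by
  simp [e₁]

theorem hasJet_massDensity {a a' a'' D D' : ℝ → Plane} (ha : IsC2Lip L a a' a'')
    (hD : IsC1Lip L D D') (z : ℝ) :
    HasJet (432 * L ^ 4 + 72 * L ^ 2) (fun u => massDensity a a' D (z + u))
      (massDensity a a' D z) := by
  have ja := (hasJet_taylor ha.deriv₁ ha.lip₁ ha.bound₀ ha.bound₁ z).coord 0
  have ja' := (hasJet_taylor ha.deriv₂ ha.lip₂ ha.bound₁ ha.bound₂ z).normSq
  have jD := hasJet_taylor hD.deriv₁ hD.lip₁ hD.bound₀ hD.bound₁ z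
  have je : HasJet 1 (fun _ : ℝ => e₁) e₁ := HasJet.const norm_e₁.le
  have := ((ja.smul ja').smul jD).add (ja'.smul je)
  simp only [smul_eq_mul] at this
  convert this using 1
  · ring
  · rfl
  · rfl

theorem hasJet_massFlux {a a' a'' D D' : ℝ → Plane} (ha : IsC2Lip L a a' a'')
    (hD : IsC1Lip L D D') (z : ℝ) :
    HasJet (6048 * L ^ 4 + 72 * L ^ 2) (fun u => massFlux a D z u)
      ((1 / 2 : ℝ) • massDensity a a' D z) := by
  have ja := (hasJet_taylor ha.deriv₁ ha.lip₁ ha.bound₀ ha.bound₁ z).coord 0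
  have jq := (hasJet_quotient ha.deriv₁ ha.deriv₂ ha.lip₂ ha.bound₁ ha.bound₂ z).normSq
  have jD := hasJet_taylor hD.deriv₁ hD.lip₁ hD.bound₀ hD.bound₁ z
  have jD0 : HasJet L (fun _ : ℝ => D z) (D z) := HasJet.const (hD.bound₀ z)
  have ha0 : |a z 0| ≤ L := (abs_coord_le _ 0).trans (ha.bound₀ z)
  have je : HasJet 1 (fun _ : ℝ => (1 / 2 : ℝ) • e₁) ((1 / 2 : ℝ) • e₁) := HasJet.const (by
    rw [norm_smul, norm_e₁]; norm_num)
  have j4 : HasJet L (fun _ : ℝ => a z 0 / 4) (a z 0 / 4) := HasJet.const (by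
    rw [Real.norm_eq_abs, abs_div, abs_of_pos (by norm_num : (0 : ℝ) < 4)]
    linarith [abs_nonneg (a z 0)])
  have j12 : HasJet L (fun _ : ℝ => a z 0 / 12) (a z 0 / 12) := HasJet.const (by
    rw [Real.norm_eq_abs, abs_div, abs_of_pos (by norm_num : (0 : ℝ) < 12)]
    linarith [abs_nonneg (a z 0)])
  have j1 : HasJet 1 (fun _ : ℝ => (1 / 12 : ℝ)) (1 / 12 : ℝ) := HasJet.const (by norm_num)
  have := jq.smul ((((j4.add (j1.smul ja)).smul jD0).add ((j12.add (j1.smul ja)).smul jD)).add je)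
  convert this using 1
  · ring
  · rfl
  · simp only [massDensity, smul_eq_mul]; module

/-- Consistency error of the mass and load terms. In the sum over the two elements that meet at a
node the terms of odd order in the mesh size cancel. -/
theorem mass_consistency {a a' a'' D D' : ℝ → Plane} (ha : IsC2Lip L a a' a'')
    (hD : IsC1Lip L D D') (η : ZMod J → Plane) :
    |massForm (1 / J) (nodal J a) (nodal J D) η + loadForm (1 / J) (nodal J a) η
      - ∑ j, 1 / J * ∫ s in (0 : ℝ)..1, inner ℝ (massDensity a a' D (node j + s * (1 / J)))
        ((1 - s) • η j + s • η (j + 1))| ≤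
      (12960 * L ^ 4 + 288 * L ^ 2) * (1 / J) ^ 2 * ((1 / J) * ∑ j, ‖η j‖) := by
  have hJ : (0 : ℝ) < J := J_pos (J := J)
  set h : ℝ := 1 / J with hh
  have hh0 : 0 < h := by positivity
  have hh1 : h ≤ 1 := by
    rw [hh, div_le_one hJ]
    exact_mod_cast Nat.one_le_iff_ne_zero.2 (NeZero.ne J)
  have hh1' : |h| ≤ 1 := by rwa [abs_of_pos hh0]
  set G := massDensity a a' D with hG
  have hGc : Continuous G := by
    have h1 := continuous_coord ha.continuous₀ 0
    have h2 := ha.continuous₁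
    have h3 := hD.continuous₀
    exact ((h1.mul (h2.norm.pow 2)).smul h3).add ((h2.norm.pow 2).smul continuous_const)
  have hGp : Function.Periodic G 1 := by
    intro ρ
    simp only [hG, massDensity]
    rw [ha.periodic, ha.periodic₁, hD.periodic]
  -- both sides are regrouped by nodes, so that the two elements at a node appear with `h` and `-h`
  have hΦp : Function.Periodic (fun z => massFlux a D z (-h)) 1 := by
    intro z
    simp only [massFlux]
    rw [show z + 1 + -h = z + -h + 1 by ring, ha.periodic, ha.periodic, hD.periodic, hD.periodic]
  have hleft : massForm h (nodal J a) (nodal J D) η + loadForm h (nodal J a) η =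
      ∑ j, h * inner ℝ (massFlux a D (node j) h + massFlux a D (node j) (-h)) (η j) := by
    have e1 : ∑ j, h * inner ℝ (massFlux a D (node j) h + massFlux a D (node j) (-h)) (η j) =
        ∑ j, (h * inner ℝ (massFlux a D (node j) h) (η j)
          + h * inner ℝ (massFlux a D (node (j + 1)) (-h)) (η (j + 1))) := by
      simp only [inner_add_left, mul_add]
      rw [Finset.sum_add_distrib, Finset.sum_add_distrib,
        sum_shift (fun j => h * inner ℝ (massFlux a D (node j) (-h)) (η j))]
    rw [e1, massForm, loadForm, ← Finset.sum_add_distrib]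
    refine Finset.sum_congr rfl fun j _ => ?_
    have e2 : massFlux a D (node (j + 1)) (-h) = massFlux a D (node j + h) (-h) :=
      nodal_node_succ hΦp j
    have e3 : (-h)⁻¹ • (a (node j + h + -h) - a (node j + h)) =
        h⁻¹ • (a (node j + h) - a (node j)) := by
      rw [show node j + h + -h = node j by ring, inv_neg, neg_smul, ← smul_neg, neg_sub]
    have e4 : ‖h⁻¹ • (a (node j + h) - a (node j))‖ ^ 2 =
        ‖a (node j + h) - a (node j)‖ ^ 2 / h ^ 2 := by
      rw [norm_smul, norm_inv, Real.norm_eq_abs, abs_of_pos hh0]; field_simp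
    have e5 : ∀ v : Plane, inner ℝ e₁ v = v 0 := fun v => by
      simp [e₁, EuclideanSpace.inner_single_left]
    rw [e2, massFlux, massFlux, e3, e4, show node j + h + -h = node j by ring, nodeDiff,
      nodal_node_succ ha.periodic, nodal_node_succ hD.periodic, nodal_node, nodal_node, ← hh]
    simp only [massQ, real_inner_smul_left, inner_add_left, e5, smul_eq_mul]
    field_simp
    ring
  have hright : ∑ j, h * ∫ s in (0 : ℝ)..1, inner ℝ (G (node j + s * h))
        ((1 - s) • η j + s • η (j + 1)) =
      ∑ j, h * ∫ s in (0 : ℝ)..1, (1 - s) * inner ℝ (G (node j + s * h) + G (node j + -(s * h)))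
        (η j) := by
    have c1 : ∀ (z : ℝ) (v : Plane), Continuous fun s : ℝ => (1 - s) * inner ℝ (G (z + s * h)) v :=
      fun z v => by fun_prop
    have c2 : ∀ (z : ℝ) (v : Plane), Continuous fun s : ℝ => s * inner ℝ (G (z + s * h)) v :=
      fun z v => by fun_prop
    have c3 : ∀ (z : ℝ) (v : Plane),
        Continuous fun s : ℝ => (1 - s) * inner ℝ (G (z + -(s * h))) v :=
      fun z v => by fun_prop
    have e1 : ∀ j, h * ∫ s in (0 : ℝ)..1, (1 - s) *
        inner ℝ (G (node j + s * h) + G (node j + -(s * h))) (η j) =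
        h * (∫ s in (0 : ℝ)..1, (1 - s) * inner ℝ (G (node j + s * h)) (η j)) +
        h * ∫ s in (0 : ℝ)..1, (1 - s) * inner ℝ (G (node j + -(s * h))) (η j) := by
      intro j
      simp only [inner_add_left, mul_add]
      rw [intervalIntegral.integral_add ((c1 _ _).intervalIntegrable _ _)
        ((c3 _ _).intervalIntegrable _ _), mul_add]
    simp only [e1]
    rw [Finset.sum_add_distrib, ← sum_shift (fun j =>
      h * ∫ s in (0 : ℝ)..1, (1 - s) * inner ℝ (G (node j + -(s * h))) (η j)),
      ← Finset.sum_add_distrib]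
    refine Finset.sum_congr rfl fun j _ => ?_
    have e2 : ∫ s in (0 : ℝ)..1, (1 - s) * inner ℝ (G (node (j + 1) + -(s * h))) (η (j + 1)) =
        ∫ s in (0 : ℝ)..1, s * inner ℝ (G (node j + s * h)) (η (j + 1)) := by
      have := intervalIntegral.integral_comp_sub_left (a := 0) (b := 1)
        (fun s : ℝ => s * inner ℝ (G (node j + s * h)) (η (j + 1))) 1
      rw [sub_self, sub_zero] at this
      rw [← this]
      congr 1
      funext s
      rw [nodal_node_succ_add hGp, ← hh]
      rw [show node j + h + -(s * h) = node j + (1 - s) * h by ring]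
    rw [e2, ← mul_add, ← intervalIntegral.integral_add ((c1 _ _).intervalIntegrable _ _)
        ((c2 _ _).intervalIntegrable _ _)]
    simp only [inner_add_right, real_inner_smul_right]
  rw [hleft, hright, ← Finset.sum_sub_distrib]
  refine (Finset.abs_sum_le_sum_abs _ _).trans ?_
  have e0 : (12960 * L ^ 4 + 288 * L ^ 2) * h ^ 2 * (h * ∑ j, ‖η j‖) =
      ∑ j, h * ((12960 * L ^ 4 + 288 * L ^ 2) * h ^ 2 * ‖η j‖) := by
    rw [← Finset.mul_sum, ← Finset.mul_sum]; ring
  rw [e0]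
  refine Finset.sum_le_sum fun j _ => ?_
  rw [← mul_sub, abs_mul, abs_of_pos hh0]
  refine mul_le_mul_of_nonneg_left ?_ hh0.le
  set z := node j
  have jΦ := (hasJet_massFlux ha hD z).even hh0.ne' hh1'
  have c4 : Continuous fun s : ℝ =>
      (1 - s) * inner ℝ (G (z + s * h) + G (z + -(s * h)) - (2 : ℝ) • G z) (η j) := by fun_prop
  have c5 : Continuous fun s : ℝ =>
      (1 - s) * inner ℝ ((2 : ℝ) • G z) (η j) := by fun_prop
  -- both are compared with `⟪G z, η j⟫`
  have i1 : ∫ s in (0 : ℝ)..1, (1 - s) * inner ℝ (G (z + s * h) + G (z + -(s * h))) (η j) =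
      (∫ s in (0 : ℝ)..1, (1 - s) * inner ℝ (G (z + s * h) + G (z + -(s * h)) - (2 : ℝ) • G z)
        (η j)) + inner ℝ (G z) (η j) := by
    have e1 : ∫ s in (0 : ℝ)..1, (1 - s) * inner ℝ ((2 : ℝ) • G z) (η j) =
        inner ℝ (G z) (η j) := by
      rw [intervalIntegral.integral_mul_const]
      have : ∫ s in (0 : ℝ)..1, (1 - s) = 1 / 2 := by
        rw [intervalIntegral.integral_sub intervalIntegrable_const
          intervalIntegral.intervalIntegrable_id, integral_id]
        simp; norm_num
      rw [this, real_inner_smul_left]; ring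
    rw [← e1, ← intervalIntegral.integral_add (c4.intervalIntegrable _ _)
      (c5.intervalIntegrable _ _)]
    congr 1
    funext s
    rw [inner_sub_left]; ring
  have i2 : |∫ s in (0 : ℝ)..1, (1 - s) *
      inner ℝ (G (z + s * h) + G (z + -(s * h)) - (2 : ℝ) • G z) (η j)| ≤
      2 * (432 * L ^ 4 + 72 * L ^ 2) * h ^ 2 * ‖η j‖ := by
    have := intervalIntegral.norm_integral_le_of_norm_le_const (a := 0) (b := 1)
      (C := 2 * (432 * L ^ 4 + 72 * L ^ 2) * h ^ 2 * ‖η j‖) (f := fun s => (1 - s) *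
      inner ℝ (G (z + s * h) + G (z + -(s * h)) - (2 : ℝ) • G z) (η j)) ?_
    · simpa using this
    · intro s hs
      rw [uIoc_of_le zero_le_one] at hs
      have hsh : s * h ≠ 0 := (mul_pos hs.1 hh0).ne'
      have hsh1 : |s * h| ≤ 1 := by
        rw [abs_of_pos (mul_pos hs.1 hh0)]; nlinarith [hs.1, hs.2]
      have jG := (hasJet_massDensity ha hD z).even hsh hsh1
      rw [norm_mul, Real.norm_eq_abs, Real.norm_eq_abs, abs_of_nonneg (by linarith [hs.2])]
      have k1 := abs_real_inner_le_norm (G (z + s * h) + G (z + -(s * h)) - (2 : ℝ) • G z) (η j)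
      have k2 : ‖G (z + s * h) + G (z + -(s * h)) - (2 : ℝ) • G z‖ ≤
          2 * (432 * L ^ 4 + 72 * L ^ 2) * h ^ 2 := by
        refine jG.trans ?_
        have : (s * h) ^ 2 ≤ h ^ 2 := by
          apply pow_le_pow_left₀ (mul_pos hs.1 hh0).le
          nlinarith [hs.1, hs.2]
        gcongr
      calc _ ≤ 1 * (2 * (432 * L ^ 4 + 72 * L ^ 2) * h ^ 2 * ‖η j‖) := by
            refine mul_le_mul (by linarith [hs.1]) (k1.trans ?_) (abs_nonneg _) zero_le_one
            gcongr
        _ = _ := one_mul _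
  have i3 : |inner ℝ (massFlux a D z h + massFlux a D z (-h)) (η j) - inner ℝ (G z) (η j)| ≤
      2 * (6048 * L ^ 4 + 72 * L ^ 2) * h ^ 2 * ‖η j‖ := by
    rw [← inner_sub_left]
    refine (abs_real_inner_le_norm _ _).trans ?_
    refine mul_le_mul_of_nonneg_right ?_ (norm_nonneg _)
    rw [smul_smul, mul_one_div_cancel two_ne_zero, one_smul] at jΦ
    exact jΦ
  rw [i1]
  rw [abs_le] at i2 i3 ⊢
  constructor <;> linarith [i2.1, i2.2, i3.1, i3.2]

theorem sum_norm_le_sqrt_l2sq (η : ZMod J → Plane) :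
    1 / J * ∑ j, ‖η j‖ ≤ √(l2sq (1 / J) η) := by
  have hJ : (0 : ℝ) < J := J_pos (J := J)
  refine Real.le_sqrt_of_sq_le ?_
  have := sq_sum_le_card_mul_sum_sq (s := Finset.univ) (f := fun j : ZMod J => ‖η j‖)
  rw [Finset.card_univ, ZMod.card] at this
  rw [l2sq, mul_pow]
  calc _ ≤ (1 / (J : ℝ)) ^ 2 * (J * ∑ j, ‖η j‖ ^ 2) := by gcongr
    _ = _ := by field_simp

/-- The form of the scheme, evaluated at nodal values of smooth functions, agrees up to second order
with the moments of the strong residual. -/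
theorem space_consistency {a a' a'' b b' b'' D D' : ℝ → Plane} (hL : 1 ≤ L)
    (ha : IsC2Lip L a a' a'') (hb : IsC2Lip L b b' b'') (hD : IsC1Lip L D D') (η : ZMod J → Plane) :
    |nodalForm (1 / J) (nodal J a) (nodal J D) (nodal J b) η
      - ∑ j, 1 / J * ∫ s in (0 : ℝ)..1, inner ℝ (strongRes a a' b' b'' D (node j + s * (1 / J)))
        ((1 - s) • η j + s • η (j + 1))| ≤
      14000 * L ^ 4 * (1 / J) ^ 2 * √(l2sq (1 / J) η) := by
  have hJ : (0 : ℝ) < J := J_pos (J := J)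
  have h1 := mass_consistency ha hD η
  have h2 := stiff_consistency ha hb η
  have h3 := sum_norm_le_sqrt_l2sq η
  set S := 1 / (J : ℝ) * ∑ j, ‖η j‖
  have hS : 0 ≤ S := by positivity
  have e : ∑ j, 1 / (J : ℝ) * ∫ s in (0 : ℝ)..1,
      inner ℝ (strongRes a a' b' b'' D (node j + s * (1 / J))) ((1 - s) • η j + s • η (j + 1)) =
      (∑ j, 1 / (J : ℝ) * ∫ s in (0 : ℝ)..1, inner ℝ (massDensity a a' D (node j + s * (1 / J)))
        ((1 - s) • η j + s • η (j + 1))) - ∑ j, 1 / J * ∫ s in (0 : ℝ)..1,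
      inner ℝ (a' (node j + s * (1 / J)) 0 • b' (node j + s * (1 / J))
        + a (node j + s * (1 / J)) 0 • b'' (node j + s * (1 / J)))
        ((1 - s) • η j + s • η (j + 1)) := by
    rw [← Finset.sum_sub_distrib]
    refine Finset.sum_congr rfl fun j _ => ?_
    have k1 := continuous_coord ha.continuous₀ 0
    have k1' := continuous_coord ha.continuous₁ 0
    have k2 := ha.continuous₁
    have k3 := hD.continuous₀
    have k4 := hb.continuous₁
    have k5 := hb.continuous₂
    have kG : Continuous (massDensity a a' D) :=
      ((k1.mul (k2.norm.pow 2)).smul k3).add ((k2.norm.pow 2).smul continuous_const)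
    have kP : Continuous fun ρ => a' ρ 0 • b' ρ + a ρ 0 • b'' ρ := (k1'.smul k4).add (k1.smul k5)
    have kin : Continuous fun s : ℝ => node j + s * (1 / J) := by fun_prop
    have kl : Continuous fun s : ℝ => (1 - s) • η j + s • η (j + 1) := by fun_prop
    have i1 := (kG.comp kin).inner kl (𝕜 := ℝ)
    have i2 := (kP.comp kin).inner kl (𝕜 := ℝ)
    simp only [Function.comp_def] at i1 i2
    rw [← mul_sub, ← intervalIntegral.integral_sub (i1.intervalIntegrable _ _)
      (i2.intervalIntegrable _ _)]
    congr 2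
    funext s
    rw [← inner_sub_left]
    congr 1
    simp only [strongRes, massDensity]
    abel
  rw [e, nodalForm]
  have h4 : (14000 * L ^ 4) * (1 / (J : ℝ)) ^ 2 * S ≤
      14000 * L ^ 4 * (1 / (J : ℝ)) ^ 2 * √(l2sq (1 / J) η) := by gcongr
  refine le_trans ?_ h4
  have hL4 : L ^ 2 ≤ L ^ 4 := pow_le_pow_right₀ hL (by norm_num)
  have h5 : (12960 * L ^ 4 + 288 * L ^ 2) * (1 / (J : ℝ)) ^ 2 * S + 4 * L ^ 2 * (1 / (J : ℝ)) ^ 2 * S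
      ≤ 14000 * L ^ 4 * (1 / (J : ℝ)) ^ 2 * S := by
    have : (12960 * L ^ 4 + 288 * L ^ 2) + 4 * L ^ 2 ≤ 14000 * L ^ 4 := by nlinarith
    calc _ = ((12960 * L ^ 4 + 288 * L ^ 2) + 4 * L ^ 2) * ((1 / (J : ℝ)) ^ 2 * S) := by ring
      _ ≤ 14000 * L ^ 4 * ((1 / (J : ℝ)) ^ 2 * S) := by gcongr
      _ = _ := by ring
  refine le_trans ?_ h5
  rw [abs_le] at h1 h2 ⊢
  constructor <;> linarith [h1.1, h1.2, h2.1, h2.2]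

theorem sq_integral_inner_le {r p : ℝ → Plane} (hr : Continuous r) (hp : Continuous p) :
    (∫ ρ in (0 : ℝ)..1, inner ℝ (r ρ) (p ρ)) ^ 2 ≤
      (∫ ρ in (0 : ℝ)..1, ‖r ρ‖ ^ 2) * ∫ ρ in (0 : ℝ)..1, ‖p ρ‖ ^ 2 := by
  have h := discrim_le_zero (a := ∫ ρ in (0 : ℝ)..1, ‖p ρ‖ ^ 2)
    (b := -2 * ∫ ρ in (0 : ℝ)..1, inner ℝ (r ρ) (p ρ)) (c := ∫ ρ in (0 : ℝ)..1, ‖r ρ‖ ^ 2) ?_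
  · rw [discrim] at h; linarith
  · intro t
    have c1 : Continuous fun ρ => (t * t) * ‖p ρ‖ ^ 2 := by fun_prop
    have c2 : Continuous fun ρ => (-2 * t) * inner ℝ (r ρ) (p ρ) := by fun_prop
    have c3 : Continuous fun ρ => ‖r ρ‖ ^ 2 := by fun_prop
    have c4 : Continuous fun ρ => (t * t) * ‖p ρ‖ ^ 2 + (-2 * t) * inner ℝ (r ρ) (p ρ) := c1.add c2
    have : ∫ ρ in (0 : ℝ)..1, ‖r ρ - t • p ρ‖ ^ 2 =
        (t * t) * (∫ ρ in (0 : ℝ)..1, ‖p ρ‖ ^ 2) + (-2 * t) *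
          (∫ ρ in (0 : ℝ)..1, inner ℝ (r ρ) (p ρ)) + ∫ ρ in (0 : ℝ)..1, ‖r ρ‖ ^ 2 := by
      rw [← intervalIntegral.integral_const_mul, ← intervalIntegral.integral_const_mul,
        ← intervalIntegral.integral_add (c1.intervalIntegrable _ _) (c2.intervalIntegrable _ _),
        ← intervalIntegral.integral_add (c4.intervalIntegrable _ _)
          (c3.intervalIntegrable _ _)]
      congr 1
      funext ρ
      rw [norm_sub_sq_real, norm_smul, real_inner_smul_right, mul_pow, Real.norm_eq_abs, sq_abs]
      ring
    have h0 : 0 ≤ ∫ ρ in (0 : ℝ)..1, ‖r ρ - t • p ρ‖ ^ 2 :=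
      intervalIntegral.integral_nonneg zero_le_one fun _ _ => by positivity
    linarith

/-- Moments of a continuous periodic function against a piecewise affine function. -/
theorem abs_moments_le {r : ℝ → Plane} (hr : Continuous r) (hp : Function.Periodic r 1) {B : ℝ}
    (hB : 0 ≤ B) (hrB : ∫ ρ in (0 : ℝ)..1, ‖r ρ‖ ^ 2 ≤ B ^ 2) (η : ZMod J → Plane) :
    |∑ j, 1 / J * ∫ s in (0 : ℝ)..1, inner ℝ (r (node j + s * (1 / J)))
        ((1 - s) • η j + s • η (j + 1))| ≤ B * √(l2sq (1 / J) η) := by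
  have hJ : (0 : ℝ) < J := J_pos (J := J)
  have e : ∑ j, 1 / J * ∫ s in (0 : ℝ)..1, inner ℝ (r (node j + s * (1 / J)))
        ((1 - s) • η j + s • η (j + 1)) = ∫ ρ in (0 : ℝ)..1, inner ℝ (r ρ) (plin η ρ) := by
    rw [integral_elements (J := J) (g := fun j s => inner ℝ (r (node j + s * (1 / J)))
      ((1 - s) • η j + s • η (j + 1))) (fun j => by fun_prop) (fun k s hs => by
        have hper : Function.Periodic (fun ρ => r (ρ + s * (1 / J))) 1 := fun ρ => by
          have := hp (ρ + s * (1 / J))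
          rw [show ρ + s * (1 / J) + 1 = ρ + 1 + s * (1 / J) by ring] at this
          exact this
        have h1 : r ((k : ℝ) / J + s * (1 / J)) = r (node (k : ZMod J) + s * (1 / J)) :=
          nodal_int hper k
        rw [plin_elem _ _ ⟨hs.1.le, hs.2.le⟩, ← h1]
        congr 2
        ring)]
    refine Finset.sum_congr rfl fun j _ => ?_
    ring
  rw [e]
  have h1 := sq_integral_inner_le hr (plin_continuous η)
  have h2 := (integral_plin_sq η).2
  have hl : 0 ≤ l2sq (1 / (J : ℝ)) η := l2sq_nonneg (by positivity) η
  refine abs_le_of_sq_le_sq ?_ (by positivity)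
  rw [mul_pow, Real.sq_sqrt hl]
  refine h1.trans (mul_le_mul hrB h2 ?_ (sq_nonneg _))
  exact intervalIntegral.integral_nonneg zero_le_one fun _ _ => by positivity

end MassConsistency

/-! ### Classes in `L²` -/

open Classical in
/-- The class of `f` in `L²(𝕀)²`, and `0` if `f` is not square integrable. -/
noncomputable def l2class (f : ℝ → Plane) : Lp Plane 2 circleVol :=
  if h : MemLp f 2 circleVol then h.toLp f else 0

theorem l2class_of_memLp {f : ℝ → Plane} (h : MemLp f 2 circleVol) : l2class f = h.toLp f :=
  dif_pos h

theorem l2class_congr {f g : ℝ → Plane} (h : f =ᵐ[circleVol] g) : l2class f = l2class g := by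
  by_cases hf : MemLp f 2 circleVol
  · have hg := hf.ae_eq h
    rw [l2class_of_memLp hf, l2class_of_memLp hg, MemLp.toLp_congr hf hg h]
  · have hg : ¬ MemLp g 2 circleVol := fun hg => hf (hg.ae_eq h.symm)
    rw [l2class, l2class, dif_neg hf, dif_neg hg]

theorem l2class_add {f g : ℝ → Plane} (hf : MemLp f 2 circleVol) (hg : MemLp g 2 circleVol) :
    l2class (f + g) = l2class f + l2class g := by
  rw [l2class_of_memLp hf, l2class_of_memLp hg, l2class_of_memLp (hf.add hg), MemLp.toLp_add]

theorem l2class_sub {f g : ℝ → Plane} (hf : MemLp f 2 circleVol) (hg : MemLp g 2 circleVol) :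
    l2class (f - g) = l2class f - l2class g := by
  rw [l2class_of_memLp hf, l2class_of_memLp hg, l2class_of_memLp (hf.sub hg), MemLp.toLp_sub]

theorem l2class_smul {f : ℝ → Plane} (c : ℝ) (hf : MemLp f 2 circleVol) :
    l2class (c • f) = c • l2class f := by
  rw [l2class_of_memLp hf, l2class_of_memLp (hf.const_smul c), MemLp.toLp_const_smul]

theorem norm_l2class {f : ℝ → Plane} (hf : MemLp f 2 circleVol) :
    ‖l2class f‖ = (eLpNorm f 2 circleVol).toReal := by
  rw [l2class_of_memLp hf, Lp.norm_toLp]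

theorem norm_l2class_sq {f : ℝ → Plane} (hf : MemLp f 2 circleVol) :
    ‖l2class f‖ ^ 2 = ∫ ρ in (0 : ℝ)..1, ‖f ρ‖ ^ 2 := by
  have h0 : 0 ≤ ∫ ρ in (0 : ℝ)..1, ‖f ρ‖ ^ 2 :=
    intervalIntegral.integral_nonneg zero_le_one fun _ _ => by positivity
  rw [norm_l2class hf, eLpNorm_two hf, ENNReal.toReal_ofReal (Real.sqrt_nonneg _), Real.sq_sqrt h0]

theorem coeFn_l2class {f : ℝ → Plane} (hf : MemLp f 2 circleVol) :
    l2class f =ᵐ[circleVol] f := by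
  rw [l2class_of_memLp hf]; exact hf.coeFn_toLp

/-- Pairing with a test function. -/
theorem inner_l2class_test {φ : ℝ → ℝ} (hφ : Continuous φ) (c : Plane) {f : ℝ → Plane}
    (hf : MemLp f 2 circleVol) :
    inner ℝ (l2class (fun ρ => φ ρ • c)) (l2class f) =
      inner ℝ c (∫ ρ in (0 : ℝ)..1, φ ρ • f ρ) := by
  have hφc : MemLp (fun ρ => φ ρ • c) 2 circleVol :=
    memLp_of_continuous_periodic (hφ.smul continuous_const) 2
  have hfi : Integrable f circleVol := hf.integrable one_le_two
  rw [L2.inner_def, integral_congr_ae (g := fun ρ => inner ℝ c (φ ρ • f ρ)), integral_circleVol]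
  · have := (innerSL ℝ c).intervalIntegral_comp_comm (continuous_smul_integrable hφ hfi)
    simpa only [innerSL_apply_apply] using this
  · filter_upwards [coeFn_l2class hφc, coeFn_l2class hf] with ρ h1 h2
    rw [h1, h2, real_inner_smul_left, real_inner_smul_right]

theorem inner_l2class_weakDeriv {φ : ℝ → ℝ} (hφ : ContDiff ℝ (⊤ : ℕ∞) φ)
    (hp : Function.Periodic φ 1) (c : Plane) {f g : ℝ → Plane} (hf : MemLp f 2 circleVol)
    (hg : MemLp g 2 circleVol) (h : HasWeakDeriv f g) :
    inner ℝ (l2class (fun ρ => φ ρ • c)) (l2class g) =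
      -inner ℝ (l2class (fun ρ => deriv φ ρ • c)) (l2class f) := by
  rw [inner_l2class_test hφ.continuous c hg,
    inner_l2class_test (continuous_deriv_of_smooth hφ) c hf, h.2.2 φ hφ hp, inner_neg_right, neg_neg]

/-- Test functions separate the points of `L²`. -/
theorem l2_eq_zero_of_test (e : Lp Plane 2 circleVol)
    (h : ∀ φ : ℝ → ℝ, ContDiff ℝ (⊤ : ℕ∞) φ → Function.Periodic φ 1 → ∀ c : Plane,
      inner ℝ (l2class (fun ρ => φ ρ • c)) e = 0) : e = 0 := by
  have hm : MemLp e 2 circleVol := Lp.memLp e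
  have he : l2class e = e := by rw [l2class_of_memLp hm, Lp.toLp_coeFn]
  have h0 := ae_eq_zero_of_periodic_test (k := e) (hm.integrable one_le_two) (fun φ hφ hp => by
    have h1 := h φ hφ hp (∫ ρ in (0 : ℝ)..1, φ ρ • e ρ)
    have h2 := inner_l2class_test hφ.continuous (∫ ρ in (0 : ℝ)..1, φ ρ • e ρ) hm
    rw [he, h1] at h2
    exact inner_self_eq_zero.1 h2.symm)
  exact Lp.eq_zero_iff_ae_eq_zero.2 h0

/-- A curve with a weak derivative, tested with a separating family of functionals, that is
continuous, is differentiable. -/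
theorem hasDerivWithinAt_of_separating {E : Type*} [NormedAddCommGroup E] [NormedSpace ℝ E]
    [CompleteSpace E] {T : ℝ} (hT : 0 < T) {U V : ℝ → E} (S : Set (E →L[ℝ] ℝ))
    (hS : ∀ e, (∀ ℓ ∈ S, ℓ e = 0) → e = 0) (hV : ContinuousOn V (Icc 0 T))
    (h : ∀ ℓ ∈ S, ∀ t ∈ Icc 0 T,
      HasDerivWithinAt (fun s => ℓ (U s)) (ℓ (V t)) (Icc 0 T) t) :
    ∀ t ∈ Icc 0 T, HasDerivWithinAt U (V t) (Icc 0 T) t := by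
  set V' : ℝ → E := IccExtend hT.le (fun t : Icc (0 : ℝ) T => V t) with hV'
  have hc : Continuous V' := (continuousOn_iff_continuous_domRestrict.1 hV).Icc_extend'
  have hVV : ∀ t ∈ Icc 0 T, V' t = V t := fun t ht => IccExtend_of_mem hT.le _ ht
  set I : ℝ → E := fun t => U 0 + ∫ s in (0 : ℝ)..t, V' s with hI
  have hId : ∀ t, HasDerivAt I (V' t) t := fun t =>
    (intervalIntegral.integral_hasDerivAt_right (hc.intervalIntegrable _ _)
      (hc.stronglyMeasurableAtFilter _ _) hc.continuousAt).const_add (U 0)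
  have h0 : (0 : ℝ) ∈ Icc 0 T := ⟨le_rfl, hT.le⟩
  have heq : ∀ t ∈ Icc 0 T, U t = I t := by
    intro t ht
    rw [← sub_eq_zero]
    refine hS _ fun ℓ hℓ => ?_
    have hd : ∀ s ∈ Icc 0 T, HasDerivWithinAt (fun s => ℓ (U s) - ℓ (I s)) 0 (Icc 0 T) s := by
      intro s hs
      have h1 := h ℓ hℓ s hs
      have h2 : HasDerivAt (fun s => ℓ (I s)) (ℓ (V' s)) s :=
        ℓ.hasFDerivAt.comp_hasDerivAt s (hId s)
      refine (h1.sub h2.hasDerivWithinAt).congr_deriv ?_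
      rw [hVV s hs, sub_self]
    have h3 := (convex_Icc 0 T).norm_image_sub_le_of_norm_hasDerivWithin_le (C := 0) hd
      (fun s _ => by simp) h0 ht
    rw [zero_mul] at h3
    have h4 := norm_le_zero_iff.1 h3
    have h5 : I 0 = U 0 := by simp [hI]
    rw [h5, sub_self, sub_zero] at h4
    rw [map_sub, h4]
  intro t ht
  have := (hId t).hasDerivWithinAt (s := Icc 0 T)
  rw [hVV t ht] at this
  exact this.congr heq (heq t ht)

/-! ### Iterated weak derivatives -/

theorem wderiv_congr {f g : ℝ → Plane} (h : f =ᵐ[circleVol] g) : wderiv f = wderiv g := by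
  have : HasWeakDeriv f = HasWeakDeriv g := by
    funext k
    exact propext ⟨fun hk => hk.congr h ae_eq_rfl, fun hk => hk.congr h.symm ae_eq_rfl⟩
  unfold wderiv
  rw [this]

theorem MemSobolev.memLp {l : ℕ} {p : ℝ≥0∞} {f : ℝ → Plane} (h : MemSobolev l p f) :
    MemLp f p circleVol := by
  cases l with
  | zero => exact h
  | succ l => exact h.1

theorem MemSobolev.congr {l : ℕ} {p : ℝ≥0∞} {f g : ℝ → Plane} (h : MemSobolev l p f)
    (hfg : f =ᵐ[circleVol] g) : MemSobolev l p g := by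
  cases l with
  | zero => exact MemLp.ae_eq hfg h
  | succ l =>
    obtain ⟨h1, k, h2, h3⟩ := h
    exact ⟨h1.ae_eq hfg, k, h2.congr hfg ae_eq_rfl, h3⟩

theorem MemSobolev.hasWeakDeriv {l : ℕ} {p : ℝ≥0∞} {f : ℝ → Plane} (h : MemSobolev (l + 1) p f) :
    HasWeakDeriv f (wderiv f) ∧ MemSobolev l p (wderiv f) := by
  obtain ⟨h1, k, h2, h3⟩ := h
  have := h2.wderiv_ae
  exact ⟨h2.congr ae_eq_rfl this.symm, h3.congr this.symm⟩

theorem MemSobolev.iterate {l : ℕ} {p : ℝ≥0∞} {f : ℝ → Plane} (k : ℕ)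
    (h : MemSobolev (l + k) p f) : MemSobolev l p (wderiv^[k] f) := by
  induction k generalizing f with
  | zero => exact h
  | succ k ih => exact ih (f := wderiv f) (MemSobolev.hasWeakDeriv (l := l + k) h).2

theorem MemSobolev.mono {l : ℕ} {p q : ℝ≥0∞} (hpq : p ≤ q) {f : ℝ → Plane} (hf : MemSobolev l q f) :
    MemSobolev l p f := by
  induction l generalizing f with
  | zero => exact MemLp.mono_exponent hf hpq
  | succ l ih =>
    obtain ⟨h1, k, h2, h3⟩ := hf
    exact ⟨h1.mono_exponent hpq, k, h2, ih h3⟩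

theorem MemSobolev.wderiv_iterate_sub {l : ℕ} {p : ℝ≥0∞} {f g : ℝ → Plane} (hf : MemSobolev l p f)
    (hg : MemSobolev l p g) {k : ℕ} (hk : k ≤ l) :
    wderiv^[k] (f - g) =ᵐ[circleVol] wderiv^[k] f - wderiv^[k] g := by
  induction k generalizing f g l with
  | zero => exact ae_eq_rfl
  | succ k ih =>
    obtain ⟨l, rfl⟩ : ∃ l', l = l' + 1 := ⟨l - 1, by omega⟩
    obtain ⟨h1, h2⟩ := hf.hasWeakDeriv
    obtain ⟨g1, g2⟩ := hg.hasWeakDeriv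
    have e := (h1.sub g1).wderiv_ae
    rw [Function.iterate_succ_apply, Function.iterate_succ_apply, Function.iterate_succ_apply]
    have e2 := ih h2 g2 (by omega)
    cases k with
    | zero => exact e
    | succ k =>
      rw [Function.iterate_succ_apply, wderiv_congr e, ← Function.iterate_succ_apply]
      exact e2

theorem eLpNorm_le_sobolevNorm {l k : ℕ} (hk : k ≤ l) {p : ℝ≥0∞} (hp : p = 2 ∨ p = ∞)
    {f : ℝ → Plane} (hf : AEStronglyMeasurable (wderiv^[k] f) circleVol) :
    eLpNorm (wderiv^[k] f) 2 circleVol ≤ sobolevNorm l p f := by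
  have hk' : k ∈ Finset.range (l + 1) := Finset.mem_range.2 (by omega)
  rcases hp with rfl | rfl
  · rw [sobolevNorm, if_neg ENNReal.ofNat_ne_top]
    have h1 := Finset.single_le_sum
      (f := fun k => eLpNorm (wderiv^[k] f) 2 circleVol ^ (2 : ℝ≥0∞).toReal)
      (fun _ _ => zero_le) hk'
    have h2 := ENNReal.rpow_le_rpow h1 (z := 1 / (2 : ℝ≥0∞).toReal) (by positivity)
    refine le_trans (le_of_eq ?_) h2
    rw [← ENNReal.rpow_mul]
    norm_num
  · rw [sobolevNorm, if_pos rfl]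
    refine (eLpNorm_le_eLpNorm_of_exponent_le le_top hf).trans ?_
    exact le_iSup₂ (f := fun k (_ : k ∈ Finset.range (l + 1)) => eLpNorm (wderiv^[k] f) ∞ circleVol)
      k hk'

/-! ### Curves in `L²` -/

/-- The curve of the classes of the `k`-th derivatives. -/
noncomputable def l2curve (k : ℕ) (u : ℝ → ℝ → Plane) (t : ℝ) : Lp Plane 2 circleVol :=
  l2class (wderiv^[k] (u t))

theorem two_le_of {p : ℝ≥0∞} (hp : p = 2 ∨ p = ∞) : 2 ≤ p := by
  rcases hp with rfl | rfl
  · exact le_rfl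
  · exact le_top

theorem ContInSobolev.continuousOn {T : ℝ} {l k : ℕ} {p : ℝ≥0∞} (hp : p = 2 ∨ p = ∞)
    {u : ℝ → ℝ → Plane} (hu : ContInSobolev T l p u) (hk : k ≤ l) :
    ContinuousOn (l2curve k u) (Icc 0 T) := by
  have hm : ∀ t ∈ Icc 0 T, MemLp (wderiv^[k] (u t)) 2 circleVol := fun t ht => by
    obtain ⟨d, rfl⟩ : ∃ d, l = d + k := ⟨l - k, by omega⟩
    exact ((hu.1 t ht).mono (two_le_of hp)).iterate k |>.memLp
  intro t ht
  rw [ContinuousWithinAt, tendsto_iff_edist_tendsto_0]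
  refine tendsto_of_tendsto_of_tendsto_of_le_of_le' tendsto_const_nhds (hu.2 t ht)
    (Eventually.of_forall fun _ => zero_le) ?_
  filter_upwards [self_mem_nhdsWithin] with s hs
  have e := (hu.1 s hs).wderiv_iterate_sub (hu.1 t ht) hk
  have hms := (hm s hs).sub (hm t ht)
  rw [l2curve, l2curve, l2class_of_memLp (hm s hs), l2class_of_memLp (hm t ht), Lp.edist_toLp_toLp,
    ← eLpNorm_congr_ae e]
  exact eLpNorm_le_sobolevNorm hk hp (hms.ae_eq e.symm).aestronglyMeasurable

theorem HasTimeDeriv.hasDerivWithinAt {T : ℝ} {u v : ℝ → ℝ → Plane} (h : HasTimeDeriv T u v)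
    (hu : ∀ t ∈ Icc 0 T, MemLp (u t) 2 circleVol) (hv : ∀ t ∈ Icc 0 T, MemLp (v t) 2 circleVol)
    {t : ℝ} (ht : t ∈ Icc 0 T) :
    HasDerivWithinAt (l2curve 0 u) (l2curve 0 v t) (Icc 0 T) t := by
  rw [hasDerivWithinAt_iff_tendsto_slope, tendsto_iff_edist_tendsto_0]
  refine (h t ht).congr' ?_
  filter_upwards [self_mem_nhdsWithin] with s hs
  have h1 := ((hu s hs.1).sub (hu t ht)).const_smul (s - t)⁻¹
  have e : slope (l2curve 0 u) t s = l2class ((s - t)⁻¹ • (u s - u t)) := by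
    rw [slope_def_module, l2class_smul _ ((hu s hs.1).sub (hu t ht)),
      l2class_sub (hu s hs.1) (hu t ht)]
    rfl
  rw [e, l2curve, l2class_of_memLp h1, Function.iterate_zero, id_eq, l2class_of_memLp (hv t ht),
    Lp.edist_toLp_toLp, normL2]

/-- Time differentiation commutes with weak differentiation in space. -/
theorem hasDerivWithinAt_l2curve_succ {T : ℝ} (hT : 0 < T) {k : ℕ} {u v : ℝ → ℝ → Plane}
    (hu : ∀ t ∈ Icc 0 T, MemSobolev (k + 1) 2 (u t))
    (hv : ∀ t ∈ Icc 0 T, MemSobolev (k + 1) 2 (v t))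
    (hc : ContinuousOn (l2curve (k + 1) v) (Icc 0 T))
    (h : ∀ t ∈ Icc 0 T, HasDerivWithinAt (l2curve k u) (l2curve k v t) (Icc 0 T) t) :
    ∀ t ∈ Icc 0 T, HasDerivWithinAt (l2curve (k + 1) u) (l2curve (k + 1) v t) (Icc 0 T) t := by
  have hk : ∀ {f : ℝ → Plane}, MemSobolev (k + 1) 2 f →
      MemLp (wderiv^[k] f) 2 circleVol ∧ MemLp (wderiv^[k + 1] f) 2 circleVol ∧
        HasWeakDeriv (wderiv^[k] f) (wderiv^[k + 1] f) := by
    intro f hf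
    have h1 := MemSobolev.iterate (l := 1) k (by rwa [add_comm])
    have h2 := h1.hasWeakDeriv
    rw [Function.iterate_succ_apply']
    exact ⟨h1.memLp, h2.2.memLp, h2.1⟩
  refine hasDerivWithinAt_of_separating hT
    {ℓ | ∃ φ : ℝ → ℝ, ContDiff ℝ (⊤ : ℕ∞) φ ∧ Function.Periodic φ 1 ∧ ∃ c : Plane,
      ℓ = innerSL ℝ (l2class (fun ρ => φ ρ • c))} (fun e he => ?_) hc ?_
  · exact l2_eq_zero_of_test e fun φ hφ hp c => he _ ⟨φ, hφ, hp, c, rfl⟩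
  · rintro ℓ ⟨φ, hφ, hp, c, rfl⟩ t ht
    have key : ∀ {w : ℝ → ℝ → Plane} {s : ℝ}, MemSobolev (k + 1) 2 (w s) →
        innerSL ℝ (l2class (fun ρ => φ ρ • c)) (l2curve (k + 1) w s) =
          -innerSL ℝ (l2class (fun ρ => deriv φ ρ • c)) (l2curve k w s) := by
      intro w s hw
      obtain ⟨m1, m2, m3⟩ := hk hw
      exact inner_l2class_weakDeriv hφ hp c m1 m2 m3
    have hd := ((innerSL ℝ (l2class (fun ρ => deriv φ ρ • c))).hasFDerivAt.comp_hasDerivWithinAt t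
      (h t ht)).neg
    rw [key (hv t ht)]
    exact hd.congr (fun s hs => key (hu s hs)) (key (hu t ht))

/-! ### Continuous representatives -/

/-- `F` is continuous and 1-periodic, and is a primitive of the square integrable function `g`. -/
structure IsPrimitive (F g : ℝ → Plane) : Prop where
  continuous : Continuous F
  periodic : Function.Periodic F 1
  memLp : MemLp g 2 circleVol
  eq : ∀ ρ ∈ Icc (0 : ℝ) 1, F ρ = F 0 + ∫ σ in (0 : ℝ)..ρ, g σ

theorem IsPrimitive.integrable {F g : ℝ → Plane} (h : IsPrimitive F g) : Integrable g circleVol :=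
  h.memLp.integrable one_le_two

theorem IsPrimitive.smul {F g : ℝ → Plane} (c : ℝ) (h : IsPrimitive F g) :
    IsPrimitive (c • F) (c • g) where
  continuous := h.continuous.const_smul c
  periodic ρ := by simp only [Pi.smul_apply, h.periodic ρ]
  memLp := h.memLp.const_smul c
  eq ρ hρ := by
    simp only [Pi.smul_apply, intervalIntegral.integral_smul]
    rw [h.eq ρ hρ, smul_add]

theorem IsPrimitive.add {F g F' g' : ℝ → Plane} (h : IsPrimitive F g) (h' : IsPrimitive F' g') :
    IsPrimitive (F + F') (g + g') where
  continuous := h.continuous.add h'.continuous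
  periodic ρ := by simp only [Pi.add_apply, h.periodic ρ, h'.periodic ρ]
  memLp := h.memLp.add h'.memLp
  eq ρ hρ := by
    simp only [Pi.add_apply]
    rw [intervalIntegral.integral_add (intervalIntegrable_of_circle h.integrable hρ)
      (intervalIntegrable_of_circle h'.integrable hρ), h.eq ρ hρ, h'.eq ρ hρ]
    abel

theorem IsPrimitive.sub {F g F' g' : ℝ → Plane} (h : IsPrimitive F g) (h' : IsPrimitive F' g') :
    IsPrimitive (F - F') (g - g') := by
  have := h.add (h'.smul (-1))
  simpa [sub_eq_add_neg] using this

theorem IsPrimitive.memLp_self {F g : ℝ → Plane} (h : IsPrimitive F g) : MemLp F 2 circleVol :=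
  memLp_of_continuous_periodic h.continuous 2

theorem integral_norm_le_l2 {f : ℝ → Plane} (hf : MemLp f 2 circleVol) :
    ∫ ρ in (0 : ℝ)..1, ‖f ρ‖ ≤ ‖l2class f‖ := by
  rw [norm_l2class hf, ← integral_circleVol,
    integral_norm_eq_lintegral_enorm hf.aestronglyMeasurable]
  refine ENNReal.toReal_mono hf.eLpNorm_ne_top ?_
  rw [← eLpNorm_one_eq_lintegral_enorm]
  exact eLpNorm_le_eLpNorm_of_exponent_le one_le_two hf.aestronglyMeasurable

/-- The embedding of `H¹(𝕀)` in the continuous functions. -/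
theorem IsPrimitive.norm_le {F g : ℝ → Plane} (h : IsPrimitive F g) (ρ : ℝ) :
    ‖F ρ‖ ≤ ‖l2class F‖ + ‖l2class g‖ := by
  wlog hρ : ρ ∈ Icc (0 : ℝ) 1 generalizing ρ
  · have e : F (Int.fract ρ) = F ρ := by
      have := h.periodic.sub_int_mul_eq (x := ρ) ⌊ρ⌋
      rw [mul_one] at this
      exact this
    rw [← e]
    exact this _ ⟨Int.fract_nonneg _, (Int.fract_lt_one _).le⟩
  have hgi := integrable_circleVol_iff.1 h.integrable
  have key : ∀ σ ∈ Icc (0 : ℝ) 1, ‖F ρ‖ ≤ ‖F σ‖ + ∫ τ in (0 : ℝ)..1, ‖g τ‖ := by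
    intro σ hσ
    have e : F ρ = F σ + ∫ τ in σ..ρ, g τ := by
      rw [h.eq ρ hρ, h.eq σ hσ, ← intervalIntegral.integral_interval_sub_left
        (intervalIntegrable_of_circle h.integrable hρ)
        (intervalIntegrable_of_circle h.integrable hσ)]
      abel
    rw [e]
    refine (norm_add_le _ _).trans (add_le_add le_rfl ?_)
    refine (intervalIntegral.norm_integral_le_integral_norm_uIoc).trans ?_
    rw [intervalIntegral.integral_of_le zero_le_one]
    refine setIntegral_mono_set ?_ (Eventually.of_forall fun _ => norm_nonneg _) ?_
    · exact h.integrable.norm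
    · refine (Ioc_subset_Ioc ?_ ?_ : uIoc σ ρ ⊆ Ioc 0 1).eventuallyLE
      · exact le_min hσ.1 hρ.1
      · exact max_le hσ.2 hρ.2
  have h1 : ∫ _σ in (0 : ℝ)..1, ‖F ρ‖ ≤ ∫ σ in (0 : ℝ)..1, (‖F σ‖ + ∫ τ in (0 : ℝ)..1, ‖g τ‖) :=
    intervalIntegral.integral_mono_on zero_le_one intervalIntegrable_const
      ((h.continuous.norm.add continuous_const).intervalIntegrable _ _) key
  rw [intervalIntegral.integral_add (h.continuous.norm.intervalIntegrable _ _)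
    intervalIntegrable_const] at h1
  simp only [intervalIntegral.integral_const, sub_zero, one_smul] at h1
  exact h1.trans (add_le_add (integral_norm_le_l2 h.memLp_self) (integral_norm_le_l2 h.memLp))

theorem IsPrimitive.congr {F g g' : ℝ → Plane} (h : IsPrimitive F g) (hg : g =ᵐ[circleVol] g') :
    IsPrimitive F g' where
  continuous := h.continuous
  periodic := h.periodic
  memLp := h.memLp.ae_eq hg
  eq ρ hρ := by
    rw [h.eq ρ hρ]
    congr 1
    refine intervalIntegral.integral_congr_ae ?_
    have := (ae_restrict_iff' measurableSet_Ioc).1 hg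
    filter_upwards [this] with σ hσ hσ'
    rw [uIoc_of_le hρ.1] at hσ'
    exact hσ ⟨hσ'.1, hσ'.2.trans hρ.2⟩

/-- A primitive of a function with a continuous representative is continuously differentiable. -/
theorem IsPrimitive.hasDerivAt {F g : ℝ → Plane} (h : IsPrimitive F g) {G : ℝ → Plane}
    (hG : Continuous G) (hGp : Function.Periodic G 1) (hgG : g =ᵐ[circleVol] G) (ρ : ℝ) :
    HasDerivAt F (G ρ) ρ := by
  have h1 := (h.congr hgG).eq
  have h01 : ∫ σ in (0 : ℝ)..1, G σ = 0 := by
    have e1 := h1 1 ⟨zero_le_one, le_rfl⟩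
    have e2 := h.periodic 0
    rw [zero_add] at e2
    rw [e2] at e1
    simpa using e1
  have hper : Function.Periodic (fun ρ => F 0 + ∫ σ in (0 : ℝ)..ρ, G σ) 1 := by
    intro ρ
    have e1 := hGp.intervalIntegral_add_eq ρ 0
    rw [zero_add, h01] at e1
    have e2 := intervalIntegral.integral_add_adjacent_intervals
      (hG.intervalIntegrable (μ := volume) 0 ρ) (hG.intervalIntegrable ρ (ρ + 1))
    rw [e1, add_zero] at e2
    simp only [← e2]
  have heq : F = fun ρ => F 0 + ∫ σ in (0 : ℝ)..ρ, G σ := by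
    funext ρ
    have e1 := h.periodic.sub_int_mul_eq (x := ρ) ⌊ρ⌋
    have e2 := hper.sub_int_mul_eq (x := ρ) ⌊ρ⌋
    rw [mul_one] at e1 e2
    rw [← e1, ← e2]
    exact h1 _ ⟨Int.fract_nonneg _, (Int.fract_lt_one _).le⟩
  rw [heq]
  exact (intervalIntegral.integral_hasDerivAt_right (hG.intervalIntegrable _ _)
      (hG.stronglyMeasurableAtFilter _ _) hG.continuousAt).const_add (F 0)

/-- Two continuous 1-periodic functions that agree almost everywhere are equal. -/
theorem eq_of_ae_eq_circle {F G : ℝ → Plane} (hF : Continuous F) (hG : Continuous G)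
    (hFp : Function.Periodic F 1) (hGp : Function.Periodic G 1) (h : F =ᵐ[circleVol] G) : F = G := by
  have h1 : EqOn F G (Ioo 0 1) := by
    refine Measure.eqOn_open_of_ae_eq (μ := volume) ?_ isOpen_Ioo hF.continuousOn hG.continuousOn
    exact ae_restrict_of_ae_restrict_of_subset Ioo_subset_Ioc_self h
  have h2 : EqOn F G (Icc 0 1) := by
    have := h1.closure hF hG
    rwa [closure_Ioo zero_ne_one] at this
  funext ρ
  have e1 := hFp.sub_int_mul_eq (x := ρ) ⌊ρ⌋
  have e2 := hGp.sub_int_mul_eq (x := ρ) ⌊ρ⌋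
  rw [mul_one] at e1 e2
  rw [← e1, ← e2]
  exact h2 ⟨Int.fract_nonneg _, (Int.fract_lt_one _).le⟩

theorem HasWeakDeriv.exists_isPrimitive {f g : ℝ → Plane} (h : HasWeakDeriv f g)
    (hg : MemLp g 2 circleVol) : ∃ F, IsPrimitive F g ∧ F =ᵐ[circleVol] f := by
  obtain ⟨F, h1, h2, h3, h4⟩ := h.exists_primitive
  exact ⟨F, ⟨h1, h2, hg, h4⟩, h3⟩

/-! ### Functions of time and space with bounded mixed differences -/

section MixedLipschitz

set_option linter.unusedSectionVars false

variable {E : Type*} [NormedAddCommGroup E] [NormedSpace ℝ E] {T : ℝ} {d : ℝ → ℝ → ℝ}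

/-- `f` is bounded, Lipschitz in time, Lipschitz in space with respect to `d`, and so are its
differences. The class for `d = 1` consists of the bounded functions that are Lipschitz in time. -/
def IsMixedLip (T : ℝ) (d : ℝ → ℝ → ℝ) (f : ℝ → ℝ → E) : Prop :=
  ∃ B : ℝ, ∀ s ∈ Icc 0 T, ∀ t ∈ Icc 0 T, ∀ ρ σ, ‖f s ρ‖ ≤ B ∧ ‖f s ρ - f t ρ‖ ≤ B * |s - t| ∧
    ‖f s ρ - f s σ‖ ≤ B * d ρ σ ∧ ‖f s ρ - f s σ - f t ρ + f t σ‖ ≤ B * (|s - t| * d ρ σ)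

theorem IsMixedLip.exists_pos (hd : ∀ ρ σ, 0 ≤ d ρ σ) {f : ℝ → ℝ → E} (h : IsMixedLip T d f) :
    ∃ B : ℝ, 1 ≤ B ∧ ∀ s ∈ Icc 0 T, ∀ t ∈ Icc 0 T, ∀ ρ σ, ‖f s ρ‖ ≤ B ∧
      ‖f s ρ - f t ρ‖ ≤ B * |s - t| ∧ ‖f s ρ - f s σ‖ ≤ B * d ρ σ ∧
      ‖f s ρ - f s σ - f t ρ + f t σ‖ ≤ B * (|s - t| * d ρ σ) := by
  obtain ⟨B, hB⟩ := h
  have hle : B ≤ max B 1 := le_max_left _ _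
  refine ⟨max B 1, le_max_right _ _, fun s hs t ht ρ σ => ?_⟩
  obtain ⟨h1, h2, h3, h4⟩ := hB s hs t ht ρ σ
  have := hd ρ σ
  exact ⟨h1.trans hle, h2.trans (by gcongr), h3.trans (by gcongr), h4.trans (by gcongr)⟩

theorem IsMixedLip.const (hd : ∀ ρ σ, 0 ≤ d ρ σ) (e : E) : IsMixedLip T d (fun _ _ => e) := by
  refine ⟨‖e‖, fun s _ t _ ρ σ => ⟨le_rfl, ?_, ?_, ?_⟩⟩
  · rw [sub_self, norm_zero]; positivity
  · rw [sub_self, norm_zero]; exact mul_nonneg (norm_nonneg _) (hd ρ σ)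
  · rw [sub_self, zero_sub, neg_add_cancel, norm_zero]
    exact mul_nonneg (norm_nonneg _) (mul_nonneg (abs_nonneg _) (hd ρ σ))

theorem IsMixedLip.add {f g : ℝ → ℝ → E} (hf : IsMixedLip T d f) (hg : IsMixedLip T d g) :
    IsMixedLip T d (fun t ρ => f t ρ + g t ρ) := by
  obtain ⟨B, hB⟩ := hf
  obtain ⟨C, hC⟩ := hg
  refine ⟨B + C, fun s hs t ht ρ σ => ?_⟩
  obtain ⟨h1, h2, h3, h4⟩ := hB s hs t ht ρ σ
  obtain ⟨k1, k2, k3, k4⟩ := hC s hs t ht ρ σ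
  simp only [add_mul]
  refine ⟨norm_add_le_of_le h1 k1, ?_, ?_, ?_⟩
  · rw [add_sub_add_comm]; exact norm_add_le_of_le h2 k2
  · rw [add_sub_add_comm]; exact norm_add_le_of_le h3 k3
  · have e : f s ρ + g s ρ - (f s σ + g s σ) - (f t ρ + g t ρ) + (f t σ + g t σ) =
        (f s ρ - f s σ - f t ρ + f t σ) + (g s ρ - g s σ - g t ρ + g t σ) := by abel
    rw [e]; exact norm_add_le_of_le h4 k4

theorem IsMixedLip.smul (hd : ∀ ρ σ, 0 ≤ d ρ σ) {f : ℝ → ℝ → ℝ} {g : ℝ → ℝ → E}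
    (hf : IsMixedLip T d f) (hg : IsMixedLip T d g) :
    IsMixedLip T d (fun t ρ => f t ρ • g t ρ) := by
  obtain ⟨B, hB1, hB⟩ := hf.exists_pos hd
  obtain ⟨C, hC1, hC⟩ := hg.exists_pos hd
  have hB0 : 0 ≤ B := zero_le_one.trans hB1
  have hC0 : 0 ≤ C := zero_le_one.trans hC1
  have key : ∀ (x : ℝ) (y : E) (a b : ℝ), ‖x‖ ≤ a → ‖y‖ ≤ b → ‖x • y‖ ≤ a * b := by
    intro x y a b hx hy
    rw [norm_smul]
    exact mul_le_mul hx hy (norm_nonneg _) ((norm_nonneg _).trans hx)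
  refine ⟨4 * (B * C), fun s hs t ht ρ σ => ?_⟩
  have hdp := hd ρ σ
  have hst := abs_nonneg (s - t)
  obtain ⟨h1, h2, h3, h4⟩ := hB s hs t ht ρ σ
  obtain ⟨k1, k2, k3, k4⟩ := hC s hs t ht ρ σ
  obtain ⟨h1s, h2s, -, -⟩ := hB s hs t ht σ ρ
  obtain ⟨h1t, -, h3t, -⟩ := hB t ht s hs ρ σ
  obtain ⟨h1u, -, -, -⟩ := hB t ht s hs σ ρ
  obtain ⟨k1s, -, -, -⟩ := hC s hs t ht σ ρ
  obtain ⟨k1t, -, -, -⟩ := hC t ht s hs ρ σ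
  have hBC : 0 ≤ B * C := mul_nonneg hB0 hC0
  refine ⟨(key _ _ _ _ h1 k1).trans (by linarith), ?_, ?_, ?_⟩
  · have e : f s ρ • g s ρ - f t ρ • g t ρ =
        (f s ρ - f t ρ) • g s ρ + f t ρ • (g s ρ - g t ρ) := by module
    rw [e]
    refine (norm_add_le_of_le (key _ _ _ _ h2 k1) (key _ _ _ _ h1t k2)).trans ?_
    nlinarith [mul_nonneg hBC hst]
  · have e : f s ρ • g s ρ - f s σ • g s σ =
        (f s ρ - f s σ) • g s ρ + f s σ • (g s ρ - g s σ) := by module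
    rw [e]
    refine (norm_add_le_of_le (key _ _ _ _ h3 k1) (key _ _ _ _ h1s k3)).trans ?_
    nlinarith [mul_nonneg hBC hdp]
  · have e : f s ρ • g s ρ - f s σ • g s σ - f t ρ • g t ρ + f t σ • g t σ =
        (f s ρ - f s σ - f t ρ + f t σ) • g s ρ + (f s σ - f t σ) • (g s ρ - g s σ) +
          (f t ρ - f t σ) • (g s ρ - g t ρ) + f t σ • (g s ρ - g s σ - g t ρ + g t σ) := by module
    rw [e]
    refine (norm_add_le_of_le (norm_add_le_of_le (norm_add_le_of_le (key _ _ _ _ h4 k1)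
      (key _ _ _ _ h2s k3)) (key _ _ _ _ h3t k2)) (key _ _ _ _ h1u k4)).trans (le_of_eq ?_)
    ring

theorem IsMixedLip.sub (hd : ∀ ρ σ, 0 ≤ d ρ σ) {f g : ℝ → ℝ → E} (hf : IsMixedLip T d f)
    (hg : IsMixedLip T d g) : IsMixedLip T d (fun t ρ => f t ρ - g t ρ) := by
  have := hf.add ((IsMixedLip.const hd (-1 : ℝ)).smul hd hg)
  simpa only [neg_smul, one_smul, ← sub_eq_add_neg] using this

theorem IsMixedLip.mul (hd : ∀ ρ σ, 0 ≤ d ρ σ) {f g : ℝ → ℝ → ℝ} (hf : IsMixedLip T d f)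
    (hg : IsMixedLip T d g) : IsMixedLip T d (fun t ρ => f t ρ * g t ρ) := hf.smul hd hg

theorem IsMixedLip.coord {f : ℝ → ℝ → Plane} (hf : IsMixedLip T d f) (i : Fin 2) :
    IsMixedLip T d (fun t ρ => f t ρ i) := by
  obtain ⟨B, hB⟩ := hf
  refine ⟨B, fun s hs t ht ρ σ => ?_⟩
  obtain ⟨h1, h2, h3, h4⟩ := hB s hs t ht ρ σ
  exact ⟨(abs_coord_le _ i).trans h1, (abs_coord_le (f s ρ - f t ρ) i).trans h2,
    (abs_coord_le (f s ρ - f s σ) i).trans h3,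
    (abs_coord_le (f s ρ - f s σ - f t ρ + f t σ) i).trans h4⟩

theorem IsMixedLip.normSq (hd : ∀ ρ σ, 0 ≤ d ρ σ) {f : ℝ → ℝ → Plane} (hf : IsMixedLip T d f) :
    IsMixedLip T d (fun t ρ => ‖f t ρ‖ ^ 2) := by
  simp only [plane_normSq]
  exact ((hf.coord 0).mul hd (hf.coord 0)).add ((hf.coord 1).mul hd (hf.coord 1))

theorem IsMixedLip.inv (hd : ∀ ρ σ, 0 ≤ d ρ σ) {f : ℝ → ℝ → ℝ} (hf : IsMixedLip T d f) {c : ℝ}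
    (hc : 0 < c) (hfc : ∀ t ∈ Icc 0 T, ∀ ρ, c ≤ f t ρ) : IsMixedLip T d (fun t ρ => (f t ρ)⁻¹) := by
  obtain ⟨B, hB1, hB⟩ := hf.exists_pos hd
  have hB0 : 0 ≤ B := zero_le_one.trans hB1
  set K := c⁻¹ with hK
  have hK0 : 0 < K := inv_pos.2 hc
  have hb : ∀ t ∈ Icc 0 T, ∀ ρ, ‖(f t ρ)⁻¹‖ ≤ K := fun t ht ρ => by
    rw [norm_inv, Real.norm_eq_abs, abs_of_pos (hc.trans_le (hfc t ht ρ))]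
    exact inv_anti₀ hc (hfc t ht ρ)
  have key : ∀ (x y a b : ℝ), ‖x‖ ≤ a → ‖y‖ ≤ b → ‖x * y‖ ≤ a * b := by
    intro x y a b hx hy
    rw [norm_mul]
    exact mul_le_mul hx hy (norm_nonneg _) ((norm_nonneg _).trans hx)
  have hdiff : ∀ x y D : ℝ, ‖x⁻¹‖ ≤ K → ‖y⁻¹‖ ≤ K → x ≠ 0 → y ≠ 0 → ‖x - y‖ ≤ D →
      ‖x⁻¹ - y⁻¹‖ ≤ D * (K * K) := by
    intro x y D hx hy hx0 hy0 hxy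
    have e : x⁻¹ - y⁻¹ = -((x - y) * (x⁻¹ * y⁻¹)) := by field_simp; ring
    rw [e, norm_neg]
    exact key _ _ _ _ hxy (key _ _ _ _ hx hy)
  have hne : ∀ t ∈ Icc 0 T, ∀ ρ, f t ρ ≠ 0 := fun t ht ρ => (hc.trans_le (hfc t ht ρ)).ne'
  refine ⟨K + B * (K * K) + 2 * (B * B * (K * K * K)), fun s hs t ht ρ σ => ?_⟩
  have hdp := hd ρ σ
  have hst := abs_nonneg (s - t)
  obtain ⟨h1, h2, h3, h4⟩ := hB s hs t ht ρ σ
  obtain ⟨-, h2s, -, -⟩ := hB s hs t ht σ ρ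
  obtain ⟨-, -, h3t, -⟩ := hB t ht s hs ρ σ
  have n1 := hb s hs ρ
  have n2 := hb s hs σ
  have n3 := hb t ht ρ
  have n4 := hb t ht σ
  have z1 := hne s hs ρ
  have z2 := hne s hs σ
  have z3 := hne t ht ρ
  have z4 := hne t ht σ
  have p1 : 0 ≤ B * (K * K) := by positivity
  have p2 : 0 ≤ B * B * (K * K * K) := by positivity
  refine ⟨by linarith, ?_, ?_, ?_⟩
  · refine (hdiff _ _ _ n1 n3 z1 z3 h2).trans ?_
    nlinarith [mul_nonneg p2 hst, mul_nonneg hK0.le hst]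
  · refine (hdiff _ _ _ n1 n2 z1 z2 h3).trans ?_
    nlinarith [mul_nonneg p2 hdp, mul_nonneg hK0.le hdp]
  · have e : (f s ρ)⁻¹ - (f s σ)⁻¹ - (f t ρ)⁻¹ + (f t σ)⁻¹ =
        -((f s ρ - f s σ - f t ρ + f t σ) * ((f s ρ)⁻¹ * (f s σ)⁻¹)) -
        (f t ρ - f t σ) * (((f s ρ)⁻¹ - (f t ρ)⁻¹) * (f s σ)⁻¹ +
          (f t ρ)⁻¹ * ((f s σ)⁻¹ - (f t σ)⁻¹)) := by
      field_simp; ring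
    rw [e]
    have m1 := key _ _ _ _ h4 (key _ _ _ _ n1 n2)
    have m2 := key _ _ _ _ (hdiff _ _ _ n1 n3 z1 z3 h2) n2
    have m3 := key _ _ _ _ n3 (hdiff _ _ _ n2 n4 z2 z4 h2s)
    have m4 := key _ _ _ _ h3t (norm_add_le_of_le m2 m3)
    refine (norm_sub_le _ _).trans ?_
    rw [norm_neg]
    refine (add_le_add m1 m4).trans ?_
    have q : 0 ≤ |s - t| * d ρ σ := mul_nonneg hst hdp
    have : B * (|s - t| * d ρ σ) * (K * K) + B * d ρ σ * (B * |s - t| * (K * K) * K +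
        K * (B * |s - t| * (K * K))) =
        (B * (K * K) + 2 * (B * B * (K * K * K))) * (|s - t| * d ρ σ) := by ring
    rw [this]
    gcongr
    linarith

/-- A bounded function that is Lipschitz in time. -/
theorem IsMixedLip.of_time {f : ℝ → ℝ → E} {B : ℝ} (hb : ∀ t ∈ Icc 0 T, ∀ ρ, ‖f t ρ‖ ≤ B)
    (hl : ∀ s ∈ Icc 0 T, ∀ t ∈ Icc 0 T, ∀ ρ, ‖f s ρ - f t ρ‖ ≤ B * |s - t|) :
    IsMixedLip T (fun _ _ => 1) f := by
  refine ⟨2 * B, fun s hs t ht ρ σ => ?_⟩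
  have hB : 0 ≤ B := (norm_nonneg _).trans (hb s hs ρ)
  have h1 := hb s hs ρ
  have h2 := hb s hs σ
  have h3 := hl s hs t ht ρ
  have h4 := hl s hs t ht σ
  refine ⟨by linarith, h3.trans (by nlinarith [mul_nonneg hB (abs_nonneg (s - t))]), ?_, ?_⟩
  · linarith [norm_sub_le (f s ρ) (f s σ)]
  · have e : f s ρ - f s σ - f t ρ + f t σ = (f s ρ - f t ρ) - (f s σ - f t σ) := by abel
    rw [e]
    linarith [norm_sub_le (f s ρ - f t ρ) (f s σ - f t σ)]

/-- If `f` and its spatial derivative are bounded and Lipschitz in time, then the mixed differences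
of `f` are controlled. -/
theorem IsMixedLip.of_deriv {f f' : ℝ → ℝ → E}
    (hf : IsMixedLip T (fun _ _ => 1) f) (hf' : IsMixedLip T (fun _ _ => 1) f')
    (hd : ∀ t ∈ Icc 0 T, ∀ ρ, HasDerivAt (f t) (f' t ρ) ρ) :
    IsMixedLip T (fun ρ σ => |ρ - σ|) f := by
  obtain ⟨B, hB1, hB⟩ := hf.exists_pos (fun _ _ => zero_le_one)
  obtain ⟨C, hC1, hC⟩ := hf'.exists_pos (fun _ _ => zero_le_one)
  have hle : B ≤ max B C := le_max_left _ _
  have hle' : C ≤ max B C := le_max_right _ _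
  refine ⟨max B C, fun s hs t ht ρ σ => ?_⟩
  obtain ⟨h1, h2, -, -⟩ := hB s hs t ht ρ σ
  have l1 := lip_of_deriv_bound (hd s hs) (fun ρ => (hC s hs t ht ρ ρ).1) ρ σ
  have l2 := lip_of_deriv_bound (fun ρ => (hd s hs ρ).sub (hd t ht ρ))
    (fun ρ => (hC s hs t ht ρ ρ).2.1) ρ σ
  refine ⟨h1.trans hle, h2.trans (by gcongr), l1.trans (by gcongr), ?_⟩
  have e : f s ρ - f s σ - f t ρ + f t σ = (f s - f t) ρ - (f s - f t) σ := by
    simp only [Pi.sub_apply]; abel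
  rw [e]
  refine l2.trans ?_
  rw [mul_assoc]
  gcongr

end MixedLipschitz

/-! ### Regularity of the solution -/

/-- A member of `H²(𝕀)` has a `C¹` representative. -/
theorem MemSobolev.exists_representative {f : ℝ → Plane} (hf : MemSobolev 2 2 f) :
    ∃ F F' : ℝ → Plane, IsPrimitive F F' ∧ (∀ ρ, HasDerivAt F (F' ρ) ρ) ∧
      IsPrimitive F' (wderiv^[2] f) ∧ F =ᵐ[circleVol] f ∧ F' =ᵐ[circleVol] wderiv f := by
  obtain ⟨h1, h2⟩ := hf.hasWeakDeriv
  obtain ⟨h3, h4⟩ := h2.hasWeakDeriv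
  obtain ⟨F, hF, hFf⟩ := h1.exists_isPrimitive h2.memLp
  obtain ⟨F', hF', hFf'⟩ := h3.exists_isPrimitive h4.memLp
  exact ⟨F, F', hF.congr hFf'.symm,
    fun ρ => hF.hasDerivAt hF'.continuous hF'.periodic hFf'.symm ρ, hF', hFf, hFf'⟩

theorem exists_bound_of_hasDerivWithinAt {E : Type*} [NormedAddCommGroup E] [NormedSpace ℝ E]
    {T : ℝ} {U V : ℝ → E} (h : ∀ t ∈ Icc 0 T, HasDerivWithinAt U (V t) (Icc 0 T) t)
    (hV : ContinuousOn V (Icc 0 T)) :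
    ∃ B : ℝ, ∀ s ∈ Icc 0 T, ∀ t ∈ Icc 0 T, ‖U s‖ ≤ B ∧ ‖U s - U t‖ ≤ B * |s - t| := by
  obtain ⟨B, hB⟩ := isCompact_Icc.exists_bound_of_continuousOn hV
  obtain ⟨C, hC⟩ := isCompact_Icc.exists_bound_of_continuousOn
    (fun t ht => (h t ht).continuousWithinAt : ContinuousOn U (Icc 0 T))
  refine ⟨max B C, fun s hs t ht => ⟨(hC s hs).trans (le_max_right _ _), ?_⟩⟩
  refine ((convex_Icc 0 T).norm_image_sub_le_of_norm_hasDerivWithin_le h hB ht hs).trans ?_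
  rw [Real.norm_eq_abs]
  gcongr
  exact le_max_left _ _

theorem isMixedLip_of_isPrimitive {T : ℝ} {F g : ℝ → ℝ → Plane}
    (h : ∀ t ∈ Icc 0 T, IsPrimitive (F t) (g t)) {U₀ U₁ : ℝ → Lp Plane 2 circleVol}
    (h0 : ∀ t ∈ Icc 0 T, U₀ t = l2class (F t)) (h1 : ∀ t ∈ Icc 0 T, U₁ t = l2class (g t))
    (b0 : ∃ B : ℝ, ∀ s ∈ Icc 0 T, ∀ t ∈ Icc 0 T, ‖U₀ s‖ ≤ B ∧ ‖U₀ s - U₀ t‖ ≤ B * |s - t|)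
    (b1 : ∃ B : ℝ, ∀ s ∈ Icc 0 T, ∀ t ∈ Icc 0 T, ‖U₁ s‖ ≤ B ∧ ‖U₁ s - U₁ t‖ ≤ B * |s - t|) :
    IsMixedLip T (fun _ _ => 1) F := by
  obtain ⟨B, hB⟩ := b0
  obtain ⟨C, hC⟩ := b1
  refine IsMixedLip.of_time (B := B + C) (fun t ht ρ => ?_) fun s hs t ht ρ => ?_
  · refine ((h t ht).norm_le ρ).trans ?_
    rw [← h0 t ht, ← h1 t ht]
    exact add_le_add (hB t ht t ht).1 (hC t ht t ht).1
  · have := ((h s hs).sub (h t ht)).norm_le ρ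
    rw [l2class_sub (h s hs).memLp_self (h t ht).memLp_self, l2class_sub (h s hs).memLp (h t ht).memLp,
      ← h0 s hs, ← h0 t ht, ← h1 s hs, ← h1 t ht] at this
    rw [add_mul]
    exact this.trans (add_le_add (hB s hs t ht).2 (hC s hs t ht).2)

/-- Compactness of `[0,T] × [0,1]`, for functions that need only be continuous in each variable with a
uniform Lipschitz bound in time. -/
theorem exists_pos_lower_bound {T : ℝ} {f : ℝ → ℝ → ℝ} (hT : 0 < T)
    (hc : ∀ t ∈ Icc 0 T, Continuous (f t)) (hp : ∀ t ∈ Icc 0 T, Function.Periodic (f t) 1)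
    (hl : IsMixedLip T (fun _ _ => 1) f) (hpos : ∀ t ∈ Icc 0 T, ∀ ρ, 0 < f t ρ) :
    ∃ c > 0, ∀ t ∈ Icc 0 T, ∀ ρ, c ≤ f t ρ := by
  obtain ⟨B, hB1, hB⟩ := hl.exists_pos (fun _ _ => zero_le_one)
  have hB0 : 0 ≤ B := zero_le_one.trans hB1
  have hcont : ContinuousOn (Function.uncurry f) (Icc 0 T ×ˢ Icc (0 : ℝ) 1) := by
    refine continuousOn_prod_of_continuousOn_lipschitzOnWith _ ⟨B, hB0⟩
      (fun t ht => (hc t ht).continuousOn) fun ρ _ => ?_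
    refine LipschitzOnWith.of_dist_le_mul fun s hs t ht => ?_
    rw [dist_eq_norm, Real.dist_eq]
    exact (hB s hs t ht ρ ρ).2.1
  obtain ⟨z, hz, hmin⟩ := (isCompact_Icc.prod isCompact_Icc).exists_isMinOn
    ⟨((0 : ℝ), (0 : ℝ)), ⟨⟨le_rfl, hT.le⟩, ⟨le_rfl, zero_le_one⟩⟩⟩ hcont
  refine ⟨f z.1 z.2, hpos _ hz.1 _, fun t ht ρ => ?_⟩
  have e := (hp t ht).sub_int_mul_eq (x := ρ) ⌊ρ⌋
  rw [mul_one] at e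
  rw [← e]
  exact hmin (a := (t, Int.fract ρ)) ⟨ht, Int.fract_nonneg _, (Int.fract_lt_one _).le⟩

/-- The second derivative of the solution in terms of lower order quantities, from the equation. -/
noncomputable def flowSecond (a a' v : ℝ → Plane) (ρ : ℝ) : Plane :=
  ‖a' ρ‖ ^ 2 • v ρ + (‖a' ρ‖ ^ 2 * (a ρ 0)⁻¹) • e₁ - (a' ρ 0 * (a ρ 0)⁻¹) • a' ρ

theorem strongRes_eq_smul {a a' b'' v : ℝ → Plane} {ρ : ℝ} (h : a ρ 0 ≠ 0) :
    strongRes a a' a' b'' v ρ = a ρ 0 • (flowSecond a a' v ρ - b'' ρ) := by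
  simp only [strongRes, flowSecond, smul_sub, smul_add, smul_smul]
  have e1 : a ρ 0 * (‖a' ρ‖ ^ 2 * (a ρ 0)⁻¹) = ‖a' ρ‖ ^ 2 := by field_simp
  have e2 : a ρ 0 * (a' ρ 0 * (a ρ 0)⁻¹) = a' ρ 0 := by field_simp
  rw [e1, e2]
  abel

theorem isMixedLip_flowSecond {T c : ℝ} {d : ℝ → ℝ → ℝ} (hd : ∀ ρ σ, 0 ≤ d ρ σ) (hc : 0 < c)
    {x x1 v : ℝ → ℝ → Plane} (hx : IsMixedLip T d x) (hx1 : IsMixedLip T d x1)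
    (hv : IsMixedLip T d v) (hxc : ∀ t ∈ Icc 0 T, ∀ ρ, c ≤ x t ρ 0) :
    IsMixedLip T d (fun t => flowSecond (x t) (x1 t) (v t)) := by
  have hi := (hx.coord 0).inv hd hc hxc
  have hn := hx1.normSq hd
  exact ((hn.smul hd hv).add ((hn.mul hd hi).smul hd (IsMixedLip.const hd e₁))).sub hd
    (((hx1.coord 0).mul hd hi).smul hd hx1)

/-- The bounds on the solution on which the error analysis rests: `x1`, `x2` are the spatial
derivatives of `x`, `v` is the continuous representative of `xt`, and `v1` its spatial derivative. -/
structure FlowData (T c L : ℝ) (x x1 x2 v v1 xt xtt xttt : ℝ → ℝ → Plane) : Prop where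
  curve : ∀ t ∈ Icc 0 T, IsC2Lip L (x t) (x1 t) (x2 t)
  lower : ∀ t ∈ Icc 0 T, ∀ ρ, c ≤ x t ρ 0
  speed : ∀ t ∈ Icc 0 T, ∀ ρ, c ≤ ‖x1 t ρ‖
  equation : ∀ t ∈ Icc 0 T, ∀ ρ, strongRes (x t) (x1 t) (x1 t) (x2 t) (v t) ρ = 0
  vel_deriv : ∀ t ∈ Icc 0 T, ∀ ρ, HasDerivAt (v t) (v1 t ρ) ρ
  vel_bound : ∀ t ∈ Icc 0 T, ∀ ρ, ‖v t ρ‖ ≤ L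
  time_lip₀ : ∀ s ∈ Icc 0 T, ∀ t ∈ Icc 0 T, ∀ ρ, ‖x s ρ - x t ρ‖ ≤ L * |s - t|
  time_lip₁ : ∀ s ∈ Icc 0 T, ∀ t ∈ Icc 0 T, ∀ ρ, ‖x1 s ρ - x1 t ρ‖ ≤ L * |s - t|
  time_lip₂ : ∀ s ∈ Icc 0 T, ∀ t ∈ Icc 0 T, ∀ ρ, ‖x2 s ρ - x2 t ρ‖ ≤ L * |s - t|
  mixed_lip₂ : ∀ s ∈ Icc 0 T, ∀ t ∈ Icc 0 T, ∀ ρ σ,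
    ‖x2 s ρ - x2 s σ - x2 t ρ + x2 t σ‖ ≤ L * (|s - t| * |ρ - σ|)
  prim₀ : ∀ t ∈ Icc 0 T, IsPrimitive (x t) (x1 t)
  prim₁ : ∀ t ∈ Icc 0 T, IsPrimitive (x1 t) (x2 t)
  vel_prim₀ : ∀ t ∈ Icc 0 T, IsPrimitive (v t) (v1 t)
  vel_prim₁ : ∀ t ∈ Icc 0 T, IsPrimitive (v1 t) (wderiv^[2] (xt t))
  class₀ : ∀ t ∈ Icc 0 T, l2curve 0 x t = l2class (x t)
  class₁ : ∀ t ∈ Icc 0 T, l2curve 1 x t = l2class (x1 t)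
  class₂ : ∀ t ∈ Icc 0 T, l2curve 2 x t = l2class (x2 t)
  vel_class₀ : ∀ t ∈ Icc 0 T, l2curve 0 xt t = l2class (v t)
  vel_class₁ : ∀ t ∈ Icc 0 T, l2curve 1 xt t = l2class (v1 t)
  curve_deriv : ∀ k ≤ 2, ∀ t ∈ Icc 0 T,
    HasDerivWithinAt (l2curve k x) (l2curve k xt t) (Icc 0 T) t
  vel_curve_deriv : ∀ k ≤ 2, ∀ t ∈ Icc 0 T,
    HasDerivWithinAt (l2curve k xt) (l2curve k xtt t) (Icc 0 T) t
  acc_curve_deriv : ∀ t ∈ Icc 0 T,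
    HasDerivWithinAt (l2curve 0 xtt) (l2curve 0 xttt t) (Icc 0 T) t
  acc_bound : ∀ k ≤ 2, ∀ t ∈ Icc 0 T, ‖l2curve k xtt t‖ ≤ L
  jerk_bound : ∀ t ∈ Icc 0 T, ‖l2curve 0 xttt t‖ ≤ L

/-- A regular solution has all the bounds collected in `FlowData`. By assumption
`x_ρρ` is only bounded and measurable; that it is continuous, Lipschitz and has bounded mixed
differences follows from the equation, which expresses it through `x`, `x_ρ` and `x_t`. -/
theorem exists_flowData {T : ℝ} (hT : 0 < T) {x xt xtt xttt : ℝ → ℝ → Plane}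
    (hx : IsRegularSolution T x xt xtt xttt) :
    ∃ (c L : ℝ) (x1 x2 v v1 : ℝ → ℝ → Plane), 0 < c ∧ 1 ≤ L ∧
      FlowData T c L x x1 x2 v v1 xt xtt xttt := by
  -- derivatives in `L²`
  have m0 : ∀ t ∈ Icc 0 T, MemSobolev 2 2 (x t) := fun t ht => (hx.reg₀.1 t ht).mono le_top
  have m1 := hx.reg₁.1
  have m2 := hx.reg₂.1
  have m3 : ∀ t ∈ Icc 0 T, MemLp (xttt t) 2 circleVol := hx.reg₃.1
  have cV : ∀ k ≤ 2, ContinuousOn (l2curve k xt) (Icc 0 T) := fun k hk =>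
    hx.reg₁.continuousOn (Or.inl rfl) hk
  have cY : ∀ k ≤ 2, ContinuousOn (l2curve k xtt) (Icc 0 T) := fun k hk =>
    hx.reg₂.continuousOn (Or.inl rfl) hk
  have cZ : ContinuousOn (l2curve 0 xttt) (Icc 0 T) := hx.reg₃.continuousOn (Or.inl rfl) le_rfl
  have low : ∀ {f : ℝ → Plane}, MemSobolev 2 2 f → MemSobolev 1 2 f := fun hf =>
    ⟨hf.1, _, hf.hasWeakDeriv.1, hf.hasWeakDeriv.2.memLp⟩
  have step : ∀ {u w : ℝ → ℝ → Plane}, (∀ t ∈ Icc 0 T, MemSobolev 2 2 (u t)) →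
      (∀ t ∈ Icc 0 T, MemSobolev 2 2 (w t)) → (∀ k ≤ 2, ContinuousOn (l2curve k w) (Icc 0 T)) →
      HasTimeDeriv T u w → ∀ k ≤ 2, ∀ t ∈ Icc 0 T,
        HasDerivWithinAt (l2curve k u) (l2curve k w t) (Icc 0 T) t := by
    intro u w hu hw hc h
    have d0 := fun t ht => h.hasDerivWithinAt (fun s hs => (hu s hs).memLp)
      (fun s hs => (hw s hs).memLp) (t := t) ht
    have d1 := hasDerivWithinAt_l2curve_succ hT (fun t ht => low (hu t ht))
      (fun t ht => low (hw t ht)) (hc 1 one_le_two) d0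
    have d2 := hasDerivWithinAt_l2curve_succ hT hu hw (hc 2 le_rfl) d1
    intro k hk
    interval_cases k
    · exact d0
    · exact d1
    · exact d2
  have dX := step m0 m1 cV hx.time_deriv₁
  have dV := step m1 m2 cY hx.time_deriv₂
  have dY := fun t ht => hx.time_deriv₃.hasDerivWithinAt (fun s hs => (m2 s hs).memLp) m3 (t := t) ht
  have bX := fun k hk => exists_bound_of_hasDerivWithinAt (dX k hk) (cV k hk)
  have bV := fun k hk => exists_bound_of_hasDerivWithinAt (dV k hk) (cY k hk)
  -- representatives
  have hrx : ∀ t, ∃ F' : ℝ → Plane, t ∈ Icc 0 T → IsPrimitive (x t) F' ∧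
      (∀ ρ, HasDerivAt (x t) (F' ρ) ρ) ∧ IsPrimitive F' (wderiv^[2] (x t)) ∧
      F' =ᵐ[circleVol] wderiv (x t) := by
    intro t
    by_cases ht : t ∈ Icc 0 T
    · obtain ⟨F, F', h1, h2, h3, h4, h5⟩ := (m0 t ht).exists_representative
      have e := eq_of_ae_eq_circle h1.continuous (hx.continuous t ht) h1.periodic
        (hx.periodic t ht) h4
      rw [e] at h1 h2
      exact ⟨F', fun _ => ⟨h1, h2, h3, h5⟩⟩
    · exact ⟨0, fun h => absurd h ht⟩
  choose x1 hx1 using hrx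
  have hrv : ∀ t, ∃ F F' : ℝ → Plane, t ∈ Icc 0 T → IsPrimitive F F' ∧
      (∀ ρ, HasDerivAt F (F' ρ) ρ) ∧ IsPrimitive F' (wderiv^[2] (xt t)) ∧ F =ᵐ[circleVol] xt t ∧
      F' =ᵐ[circleVol] wderiv (xt t) := by
    intro t
    by_cases ht : t ∈ Icc 0 T
    · obtain ⟨F, F', h⟩ := (m1 t ht).exists_representative
      exact ⟨F, F', fun _ => h⟩
    · exact ⟨0, 0, fun h => absurd h ht⟩
  choose v v1 hv using hrv
  have k0 : ∀ t ∈ Icc 0 T, l2curve 0 x t = l2class (x t) := fun t _ => rfl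
  have k1 : ∀ t ∈ Icc 0 T, l2curve 1 x t = l2class (x1 t) := fun t ht =>
    l2class_congr (hx1 t ht).2.2.2.symm
  have kv0 : ∀ t ∈ Icc 0 T, l2curve 0 xt t = l2class (v t) := fun t ht =>
    l2class_congr (hv t ht).2.2.2.1.symm
  have kv1 : ∀ t ∈ Icc 0 T, l2curve 1 xt t = l2class (v1 t) := fun t ht =>
    l2class_congr (hv t ht).2.2.2.2.symm
  have tx : IsMixedLip T (fun _ _ => 1) x := isMixedLip_of_isPrimitive
    (fun t ht => (hx1 t ht).1) k0 k1 (bX 0 (by norm_num)) (bX 1 (by norm_num))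
  have tx1 : IsMixedLip T (fun _ _ => 1) x1 := isMixedLip_of_isPrimitive
    (fun t ht => (hx1 t ht).2.2.1) k1 (fun t _ => rfl) (bX 1 (by norm_num)) (bX 2 (by norm_num))
  have tv : IsMixedLip T (fun _ _ => 1) v := isMixedLip_of_isPrimitive
    (fun t ht => (hv t ht).1) kv0 kv1 (bV 0 (by norm_num)) (bV 1 (by norm_num))
  have tv1 : IsMixedLip T (fun _ _ => 1) v1 := isMixedLip_of_isPrimitive
    (fun t ht => (hv t ht).2.2.1) kv1 (fun t _ => rfl) (bV 1 (by norm_num)) (bV 2 (by norm_num))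
  have hd1 : ∀ ρ σ : ℝ, (0 : ℝ) ≤ (fun _ _ => 1 : ℝ → ℝ → ℝ) ρ σ := fun _ _ => zero_le_one
  have hd2 : ∀ ρ σ : ℝ, 0 ≤ (fun ρ σ => |ρ - σ| : ℝ → ℝ → ℝ) ρ σ := fun _ _ => abs_nonneg _
  -- lower bounds
  obtain ⟨c1, hc1, hc1x⟩ := exists_pos_lower_bound hT (f := fun t ρ => x t ρ 0)
    (fun t ht => continuous_coord (hx.continuous t ht) 0)
    (fun t ht ρ => by simp only [hx.periodic t ht ρ]) (tx.coord 0) hx.pos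
  obtain ⟨c2, hc2, hc2x⟩ := exists_pos_lower_bound hT (f := fun t ρ => ‖x1 t ρ‖ ^ 2)
    (fun t ht => (hx1 t ht).2.2.1.continuous.norm.pow 2)
    (fun t ht ρ => by simp only [(hx1 t ht).2.2.1.periodic ρ]) (tx1.normSq hd1)
    (fun t ht ρ => by
      have := hx.immersed t ht ρ
      rw [((hx1 t ht).2.1 ρ).deriv] at this
      positivity)
  set c := min c1 (min c2 1) with hc
  have hc0 : 0 < c := lt_min hc1 (lt_min hc2 one_pos)
  have hcx : ∀ t ∈ Icc 0 T, ∀ ρ, c ≤ x t ρ 0 := fun t ht ρ =>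
    (min_le_left _ _).trans (hc1x t ht ρ)
  have hcs : ∀ t ∈ Icc 0 T, ∀ ρ, c ≤ ‖x1 t ρ‖ := by
    intro t ht ρ
    have h1 : c ≤ c2 := (min_le_right _ _).trans (min_le_left _ _)
    have h2 : c ≤ 1 := (min_le_right _ _).trans (min_le_right _ _)
    refine le_of_sq_le_sq ?_ (norm_nonneg _)
    have := hc2x t ht ρ
    nlinarith
  -- the second derivative from the equation
  set x2 : ℝ → ℝ → Plane := fun t => flowSecond (x t) (x1 t) (v t) with hx2
  have tx2 : IsMixedLip T (fun _ _ => 1) x2 := isMixedLip_flowSecond hd1 hc0 tx tx1 tv hcx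
  have x2c : ∀ t ∈ Icc 0 T, Continuous (x2 t) := by
    intro t ht
    have a1 := continuous_coord (hx.continuous t ht) 0
    have a2 := (hx1 t ht).2.2.1.continuous
    have a3 := (hv t ht).1.continuous
    have a4 := a1.inv₀ (fun ρ => (hc0.trans_le (hcx t ht ρ)).ne')
    exact (((a2.norm.pow 2).smul a3).add (((a2.norm.pow 2).mul a4).smul continuous_const)).sub
      (((continuous_coord a2 0).mul a4).smul a2)
  have x2p : ∀ t ∈ Icc 0 T, Function.Periodic (x2 t) 1 := by
    intro t ht ρ
    simp only [hx2, flowSecond]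
    rw [hx.periodic t ht ρ, (hx1 t ht).2.2.1.periodic ρ, (hv t ht).1.periodic ρ]
  have x2m : ∀ t ∈ Icc 0 T, MemLp (x2 t) 2 circleVol := fun t ht =>
    memLp_of_continuous_periodic (x2c t ht) 2
  have hae : ∀ t ∈ Ioc 0 T, wderiv^[2] (x t) =ᵐ[circleVol] x2 t := by
    intro t ht
    have ht' : t ∈ Icc 0 T := ⟨ht.1.le, ht.2⟩
    obtain ⟨p1, p2, p3, p4⟩ := hx1 t ht'
    have hw : HasWeakDeriv (fun ρ => x t ρ 0 • x1 t ρ)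
        (fun ρ => x1 t ρ 0 • x1 t ρ + x t ρ 0 • wderiv^[2] (x t) ρ) := by
      refine hasWeakDeriv_smul_primitive (fun ρ => hasDerivAt_coord (p2 ρ) 0)
        (continuous_coord p3.continuous 0) ?_ p3.integrable p3.continuous ?_ p3.eq
      · have := hx.periodic t ht' 0
        rw [zero_add] at this
        rw [this]
      · have := p3.periodic 0
        rwa [zero_add] at this
    have e1 : wderiv (fun σ => x t σ 0 • wderiv (x t) σ) =
        wderiv (fun ρ => x t ρ 0 • x1 t ρ) := by
      refine wderiv_congr ?_
      filter_upwards [p4] with ρ hρ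
      rw [hρ]
    have heq := hx.equation t ht
    rw [e1] at heq
    filter_upwards [heq, hw.wderiv_ae, p4, (hv t ht').2.2.2.1] with ρ h1 h2 h3 h4
    rw [h2, ← h3, ← h4] at h1
    have hne : x t ρ 0 ≠ 0 := (hc0.trans_le (hcx t ht' ρ)).ne'
    have h5 := strongRes_eq_smul (a' := x1 t) (b'' := wderiv^[2] (x t)) (v := v t) hne
    rw [strongRes, h1] at h5
    have := (smul_eq_zero.1 h5.symm).resolve_left hne
    exact (sub_eq_zero.1 this).symm
  -- the equation is posed for `t > 0` only; at `t = 0` the identity follows by continuity in time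
  have k2 : ∀ t ∈ Icc 0 T, l2curve 2 x t = l2class (x2 t) := by
    obtain ⟨B, hB1, hB⟩ := tx2.exists_pos hd1
    have hlip : LipschitzOnWith ⟨B, zero_le_one.trans hB1⟩ (fun t => l2class (x2 t)) (Icc 0 T) := by
      refine LipschitzOnWith.of_dist_le_mul fun s hs t ht => ?_
      rw [dist_eq_norm, ← l2class_sub (x2m s hs) (x2m t ht),
        norm_l2class ((x2m s hs).sub (x2m t ht)), Real.dist_eq]
      have h1 : eLpNorm (x2 s - x2 t) 2 circleVol ≤ ENNReal.ofReal (B * |s - t|) :=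
        eLpNorm_le_of_bound fun ρ => (hB s hs t ht ρ ρ).2.1
      refine ENNReal.toReal_le_of_le_ofReal ?_ h1
      exact mul_nonneg (zero_le_one.trans hB1) (abs_nonneg _)
    have hEq : EqOn (l2curve 2 x) (fun t => l2class (x2 t)) (Ioc 0 T) := fun t ht =>
      l2class_congr (hae t ht)
    refine hEq.of_subset_closure (fun t ht => (dX 2 le_rfl t ht).continuousWithinAt)
      hlip.continuousOn Ioc_subset_Icc_self ?_
    rw [closure_Ioc hT.ne]
  have hae' : ∀ t ∈ Icc 0 T, wderiv^[2] (x t) =ᵐ[circleVol] x2 t := by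
    intro t ht
    have h1 := (hx1 t ht).2.2.1.memLp
    have h2 := k2 t ht
    rw [l2curve, l2class_of_memLp h1, l2class_of_memLp (x2m t ht), MemLp.toLp_eq_toLp_iff] at h2
    exact h2
  have dx1 : ∀ t ∈ Icc 0 T, ∀ ρ, HasDerivAt (x1 t) (x2 t ρ) ρ := fun t ht =>
    (hx1 t ht).2.2.1.hasDerivAt (x2c t ht) (x2p t ht) (hae' t ht)
  -- with `x1` and `x2` bounded, the first order quantities have bounded mixed differences, and the
  -- equation passes this on to `x2`
  have mx := IsMixedLip.of_deriv tx tx1 (fun t ht => (hx1 t ht).2.1)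
  have mx1 := IsMixedLip.of_deriv tx1 tx2 dx1
  have mv := IsMixedLip.of_deriv tv tv1 (fun t ht => (hv t ht).2.1)
  have mx2 : IsMixedLip T (fun ρ σ => |ρ - σ|) x2 := isMixedLip_flowSecond hd2 hc0 mx mx1 mv hcx
  obtain ⟨A0, hA0, hx0'⟩ := mx.exists_pos hd2
  obtain ⟨A1, hA1, hx1'⟩ := mx1.exists_pos hd2
  obtain ⟨A2, hA2, hx2'⟩ := mx2.exists_pos hd2
  obtain ⟨A3, hA3, hv'⟩ := mv.exists_pos hd2
  have bY : ∃ A4 : ℝ, ∀ k ≤ 2, ∀ t ∈ Icc 0 T, ‖l2curve k xtt t‖ ≤ A4 := by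
    obtain ⟨B0, h0⟩ := isCompact_Icc.exists_bound_of_continuousOn (cY 0 (by norm_num))
    obtain ⟨B1, h1⟩ := isCompact_Icc.exists_bound_of_continuousOn (cY 1 (by norm_num))
    obtain ⟨B2, h2⟩ := isCompact_Icc.exists_bound_of_continuousOn (cY 2 (by norm_num))
    refine ⟨max B0 (max B1 B2), fun k hk t ht => ?_⟩
    interval_cases k
    · exact (h0 t ht).trans (le_max_left _ _)
    · exact (h1 t ht).trans ((le_max_left _ _).trans (le_max_right _ _))
    · exact (h2 t ht).trans ((le_max_right _ _).trans (le_max_right _ _))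
  obtain ⟨A4, hY⟩ := bY
  obtain ⟨A5, hZ⟩ := isCompact_Icc.exists_bound_of_continuousOn cZ
  set L := A0 + A1 + A2 + A3 + |A4| + |A5| with hL
  have l0 : A0 ≤ L := by rw [hL]; linarith [abs_nonneg A4, abs_nonneg A5]
  have l1 : A1 ≤ L := by rw [hL]; linarith [abs_nonneg A4, abs_nonneg A5]
  have l2 : A2 ≤ L := by rw [hL]; linarith [abs_nonneg A4, abs_nonneg A5]
  have l3 : A3 ≤ L := by rw [hL]; linarith [abs_nonneg A4, abs_nonneg A5]
  have l4 : A4 ≤ L := by rw [hL]; linarith [abs_nonneg A4, abs_nonneg A5, le_abs_self A4]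
  have l5 : A5 ≤ L := by rw [hL]; linarith [abs_nonneg A4, abs_nonneg A5, le_abs_self A5]
  refine ⟨c, L, x1, x2, v, v1, hc0, hA0.trans l0, ?_⟩
  exact
  { curve := fun t ht =>
      { periodic := hx.periodic t ht
        deriv₁ := (hx1 t ht).2.1
        deriv₂ := dx1 t ht
        bound₀ := fun ρ => (hx0' t ht t ht ρ ρ).1.trans l0
        bound₁ := fun ρ => (hx1' t ht t ht ρ ρ).1.trans l1
        bound₂ := fun ρ => (hx2' t ht t ht ρ ρ).1.trans l2
        lip₂ := fun ρ σ => (hx2' t ht t ht ρ σ).2.2.1.trans (by gcongr) }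
    lower := hcx
    speed := hcs
    equation := fun t ht ρ => by
      rw [strongRes_eq_smul (hc0.trans_le (hcx t ht ρ)).ne']
      simp [hx2]
    vel_deriv := fun t ht => (hv t ht).2.1
    vel_bound := fun t ht ρ => (hv' t ht t ht ρ ρ).1.trans l3
    time_lip₀ := fun s hs t ht ρ => (hx0' s hs t ht ρ ρ).2.1.trans (by gcongr)
    time_lip₁ := fun s hs t ht ρ => (hx1' s hs t ht ρ ρ).2.1.trans (by gcongr)
    time_lip₂ := fun s hs t ht ρ => (hx2' s hs t ht ρ ρ).2.1.trans (by gcongr)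
    mixed_lip₂ := fun s hs t ht ρ σ => (hx2' s hs t ht ρ σ).2.2.2.trans (by gcongr)
    prim₀ := fun t ht => (hx1 t ht).1
    prim₁ := fun t ht => (hx1 t ht).2.2.1.congr (hae' t ht)
    vel_prim₀ := fun t ht => (hv t ht).1
    vel_prim₁ := fun t ht => (hv t ht).2.2.1
    class₀ := k0
    class₁ := k1
    class₂ := k2
    vel_class₀ := kv0
    vel_class₁ := kv1
    curve_deriv := dX
    vel_curve_deriv := dV
    acc_curve_deriv := dY
    acc_bound := fun k hk t ht => (hY k hk t ht).trans l4
    jerk_bound := fun t ht => (hZ t ht).trans l5 }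

/-! ### Consistency in time -/

section TimeTaylor

variable {E : Type*} [NormedAddCommGroup E] [NormedSpace ℝ E] {T L : ℝ} {U V Y Z : ℝ → E}

theorem taylor_one_on (dU : ∀ t ∈ Icc 0 T, HasDerivWithinAt U (V t) (Icc 0 T) t)
    (dV : ∀ t ∈ Icc 0 T, HasDerivWithinAt V (Y t) (Icc 0 T) t) (hY : ∀ t ∈ Icc 0 T, ‖Y t‖ ≤ L)
    {s t : ℝ} (hs : s ∈ Icc 0 T) (ht : t ∈ Icc 0 T) :
    ‖U s - U t - (s - t) • V t‖ ≤ L * |s - t| ^ 2 := by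
  have hL : 0 ≤ L := (norm_nonneg _).trans (hY t ht)
  have hsub : uIcc t s ⊆ Icc 0 T := (convex_Icc 0 T).ordConnected.uIcc_subset ht hs
  have hd : ∀ r ∈ uIcc t s, HasDerivWithinAt (fun r => U r - (r - t) • V t) (V r - V t)
      (uIcc t s) r := fun r hr => by
    have h1 := (dU r (hsub hr)).mono hsub
    have h2 : HasDerivWithinAt (fun r => (r - t) • V t) (V t) (uIcc t s) r := by
      simpa using (((hasDerivAt_id r).sub_const t).smul_const (V t)).hasDerivWithinAt
    exact h1.sub h2
  have hb : ∀ r ∈ uIcc t s, ‖V r - V t‖ ≤ L * |s - t| := fun r hr => by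
    refine ((convex_Icc 0 T).norm_image_sub_le_of_norm_hasDerivWithin_le dV hY ht (hsub hr)).trans ?_
    rw [Real.norm_eq_abs]
    exact mul_le_mul_of_nonneg_left (abs_sub_left_of_mem_uIcc hr) hL
  have := (convex_uIcc t s).norm_image_sub_le_of_norm_hasDerivWithin_le hd hb left_mem_uIcc
    right_mem_uIcc
  rw [sub_self, zero_smul, sub_zero, Real.norm_eq_abs] at this
  have e : U s - U t - (s - t) • V t = U s - (s - t) • V t - U t := by abel
  rw [e]
  exact this.trans (le_of_eq (by ring))

theorem taylor_two_on (dU : ∀ t ∈ Icc 0 T, HasDerivWithinAt U (V t) (Icc 0 T) t)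
    (dV : ∀ t ∈ Icc 0 T, HasDerivWithinAt V (Y t) (Icc 0 T) t)
    (dY : ∀ t ∈ Icc 0 T, HasDerivWithinAt Y (Z t) (Icc 0 T) t) (hZ : ∀ t ∈ Icc 0 T, ‖Z t‖ ≤ L)
    {s t : ℝ} (hs : s ∈ Icc 0 T) (ht : t ∈ Icc 0 T) :
    ‖U s - U t - (s - t) • V t - ((s - t) ^ 2 / 2) • Y t‖ ≤ L * |s - t| ^ 3 := by
  have hL : 0 ≤ L := (norm_nonneg _).trans (hZ t ht)
  have hsub : uIcc t s ⊆ Icc 0 T := (convex_Icc 0 T).ordConnected.uIcc_subset ht hs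
  have hd : ∀ r ∈ uIcc t s, HasDerivWithinAt
      (fun r => U r - (r - t) • V t - ((r - t) ^ 2 / 2) • Y t) (V r - V t - (r - t) • Y t)
      (uIcc t s) r := fun r hr => by
    have h1 := (dU r (hsub hr)).mono hsub
    have h2 : HasDerivWithinAt (fun r => (r - t) • V t) (V t) (uIcc t s) r := by
      simpa using (((hasDerivAt_id r).sub_const t).smul_const (V t)).hasDerivWithinAt
    have h3 : HasDerivWithinAt (fun r => ((r - t) ^ 2 / 2) • Y t) ((r - t) • Y t) (uIcc t s) r := by
      have := (((((hasDerivAt_id r).sub_const t).pow 2).div_const 2).smul_const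
        (Y t)).hasDerivWithinAt (s := uIcc t s)
      simpa using this
    exact (h1.sub h2).sub h3
  have hb : ∀ r ∈ uIcc t s, ‖V r - V t - (r - t) • Y t‖ ≤ L * |s - t| ^ 2 := fun r hr => by
    refine (taylor_one_on dV dY hZ (hsub hr) ht).trans ?_
    have := abs_sub_left_of_mem_uIcc hr
    gcongr
  have := (convex_uIcc t s).norm_image_sub_le_of_norm_hasDerivWithin_le hd hb left_mem_uIcc
    right_mem_uIcc
  simp only [sub_self, zero_smul, sub_zero, Real.norm_eq_abs, ne_eq, OfNat.ofNat_ne_zero,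
    not_false_eq_true, zero_pow, zero_div] at this
  have e : U s - U t - (s - t) • V t - ((s - t) ^ 2 / 2) • Y t =
      U s - (s - t) • V t - ((s - t) ^ 2 / 2) • Y t - U t := by abel
  rw [e]
  exact this.trans (le_of_eq (by ring))

variable {dt θ : ℝ} {m : ℕ}

/-- The three time levels of a step, and the time at which the equation is collocated. -/
theorem levels_mem (hdt : 0 < dt) (hθ : 0 ≤ θ) (hθ1 : θ ≤ 1) (hm : 1 ≤ m)
    (hT : ((m : ℝ) + 1) * dt ≤ T) :
    ((m - 1 : ℕ) : ℝ) * dt ∈ Icc 0 T ∧ (m : ℝ) * dt ∈ Icc 0 T ∧ ((m + 1 : ℕ) : ℝ) * dt ∈ Icc 0 T ∧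
      (m + θ) * dt ∈ Icc 0 T := by
  have h1 : (1 : ℝ) ≤ m := by exact_mod_cast hm
  rw [Nat.cast_sub hm]
  push_cast
  refine ⟨⟨?_, ?_⟩, ⟨?_, ?_⟩, ⟨?_, hT⟩, ⟨?_, ?_⟩⟩
  · exact mul_nonneg (by linarith) hdt.le
  · nlinarith
  · positivity
  · nlinarith
  · positivity
  · positivity
  · nlinarith

/-- The first derivative cancels, so that the extrapolation is of second order for every `θ`. -/
theorem extrap_error (dU : ∀ t ∈ Icc 0 T, HasDerivWithinAt U (V t) (Icc 0 T) t)
    (dV : ∀ t ∈ Icc 0 T, HasDerivWithinAt V (Y t) (Icc 0 T) t) (hY : ∀ t ∈ Icc 0 T, ‖Y t‖ ≤ L)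
    (hdt : 0 < dt) (hθ : 0 ≤ θ) (hθ1 : θ ≤ 1) (hm : 1 ≤ m) (hT : ((m : ℝ) + 1) * dt ≤ T) :
    ‖extrap θ (fun k : ℕ => U (k * dt)) m - U ((m + θ) * dt)‖ ≤ 6 * L * dt ^ 2 := by
  obtain ⟨i0, i1, -, iτ⟩ := levels_mem hdt hθ hθ1 hm hT
  have hL : 0 ≤ L := (norm_nonneg _).trans (hY _ iτ)
  have r1 := taylor_one_on dU dV hY i1 iτ
  have r0 := taylor_one_on dU dV hY i0 iτ
  have e1 : (m : ℝ) * dt - (m + θ) * dt = -(θ * dt) := by ring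
  have e0 : ((m - 1 : ℕ) : ℝ) * dt - (m + θ) * dt = -((1 + θ) * dt) := by
    rw [Nat.cast_sub hm]; push_cast; ring
  rw [e1, abs_neg, abs_of_nonneg (by positivity)] at r1
  rw [e0, abs_neg, abs_of_nonneg (by positivity)] at r0
  set τ := ((m : ℝ) + θ) * dt
  set R1 := U (m * dt) - U τ - (-(θ * dt)) • V τ with hR1
  set R0 := U ((m - 1 : ℕ) * dt) - U τ - (-((1 + θ) * dt)) • V τ with hR0
  have e : extrap θ (fun k : ℕ => U (k * dt)) m - U τ = (1 + θ) • R1 - θ • R0 := by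
    rw [extrap, hR1, hR0]; module
  rw [e]
  refine (norm_sub_le _ _).trans ?_
  rw [norm_smul, norm_smul, Real.norm_eq_abs, Real.norm_eq_abs, abs_of_nonneg hθ,
    abs_of_nonneg (by linarith)]
  have b1 : (1 + θ) * ‖R1‖ ≤ 2 * (L * (1 * dt) ^ 2) := by
    refine mul_le_mul (by linarith) (r1.trans ?_) (norm_nonneg _) (by norm_num)
    gcongr
  have b0 : θ * ‖R0‖ ≤ 1 * (L * (2 * dt) ^ 2) := by
    refine mul_le_mul hθ1 (r0.trans ?_) (norm_nonneg _) (by norm_num)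
    gcongr
    linarith
  linarith

theorem midval_error (dU : ∀ t ∈ Icc 0 T, HasDerivWithinAt U (V t) (Icc 0 T) t)
    (dV : ∀ t ∈ Icc 0 T, HasDerivWithinAt V (Y t) (Icc 0 T) t) (hY : ∀ t ∈ Icc 0 T, ‖Y t‖ ≤ L)
    (hdt : 0 < dt) (hθ : 0 ≤ θ) (hθ1 : θ ≤ 1) (hm : 1 ≤ m) (hT : ((m : ℝ) + 1) * dt ≤ T) :
    ‖midval θ (fun k : ℕ => U (k * dt)) m - U ((m + θ) * dt)‖ ≤ 6 * L * dt ^ 2 := by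
  obtain ⟨-, i1, i2, iτ⟩ := levels_mem hdt hθ hθ1 hm hT
  have hL : 0 ≤ L := (norm_nonneg _).trans (hY _ iτ)
  have r1 := taylor_one_on dU dV hY i1 iτ
  have r2 := taylor_one_on dU dV hY i2 iτ
  have e1 : (m : ℝ) * dt - (m + θ) * dt = -(θ * dt) := by ring
  have e2 : ((m + 1 : ℕ) : ℝ) * dt - (m + θ) * dt = (1 - θ) * dt := by
    push_cast; ring
  rw [e1, abs_neg, abs_of_nonneg (by positivity)] at r1
  rw [e2, abs_of_nonneg (mul_nonneg (by linarith) hdt.le)] at r2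
  set τ := ((m : ℝ) + θ) * dt
  set R1 := U (m * dt) - U τ - (-(θ * dt)) • V τ with hR1
  set R2 := U ((m + 1 : ℕ) * dt) - U τ - ((1 - θ) * dt) • V τ with hR2
  have e : midval θ (fun k : ℕ => U (k * dt)) m - U τ = (1 - θ) • R1 + θ • R2 := by
    rw [midval, hR1, hR2]; module
  rw [e]
  refine (norm_add_le _ _).trans ?_
  rw [norm_smul, norm_smul, Real.norm_eq_abs, Real.norm_eq_abs, abs_of_nonneg hθ,
    abs_of_nonneg (by linarith)]
  have b1 : (1 - θ) * ‖R1‖ ≤ 1 * (L * (1 * dt) ^ 2) := by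
    refine mul_le_mul (by linarith) (r1.trans ?_) (norm_nonneg _) (by norm_num)
    gcongr
  have b2 : θ * ‖R2‖ ≤ 1 * (L * (1 * dt) ^ 2) := by
    refine mul_le_mul hθ1 (r2.trans ?_) (norm_nonneg _) (by norm_num)
    have : 0 ≤ 1 - θ := by linarith
    gcongr
    linarith
  nlinarith [mul_nonneg hL (sq_nonneg dt)]

/-- The coefficients are chosen such that first and second order terms cancel for every `θ`. -/
theorem timeDiff_error (dU : ∀ t ∈ Icc 0 T, HasDerivWithinAt U (V t) (Icc 0 T) t)
    (dV : ∀ t ∈ Icc 0 T, HasDerivWithinAt V (Y t) (Icc 0 T) t)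
    (dY : ∀ t ∈ Icc 0 T, HasDerivWithinAt Y (Z t) (Icc 0 T) t) (hZ : ∀ t ∈ Icc 0 T, ‖Z t‖ ≤ L)
    (hdt : 0 < dt) (hθ : 1 / 2 ≤ θ) (hθ1 : θ ≤ 1) (hm : 1 ≤ m) (hT : ((m : ℝ) + 1) * dt ≤ T) :
    ‖timeDiff θ dt (fun k : ℕ => U (k * dt)) m - V ((m + θ) * dt)‖ ≤ 12 * L * dt ^ 2 := by
  have hθ0 : 0 ≤ θ := by linarith
  obtain ⟨i0, i1, i2, iτ⟩ := levels_mem hdt hθ0 hθ1 hm hT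
  have hL : 0 ≤ L := (norm_nonneg _).trans (hZ _ iτ)
  have r0 := taylor_two_on dU dV dY hZ i0 iτ
  have r1 := taylor_two_on dU dV dY hZ i1 iτ
  have r2 := taylor_two_on dU dV dY hZ i2 iτ
  have e1 : (m : ℝ) * dt - (m + θ) * dt = -(θ * dt) := by ring
  have e2 : ((m + 1 : ℕ) : ℝ) * dt - (m + θ) * dt = (1 - θ) * dt := by
    push_cast; ring
  have e0 : ((m - 1 : ℕ) : ℝ) * dt - (m + θ) * dt = -((1 + θ) * dt) := by
    rw [Nat.cast_sub hm]; push_cast; ring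
  rw [e0, abs_neg, abs_of_nonneg (by positivity)] at r0
  rw [e1, abs_neg, abs_of_nonneg (by positivity)] at r1
  rw [e2, abs_of_nonneg (mul_nonneg (by linarith) hdt.le)] at r2
  set τ := ((m : ℝ) + θ) * dt
  set R0 := U ((m - 1 : ℕ) * dt) - U τ - (-((1 + θ) * dt)) • V τ
    - ((-((1 + θ) * dt)) ^ 2 / 2) • Y τ with hR0
  set R1 := U (m * dt) - U τ - (-(θ * dt)) • V τ - ((-(θ * dt)) ^ 2 / 2) • Y τ with hR1
  set R2 := U ((m + 1 : ℕ) * dt) - U τ - ((1 - θ) * dt) • V τ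
    - (((1 - θ) * dt) ^ 2 / 2) • Y τ with hR2
  -- the coefficient of the second derivative cancels
  have e : timeDiff θ dt (fun k : ℕ => U (k * dt)) m - V τ =
      dt⁻¹ • ((θ + 1 / 2) • (R2 - R1) - (θ - 1 / 2) • (R1 - R0)) := by
    have e' : (θ + 1 / 2) • (R2 - R1) - (θ - 1 / 2) • (R1 - R0) =
        (θ + 1 / 2) • (U ((m + 1 : ℕ) * dt) - U (m * dt))
          - (θ - 1 / 2) • (U (m * dt) - U ((m - 1 : ℕ) * dt)) - dt • V τ := by
      rw [hR0, hR1, hR2]; module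
    rw [e', smul_sub _ _ (dt • V τ), inv_smul_smul₀ hdt.ne', timeDiff]
  rw [e, norm_smul, norm_inv, Real.norm_eq_abs, abs_of_pos hdt, inv_mul_le_iff₀ hdt]
  have n0 : ‖R0‖ ≤ 8 * L * dt ^ 3 := by
    refine r0.trans ?_
    calc _ ≤ L * (2 * dt) ^ 3 := by gcongr; linarith
      _ = _ := by ring
  have n1 : ‖R1‖ ≤ L * dt ^ 3 := by
    refine r1.trans ?_
    calc _ ≤ L * (1 * dt) ^ 3 := by gcongr
      _ = _ := by ring
  have n2 : ‖R2‖ ≤ L * dt ^ 3 := by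
    refine r2.trans ?_
    have : 0 ≤ 1 - θ := by linarith
    calc _ ≤ L * (1 * dt) ^ 3 := by gcongr; linarith
      _ = _ := by ring
  refine (norm_sub_le _ _).trans ?_
  rw [norm_smul, norm_smul, Real.norm_eq_abs, Real.norm_eq_abs, abs_of_nonneg (by linarith),
    abs_of_nonneg (by linarith)]
  have b1 : (θ + 1 / 2) * ‖R2 - R1‖ ≤ 3 / 2 * (L * dt ^ 3 + L * dt ^ 3) :=
    mul_le_mul (by linarith) ((norm_sub_le _ _).trans (add_le_add n2 n1)) (norm_nonneg _)
      (by norm_num)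
  have b0 : (θ - 1 / 2) * ‖R1 - R0‖ ≤ 1 / 2 * (L * dt ^ 3 + 8 * L * dt ^ 3) :=
    mul_le_mul (by linarith) ((norm_sub_le _ _).trans (add_le_add n1 n0)) (norm_nonneg _)
      (by norm_num)
  nlinarith [mul_nonneg hL (pow_nonneg hdt.le 3)]

end TimeTaylor

/-! ### Linear combinations of smooth curves -/

theorem IsC2Lip.add {L L' : ℝ} {f f' f'' g g' g'' : ℝ → Plane} (hf : IsC2Lip L f f' f'')
    (hg : IsC2Lip L' g g' g'') : IsC2Lip (L + L') (f + g) (f' + g') (f'' + g'') where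
  periodic ρ := by simp only [Pi.add_apply, hf.periodic ρ, hg.periodic ρ]
  deriv₁ ρ := (hf.deriv₁ ρ).add (hg.deriv₁ ρ)
  deriv₂ ρ := (hf.deriv₂ ρ).add (hg.deriv₂ ρ)
  bound₀ ρ := norm_add_le_of_le (hf.bound₀ ρ) (hg.bound₀ ρ)
  bound₁ ρ := norm_add_le_of_le (hf.bound₁ ρ) (hg.bound₁ ρ)
  bound₂ ρ := norm_add_le_of_le (hf.bound₂ ρ) (hg.bound₂ ρ)
  lip₂ ρ σ := by
    simp only [Pi.add_apply]
    rw [add_sub_add_comm, add_mul]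
    exact norm_add_le_of_le (hf.lip₂ ρ σ) (hg.lip₂ ρ σ)

theorem IsC2Lip.smul {L : ℝ} {f f' f'' : ℝ → Plane} (c : ℝ) (hf : IsC2Lip L f f' f'') :
    IsC2Lip (|c| * L) (c • f) (c • f') (c • f'') where
  periodic ρ := by simp only [Pi.smul_apply, hf.periodic ρ]
  deriv₁ ρ := (hf.deriv₁ ρ).const_smul c
  deriv₂ ρ := (hf.deriv₂ ρ).const_smul c
  bound₀ ρ := by
    rw [Pi.smul_apply, norm_smul, Real.norm_eq_abs]; gcongr; exact hf.bound₀ ρ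
  bound₁ ρ := by
    rw [Pi.smul_apply, norm_smul, Real.norm_eq_abs]; gcongr; exact hf.bound₁ ρ
  bound₂ ρ := by
    rw [Pi.smul_apply, norm_smul, Real.norm_eq_abs]; gcongr; exact hf.bound₂ ρ
  lip₂ ρ σ := by
    rw [Pi.smul_apply, Pi.smul_apply, ← smul_sub, norm_smul, Real.norm_eq_abs, mul_assoc]
    gcongr; exact hf.lip₂ ρ σ

theorem IsC2Lip.mono {L L' : ℝ} {f f' f'' : ℝ → Plane} (hf : IsC2Lip L f f' f'') (h : L ≤ L') :
    IsC2Lip L' f f' f'' where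
  periodic := hf.periodic
  deriv₁ := hf.deriv₁
  deriv₂ := hf.deriv₂
  bound₀ ρ := (hf.bound₀ ρ).trans h
  bound₁ ρ := (hf.bound₁ ρ).trans h
  bound₂ ρ := (hf.bound₂ ρ).trans h
  lip₂ ρ σ := (hf.lip₂ ρ σ).trans (by gcongr)

theorem IsC2Lip.add_smul_sub {L θ : ℝ} {f f' f'' g g' g'' k k' k'' : ℝ → Plane}
    (hf : IsC2Lip L f f' f'') (hg : IsC2Lip L g g' g'') (hk : IsC2Lip L k k' k'') (hθ : |θ| ≤ 1) :
    IsC2Lip (3 * L) (f + θ • (g - k)) (f' + θ • (g' - k')) (f'' + θ • (g'' - k'')) := by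
  have hL : 0 ≤ L := (norm_nonneg _).trans (hf.bound₀ 0)
  have h := hf.add ((hg.add (hk.smul (-1))).smul θ)
  simp only [neg_smul, one_smul, ← sub_eq_add_neg, abs_neg, abs_one, one_mul] at h
  refine h.mono ?_
  nlinarith [mul_le_mul_of_nonneg_right hθ hL]

theorem IsC1Lip.add {L L' : ℝ} {f f' g g' : ℝ → Plane} (hf : IsC1Lip L f f')
    (hg : IsC1Lip L' g g') : IsC1Lip (L + L') (f + g) (f' + g') where
  periodic ρ := by simp only [Pi.add_apply, hf.periodic ρ, hg.periodic ρ]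
  deriv₁ ρ := (hf.deriv₁ ρ).add (hg.deriv₁ ρ)
  bound₀ ρ := norm_add_le_of_le (hf.bound₀ ρ) (hg.bound₀ ρ)
  bound₁ ρ := norm_add_le_of_le (hf.bound₁ ρ) (hg.bound₁ ρ)
  lip₁ ρ σ := by
    simp only [Pi.add_apply]
    rw [add_sub_add_comm, add_mul]
    exact norm_add_le_of_le (hf.lip₁ ρ σ) (hg.lip₁ ρ σ)

theorem IsC1Lip.smul {L : ℝ} {f f' : ℝ → Plane} (c : ℝ) (hf : IsC1Lip L f f') :
    IsC1Lip (|c| * L) (c • f) (c • f') where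
  periodic ρ := by simp only [Pi.smul_apply, hf.periodic ρ]
  deriv₁ ρ := (hf.deriv₁ ρ).const_smul c
  bound₀ ρ := by
    rw [Pi.smul_apply, norm_smul, Real.norm_eq_abs]; gcongr; exact hf.bound₀ ρ
  bound₁ ρ := by
    rw [Pi.smul_apply, norm_smul, Real.norm_eq_abs]; gcongr; exact hf.bound₁ ρ
  lip₁ ρ σ := by
    rw [Pi.smul_apply, Pi.smul_apply, ← smul_sub, norm_smul, Real.norm_eq_abs, mul_assoc]
    gcongr; exact hf.lip₁ ρ σ

theorem IsC1Lip.mono {L L' : ℝ} {f f' : ℝ → Plane} (hf : IsC1Lip L f f') (h : L ≤ L') :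
    IsC1Lip L' f f' where
  periodic := hf.periodic
  deriv₁ := hf.deriv₁
  bound₀ ρ := (hf.bound₀ ρ).trans h
  bound₁ ρ := (hf.bound₁ ρ).trans h
  lip₁ ρ σ := (hf.lip₁ ρ σ).trans (by gcongr)

/-- Time differences of the solution are small together with two spatial derivatives. -/
theorem FlowData.sub_isC1Lip {T c L : ℝ} {x x1 x2 v v1 xt xtt xttt : ℝ → ℝ → Plane}
    (F : FlowData T c L x x1 x2 v v1 xt xtt xttt) {s t : ℝ} (hs : s ∈ Icc 0 T) (ht : t ∈ Icc 0 T) :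
    IsC1Lip (L * |s - t|) (x s - x t) (x1 s - x1 t) where
  periodic ρ := by
    simp only [Pi.sub_apply, (F.curve s hs).periodic ρ, (F.curve t ht).periodic ρ]
  deriv₁ ρ := ((F.curve s hs).deriv₁ ρ).sub ((F.curve t ht).deriv₁ ρ)
  bound₀ ρ := F.time_lip₀ s hs t ht ρ
  bound₁ ρ := F.time_lip₁ s hs t ht ρ
  lip₁ ρ σ := lip_of_deriv_bound
    (fun ρ => ((F.curve s hs).deriv₂ ρ).sub ((F.curve t ht).deriv₂ ρ))
    (fun ρ => F.time_lip₂ s hs t ht ρ) ρ σ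

/-- Dependence of the strong form of the operator on its arguments. -/
theorem norm_strongRes_sub_le {K δ : ℝ} (hK : 1 ≤ K) {a a' b' b'' D y y' y'' v : ℝ → Plane} {ρ : ℝ}
    (ha : ‖a ρ‖ ≤ K) (ha' : ‖a' ρ‖ ≤ K)
    (hy' : ‖y' ρ‖ ≤ K) (hy'' : ‖y'' ρ‖ ≤ K) (hv : ‖v ρ‖ ≤ K) (h0 : ‖a ρ - y ρ‖ ≤ δ)
    (h1 : ‖a' ρ - y' ρ‖ ≤ δ) (h1b : ‖b' ρ - y' ρ‖ ≤ δ) :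
    ‖strongRes a a' b' b'' D ρ - strongRes y y' y' y'' v ρ‖ ≤
      8 * K ^ 3 * (δ + ‖D ρ - v ρ‖ + ‖b'' ρ - y'' ρ‖) := by
  have hK0 : 0 ≤ K := zero_le_one.trans hK
  have hδ : 0 ≤ δ := (norm_nonneg _).trans h0
  have key : ∀ (x : ℝ) (y : Plane) (a b : ℝ), |x| ≤ a → ‖y‖ ≤ b → ‖x • y‖ ≤ a * b := by
    intro x y a b hx hy
    rw [norm_smul, Real.norm_eq_abs]
    exact mul_le_mul hx hy (norm_nonneg _) ((abs_nonneg _).trans hx)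
  have c0 : |a ρ 0| ≤ K := (abs_coord_le _ 0).trans ha
  have c1 : |a ρ 0 - y ρ 0| ≤ δ := (abs_coord_le (a ρ - y ρ) 0).trans h0
  have c2 : |a' ρ 0 - y' ρ 0| ≤ δ := (abs_coord_le (a' ρ - y' ρ) 0).trans h1
  have c3 : |a' ρ 0| ≤ K := (abs_coord_le _ 0).trans ha'
  have n1 : |‖a' ρ‖ ^ 2| ≤ K ^ 2 := by
    rw [abs_of_nonneg (sq_nonneg _)]; gcongr
  have n2 : |‖y' ρ‖ ^ 2| ≤ K ^ 2 := by
    rw [abs_of_nonneg (sq_nonneg _)]; gcongr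
  have n3 : |‖a' ρ‖ ^ 2 - ‖y' ρ‖ ^ 2| ≤ 2 * K * δ := by
    have e : ‖a' ρ‖ ^ 2 - ‖y' ρ‖ ^ 2 = (‖a' ρ‖ + ‖y' ρ‖) * (‖a' ρ‖ - ‖y' ρ‖) := by ring
    rw [e, abs_mul, abs_of_nonneg (by positivity)]
    exact mul_le_mul (by linarith) ((abs_norm_sub_norm_le _ _).trans h1) (abs_nonneg _)
      (by positivity)
  have n4 : |a ρ 0 * ‖a' ρ‖ ^ 2| ≤ K * K ^ 2 := by
    rw [abs_mul]; exact mul_le_mul c0 n1 (abs_nonneg _) hK0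
  have n5 : |a ρ 0 * ‖a' ρ‖ ^ 2 - y ρ 0 * ‖y' ρ‖ ^ 2| ≤ K * (2 * K * δ) + δ * K ^ 2 := by
    have e : a ρ 0 * ‖a' ρ‖ ^ 2 - y ρ 0 * ‖y' ρ‖ ^ 2 =
        a ρ 0 * (‖a' ρ‖ ^ 2 - ‖y' ρ‖ ^ 2) + (a ρ 0 - y ρ 0) * ‖y' ρ‖ ^ 2 := by ring
    rw [e]
    refine (abs_add_le _ _).trans ?_
    rw [abs_mul, abs_mul]
    exact add_le_add (mul_le_mul c0 n3 (abs_nonneg _) hK0) (mul_le_mul c1 n2 (abs_nonneg _) hδ)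
  have e : strongRes a a' b' b'' D ρ - strongRes y y' y' y'' v ρ =
      (a ρ 0 * ‖a' ρ‖ ^ 2) • (D ρ - v ρ) + (a ρ 0 * ‖a' ρ‖ ^ 2 - y ρ 0 * ‖y' ρ‖ ^ 2) • v ρ
      + -(a' ρ 0 • (b' ρ - y' ρ)) + -((a' ρ 0 - y' ρ 0) • y' ρ)
      + -(a ρ 0 • (b'' ρ - y'' ρ)) + -((a ρ 0 - y ρ 0) • y'' ρ)
      + (‖a' ρ‖ ^ 2 - ‖y' ρ‖ ^ 2) • e₁ := by
    simp only [strongRes]; module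
  rw [e]
  have q := norm_add_le_of_le (norm_add_le_of_le (norm_add_le_of_le (norm_add_le_of_le
    (norm_add_le_of_le (norm_add_le_of_le
    (key _ _ _ _ n4 (le_refl ‖D ρ - v ρ‖)) (key _ _ _ _ n5 hv))
    ((norm_neg _).trans_le (key _ _ _ _ c3 h1b))) ((norm_neg _).trans_le (key _ _ _ _ c2 hy')))
    ((norm_neg _).trans_le (key _ _ _ _ c0 (le_refl ‖b'' ρ - y'' ρ‖))))
    ((norm_neg _).trans_le (key _ _ _ _ c1 hy''))) (key _ _ _ _ n3 norm_e₁.le)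
  refine q.trans ?_
  have hK2 : K ≤ K ^ 3 := le_self_pow₀ hK (by norm_num)
  have hδK : K * δ ≤ K ^ 3 * δ := mul_le_mul_of_nonneg_right hK2 hδ
  have hbK : K * ‖b'' ρ - y'' ρ‖ ≤ K ^ 3 * ‖b'' ρ - y'' ρ‖ :=
    mul_le_mul_of_nonneg_right hK2 (norm_nonneg _)
  have p1 : 0 ≤ K ^ 3 * ‖D ρ - v ρ‖ := by positivity
  have p2 : 0 ≤ K ^ 3 * ‖b'' ρ - y'' ρ‖ := by positivity
  nlinarith

section StepConsistency

/-! ### Consistency of a step -/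

theorem strongRes_continuous_periodic {L L' : ℝ} {a a' a'' b b' b'' D : ℝ → Plane}
    (ha : IsC2Lip L a a' a'') (hb : IsC2Lip L' b b' b'') (hD : Continuous D)
    (hDp : Function.Periodic D 1) (hb''p : Function.Periodic b'' 1) :
    Continuous (strongRes a a' b' b'' D) ∧ Function.Periodic (strongRes a a' b' b'' D) 1 := by
  have k1 := continuous_coord ha.continuous₀ 0
  have k2 := continuous_coord ha.continuous₁ 0
  have k3 := ha.continuous₁
  have k4 := hb.continuous₁
  have k5 := hb.continuous₂
  refine ⟨(((k1.mul (k3.norm.pow 2)).smul hD).sub ((k2.smul k4).add (k1.smul k5))).add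
    ((k3.norm.pow 2).smul continuous_const), fun ρ => ?_⟩
  simp only [strongRes]
  rw [ha.periodic, ha.periodic₁, hb.periodic₁, hDp, hb''p]

theorem IsC2Lip.periodic₂ {L : ℝ} {f f' f'' : ℝ → Plane} (h : IsC2Lip L f f' f'') :
    Function.Periodic f'' 1 := by
  intro ρ
  have h1 := (h.deriv₂ (ρ + 1)).comp_add_const ρ 1
  rw [show (fun ρ => f' (ρ + 1)) = f' from funext h.periodic₁] at h1
  exact h1.unique (h.deriv₂ ρ)

/-- Lower bound for the length of the chords of a curve with nonvanishing derivative. -/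
theorem IsC2Lip.chord_lower {L c h : ℝ} {f f' f'' : ℝ → Plane} (hf : IsC2Lip L f f' f'')
    (hc : ∀ ρ, c ≤ ‖f' ρ‖) (hh : 0 < h) (ρ : ℝ) : (c - L * h) * h ≤ ‖f (ρ + h) - f ρ‖ := by
  have h1 := taylor_one hf.deriv₁ hf.lip₁ ρ h
  have h2 : ‖h • f' ρ‖ ≤ ‖f (ρ + h) - f ρ‖ + ‖f (ρ + h) - f ρ - h • f' ρ‖ := by
    have := norm_sub_le (f (ρ + h) - f ρ) (f (ρ + h) - f ρ - h • f' ρ)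
    rwa [sub_sub_cancel] at this
  rw [norm_smul, Real.norm_eq_abs, abs_of_pos hh] at h2
  nlinarith [mul_le_mul_of_nonneg_left (hc ρ) hh.le]

variable {J : ℕ} [NeZero J]

theorem nodeDiff_nodal {f : ℝ → Plane} (hf : Function.Periodic f 1) (j : ZMod J) :
    nodeDiff (nodal J f) j = f (node j + 1 / J) - f (node j) := by
  rw [nodeDiff, nodal_node_succ hf, nodal_node]

theorem IsC2Lip.second_diff {L : ℝ} {f f' f'' : ℝ → Plane} (hf : IsC2Lip L f f' f'')
    (j : ZMod J) :
    ‖nodeDiff (nodal J f) (j + 1) - nodeDiff (nodal J f) j‖ ≤ 2 * L * (1 / J) ^ 2 := by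
  set h : ℝ := 1 / J with hh
  have hper : Function.Periodic (fun ρ => f (ρ + h) - f ρ) 1 := fun ρ => by
    have := hf.periodic (ρ + h)
    simp only []
    rw [show ρ + 1 + h = ρ + h + 1 by ring, this, hf.periodic ρ]
  have e1 : f (node (j + 1) + h) - f (node (j + 1)) =
      f (node j + h + h) - f (node j + h) := nodal_node_succ hper j
  rw [nodeDiff_nodal hf.periodic, nodeDiff_nodal hf.periodic, ← hh, e1]
  set z := node j + h with hz
  have t1 := taylor_one hf.deriv₁ hf.lip₁ z h
  have t2 := taylor_one hf.deriv₁ hf.lip₁ z (-h)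
  have e2 : z + -h = node j := by rw [hz]; ring
  rw [e2] at t2
  have e3 : f (z + h) - f z - (f z - f (node j)) =
      (f (z + h) - f z - h • f' z) + (f (node j) - f z - (-h) • f' z) := by module
  rw [e3]
  refine (norm_add_le_of_le t1 t2).trans (le_of_eq ?_)
  ring

variable {T c L : ℝ} {x x1 x2 v v1 xt xtt xttt : ℝ → ℝ → Plane}

/-- A pointwise bound by a constant and two functions that are small in `L²` is a bound in `L²`. -/
theorem integral_sq_le_of_norm_le {r f g : ℝ → Plane} (hr : Continuous r) (hf : Continuous f)
    (hg : Continuous g) {K δ : ℝ} (h : ∀ ρ, ‖r ρ‖ ≤ K * (δ + ‖f ρ‖ + ‖g ρ‖)) {A B : ℝ}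
    (hA : ‖l2class f‖ ≤ A) (hB : ‖l2class g‖ ≤ B) :
    ∫ ρ in (0 : ℝ)..1, ‖r ρ‖ ^ 2 ≤ 3 * K ^ 2 * (δ ^ 2 + A ^ 2 + B ^ 2) := by
  have c1 : Continuous fun ρ => ‖f ρ‖ ^ 2 := by fun_prop
  have c2 : Continuous fun ρ => ‖g ρ‖ ^ 2 := by fun_prop
  have c3 : Continuous fun ρ => δ ^ 2 + ‖f ρ‖ ^ 2 := by fun_prop
  have c4 : Continuous fun ρ => 3 * K ^ 2 * (δ ^ 2 + ‖f ρ‖ ^ 2 + ‖g ρ‖ ^ 2) := by fun_prop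
  have h1 : ∫ ρ in (0 : ℝ)..1, ‖r ρ‖ ^ 2 ≤
      ∫ ρ in (0 : ℝ)..1, 3 * K ^ 2 * (δ ^ 2 + ‖f ρ‖ ^ 2 + ‖g ρ‖ ^ 2) := by
    refine intervalIntegral.integral_mono_on zero_le_one
      ((hr.norm.pow 2).intervalIntegrable _ _) (c4.intervalIntegrable _ _) fun ρ _ => ?_
    have h2 : ‖r ρ‖ ^ 2 ≤ (K * (δ + ‖f ρ‖ + ‖g ρ‖)) ^ 2 := by gcongr; exact h ρ
    refine h2.trans ?_
    have h3 : (δ + ‖f ρ‖ + ‖g ρ‖) ^ 2 ≤ 3 * (δ ^ 2 + ‖f ρ‖ ^ 2 + ‖g ρ‖ ^ 2) := by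
      nlinarith [sq_nonneg (δ - ‖f ρ‖), sq_nonneg (δ - ‖g ρ‖), sq_nonneg (‖f ρ‖ - ‖g ρ‖)]
    rw [mul_pow]
    nlinarith [mul_le_mul_of_nonneg_left h3 (sq_nonneg K)]
  refine h1.trans ?_
  rw [intervalIntegral.integral_const_mul, intervalIntegral.integral_add
    (c3.intervalIntegrable _ _) (c2.intervalIntegrable _ _), intervalIntegral.integral_add
    intervalIntegrable_const (c1.intervalIntegrable _ _), intervalIntegral.integral_const,
    ← norm_l2class_sq (memLp_of_continuous_periodic hf 2),
    ← norm_l2class_sq (memLp_of_continuous_periodic hg 2), sub_zero, one_smul]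
  gcongr

/-- The nodal values of the solution satisfy each step of the multistep methods up to a residual of
second order in time and space. -/
theorem FlowData.stepData (F : FlowData T c L x x1 x2 v v1 xt xtt xttt) (hc : 0 < c) (hL : 1 ≤ L)
    {dt θ : ℝ} {m : ℕ} (hdt : 0 < dt) (hθ : 1 / 2 ≤ θ) (hθ1 : θ ≤ 1) (hm : 1 ≤ m)
    (hmT : ((m : ℝ) + 1) * dt ≤ T) (hdtc : L * dt ≤ c / 2) (hJc : 12 * L * (1 / J) ≤ c) :
    StepData (c / 4) (6 * L) (1 / J) (1134000 * L ^ 4 * (dt ^ 2 + (1 / J) ^ 2))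
      (extrap θ (fun k : ℕ => nodal J (x (k * dt))) m)
      (timeDiff θ dt (fun k : ℕ => nodal J (x (k * dt))) m)
      (midval θ (fun k : ℕ => nodal J (x (k * dt))) m) := by
  have hJ : (0 : ℝ) < J := J_pos (J := J)
  have hh : (0 : ℝ) < 1 / J := by positivity
  have hL0 : 0 < L := by linarith
  have hθ0 : 0 ≤ θ := by linarith
  have habs : |θ| ≤ 1 := by rwa [abs_of_nonneg hθ0]
  obtain ⟨i0, i1, i2, iτ⟩ := levels_mem hdt hθ0 hθ1 hm hmT
  set t0 : ℝ := ((m - 1 : ℕ) : ℝ) * dt with ht0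
  set t1 : ℝ := (m : ℝ) * dt with ht1
  set t2 : ℝ := ((m + 1 : ℕ) : ℝ) * dt with ht2
  set τ : ℝ := (m + θ) * dt with hτ
  have d10 : t1 - t0 = dt := by
    rw [ht1, ht0, Nat.cast_sub hm]; push_cast; ring
  have d21 : t2 - t1 = dt := by
    rw [ht2, ht1]; push_cast; ring
  set a := x t1 + θ • (x t1 - x t0) with ha_def
  set a' := x1 t1 + θ • (x1 t1 - x1 t0) with ha'_def
  set a'' := x2 t1 + θ • (x2 t1 - x2 t0) with ha''_def
  set b := x t1 + θ • (x t2 - x t1) with hb_def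
  set b' := x1 t1 + θ • (x1 t2 - x1 t1) with hb'_def
  set b'' := x2 t1 + θ • (x2 t2 - x2 t1) with hb''_def
  set D := dt⁻¹ • ((θ + 1 / 2) • (x t2 - x t1) - (θ - 1 / 2) • (x t1 - x t0)) with hD_def
  set D' := dt⁻¹ • ((θ + 1 / 2) • (x1 t2 - x1 t1) - (θ - 1 / 2) • (x1 t1 - x1 t0)) with hD'_def
  have Ca : IsC2Lip (3 * L) a a' a'' :=
    (F.curve _ i1).add_smul_sub (F.curve _ i1) (F.curve _ i0) habs
  have Cb : IsC2Lip (3 * L) b b' b'' :=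
    (F.curve _ i1).add_smul_sub (F.curve _ i2) (F.curve _ i1) habs
  have CD : IsC1Lip (2 * L) D D' := by
    have h := (((F.sub_isC1Lip i2 i1).smul (θ + 1 / 2)).add
      ((F.sub_isC1Lip i1 i0).smul (-(θ - 1 / 2)))).smul dt⁻¹
    rw [d21, d10, abs_of_pos hdt, abs_of_nonneg (by linarith : 0 ≤ θ + 1 / 2), abs_neg,
      abs_of_nonneg (by linarith : 0 ≤ θ - 1 / 2), abs_of_pos (inv_pos.2 hdt)] at h
    simp only [neg_smul, ← sub_eq_add_neg] at h
    refine h.mono ?_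
    rw [inv_mul_le_iff₀ hdt]
    nlinarith [mul_pos hL0 hdt]
  -- first order closeness to the time level `t1`
  have close : ∀ {f : ℝ → ℝ → Plane}, (∀ s ∈ Icc 0 T, ∀ t ∈ Icc 0 T, ∀ ρ,
      ‖f s ρ - f t ρ‖ ≤ L * |s - t|) → ∀ ρ, ‖θ • (f t1 - f t0) ρ‖ ≤ L * dt := by
    intro f hf ρ
    rw [norm_smul, Real.norm_eq_abs, Pi.sub_apply]
    have := hf t1 i1 t0 i0 ρ
    rw [d10, abs_of_pos hdt] at this
    calc _ ≤ 1 * (L * dt) := mul_le_mul habs this (norm_nonneg _) zero_le_one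
      _ = _ := one_mul _
  have hale : ∀ ρ, c / 2 ≤ a ρ 0 := by
    intro ρ
    have h1 := F.lower t1 i1 ρ
    have h2 := (abs_coord_le _ 0).trans (close F.time_lip₀ ρ)
    have e : a ρ 0 = x t1 ρ 0 + (θ • (x t1 - x t0) ρ) 0 := rfl
    rw [e]
    linarith [(abs_le.1 h2).1]
  have hspeed : ∀ ρ, c / 2 ≤ ‖a' ρ‖ := by
    intro ρ
    have h1 := F.speed t1 i1 ρ
    have h2 := close F.time_lip₁ ρ
    have e : x1 t1 ρ = a' ρ - θ • (x1 t1 - x1 t0) ρ := by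
      rw [ha'_def]; simp
    rw [e] at h1
    linarith [norm_sub_le (a' ρ) (θ • (x1 t1 - x1 t0) ρ)]
  -- second order closeness to the collocation time
  have l2ext : ∀ {f g k : ℝ → Plane}, MemLp f 2 circleVol → MemLp g 2 circleVol →
      MemLp k 2 circleVol → l2class (f + θ • (g - k)) =
        l2class f + θ • (l2class g - l2class k) := by
    intro f g k hf hg hk
    rw [l2class_add hf ((hg.sub hk).const_smul θ), l2class_smul θ (hg.sub hk), l2class_sub hg hk]
  have m0 : ∀ t ∈ Icc 0 T, MemLp (x t) 2 circleVol := fun t ht => (F.prim₀ t ht).memLp_self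
  have m1 : ∀ t ∈ Icc 0 T, MemLp (x1 t) 2 circleVol := fun t ht => (F.prim₀ t ht).memLp
  have m2 : ∀ t ∈ Icc 0 T, MemLp (x2 t) 2 circleVol := fun t ht => (F.prim₁ t ht).memLp
  have ma : ∀ {f : ℝ → ℝ → Plane}, (∀ t ∈ Icc 0 T, MemLp (f t) 2 circleVol) → ∀ {k : ℕ}, k ≤ 2 →
      (∀ t ∈ Icc 0 T, l2curve k x t = l2class (f t)) →
      ‖l2class (f t1 + θ • (f t1 - f t0) - f τ)‖ ≤ 6 * L * dt ^ 2 ∧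
      ‖l2class (f t1 + θ • (f t2 - f t1) - f τ)‖ ≤ 6 * L * dt ^ 2 := by
    intro f hf k hk hcl
    have h1 := extrap_error (F.curve_deriv k hk) (F.vel_curve_deriv k hk) (F.acc_bound k hk)
      hdt hθ0 hθ1 hm hmT
    have h2 := midval_error (F.curve_deriv k hk) (F.vel_curve_deriv k hk) (F.acc_bound k hk)
      hdt hθ0 hθ1 hm hmT
    rw [extrap, ← ht1, ← ht0, ← hτ, hcl _ i1, hcl _ i0, hcl _ iτ,
      ← l2ext (hf _ i1) (hf _ i1) (hf _ i0), ← l2class_sub ((hf _ i1).add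
        (((hf _ i1).sub (hf _ i0)).const_smul θ)) (hf _ iτ)] at h1
    rw [midval, ← ht1, ← ht2, ← hτ, hcl _ i1, hcl _ i2, hcl _ iτ,
      ← l2ext (hf _ i1) (hf _ i2) (hf _ i1), ← l2class_sub ((hf _ i1).add
        (((hf _ i2).sub (hf _ i1)).const_smul θ)) (hf _ iτ)] at h2
    exact ⟨h1, h2⟩
  have q0 := ma m0 (by norm_num) F.class₀
  have q1 := ma m1 (by norm_num) F.class₁
  have q2 := ma m2 le_rfl F.class₂
  have pa : IsPrimitive (a - x τ) (a' - x1 τ) :=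
    ((F.prim₀ _ i1).add (((F.prim₀ _ i1).sub (F.prim₀ _ i0)).smul θ)).sub (F.prim₀ _ iτ)
  have pa' : IsPrimitive (a' - x1 τ) (a'' - x2 τ) :=
    ((F.prim₁ _ i1).add (((F.prim₁ _ i1).sub (F.prim₁ _ i0)).smul θ)).sub (F.prim₁ _ iτ)
  have pb' : IsPrimitive (b' - x1 τ) (b'' - x2 τ) :=
    ((F.prim₁ _ i1).add (((F.prim₁ _ i2).sub (F.prim₁ _ i1)).smul θ)).sub (F.prim₁ _ iτ)
  set δ := 12 * L * dt ^ 2 with hδ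
  have s0 : ∀ ρ, ‖a ρ - x τ ρ‖ ≤ δ := fun ρ => (pa.norm_le ρ).trans (by linarith [q0.1, q1.1])
  have s1 : ∀ ρ, ‖a' ρ - x1 τ ρ‖ ≤ δ := fun ρ => (pa'.norm_le ρ).trans (by linarith [q1.1, q2.1])
  have s1b : ∀ ρ, ‖b' ρ - x1 τ ρ‖ ≤ δ := fun ρ => (pb'.norm_le ρ).trans (by linarith [q1.2, q2.2])
  have sD : ‖l2class (D - v τ)‖ ≤ 12 * L * dt ^ 2 := by
    have h1 := timeDiff_error (F.curve_deriv 0 (by norm_num)) (F.vel_curve_deriv 0 (by norm_num))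
      F.acc_curve_deriv F.jerk_bound hdt hθ hθ1 hm hmT
    have n21 := (m0 _ i2).sub (m0 _ i1)
    have n10 := (m0 _ i1).sub (m0 _ i0)
    rw [timeDiff, ← ht1, ← ht0, ← ht2, ← hτ, F.class₀ _ i1, F.class₀ _ i0, F.class₀ _ i2,
      F.vel_class₀ _ iτ, ← l2class_sub (m0 _ i2) (m0 _ i1), ← l2class_sub (m0 _ i1) (m0 _ i0),
      ← l2class_smul _ n21, ← l2class_smul _ n10,
      ← l2class_sub (n21.const_smul _) (n10.const_smul _),
      ← l2class_smul _ ((n21.const_smul _).sub (n10.const_smul _)),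
      ← l2class_sub (((n21.const_smul _).sub (n10.const_smul _)).const_smul _)
        (F.vel_prim₀ _ iτ).memLp_self] at h1
    exact h1
  -- the strong residual
  set r := strongRes a a' b' b'' D with hr
  obtain ⟨rc, rp⟩ := strongRes_continuous_periodic Ca Cb CD.continuous₀ CD.periodic Cb.periodic₂
  have hK1 : 1 ≤ 3 * L := by linarith
  have hr_le : ∀ ρ, ‖r ρ‖ ≤ 8 * (3 * L) ^ 3 * (δ + ‖(D - v τ) ρ‖ + ‖(b'' - x2 τ) ρ‖) := by
    intro ρ
    have Cτ := F.curve τ iτ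
    have h1 := norm_strongRes_sub_le (K := 3 * L) (δ := δ) hK1 (a := a) (a' := a') (b' := b')
      (b'' := b'') (D := D) (y := x τ) (y' := x1 τ) (y'' := x2 τ) (v := v τ) (ρ := ρ)
      (Ca.bound₀ ρ) (Ca.bound₁ ρ) ((Cτ.bound₁ ρ).trans (by linarith))
      ((Cτ.bound₂ ρ).trans (by linarith)) ((F.vel_bound τ iτ ρ).trans (by linarith))
      (s0 ρ) (s1 ρ) (s1b ρ)
    rw [F.equation τ iτ ρ, sub_zero] at h1
    exact h1
  have hr2 := integral_sq_le_of_norm_le rc (CD.continuous₀.sub (F.vel_prim₀ _ iτ).continuous)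
    (Cb.continuous₂.sub (F.curve _ iτ).continuous₂) hr_le sD q2.2
  have hB : ∫ ρ in (0 : ℝ)..1, ‖r ρ‖ ^ 2 ≤ (7000 * L ^ 4 * dt ^ 2) ^ 2 := by
    refine hr2.trans ?_
    rw [hδ]
    have : 0 ≤ L ^ 8 * dt ^ 4 := by positivity
    nlinarith
  exact
  { lower := fun j => by
      have := hale (node j)
      have e : extrap θ (fun k : ℕ => nodal J (x (k * dt))) m j 0 = a (node j) 0 := rfl
      rw [e]; linarith
    upper := fun j => by
      refine (abs_coord_le _ 0).trans ((Ca.bound₀ (node j)).trans ?_)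
      linarith
    slope_lower := fun j => by
      have e := nodeDiff_nodal Ca.periodic j
      have h1 := Ca.chord_lower hspeed hh (node j)
      rw [← e] at h1
      refine le_trans ?_ h1
      gcongr
      linarith
    slope_upper := fun j => by
      have e := nodeDiff_nodal Ca.periodic j
      have h1 := Ca.lip₀ (node j + 1 / J) (node j)
      rw [← e, add_sub_cancel_left, abs_of_pos hh] at h1
      refine h1.trans ?_
      gcongr
      norm_num
    slope_mid := fun j => by
      have e := nodeDiff_nodal Cb.periodic j
      have h1 := Cb.lip₀ (node j + 1 / J) (node j)
      rw [← e, add_sub_cancel_left, abs_of_pos hh] at h1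
      refine h1.trans ?_
      gcongr
      norm_num
    second_diff := fun j => by
      refine (Cb.second_diff j).trans (le_of_eq ?_)
      ring
    velocity := fun j => by
      refine (CD.bound₀ (node j)).trans ?_
      linarith
    residual := fun η => by
      have h1 := space_consistency (J := J) hK1 Ca Cb (CD.mono (by linarith)) η
      have h2 := abs_moments_le (J := J) rc rp (by positivity) hB η
      set S := √(l2sq (1 / (J : ℝ)) η) with hS
      have hS0 : 0 ≤ S := Real.sqrt_nonneg _
      have e : nodalForm (1 / J) (extrap θ (fun k : ℕ => nodal J (x (k * dt))) m)
        (timeDiff θ dt (fun k : ℕ => nodal J (x (k * dt))) m)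
        (midval θ (fun k : ℕ => nodal J (x (k * dt))) m) η =
          nodalForm (1 / J) (nodal J a) (nodal J D) (nodal J b) η := rfl
      rw [e]
      have h3 : 7000 * L ^ 4 * dt ^ 2 * S ≤ 1134000 * L ^ 4 * dt ^ 2 * S := by
        gcongr; norm_num
      have h4 : 14000 * (3 * L) ^ 4 * (1 / (J : ℝ)) ^ 2 * S =
          1134000 * L ^ 4 * (1 / (J : ℝ)) ^ 2 * S := by ring
      have h5 : 1134000 * L ^ 4 * (dt ^ 2 + (1 / (J : ℝ)) ^ 2) * S =
        1134000 * L ^ 4 * dt ^ 2 * S + 1134000 * L ^ 4 * (1 / (J : ℝ)) ^ 2 * S := by ring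
      rw [h5]
      rw [abs_le] at h1 h2 ⊢
      constructor <;> linarith [h1.1, h1.2, h2.1, h2.2] }

end StepConsistency

section StartingStep

/-! ### Error of the starting step -/

/-- `f` is bounded by `B` and Lipschitz with constant `B`. -/
def IsBddLip {E : Type*} [NormedAddCommGroup E] (B : ℝ) (f : ℝ → E) : Prop :=
  (∀ ρ, ‖f ρ‖ ≤ B) ∧ ∀ ρ σ, ‖f ρ - f σ‖ ≤ B * |ρ - σ|

section BddLip

set_option linter.unusedSectionVars false

variable {E : Type*} [NormedAddCommGroup E] [NormedSpace ℝ E] {B C : ℝ}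

theorem IsBddLip.nonneg {f : ℝ → E} (hf : IsBddLip B f) : 0 ≤ B := (norm_nonneg _).trans (hf.1 0)

theorem IsBddLip.mono {f : ℝ → E} (hf : IsBddLip B f) (h : B ≤ C) : IsBddLip C f :=
  ⟨fun ρ => (hf.1 ρ).trans h, fun ρ σ => (hf.2 ρ σ).trans (by gcongr)⟩

theorem IsBddLip.add {f g : ℝ → E} (hf : IsBddLip B f) (hg : IsBddLip C g) :
    IsBddLip (B + C) (fun ρ => f ρ + g ρ) :=
  ⟨fun ρ => norm_add_le_of_le (hf.1 ρ) (hg.1 ρ), fun ρ σ => by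
    rw [add_sub_add_comm, add_mul]; exact norm_add_le_of_le (hf.2 ρ σ) (hg.2 ρ σ)⟩

theorem IsBddLip.neg {f : ℝ → E} (hf : IsBddLip B f) : IsBddLip B (fun ρ => -f ρ) :=
  ⟨fun ρ => by rw [norm_neg]; exact hf.1 ρ, fun ρ σ => by
    rw [← neg_sub', norm_neg]; exact hf.2 ρ σ⟩

theorem IsBddLip.smul {f : ℝ → ℝ} {g : ℝ → E} (hf : IsBddLip B f) (hg : IsBddLip C g) :
    IsBddLip (2 * (B * C)) (fun ρ => f ρ • g ρ) := by
  have hB := hf.nonneg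
  have hC := hg.nonneg
  have hBC := mul_nonneg hB hC
  have key : ∀ (x : ℝ) (y : E) (a b : ℝ), ‖x‖ ≤ a → ‖y‖ ≤ b → ‖x • y‖ ≤ a * b := by
    intro x y a b hx hy
    rw [norm_smul]
    exact mul_le_mul hx hy (norm_nonneg _) ((norm_nonneg _).trans hx)
  refine ⟨fun ρ => (key _ _ _ _ (hf.1 ρ) (hg.1 ρ)).trans (by linarith), fun ρ σ => ?_⟩
  have e : f ρ • g ρ - f σ • g σ = (f ρ - f σ) • g ρ + f σ • (g ρ - g σ) := by module
  rw [e]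
  refine (norm_add_le_of_le (key _ _ _ _ (hf.2 ρ σ) (hg.1 ρ))
    (key _ _ _ _ (hf.1 σ) (hg.2 ρ σ))).trans (le_of_eq ?_)
  ring

theorem IsBddLip.coord {f : ℝ → Plane} (hf : IsBddLip B f) (i : Fin 2) :
    IsBddLip B (fun ρ => f ρ i) :=
  ⟨fun ρ => (abs_coord_le _ i).trans (hf.1 ρ), fun ρ σ =>
    (abs_coord_le (f ρ - f σ) i).trans (hf.2 ρ σ)⟩

theorem IsBddLip.normSq {f : ℝ → Plane} (hf : IsBddLip B f) :
    IsBddLip (4 * B ^ 2) (fun ρ => ‖f ρ‖ ^ 2) := by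
  simp only [plane_normSq]
  refine (((hf.coord 0).smul (hf.coord 0)).add ((hf.coord 1).smul (hf.coord 1))).mono (le_of_eq ?_)
  ring

theorem IsBddLip.inv {f : ℝ → ℝ} (hf : IsBddLip B f) {c : ℝ} (hc : 0 < c) (hfc : ∀ ρ, c ≤ f ρ) :
    IsBddLip (c⁻¹ + B * (c⁻¹ * c⁻¹)) (fun ρ => (f ρ)⁻¹) := by
  have hB := hf.nonneg
  have hp : ∀ ρ, 0 < f ρ := fun ρ => hc.trans_le (hfc ρ)
  have hb : ∀ ρ, ‖(f ρ)⁻¹‖ ≤ c⁻¹ := fun ρ => by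
    rw [norm_inv, Real.norm_eq_abs, abs_of_pos (hp ρ)]
    exact inv_anti₀ hc (hfc ρ)
  have hci : 0 < c⁻¹ := inv_pos.2 hc
  have hBc : 0 ≤ B * (c⁻¹ * c⁻¹) := by positivity
  refine ⟨fun ρ => (hb ρ).trans (by linarith), fun ρ σ => ?_⟩
  have h1 := (hp ρ).ne'
  have h2 := (hp σ).ne'
  have e : (f ρ)⁻¹ - (f σ)⁻¹ = -((f ρ - f σ) * ((f ρ)⁻¹ * (f σ)⁻¹)) := by field_simp; ring
  rw [e, norm_neg, norm_mul, norm_mul]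
  have h3 : ‖f ρ - f σ‖ * (‖(f ρ)⁻¹‖ * ‖(f σ)⁻¹‖) ≤ B * |ρ - σ| * (c⁻¹ * c⁻¹) := by
    refine mul_le_mul (hf.2 ρ σ) (mul_le_mul (hb ρ) (hb σ) (norm_nonneg _) hci.le) (by positivity)
      (by positivity)
  refine h3.trans ?_
  nlinarith [mul_nonneg hci.le (abs_nonneg (ρ - σ))]

theorem IsBddLip.continuous {f : ℝ → Plane} (hf : IsBddLip B f) : Continuous f :=
  continuous_of_lip hf.2

theorem IsBddLip.of_hasDerivAt {f f' : ℝ → E} (h : ∀ ρ, HasDerivAt f (f' ρ) ρ)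
    (h0 : ∀ ρ, ‖f ρ‖ ≤ B) (h1 : ∀ ρ, ‖f' ρ‖ ≤ B) : IsBddLip B f :=
  ⟨h0, lip_of_deriv_bound h h1⟩

end BddLip

variable {J : ℕ} [NeZero J]

set_option maxHeartbeats 800000 in
/-- The mass form with merely Lipschitz data agrees to first order with the moments of its density. -/
theorem mass_moments_le {L W B : ℝ} {a a' a'' w r : ℝ → Plane} (ha : IsC2Lip L a a' a'')
    (hw : IsBddLip W w) (hwp : Function.Periodic w 1) (hr : IsBddLip B r)
    (hrw : ∀ ρ, r ρ = (a ρ 0 * ‖a' ρ‖ ^ 2) • w ρ) (η : ZMod J → Plane) :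
    |massForm (1 / J) (nodal J a) (nodal J w) η - ∑ j, 1 / J * ∫ s in (0 : ℝ)..1,
      inner ℝ (r (node j + s * (1 / J))) ((1 - s) • η j + s • η (j + 1))| ≤
      2 * (4 * L ^ 3 * W + B) * (1 / J) * √(l2sq (1 / J) η) := by
  have hJ : (0 : ℝ) < J := J_pos (J := J)
  set h : ℝ := 1 / J with hh
  have hh0 : 0 < h := by positivity
  have hL : 0 ≤ L := (norm_nonneg _).trans (ha.bound₀ 0)
  have hW := hw.nonneg
  have hB := hr.nonneg
  have hS := sum_norm_le_sqrt_l2sq η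
  rw [← hh] at hS
  rw [massForm, ← Finset.sum_sub_distrib]
  refine (Finset.abs_sum_le_sum_abs _ _).trans ?_
  have hsum : ∑ j, h * ((4 * L ^ 3 * W + B) * h * (‖η j‖ + ‖η (j + 1)‖)) =
      2 * (4 * L ^ 3 * W + B) * h * (h * ∑ j, ‖η j‖) := by
    rw [← Finset.mul_sum, ← Finset.mul_sum, Finset.sum_add_distrib, sum_shift (fun j => ‖η j‖)]
    ring
  have hle : 2 * (4 * L ^ 3 * W + B) * h * (h * ∑ j, ‖η j‖) ≤
      2 * (4 * L ^ 3 * W + B) * h * √(l2sq h η) := by gcongr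
  refine le_trans ?_ hle
  rw [← hsum]
  refine Finset.sum_le_sum fun j _ => ?_
  rw [nodeDiff_nodal ha.periodic, nodal_node_succ ha.periodic, nodal_node_succ hwp, nodal_node,
    nodal_node, ← hh]
  set z := node j with hz
  set N := ‖h⁻¹ • (a (z + h) - a z)‖ ^ 2 with hN
  set n := ‖a' z‖ ^ 2 with hn
  set p0 := a z 0 with hp0
  set p1 := a (z + h) 0 with hp1
  have eN : ‖a (z + h) - a z‖ ^ 2 / h = h * N := by
    rw [hN, norm_smul, norm_inv, Real.norm_eq_abs, abs_of_pos hh0]; field_simp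
  have t1 := taylor_one ha.deriv₁ ha.lip₁ z h
  have l1 := ha.lip₀ (z + h) z
  rw [add_sub_cancel_left, abs_of_pos hh0] at l1
  have bq : ‖h⁻¹ • (a (z + h) - a z)‖ ≤ L := by
    rw [norm_smul, norm_inv, Real.norm_eq_abs, abs_of_pos hh0, inv_mul_le_iff₀ hh0]
    linarith
  have bd : ‖h⁻¹ • (a (z + h) - a z) - a' z‖ ≤ L * h := by
    have e : h⁻¹ • (a (z + h) - a z) - a' z = h⁻¹ • (a (z + h) - a z - h • a' z) := by
      rw [smul_sub _ _ (h • a' z), inv_smul_smul₀ hh0.ne']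
    rw [e, norm_smul, norm_inv, Real.norm_eq_abs, abs_of_pos hh0, inv_mul_le_iff₀ hh0]
    linarith
  have bN : |N| ≤ L ^ 2 := by
    rw [hN, abs_of_nonneg (sq_nonneg _)]; gcongr
  have bNn : |N - n| ≤ L * h * (2 * L) := by
    refine (abs_normSq_sub_le _ _).trans ?_
    exact mul_le_mul bd (by linarith [ha.bound₁ z]) (by positivity) (by positivity)
  have bp0 : |p0| ≤ L := (abs_coord_le _ 0).trans (ha.bound₀ z)
  have bp : |p1 - p0| ≤ L * h := by
    have := (abs_coord_le (a (z + h) - a z) 0).trans l1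
    exact this
  have bw : ‖w (z + h) - w z‖ ≤ W * h := by
    have := hw.2 (z + h) z
    rwa [add_sub_cancel_left, abs_of_pos hh0] at this
  set η0 := η j
  set η1 := η (j + 1)
  set S := ‖η0‖ + ‖η1‖ with hSdef
  have hS0 : 0 ≤ S := by positivity
  have m1 : |massQ 0 (p1 - p0) (w z) (w (z + h)) η0 η1| ≤ L * h * W * S :=
    massQ_bound (by rw [abs_zero]; positivity) bp (hw.1 _) (hw.1 _)
  have m2 : |massQ p0 p0 0 (w (z + h) - w z) η0 η1| ≤ L * (W * h) * S :=
    massQ_bound bp0 bp0 (by rw [norm_zero]; positivity) bw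
  have m3 : |massQ p0 p0 (w z) (w z) η0 η1| ≤ L * W * S := massQ_bound bp0 bp0 (hw.1 _) (hw.1 _)
  have em : massQ p0 p1 (w z) (w (z + h)) η0 η1 = massQ p0 p0 (w z) (w z) η0 η1
      + massQ 0 (p1 - p0) (w z) (w (z + h)) η0 η1 + massQ p0 p0 0 (w (z + h) - w z) η0 η1 := by
    simp only [massQ, inner_sub_left, inner_zero_left]; ring
  -- the integral
  have kr := hr.continuous
  have c1 : Continuous fun s : ℝ => inner ℝ (r (z + s * h) - r z) ((1 - s) • η0 + s • η1) := by
    fun_prop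
  have c2 : Continuous fun s : ℝ => inner ℝ (r z) ((1 - s) • η0 + s • η1) := by fun_prop
  have ei : ∫ s in (0 : ℝ)..1, inner ℝ (r (z + s * h)) ((1 - s) • η0 + s • η1) =
      (∫ s in (0 : ℝ)..1, inner ℝ (r (z + s * h) - r z) ((1 - s) • η0 + s • η1))
        + n * massQ p0 p0 (w z) (w z) η0 η1 := by
    have e1 : ∫ s in (0 : ℝ)..1, inner ℝ (r z) ((1 - s) • η0 + s • η1) =
        n * massQ p0 p0 (w z) (w z) η0 η1 := by
      have e2 : ∀ s : ℝ, inner ℝ (r z) ((1 - s) • η0 + s • η1) = inner ℝ (r z) η0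
          + (inner ℝ (r z) η1 - inner ℝ (r z) η0) * s + 0 * s ^ 2 + 0 * s ^ 3 := fun s => by
        rw [inner_add_right, real_inner_smul_right, real_inner_smul_right]; ring
      simp only [e2]
      rw [integral_cubic, hrw]
      simp only [massQ, real_inner_smul_left]
      ring
    rw [← e1, ← intervalIntegral.integral_add (c1.intervalIntegrable _ _)
      (c2.intervalIntegrable _ _)]
    congr 1
    funext s
    rw [inner_sub_left]; ring
  have bi : |∫ s in (0 : ℝ)..1, inner ℝ (r (z + s * h) - r z) ((1 - s) • η0 + s • η1)| ≤
      B * h * S := by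
    have := intervalIntegral.norm_integral_le_of_norm_le_const (a := 0) (b := 1)
      (C := B * h * S) (f := fun s => inner ℝ (r (z + s * h) - r z) ((1 - s) • η0 + s • η1)) ?_
    · simpa using this
    · intro s hs
      rw [uIoc_of_le zero_le_one] at hs
      refine (norm_inner_le_norm _ _).trans ?_
      have k1 := hr.2 (z + s * h) z
      rw [add_sub_cancel_left, abs_of_pos (mul_pos hs.1 hh0)] at k1
      have k2 : ‖(1 - s) • η0 + s • η1‖ ≤ S := by
        refine (norm_add_le _ _).trans ?_
        rw [norm_smul, norm_smul, Real.norm_eq_abs, Real.norm_eq_abs, abs_of_pos hs.1,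
          abs_of_nonneg (by linarith [hs.2])]
        exact add_le_add (mul_le_of_le_one_left (norm_nonneg _) (by linarith [hs.1]))
          (mul_le_of_le_one_left (norm_nonneg _) hs.2)
      have k3 : B * (s * h) ≤ B * h := by
        gcongr
        exact mul_le_of_le_one_left hh0.le hs.2
      exact mul_le_mul (k1.trans k3) k2 (norm_nonneg _) (by positivity)
  rw [eN, em, ei]
  set I := ∫ s in (0 : ℝ)..1, inner ℝ (r (z + s * h) - r z) ((1 - s) • η0 + s • η1)
  set Q := massQ p0 p0 (w z) (w z) η0 η1
  set Q1 := massQ 0 (p1 - p0) (w z) (w (z + h)) η0 η1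
  set Q2 := massQ p0 p0 0 (w (z + h) - w z) η0 η1
  have e : h * N * (Q + Q1 + Q2) - h * (I + n * Q) =
      h * ((N - n) * Q + N * (Q1 + Q2) - I) := by ring
  rw [e, abs_mul, abs_of_pos hh0]
  refine mul_le_mul_of_nonneg_left ?_ hh0.le
  have f1 : |(N - n) * Q| ≤ L * h * (2 * L) * (L * W * S) := by
    rw [abs_mul]; exact mul_le_mul bNn m3 (abs_nonneg _) (by positivity)
  have f2 : |N * (Q1 + Q2)| ≤ L ^ 2 * (L * h * W * S + L * (W * h) * S) := by
    rw [abs_mul]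
    exact mul_le_mul bN ((abs_add_le _ _).trans (add_le_add m1 m2)) (abs_nonneg _) (by positivity)
  have f3 : |(N - n) * Q + N * (Q1 + Q2) - I| ≤ |(N - n) * Q| + |N * (Q1 + Q2)| + |I| := by
    refine (abs_sub _ _).trans ?_
    linarith [abs_add_le ((N - n) * Q) (N * (Q1 + Q2))]
  refine f3.trans ((add_le_add (add_le_add f1 f2) bi).trans (le_of_eq ?_))
  ring

theorem energy_nodal_le {B : ℝ} {f : ℝ → Plane} (hf : IsBddLip B f) (hp : Function.Periodic f 1) :
    energy (1 / J) (nodal J f) ≤ 2 * B ^ 2 := by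
  have hJ : (0 : ℝ) < J := J_pos (J := J)
  have hB := hf.nonneg
  have h1 : ∑ j : ZMod J, ‖nodal J f j‖ ^ 2 ≤ J * B ^ 2 := by
    have := Finset.sum_le_card_nsmul Finset.univ (fun j : ZMod J => ‖nodal J f j‖ ^ 2) (B ^ 2)
      (fun j _ => by
        have := hf.1 (node j)
        rw [nodal_node]; gcongr)
    rwa [Finset.card_univ, ZMod.card, nsmul_eq_mul] at this
  have h2 : ∑ j : ZMod J, ‖nodeDiff (nodal J f) j‖ ^ 2 ≤ J * (B * (1 / J)) ^ 2 := by
    have := Finset.sum_le_card_nsmul Finset.univ (fun j : ZMod J => ‖nodeDiff (nodal J f) j‖ ^ 2)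
      ((B * (1 / J)) ^ 2) (fun j _ => by
        have := hf.2 (node j + 1 / J) (node j)
        rw [add_sub_cancel_left, abs_of_pos (by positivity)] at this
        rw [nodeDiff_nodal hp]; gcongr)
    rwa [Finset.card_univ, ZMod.card, nsmul_eq_mul] at this
  have e1 : 1 / (J : ℝ) * (J * B ^ 2) = B ^ 2 := by field_simp
  have e2 : (J * (B * (1 / (J : ℝ))) ^ 2) / (1 / J) = B ^ 2 := by field_simp
  have k1 : l2sq (1 / J) (nodal J f) ≤ B ^ 2 := by
    rw [l2sq, ← e1]; gcongr
  have k2 : h1sq (1 / J) (nodal J f) ≤ B ^ 2 := by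
    rw [h1sq, ← e2]; gcongr
  rw [energy]; linarith

variable {T c L : ℝ} {x x1 x2 v v1 xt xtt xttt : ℝ → ℝ → Plane}

set_option maxHeartbeats 1000000 in
/-- Although the Euler step is consistent of first order only, it is taken once, and its error is of
second order: up to higher order terms it equals `dt` times the nodal values of the strong residual
over the mass density. -/
theorem FlowData.euler_start (F : FlowData T c L x x1 x2 v v1 xt xtt xttt) (hc : 0 < c)
    (hL : 1 ≤ L) :
    ∃ K : ℝ, 0 ≤ K ∧ ∀ (J : ℕ) [NeZero J] (dt : ℝ) (X1 : ZMod J → Plane), 0 < dt → dt ≤ 1 →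
      dt ≤ T → 2 * L * (1 / J) ≤ c →
      (∀ η, nodalForm (1 / J) (nodal J (x 0)) (dt⁻¹ • (X1 - nodal J (x 0))) X1 η = 0) →
      energy (1 / J) (nodal J (x dt) - X1) ≤ K * (dt ^ 2 + (1 / J) ^ 2) ^ 2 := by
  have hL0 : 0 < L := by linarith
  obtain ⟨C, hC, hstep⟩ := euler_step_error (c := c / 2) (L := L) (by positivity) hL0
  set Gc : ℝ := (c ^ 3)⁻¹ + 8 * L ^ 3 * ((c ^ 3)⁻¹ * (c ^ 3)⁻¹) with hGc
  have hGc0 : 0 < Gc := by positivity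
  set W : ℝ := 2 * (Gc * (36 * L ^ 4)) with hW
  have hW0 : 0 < W := by positivity
  set R : ℝ := 14000 * L ^ 4 + 2 * (4 * L ^ 3 * W + 36 * L ^ 4) with hR
  have hR0 : 0 < R := by positivity
  refine ⟨C * (2 * W ^ 2 + 4 * R ^ 2), by positivity, ?_⟩
  intro J _ dt X1 hdt hdt1 hdtT hJc hX1
  have hJ : (0 : ℝ) < J := J_pos (J := J)
  set h : ℝ := 1 / J with hh
  have hh0 : 0 < h := by positivity
  have i0 : (0 : ℝ) ∈ Icc 0 T := ⟨le_rfl, hdt.le.trans hdtT⟩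
  have i1 : dt ∈ Icc 0 T := ⟨hdt.le, hdtT⟩
  have C0 := F.curve 0 i0
  have C1 := F.curve dt i1
  set D := dt⁻¹ • (x dt - x 0) with hD
  set D' := dt⁻¹ • (x1 dt - x1 0) with hD'
  have habs : |dt - 0| = dt := by rw [sub_zero, abs_of_pos hdt]
  have CD : IsC1Lip L D D' := by
    have h1 := (F.sub_isC1Lip i1 i0).smul dt⁻¹
    rw [habs, abs_of_pos (inv_pos.2 hdt)] at h1
    exact h1.mono (by rw [inv_mul_le_iff₀ hdt]; linarith)
  -- the difference quotient is first order accurate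
  have tay : ∀ k ≤ 2, ‖l2curve k x dt - l2curve k x 0 - dt • l2curve k xt 0‖ ≤ L * dt ^ 2 := by
    intro k hk
    have := taylor_one_on (F.curve_deriv k hk) (F.vel_curve_deriv k hk) (F.acc_bound k hk) i1 i0
    rwa [habs, sub_zero] at this
  have sup : ∀ {f f' g g' : ℝ → Plane} {A B : Lp Plane 2 circleVol}, IsPrimitive (f - dt • g)
      (f' - dt • g') → l2class (f - dt • g) = A → l2class (f' - dt • g') = B →
      ‖A‖ ≤ L * dt ^ 2 → ‖B‖ ≤ L * dt ^ 2 → ∀ ρ, ‖(dt⁻¹ • f) ρ - g ρ‖ ≤ 2 * L * dt := by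
    intro f f' g g' A B hp hA hB hAn hBn ρ
    have h1 := hp.norm_le ρ
    rw [hA, hB] at h1
    have e : (dt⁻¹ • f) ρ - g ρ = dt⁻¹ • (f - dt • g) ρ := by
      simp only [Pi.smul_apply, Pi.sub_apply, smul_sub]
      rw [inv_smul_smul₀ hdt.ne']
    rw [e, norm_smul, norm_inv, Real.norm_eq_abs, abs_of_pos hdt, inv_mul_le_iff₀ hdt]
    linarith
  have cls : ∀ {f f0 g : ℝ → Plane}, MemLp f 2 circleVol → MemLp f0 2 circleVol →
      MemLp g 2 circleVol → l2class (f - f0 - dt • g) = l2class f - l2class f0 - dt • l2class g := by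
    intro f f0 g hf hf0 hg
    rw [l2class_sub (hf.sub hf0) (hg.const_smul dt), l2class_sub hf hf0, l2class_smul dt hg]
  have q0 : ∀ ρ, ‖D ρ - v 0 ρ‖ ≤ 2 * L * dt := by
    refine sup (f' := x1 dt - x1 0) (g' := v1 0)
      (((F.prim₀ _ i1).sub (F.prim₀ _ i0)).sub ((F.vel_prim₀ _ i0).smul dt))
      (cls (F.prim₀ _ i1).memLp_self (F.prim₀ _ i0).memLp_self (F.vel_prim₀ _ i0).memLp_self)
      (cls (F.prim₀ _ i1).memLp (F.prim₀ _ i0).memLp (F.vel_prim₀ _ i0).memLp) ?_ ?_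
    · have := tay 0 (by norm_num)
      rwa [F.class₀ _ i1, F.class₀ _ i0, F.vel_class₀ _ i0] at this
    · have := tay 1 (by norm_num)
      rwa [F.class₁ _ i1, F.class₁ _ i0, F.vel_class₁ _ i0] at this
  have q1 : ∀ ρ, ‖D' ρ - v1 0 ρ‖ ≤ 2 * L * dt := by
    refine sup (f' := x2 dt - x2 0) (g' := wderiv^[2] (xt 0))
      (((F.prim₁ _ i1).sub (F.prim₁ _ i0)).sub ((F.vel_prim₁ _ i0).smul dt))
      (cls (F.prim₁ _ i1).memLp_self (F.prim₁ _ i0).memLp_self (F.vel_prim₁ _ i0).memLp_self)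
      (cls (F.prim₁ _ i1).memLp (F.prim₁ _ i0).memLp (F.vel_prim₁ _ i0).memLp) ?_ ?_
    · have := tay 1 (by norm_num)
      rwa [F.class₁ _ i1, F.class₁ _ i0, F.vel_class₁ _ i0] at this
    · have := tay 2 le_rfl
      rwa [F.class₂ _ i1, F.class₂ _ i0] at this
  have bD : IsBddLip (2 * L * dt) (fun ρ => D ρ - v 0 ρ) :=
    IsBddLip.of_hasDerivAt (fun ρ => (CD.deriv₁ ρ).sub (F.vel_deriv 0 i0 ρ)) q0 q1
  have b1 : IsBddLip (L * dt) (fun ρ => x1 dt ρ - x1 0 ρ) := by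
    refine IsBddLip.of_hasDerivAt (fun ρ => (C1.deriv₂ ρ).sub (C0.deriv₂ ρ)) (fun ρ => ?_)
      fun ρ => ?_
    · have := F.time_lip₁ dt i1 0 i0 ρ; rwa [habs] at this
    · have := F.time_lip₂ dt i1 0 i0 ρ; rwa [habs] at this
  have b2 : IsBddLip (L * dt) (fun ρ => x2 dt ρ - x2 0 ρ) := by
    refine ⟨fun ρ => ?_, fun ρ σ => ?_⟩
    · have := F.time_lip₂ dt i1 0 i0 ρ; rwa [habs] at this
    · have := F.mixed_lip₂ dt i1 0 i0 ρ σ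
      rw [habs] at this
      have e : x2 dt ρ - x2 0 ρ - (x2 dt σ - x2 0 σ) =
          x2 dt ρ - x2 dt σ - x2 0 ρ + x2 0 σ := by abel
      rw [e]
      exact this.trans (le_of_eq (by ring))
  have bx : IsBddLip L (x 0) := ⟨C0.bound₀, C0.lip₀⟩
  have bx1 : IsBddLip L (x1 0) := ⟨C0.bound₁, C0.lip₁⟩
  have bg : IsBddLip (8 * L ^ 3) (fun ρ => x 0 ρ 0 * ‖x1 0 ρ‖ ^ 2) :=
    ((bx.coord 0).smul bx1.normSq).mono (le_of_eq (by ring))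
  have hg : ∀ ρ, c ^ 3 ≤ x 0 ρ 0 * ‖x1 0 ρ‖ ^ 2 := fun ρ => by
    have k1 := F.lower 0 i0 ρ
    have k2 := F.speed 0 i0 ρ
    calc c ^ 3 = c * c ^ 2 := by ring
      _ ≤ _ := by gcongr; exact hc.le.trans k1
  have hg0 : ∀ ρ, x 0 ρ 0 * ‖x1 0 ρ‖ ^ 2 ≠ 0 := fun ρ =>
    ((pow_pos hc 3).trans_le (hg ρ)).ne'
  -- the residual of the Euler step is of order `dt` together with its Lipschitz constant
  set r := strongRes (x 0) (x1 0) (x1 dt) (x2 dt) D with hr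
  have er : r = fun ρ => (x 0 ρ 0 * ‖x1 0 ρ‖ ^ 2) • (D ρ - v 0 ρ)
      + -(x1 0 ρ 0 • (x1 dt ρ - x1 0 ρ) + x 0 ρ 0 • (x2 dt ρ - x2 0 ρ)) := by
    funext ρ
    have h1 := F.equation 0 i0 ρ
    have h2 : r ρ = r ρ - strongRes (x 0) (x1 0) (x1 0) (x2 0) (v 0) ρ := by rw [h1, sub_zero]
    rw [h2, hr]
    simp only [strongRes]
    module
  have br : IsBddLip (36 * L ^ 4 * dt) r := by
    rw [er]
    refine ((bg.smul bD).add (((bx1.coord 0).smul b1).add ((bx.coord 0).smul b2)).neg).mono ?_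
    have hL4 : L ^ 2 ≤ L ^ 4 := pow_le_pow_right₀ hL (by norm_num)
    nlinarith [mul_le_mul_of_nonneg_right hL4 hdt.le]
  -- `dt • w` is the leading part of the error, where `w` is the residual over the mass density
  set w : ℝ → Plane := fun ρ => (x 0 ρ 0 * ‖x1 0 ρ‖ ^ 2)⁻¹ • r ρ with hw
  have bw : IsBddLip (W * dt) w :=
    ((bg.inv (pow_pos hc 3) hg).smul br).mono (le_of_eq (by rw [hW, hGc]; ring))
  obtain ⟨rc, rp⟩ := strongRes_continuous_periodic C0 C1 CD.continuous₀ CD.periodic C1.periodic₂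
  have wp : Function.Periodic w 1 := fun ρ => by
    simp only [hw]
    rw [C0.periodic, C0.periodic₁, hr, rp]
  have hrw : ∀ ρ, r ρ = (x 0 ρ 0 * ‖x1 0 ρ‖ ^ 2) • w ρ := fun ρ => by
    simp only [hw]
    rw [smul_inv_smul₀ (hg0 ρ)]
  set q : ZMod J → Plane := nodal J (dt • w) with hq
  have hqe : energy h q ≤ 2 * (dt * (W * dt)) ^ 2 := by
    refine energy_nodal_le ⟨fun ρ => ?_, fun ρ σ => ?_⟩ fun ρ => ?_
    · rw [Pi.smul_apply, norm_smul, Real.norm_eq_abs, abs_of_pos hdt]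
      gcongr; exact bw.1 ρ
    · rw [Pi.smul_apply, Pi.smul_apply, ← smul_sub, norm_smul, Real.norm_eq_abs, abs_of_pos hdt,
        mul_assoc]
      gcongr; exact bw.2 ρ σ
    · simp only [Pi.smul_apply, wp ρ]
  set e := nodal J (x dt) - X1 with he
  have key : ∀ η, |massForm h (nodal J (x 0)) (dt⁻¹ • (e - q)) η
      + stiffForm h (nodal J (x 0)) e η| ≤ (R * (h ^ 2 + h * dt)) * √(l2sq h η) := by
    intro η
    have h1 := space_consistency (J := J) hL C0 C1 CD η
    have h2 := mass_moments_le (J := J) C0 bw wp br hrw η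
    rw [← hh] at h1 h2
    rw [← hr] at h1
    set Mo := ∑ j, h * ∫ s in (0 : ℝ)..1, inner ℝ (r (node j + s * h))
      ((1 - s) • η j + s • η (j + 1))
    have e1 : massForm h (nodal J (x 0)) (dt⁻¹ • (e - q)) η + stiffForm h (nodal J (x 0)) e η =
        nodalForm h (nodal J (x 0)) (nodal J D) (nodal J (x dt)) η
          - massForm h (nodal J (x 0)) (nodal J w) η := by
      have e2 : dt⁻¹ • (e - q) = nodal J D - dt⁻¹ • (X1 - nodal J (x 0)) - nodal J w := by
        have e3 : nodal J D = dt⁻¹ • (nodal J (x dt) - nodal J (x 0)) := rfl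
        have e4 : q = dt • nodal J w := rfl
        rw [e3, e4, he, smul_sub dt⁻¹ _ (dt • nodal J w), inv_smul_smul₀ hdt.ne']
        module
      have e5 := hX1 η
      rw [nodalForm] at e5
      rw [e2, massForm_sub, massForm_sub, he, stiffForm_sub, nodalForm]
      linarith
    rw [e1]
    set S := √(l2sq h η)
    have hS0 : 0 ≤ S := Real.sqrt_nonneg _
    have h3 : |nodalForm h (nodal J (x 0)) (nodal J D) (nodal J (x dt)) η
          - massForm h (nodal J (x 0)) (nodal J w) η| ≤ 14000 * L ^ 4 * h ^ 2 * S +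
            2 * (4 * L ^ 3 * (W * dt) + 36 * L ^ 4 * dt) * h * S := by
      rw [abs_le] at h1 h2 ⊢
      constructor <;> linarith [h1.1, h1.2, h2.1, h2.2]
    refine h3.trans ?_
    have k1 : 0 ≤ 14000 * L ^ 4 * (h * dt) * S := by positivity
    have k2 : 0 ≤ 2 * (4 * L ^ 3 * W + 36 * L ^ 4) * h ^ 2 * S := by positivity
    have k3 : R * (h ^ 2 + h * dt) * S = 14000 * L ^ 4 * h ^ 2 * S +
        2 * (4 * L ^ 3 * (W * dt) + 36 * L ^ 4 * dt) * h * S + 14000 * L ^ 4 * (h * dt) * S +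
        2 * (4 * L ^ 3 * W + 36 * L ^ 4) * h ^ 2 * S := by
      rw [hR]; ring
    linarith
  have hslope : ∀ j, c / 2 * h ≤ ‖nodeDiff (nodal J (x 0)) j‖ := by
    intro j
    have h1 := C0.chord_lower (F.speed 0 i0) hh0 (node j)
    rw [nodeDiff_nodal C0.periodic]
    refine le_trans ?_ h1
    gcongr
    linarith
  have hfin := hstep J h dt (R * (h ^ 2 + h * dt)) (nodal J (x 0)) e q hh0 hdt hdt1
    (fun j => by
      have := F.lower 0 i0 (node j)
      have e : nodal J (x 0) j 0 = x 0 (node j) 0 := rfl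
      rw [e]; linarith)
    (fun j => (abs_coord_le _ 0).trans (C0.bound₀ (node j))) hslope key
  refine hfin.trans ?_
  rw [mul_assoc C]
  refine mul_le_mul_of_nonneg_left ?_ hC.le
  have s1 : (dt * (W * dt)) ^ 2 ≤ W ^ 2 * (dt ^ 2 + h ^ 2) ^ 2 := by
    have : (dt * (W * dt)) ^ 2 = W ^ 2 * (dt ^ 2) ^ 2 := by ring
    rw [this]
    gcongr
    linarith [sq_nonneg h]
  have s2 : dt * (R * (h ^ 2 + h * dt)) ^ 2 ≤ 4 * R ^ 2 * (dt ^ 2 + h ^ 2) ^ 2 := by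
    have t1 : h ^ 2 + h * dt ≤ 2 * (dt ^ 2 + h ^ 2) := by
      nlinarith [sq_nonneg (h - dt)]
    calc dt * (R * (h ^ 2 + h * dt)) ^ 2 ≤ 1 * (R * (2 * (dt ^ 2 + h ^ 2))) ^ 2 := by
          gcongr
      _ = _ := by ring
  nlinarith

end StartingStep

/-! ### The two methods as one family -/

section Schemes

variable {J : ℕ} [NeZero J]

theorem forall_feSpace_iff {P : (ℝ → Plane) → Prop} :
    (∀ η ∈ feSpace J, P η) ↔ ∀ η : ZMod J → Plane, P (plin η) :=
  ⟨fun h η => h _ (plin_mem_feSpace η), fun h η hη => by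
    rw [feSpace_eq_plin hη]; exact h _⟩

theorem isBDF1Step_iff {dt : ℝ} (u0 : ZMod J → Plane) {X1 : ℝ → Plane} (hX1 : X1 ∈ feSpace J) :
    IsBDF1Step J dt (plin u0) X1 ↔
      ∀ η, nodalForm (1 / J) u0 (dt⁻¹ • (nodal J X1 - u0)) (nodal J X1) η = 0 := by
  rw [IsBDF1Step, forall_feSpace_iff]
  refine ⟨fun h η => ?_, fun h => ⟨hX1, fun η => ?_⟩⟩
  · have := h.2 η
    rwa [feSpace_eq_plin hX1, ← plin_sub, ← plin_smul, schemeForm_plin] at this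
  · rw [feSpace_eq_plin hX1, ← plin_sub, ← plin_smul, schemeForm_plin]
    exact h η

/-- The Crank-Nicolson (`θ = 1/2`) and BDF2 (`θ = 1`) methods, with the equation posed for nodal
values. -/
def IsThetaSolution (J : ℕ) [NeZero J] (M : ℕ) (dt θ : ℝ) (X0 X1 : ℝ → Plane)
    (X : ℕ → ℝ → Plane) : Prop :=
  X 0 = X0 ∧ X 1 = X1 ∧ (∀ m ≤ M, X m ∈ feSpace J) ∧
    ∀ m, 1 ≤ m → m + 1 ≤ M → IsThetaStep (1 / J) dt θ (fun k => nodal J (X k)) m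

theorem isCNSolution_iff {M : ℕ} {dt : ℝ} {X0 X1 : ℝ → Plane} {X : ℕ → ℝ → Plane} :
    IsCNSolution J M dt X0 X1 X ↔ IsThetaSolution J M dt (1 / 2) X0 X1 X := by
  refine and_congr_right fun _ => and_congr_right fun _ => and_congr_right fun hm =>
    forall_congr' fun m => forall_congr' fun h1 => forall_congr' fun h2 => ?_
  rw [forall_feSpace_iff, IsThetaStep]
  refine forall_congr' fun η => ?_
  rw [feSpace_eq_plin (hm (m - 1) (by omega)), feSpace_eq_plin (hm m (by omega)),
    feSpace_eq_plin (hm (m + 1) h2)]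
  simp only [← plin_sub, ← plin_smul, ← plin_add, schemeForm_plin]
  have e1 : extrap (1 / 2) (fun k => nodal J (X k)) m =
      (1 / 2 : ℝ) • ((3 : ℝ) • nodal J (X m) - nodal J (X (m - 1))) := by
    rw [extrap]; module
  have e2 : timeDiff (1 / 2) dt (fun k => nodal J (X k)) m =
      dt⁻¹ • (nodal J (X (m + 1)) - nodal J (X m)) := by
    rw [timeDiff]; module
  have e3 : midval (1 / 2) (fun k => nodal J (X k)) m =
      (1 / 2 : ℝ) • (nodal J (X (m + 1)) + nodal J (X m)) := by
    rw [midval]; module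
  rw [e1, e2, e3]

theorem isBDF2Solution_iff {M : ℕ} {dt : ℝ} {X0 X1 : ℝ → Plane} {X : ℕ → ℝ → Plane} :
    IsBDF2Solution J M dt X0 X1 X ↔ IsThetaSolution J M dt 1 X0 X1 X := by
  refine and_congr_right fun _ => and_congr_right fun _ => and_congr_right fun hm =>
    forall_congr' fun m => forall_congr' fun h1 => forall_congr' fun h2 => ?_
  rw [forall_feSpace_iff, IsThetaStep]
  refine forall_congr' fun η => ?_
  rw [feSpace_eq_plin (hm (m - 1) (by omega)), feSpace_eq_plin (hm m (by omega)),
    feSpace_eq_plin (hm (m + 1) h2)]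
  simp only [← plin_sub, ← plin_smul, ← plin_add, schemeForm_plin]
  have e1 : extrap 1 (fun k => nodal J (X k)) m =
      (2 : ℝ) • nodal J (X m) - nodal J (X (m - 1)) := by
    rw [extrap]; module
  have e2 : timeDiff 1 dt (fun k => nodal J (X k)) m = (2 * dt)⁻¹ •
      ((3 : ℝ) • nodal J (X (m + 1)) - (4 : ℝ) • nodal J (X m) + nodal J (X (m - 1))) := by
    rw [timeDiff, mul_inv]; module
  have e3 : midval 1 (fun k => nodal J (X k)) m = nodal J (X (m + 1)) := by
    rw [midval]; module
  rw [e1, e2, e3]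

end Schemes

/-! ### Convergence -/

/-- Both methods, started from a second order accurate value, are uniquely solvable and of second
order. -/
theorem FlowData.theta_convergence {T c L : ℝ} {x x1 x2 v v1 xt xtt xttt : ℝ → ℝ → Plane}
    (F : FlowData T c L x x1 x2 v v1 xt xtt xttt) (hc : 0 < c) (hL : 1 ≤ L) (hT : 0 < T) {K : ℝ}
    (hK : 0 ≤ K) :
    ∃ C dt₀ h₀ γ : ℝ, 0 < C ∧ 0 < dt₀ ∧ 0 < h₀ ∧ 0 < γ ∧
      ∀ (J M : ℕ) [NeZero J] (dt θ : ℝ) (X1 : ℝ → Plane), 1 ≤ M → dt = T / M → 1 / J ≤ h₀ →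
        dt ≤ dt₀ → dt ^ 4 ≤ γ * (1 / J) → 1 / 2 ≤ θ → θ ≤ 1 → X1 ∈ feSpace J →
        energy (1 / J) (nodal J (x dt) - nodal J X1) ≤ K * (dt ^ 2 + (1 / J) ^ 2) ^ 2 →
        ∃ X, IsThetaSolution J M dt θ (interp J (x 0)) X1 X ∧
          (∀ Y, IsThetaSolution J M dt θ (interp J (x 0)) X1 Y → ∀ m ≤ M, Y m = X m) ∧
          ErrorBounds x J M (1 / J) dt C X := by
  have hL0 : 0 < L := by linarith
  have i0 : (0 : ℝ) ∈ Icc 0 T := ⟨le_rfl, hT.le⟩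
  have hcL : c ≤ L := (F.lower 0 i0 0).trans
    ((le_abs_self _).trans ((abs_coord_le _ 0).trans ((F.curve 0 i0).bound₀ 0)))
  obtain ⟨C, dt₀, h₀, γ, hC, hdt₀, hh₀, hγ, hscheme⟩ := theta_scheme (c := c / 4) (L := 6 * L)
    (R := 1134000 * L ^ 4) (K := K) (T := T) (by positivity) (by linarith) (by linarith)
    (by positivity) hK
  refine ⟨2 * L + √C, min dt₀ (c / (2 * L)), min h₀ (c / (12 * L)), γ, by positivity,
    by positivity, by positivity, hγ, ?_⟩
  intro J M _ dt θ X1 hM hdtM hh hdtt hdt4 hθ hθ1 hX1 hstart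
  have hJ : (0 : ℝ) < J := J_pos (J := J)
  have hM0 : (0 : ℝ) < M := by exact_mod_cast hM
  have hdt : 0 < dt := by rw [hdtM]; positivity
  have hMT : M * dt = T := by rw [hdtM]; field_simp
  have hJc : 12 * L * (1 / J) ≤ c := by
    have := hh.trans (min_le_right _ _)
    rw [le_div_iff₀ (by positivity)] at this
    linarith
  have hdtc : L * dt ≤ c / 2 := by
    have := hdtt.trans (min_le_right _ _)
    rw [le_div_iff₀ (by positivity)] at this
    linarith
  set y : ℕ → ZMod J → Plane := fun k => nodal J (x (k * dt)) with hy
  have hy0 : y 0 = nodal J (x 0) := by simp [hy]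
  have hy1 : y 1 = nodal J (x dt) := by simp [hy]
  have hint : interp J (x 0) = plin (y 0) := by rw [hy0, interp_eq (F.curve 0 i0).periodic]
  have hmT : ∀ m ≤ M, (m : ℝ) * dt ∈ Icc 0 T := fun m hm => by
    refine ⟨by positivity, ?_⟩
    rw [← hMT]
    gcongr
  obtain ⟨U, hU0, hU1, hUs, hUu, hUe⟩ := hscheme J (1 / J) dt θ M y (nodal J X1) (by positivity)
    (hh.trans (min_le_left _ _)) hdt (hdtt.trans (min_le_left _ _)) hdt4 hθ hθ1 hMT.le
    (fun m h1 h2 => F.stepData hc hL hdt hθ hθ1 h1 (by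
      have := (hmT (m + 1) h2).2
      push_cast at this
      exact this) hdtc hJc) (by rw [hy1]; exact hstart)
  refine ⟨fun m => plin (U m), ⟨by simp only [hU0, hint],
    by simp only [hU1, ← feSpace_eq_plin hX1],
    fun m _ => plin_mem_feSpace _, fun m h1 h2 => ?_⟩, fun Y hY m hm => ?_, fun m hm => ?_⟩
  · simp only [nodal_plin]
    exact hUs m h1 h2
  · obtain ⟨hY0, hY1, hYm, hYs⟩ := hY
    have := hUu (fun k => nodal J (Y k)) (by simp only [hY0, hint, nodal_plin])
      (by simp only [hY1]) hYs m hM hm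
    exact (feSpace_eq_plin (hYm m hm)).trans (congrArg plin this)
  · have Cm := F.curve _ (hmT m hm)
    set h : ℝ := 1 / J with hh_def
    have hh0 : 0 < h := by positivity
    have hh1 : h ≤ 1 := by
      rw [hh_def, div_le_one hJ]
      exact_mod_cast Nat.one_le_iff_ne_zero.2 (NeZero.ne J)
    have hr : 0 ≤ √C * (dt ^ 2 + h ^ 2) := by positivity
    have he := errorBounds_of_energy Cm.periodic Cm.deriv₁ Cm.lip₁ hr (U m) (by
      rw [mul_pow, Real.sq_sqrt hC.le]
      exact hUe m hM hm)
    have hd2 : 0 ≤ L * dt ^ 2 := by positivity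
    refine ⟨he.1.trans (ENNReal.ofReal_le_ofReal ?_), he.2.1.trans (ENNReal.ofReal_le_ofReal ?_),
      he.2.2.trans (ENNReal.ofReal_le_ofReal ?_)⟩
    · rw [← hh_def]; linarith
    · have : h ^ 2 ≤ h := by nlinarith
      have := mul_le_mul_of_nonneg_left this (Real.sqrt_nonneg C)
      rw [← hh_def]
      linarith
    · have : 0 ≤ L * h ^ 2 := by positivity
      linarith

/-- The linear Euler step has a unique solution. -/
theorem FlowData.existsUnique_euler {T c L : ℝ} {x x1 x2 v v1 xt xtt xttt : ℝ → ℝ → Plane}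
    (F : FlowData T c L x x1 x2 v v1 xt xtt xttt) (hc : 0 < c) (hT : 0 < T) {J : ℕ} [NeZero J]
    {dt : ℝ} (hdt : 0 < dt) (hJc : 2 * L * (1 / J) ≤ c) :
    ∃! X1, IsBDF1Step J dt (interp J (x 0)) X1 := by
  have hJ : (0 : ℝ) < J := J_pos (J := J)
  have hh : (0 : ℝ) < 1 / J := by positivity
  have i0 : (0 : ℝ) ∈ Icc 0 T := ⟨le_rfl, hT.le⟩
  have C0 := F.curve 0 i0
  rw [interp_eq C0.periodic]
  set u0 := nodal J (x 0)
  obtain ⟨u, hu, huu⟩ := nodalForm_solvable (J := J) (κ := c / 2) (μ := dt⁻¹) (θ := 1) hh hc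
    (by positivity) (inv_pos.2 hdt) zero_le_one u0 (-(dt⁻¹ • u0)) 0 (fun j => F.lower 0 i0 (node j))
    (fun j => by
      have h1 := C0.chord_lower (F.speed 0 i0) hh (node j)
      rw [nodeDiff_nodal C0.periodic]
      refine le_trans ?_ h1
      gcongr
      linarith)
  have e : ∀ X : ZMod J → Plane, dt⁻¹ • X + -(dt⁻¹ • u0) = dt⁻¹ • (X - u0) := fun X => by
    rw [smul_sub]; abel
  simp only [e, one_smul, add_zero] at hu huu
  refine ⟨plin u, (isBDF1Step_iff u0 (plin_mem_feSpace u)).2 (by rwa [nodal_plin]),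
    fun X1 hX1 => ?_⟩
  have := huu _ ((isBDF1Step_iff u0 hX1.1).1 hX1)
  rw [feSpace_eq_plin hX1.1, this]

end GenusOneMCF

theorem theorem2p1 (T : ℝ) (hT : 0 < T) (x xt xtt xttt : ℝ → ℝ → Plane)
    (hx : IsRegularSolution T x xt xtt xttt) (K : ℝ) :
    ∃ dt₀ h₀ γ₁ γ₂ C : ℝ, 0 < dt₀ ∧ 0 < h₀ ∧ 0 < γ₁ ∧ 0 < γ₂ ∧ 0 < C ∧
      ∀ (J M : ℕ) (h dt : ℝ), 3 ≤ J → 1 ≤ M → h = 1 / J → dt = T / M →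
        h ≤ h₀ → dt ≤ dt₀ → dt ≤ γ₁ * h ^ (1 / 4 : ℝ) → h ≤ γ₂ * √dt →
        (∃! X1, IsBDF1Step J dt (interp J (x 0)) X1) ∧
        ∀ X1 ∈ feSpace J,
          (IsBDF1Step J dt (interp J (x 0)) X1 ∨
            normH1 (interp J (x dt) - X1) ≤ ENNReal.ofReal (K * (dt ^ 2 + h ^ 2))) →
          (∃ X, IsCNSolution J M dt (interp J (x 0)) X1 X ∧
            (∀ Y, IsCNSolution J M dt (interp J (x 0)) X1 Y → ∀ m ≤ M, Y m = X m) ∧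
            ErrorBounds x J M h dt C X) ∧
          (∃ X, IsBDF2Solution J M dt (interp J (x 0)) X1 X ∧
            (∀ Y, IsBDF2Solution J M dt (interp J (x 0)) X1 Y → ∀ m ≤ M, Y m = X m) ∧
            ErrorBounds x J M h dt C X) := by
  obtain ⟨c, L, x1, x2, v, v1, hc, hL, F⟩ := exists_flowData hT hx
  have hL0 : 0 < L := by linarith
  obtain ⟨KE, hKE, hstart⟩ := F.euler_start hc hL
  obtain ⟨C, dt₀, h₀, γ, hC, hdt₀, hh₀, hγ, hconv⟩ :=
    F.theta_convergence hc hL hT (K := KE + 3 * K ^ 2) (by positivity)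
  refine ⟨min dt₀ 1, min h₀ (c / (2 * L)), γ ^ (1 / 4 : ℝ), 1, C, by positivity, by positivity,
    by positivity, one_pos, hC, ?_⟩
  intro J M h dt hJ3 hM hh hdtM hhh hdtt hdtγ _
  have : NeZero J := ⟨by omega⟩
  have hJ : (0 : ℝ) < J := J_pos (J := J)
  have hh0 : 0 < h := by rw [hh]; positivity
  have hM1 : (1 : ℝ) ≤ M := by exact_mod_cast hM
  have hdt : 0 < dt := by rw [hdtM]; positivity
  have hdtT : dt ≤ T := by rw [hdtM]; exact div_le_self hT.le hM1
  have hJc : 2 * L * (1 / J) ≤ c := by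
    have := hhh.trans (min_le_right _ _)
    rw [le_div_iff₀ (by positivity), hh] at this
    linarith
  have hdt4 : dt ^ 4 ≤ γ * (1 / J) := by
    have h1 : dt ^ 4 ≤ (γ ^ (1 / 4 : ℝ) * h ^ (1 / 4 : ℝ)) ^ 4 := by gcongr
    rw [← Real.mul_rpow hγ.le hh0.le, ← Real.rpow_natCast (_ ^ _) 4,
      ← Real.rpow_mul (by positivity)] at h1
    norm_num at h1
    rw [hh] at h1
    simpa using h1
  have hx0 := (F.curve 0 ⟨le_rfl, hT.le⟩).periodic
  have hxdt := (F.curve dt ⟨hdt.le, hdtT⟩).periodic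
  refine ⟨F.existsUnique_euler hc hT hdt hJc, fun X1 hX1 hX1s => ?_⟩
  have hen : energy (1 / J) (nodal J (x dt) - nodal J X1) ≤
      (KE + 3 * K ^ 2) * (dt ^ 2 + (1 / J) ^ 2) ^ 2 := by
    have p1 : 0 ≤ KE * (dt ^ 2 + (1 / (J : ℝ)) ^ 2) ^ 2 := by positivity
    have p2 : 0 ≤ 3 * K ^ 2 * (dt ^ 2 + (1 / (J : ℝ)) ^ 2) ^ 2 := by positivity
    rcases hX1s with h1 | h1
    · rw [interp_eq hx0, isBDF1Step_iff _ hX1] at h1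
      have := hstart J dt (nodal J X1) hdt (hdtt.trans (min_le_right _ _)) hdtT hJc h1
      linarith
    · rw [interp_eq hxdt, feSpace_eq_plin hX1, ← plin_sub] at h1
      have := energy_le_of_normH1 _ h1
      rw [hh] at this
      linarith
  rw [hh]
  have hfin := fun θ h1 h2 => hconv J M dt θ X1 hM hdtM (by
    rw [← hh]; exact hhh.trans (min_le_left _ _)) (hdtt.trans (min_le_left _ _)) hdt4 h1 h2 hX1 hen
  refine ⟨?_, ?_⟩
  · simp only [isCNSolution_iff]
    exact hfin (1 / 2) le_rfl (by norm_num)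
  · simp only [isBDF2Solution_iff]
    exact hfin 1 (by norm_num) le_rfl
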